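/- Let $q$ be real-valued white noise on $\mathbb{R}$, that is, a random real tempered distribution with $\mathbb{E}\,e^{i\langle f,q\rangle}=\exp\{-\tfrac12\|f\|_{L^2}^2\}$ for every real-valued Schwartz function $f$. Write $2^{\mathbb{N}}=\{2,4,8,\dots\}$. For $L_0\in 2^{\mathbb{N}}$ let $q_{L_0}$ be the $2L_0$-periodic distribution $q_{L_0}(x)=\sum_{j\in\mathbb{Z}}[1_{[-L_0,L_0]}q](x-2jL_0)$, and let $q_{\infty}=q$. Let $R_{L_0}(k)=(-\partial_x^2+q_{L_0}+k^2)^{-1}$ denote the resolvent of the Schrödinger operator on the line with potential $q_{L_0}$; thus $u=R_{L_0}(k)f$ means that $u\in L^2(\mathbb{R})\cap H^1_{\rm loc}(\mathbb{R})$ and $-u''+q_{L_0}u+k^2u=f$ in the sense of distributions. Fix a constant $C_0\ge 1$ and call $k\in\mathbb{C}\setminus\{0\}$ strictly admissible if $0\le\arg k<\tfrac{\pi}{4}$, $\operatorname{Im}(k^2)\ge C_0$ and $|\tfrac{\pi}{8}-\arg k|<\tfrac{\pi}{16}$; put $\kappa=|k|$. Let $\|f\|_{H^s_\kappa}^2=\int|\hat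 f(\xi)|^2(4\kappa^2+\xi^2)^s\,d\xi$ with the unitary Fourier transform $\hat f(\xi)=(2\pi)^{-1/2}\int e^{-ix\xi}f(x)\,dx$, and let $\langle x\rangle=\sqrt{1+x^2}$. Fix $\chi_1\in C_c^\infty(\mathbb{R})$ with $1_{[-1,1]}\le\chi_1\le 1_{[-2,2]}$ and set $\chi_n(x)=\chi_1(\tfrac{x}{n})-\chi_1(\tfrac{2x}{n})$ for $n\in2^{\mathbb{N}}$. Fix $0<\alpha<\tfrac12$ and $1\le p<\infty$. Then there is a constant $C>0$, depending only on $p$, $\alpha$, $C_0$ and $\chi_1$, such that for all $m,n\in 2^{\mathbb{N}}$, all $L_0\in 2^{\mathbb{N}}\cup\{\infty\}$ and all strictly admissible $k$, almost surely $\chi_mR_{L_0}(k)\chi_n$ is a well-defined bounded operator from $H^{-1}_\kappa(\mathbb{R})$ to $H^{1}_\kappa(\mathbb{R})$, and $$ \mathbb{E}\bigl\{\|\chi_mR_{L_0}(k)\chi_n\|^p_{H^{-1}_\kappa\to H^1_\kappa}\bigr\}\le C \begin{cases} [\log m]^p &\text{if } \tfrac n4\le m\le 4n,\\ e^{-6p\langle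 m\rangle^\alpha} &\text{if } m>4n,\\ e^{-6p\langle n\rangle^\alpha} &\text{if } n>4m. \end{cases} $$ -/

import Mathlib

open MeasureTheory
open scoped SchwartzMap ENNReal

noncomputable section

namespace WhiteNoiseResolvent

/-- The Japanese bracket `⟨x⟩ = √(1 + x²)`. -/
def japaneseBracket (x : ℝ) : ℝ := Real.sqrt (1 + x ^ 2)

/-- `n ∈ 2^ℕ = {2, 4, 8, …}`. -/
def IsDyadic (n : ℕ) : Prop := ∃ i : ℕ, 1 ≤ i ∧ n = 2 ^ i

/-- `L₀ ∈ 2^ℕ ∪ {∞}`. -/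
def IsDyadicOrInfinite (L₀ : ℕ∞) : Prop := L₀ = ⊤ ∨ ∃ L : ℕ, IsDyadic L ∧ L₀ = L

/-- Strictly admissible spectral parameters, relative to the lower bound `C₀` for `Im k²`. -/
structure StrictlyAdmissible (C₀ : ℝ) (k : ℂ) : Prop where
  ne_zero : k ≠ 0
  arg_nonneg : 0 ≤ k.arg
  arg_lt : k.arg < Real.pi / 4
  le_im_sq : C₀ ≤ (k ^ 2).im
  arg_close : |Real.pi / 8 - k.arg| < Real.pi / 16

/-! ### Cutoffs -/

/-- A smooth bump function with `1_{[-1,1]} ≤ χ₁ ≤ 1_{[-2,2]}`. -/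
structure IsBump (χ₁ : ℝ → ℝ) : Prop where
  smooth : ContDiff ℝ (⊤ : ℕ∞) χ₁
  lower : ∀ x, (Set.Icc (-1 : ℝ) 1).indicator 1 x ≤ χ₁ x
  upper : ∀ x, χ₁ x ≤ (Set.Icc (-2 : ℝ) 2).indicator 1 x

/-- The dyadic cutoff `χ_n(x) = χ₁(x/n) - χ₁(2x/n)`, used for `n ∈ 2^ℕ`. It is complex valued so
that it can multiply complex distributions. -/
def dyadicCutoff (χ₁ : ℝ → ℝ) (n : ℕ) (x : ℝ) : ℂ :=
  ((χ₁ (x / n) - χ₁ (2 * x / n) : ℝ) : ℂ)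

/-! ### The spaces `H^s_κ(ℝ)` -/

/-- `‖T‖_{H^s_κ} = ‖(4κ² + |∂|²)^{s/2} T‖_{L²} ∈ [0, ∞]`, with value `∞` if `T` is not in `H^s_κ`.
Mathlib's Fourier transform has the phase `e^{-2πixξ}`, so `-∂²` is multiplication by `(2πξ)²`.
By Plancherel this is `(∫ |T̂(ξ)|² (4κ² + ξ²)^s dξ)^{1/2}` for the unitary transform
`T̂(ξ) = (2π)^{-1/2} ∫ e^{-ixξ} T(x) dx`. -/
def sobolevNorm (s κ : ℝ) (T : 𝓢'(ℝ, ℂ)) : ℝ≥0∞ :=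
  ⨅ (g : Lp ℂ 2 (volume : Measure ℝ))
    (_ : TemperedDistribution.fourierMultiplierCLM ℂ
      (fun ξ : ℝ => (((4 * κ ^ 2 + (2 * Real.pi * ξ) ^ 2) ^ (s / 2) : ℝ) : ℂ)) T
        = (g : 𝓢'(ℝ, ℂ))), ‖g‖ₑ

/-! ### White noise -/

/-- Real-valued white noise on the line: a random real tempered distribution `q` with
`𝔼 e^{i⟨f,q⟩} = exp(-½ ‖f‖²_{L²})` for all real Schwartz functions `f`. -/
structure IsWhiteNoise {Ω : Type*} [MeasurableSpace Ω] (P : Measure Ω)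
    (q : Ω → (𝓢(ℝ, ℝ) →L[ℝ] ℝ)) : Prop where
  measurable : ∀ f : 𝓢(ℝ, ℝ), Measurable fun ω => q ω f
  charFun : ∀ f : 𝓢(ℝ, ℝ),
    ∫ ω, Complex.exp (Complex.I * (q ω f : ℂ)) ∂P
      = Complex.exp (-(1 / 2 : ℂ) * ((∫ x, f x ^ 2 : ℝ) : ℂ))

/-- `W` is the continuous function with `W(0) = 0` and `W' = q` in the sense of distributions. -/
structure IsPrimitive (q : 𝓢(ℝ, ℝ) →L[ℝ] ℝ) (W : ℝ → ℝ) : Prop where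
  continuous : Continuous W
  zero : W 0 = 0
  deriv_eq : ∀ φ : 𝓢(ℝ, ℝ), HasCompactSupport φ → q φ = -∫ x, W x * deriv φ x

open scoped Classical in
/-- The continuous primitive of `q` vanishing at `0` (it is unique if it exists). Samples of white
noise have one almost surely, namely a two-sided Brownian path; the value `0` is assigned to all
distributions which do not. -/
def primitive (q : 𝓢(ℝ, ℝ) →L[ℝ] ℝ) : ℝ → ℝ :=
  if h : ∃ W, IsPrimitive q W then h.choose else 0

/-- A primitive of the potential `q_{L₀}`, where `W` is a primitive of `q`.
If `L₀ = ∞` then `q_{L₀} = q`.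
If `L₀` is finite then `q_{L₀}(x) = ∑_{j ∈ ℤ} [1_{[-L₀,L₀]} q](x - 2jL₀)` is the `2L₀`-periodic
extension of the restriction of `q` to `[-L₀,L₀]`: the distribution `1_{[-L₀,L₀]} q` is the
derivative of `x ↦ W (max (-L₀) (min L₀ x))`, and the terms of the sum over `j` are normalized to
vanish at `0` (for every `x` only finitely many of them are nonzero). -/
def potentialPrimitive (L₀ : ℕ∞) (W : ℝ → ℝ) : ℝ → ℝ :=
  match L₀ with
  | ⊤ => W
  | (L : ℕ) =>
    let W_L : ℝ → ℝ := fun x => W (max (-(L : ℝ)) (min (L : ℝ) x))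
    fun x => ∑' j : ℤ, (W_L (x - 2 * j * L) - W_L (-(2 * j * L)))

/-! ### Schrödinger resolvents -/

/-- `v` is the weak derivative of `u`. -/
structure IsWeakDeriv (u v : ℝ → ℂ) : Prop where
  left : LocallyIntegrable u
  right : LocallyIntegrable v
  eq : ∀ φ : 𝓢(ℝ, ℂ), HasCompactSupport φ → ∫ x, u x * deriv φ x = -∫ x, v x * φ x

/-- `u = R(k) f`, where `R(k) = (-∂² + q + k²)⁻¹` is the resolvent of the Schrödinger operator on
`L²(ℝ)` with potential `q = W'`: the function `u` is in `L²(ℝ) ∩ H¹_loc(ℝ)` and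
`-u'' + q u + k² u = f` in the sense of distributions. As `W` is continuous, `q u` is the
distribution `φ ↦ ⟨q, uφ⟩ = -∫ W (uφ)'`. -/
def IsResolventImage (W : ℝ → ℝ) (k : ℂ) (f : 𝓢'(ℝ, ℂ))
    (u : Lp ℂ 2 (volume : Measure ℝ)) : Prop :=
  ∃ v : ℝ → ℂ, IsWeakDeriv u v ∧
    (∀ K : Set ℝ, IsCompact K → MemLp v 2 (volume.restrict K)) ∧
    ∀ φ : 𝓢(ℝ, ℂ), HasCompactSupport φ →
      (∫ x, v x * deriv φ x) - (∫ x, (W x : ℂ) * (v x * φ x + u x * deriv φ x))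
        + k ^ 2 * ∫ x, u x * φ x = f φ

/-- The operator norm `‖χ R(k) χ'‖_{H^{-1}_κ → H^1_κ} ∈ [0, ∞]` for the potential `W'`: the least
`M` such that, for every `f ∈ H^{-1}`, `R(k) (χ' f)` is well defined and
`‖χ R(k) (χ' f)‖_{H^1_κ} ≤ M ‖f‖_{H^{-1}_κ}`. In particular it is `∞` if `R(k) (χ' f)` fails to
exist or to be unique for some `f ∈ H^{-1}`. -/
def localizedResolventNorm (W : ℝ → ℝ) (k : ℂ) (κ : ℝ) (χ χ' : ℝ → ℂ) : ℝ≥0∞ :=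
  sInf {M : ℝ≥0∞ | ∀ f : 𝓢'(ℝ, ℂ), TemperedDistribution.MemSobolev (-1) 2 f →
    ∃ u : Lp ℂ 2 (volume : Measure ℝ),
      (∀ w, IsResolventImage W k (TemperedDistribution.smulLeftCLM ℂ χ' f) w ↔ w = u) ∧
      sobolevNorm 1 κ (TemperedDistribution.smulLeftCLM ℂ χ (u : 𝓢'(ℝ, ℂ)))
        ≤ M * sobolevNorm (-1) κ f}

/-- The random variable `‖χ_m R_{L₀}(k) χ_n‖_{H^{-1}_κ → H^1_κ}` with `κ = |k|`, as a function of
the sample `q` of white noise. -/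
def blockNorm (χ₁ : ℝ → ℝ) (L₀ : ℕ∞) (k : ℂ) (m n : ℕ) (q : 𝓢(ℝ, ℝ) →L[ℝ] ℝ) : ℝ≥0∞ :=
  localizedResolventNorm (potentialPrimitive L₀ (primitive q)) k ‖k‖
    (dyadicCutoff χ₁ m) (dyadicCutoff χ₁ n)

end WhiteNoiseResolvent

end

namespace WhiteNoiseResolvent

open Set Filter Topology intervalIntegral

/-! ### Locally absolutely continuous functions -/

/-! White noise is the derivative of a Brownian path `W`, so the potential is `V'` with `V`
continuous: `W` itself, or the primitive of the periodized noise. The deterministic part uses one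
feature of `V`, its oscillation on unit intervals. Replacing `V` on each such interval by its linear
interpolant makes the boundary terms telescope, so that `∫ V P'` is bounded by `∫ b (|P| + |P'|)`,
where `b` is a bound for the oscillation (`norm_integral_potential_le`).

Test the equation with `η² ū`. The potential is real, so the imaginary part contains only `Im k² ∫
η² |u|²`, the source and commutators, and `Im k² ≥ c₀ κ²` because `k²` stays in a sector. The real
part bounds `u'` by `b κ u` in `L²`, up to constants and sources (`IsWeakSol.caccioppoli`). An
exponential weight of rate `s` adds a commutator of size `s |u| |u'|`, which is absorbed as soon as
`s ≤ c₀ / (64 b)`. The resulting estimate `IsWeakSol.weighted_estimate` involves the oscillation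
only near the two cutoffs; the square root growth of `V` at infinity matters only for removing an
auxiliary cutoff. Thus a block has norm of order at most `b²`, with an additional factor `exp (-c₀ M
/ (256 b))`, `M = max m n`, when the annuli are separated (`block_le`, `block_le_exp`). Uniqueness
of the resolvent is the same estimate with zero source. Existence follows from Lions' theorem, after
multiplying test functions by `⟨x⟩⁻² - i M₀` with a large constant `M₀` (`IsTest.coercive`,
`exists_isWeakSol`).

For the probabilistic part, Gaussian increments and dyadic chaining bound the oscillation of `W` on
`[j, j + 1]` by `72 √(1 + log g_j)` with `E g_j ≤ 3`. On the window relevant for a block one may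
take `b = 72 √(1 + log S)`, where `S` is the sum of the `g_j` and `E S ≤ 30 M`; periodizing does not
increase this bound. Near the diagonal, powers of `b²` are powers of `log S`, and a bound that is
linear in `S` gives powers of `log m`. Off the diagonal either `b ≤ √M`, and the exponential factor
is at most `exp (-c √M)`, or `b` exceeds `√M`, which is exponentially unlikely; `min_mul_sqrt_le`
combines both cases. Every `α < 1/2` is then allowed.

The block norm is defined through all distributions `f` at once, so its measurability needs proof:
among potentials with a common growth constant it depends continuously on `V` in the locally uniform
topology (`exists_localizedResolventNorm_le_add`), which is second countable
(`aemeasurable_of_uniformContinuous`). That the path built by chaining is the primitive of `q`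
almost surely, for all test functions simultaneously, is `IsWhiteNoise.isPrimitive_brownian_ae`. -/

theorem _root_.MeasureTheory.LocallyIntegrable.intervalIntegrable_real
    {v : ℝ → ℂ} (hv : LocallyIntegrable v) (a b : ℝ) : IntervalIntegrable v volume a b :=
  intervalIntegrable_iff.2
    ((hv.integrableOn_isCompact isCompact_uIcc).mono_set uIoc_subset_uIcc)

/-- `u` is locally absolutely continuous with derivative `v`. -/
structure HasLocDeriv (u v : ℝ → ℂ) : Prop where
  loc : LocallyIntegrable v
  eq : ∀ a b : ℝ, ∫ x in a..b, v x = u b - u a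

theorem _root_.MeasureTheory.LocallyIntegrable.absolutelyContinuousOnInterval
    {v : ℝ → ℂ} (hv : LocallyIntegrable v) (a b : ℝ) :
    AbsolutelyContinuousOnInterval (fun x => ∫ t in a..x, v t) a b := by
  have hi : ∀ x y, IntervalIntegrable v volume x y := fun x y => hv.intervalIntegrable_real x y
  have hre : IntervalIntegrable (fun t => (v t).re) volume a b :=
    ⟨(hi a b).1.re, (hi a b).2.re⟩
  have him : IntervalIntegrable (fun t => (v t).im) volume a b :=
    ⟨(hi a b).1.im, (hi a b).2.im⟩
  have h1 := hre.absolutelyContinuousOnInterval_intervalIntegral (c := a) left_mem_uIcc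
  have h2 := him.absolutelyContinuousOnInterval_intervalIntegral (c := a) left_mem_uIcc
  have c1 : AbsolutelyContinuousOnInterval (fun _ : ℝ => (1 : ℂ)) a b :=
    (contDiff_const.contDiffOn).absolutelyContinuousOnInterval
  have c2 : AbsolutelyContinuousOnInterval (fun _ : ℝ => Complex.I) a b :=
    (contDiff_const.contDiffOn).absolutelyContinuousOnInterval
  have h3 := (h1.smul c1).add (h2.smul c2)
  suffices e : (fun x => ∫ t in a..x, v t) = (fun x => ∫ t in a..x, (v t).re) • (fun _ => (1 : ℂ))
      + (fun x => ∫ t in a..x, (v t).im) • fun _ => Complex.I by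
    rw [e]; exact h3
  funext x
  have hx : IntervalIntegrable v volume a x := hi a x
  have e1 : ∫ t in a..x, v t
      = ∫ t in a..x, (((v t).re : ℂ) + ((v t).im : ℂ) * Complex.I) := by
    simp only [Complex.re_add_im]
  rw [e1, intervalIntegral.integral_add, intervalIntegral.integral_mul_const,
    intervalIntegral.integral_ofReal, intervalIntegral.integral_ofReal]
  · simp
  · exact ⟨hx.1.re.ofReal, hx.2.re.ofReal⟩
  · exact IntervalIntegrable.mul_const ⟨hx.1.im.ofReal, hx.2.im.ofReal⟩ _

namespace HasLocDeriv

variable {u v w z : ℝ → ℂ}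

theorem intervalIntegrable (h : HasLocDeriv u v) (a b : ℝ) : IntervalIntegrable v volume a b :=
  h.loc.intervalIntegrable_real a b

theorem eq_add (h : HasLocDeriv u v) (a x : ℝ) : u x = u a + ∫ t in a..x, v t := by
  rw [h.eq]; ring

theorem continuous (h : HasLocDeriv u v) : Continuous u := by
  have : u = fun x => u 0 + ∫ t in (0 : ℝ)..x, v t := funext fun x => h.eq_add 0 x
  rw [this]
  exact continuous_const.add (intervalIntegral.continuous_primitive h.intervalIntegrable 0)

theorem absolutelyContinuousOnInterval (h : HasLocDeriv u v) (a b : ℝ) :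
    AbsolutelyContinuousOnInterval u a b := by
  have : u = (fun _ => u a) + fun x => ∫ t in a..x, v t := funext fun x => h.eq_add a x
  rw [this]
  exact (contDiff_const.contDiffOn).absolutelyContinuousOnInterval.add
    (h.loc.absolutelyContinuousOnInterval a b)

theorem ae_hasDerivAt (h : HasLocDeriv u v) : ∀ᵐ x, HasDerivAt u (v x) x := by
  filter_upwards [_root_.LocallyIntegrable.ae_hasDerivAt_integral h.loc] with x hx
  have : u = fun y => u 0 + ∫ t in (0 : ℝ)..y, v t := funext fun y => h.eq_add 0 y
  rw [this]
  exact (hx 0).const_add _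

theorem congr_ae (h : HasLocDeriv u v) (hz : v =ᵐ[volume] z) : HasLocDeriv u z where
  loc := h.loc.congr hz
  eq a b := by
    rw [← h.eq a b]
    exact intervalIntegral.integral_congr_ae (hz.symm.mono fun x hx _ => hx)

theorem integral (hv : LocallyIntegrable v) (c : ℂ) :
    HasLocDeriv (fun x => c + ∫ t in (0 : ℝ)..x, v t) v where
  loc := hv
  eq a b := by
    have hi : ∀ x y, IntervalIntegrable v volume x y := fun x y => hv.intervalIntegrable_real x y
    rw [← intervalIntegral.integral_add_adjacent_intervals (hi 0 a) (hi a b)]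
    ring

theorem of_hasDerivAt (h : ∀ x, HasDerivAt u (v x) x) (hv : Continuous v) : HasLocDeriv u v where
  loc := hv.locallyIntegrable
  eq a b := intervalIntegral.integral_eq_sub_of_hasDerivAt (fun x _ => h x)
    (hv.intervalIntegrable a b)

theorem const (c : ℂ) : HasLocDeriv (fun _ => c) (fun _ => 0) :=
  of_hasDerivAt (fun x => hasDerivAt_const x c) continuous_const

theorem add (h : HasLocDeriv u v) (h' : HasLocDeriv w z) :
    HasLocDeriv (fun x => u x + w x) (fun x => v x + z x) where
  loc := h.loc.add h'.loc
  eq a b := by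
    rw [intervalIntegral.integral_add (h.intervalIntegrable a b) (h'.intervalIntegrable a b),
      h.eq, h'.eq]
    ring

theorem const_mul (h : HasLocDeriv u v) (c : ℂ) :
    HasLocDeriv (fun x => c * u x) (fun x => c * v x) where
  loc := h.loc.smul c
  eq a b := by
    rw [intervalIntegral.integral_const_mul, h.eq]
    ring

theorem sub (h : HasLocDeriv u v) (h' : HasLocDeriv w z) :
    HasLocDeriv (fun x => u x - w x) (fun x => v x - z x) where
  loc := h.loc.sub h'.loc
  eq a b := by
    rw [intervalIntegral.integral_sub (h.intervalIntegrable a b) (h'.intervalIntegrable a b),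
      h.eq, h'.eq]
    ring

theorem conj (h : HasLocDeriv u v) :
    HasLocDeriv (fun x => star (u x)) (fun x => star (v x)) where
  loc x := by
    obtain ⟨s, hs, hi⟩ := h.loc x
    exact ⟨s, hs, (Complex.conjCLE : ℂ →L[ℝ] ℂ).integrable_comp hi⟩
  eq a b := by
    have e := congrArg star (h.eq a b)
    rw [star_sub] at e
    rw [← e, intervalIntegral.intervalIntegral_eq_integral_uIoc,
      intervalIntegral.intervalIntegral_eq_integral_uIoc, star_smul, star_trivial]
    congr 1
    exact integral_conj

/-- `u w` minus the primitive of the expected derivative is absolutely continuous with derivative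
zero almost everywhere, hence constant. -/
theorem mul (h : HasLocDeriv u v) (h' : HasLocDeriv w z) :
    HasLocDeriv (fun x => u x * w x) (fun x => v x * w x + u x * z x) := by
  have hloc : LocallyIntegrable fun x => v x * w x + u x * z x := by
    refine (h.loc.mul_continuous h'.continuous).add (h'.loc.continuous_mul h.continuous)
  refine ⟨hloc, fun a b => ?_⟩
  have hac : AbsolutelyContinuousOnInterval
      (u • w - fun x => ∫ t in a..x, (v t * w t + u t * z t)) a b :=
    ((h.absolutelyContinuousOnInterval a b).smul (h'.absolutelyContinuousOnInterval a b)).sub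
      (hloc.absolutelyContinuousOnInterval a b)
  obtain ⟨C, hC⟩ := hac.const_of_ae_hasDerivAt_zero (by
    filter_upwards [h.ae_hasDerivAt, h'.ae_hasDerivAt, _root_.LocallyIntegrable.ae_hasDerivAt_integral hloc]
      with x h1 h2 h3 _
    have := (h1.mul h2).sub (h3 a)
    simpa using this)
  have e1 := hC a left_mem_uIcc
  have e2 := hC b right_mem_uIcc
  simp only [Pi.sub_apply, smul_eq_mul, Pi.mul_apply, intervalIntegral.integral_same,
    sub_zero] at e1 e2
  rw [e1, ← e2]
  ring

theorem of_lipschitz {f : ℝ → ℝ} {K : NNReal} (hf : LipschitzWith K f) :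
    HasLocDeriv (fun x => (f x : ℂ)) (fun x => ((deriv f x : ℝ) : ℂ)) := by
  have hb : ∀ x, ‖deriv f x‖ ≤ K := fun x => norm_deriv_le_of_lipschitz hf
  have hl : LocallyIntegrable fun x => deriv f x := by
    intro x
    refine ⟨Icc (x - 1) (x + 1), Icc_mem_nhds (by linarith) (by linarith), ?_⟩
    exact Measure.integrableOn_of_bounded (M := K) (by simp)
      (measurable_deriv f).aestronglyMeasurable (Eventually.of_forall fun x => hb x)
  refine ⟨fun x => ?_, fun a b => ?_⟩
  · obtain ⟨s, hs, hi⟩ := hl x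
    exact ⟨s, hs, hi.ofReal⟩
  · rw [intervalIntegral.integral_ofReal,
      (hf.lipschitzOnWith (s := uIcc a b)).absolutelyContinuousOnInterval.integral_deriv_eq_sub]
    push_cast; ring

theorem integral_eq_zero (h : HasLocDeriv u v) {R : ℝ} (hu : ∀ x, R < |x| → u x = 0)
    (hv : ∀ x, R < |x| → v x = 0) : ∫ x, v x = 0 := by
  -- `R` may be negative, so the interval of integration is built from `|R| + 1`.
  have hR : R < |R| + 1 := by linarith [le_abs_self R]
  have e := h.eq (-(|R| + 1)) (|R| + 1)
  rw [hu _ (by rwa [abs_of_nonneg (by positivity)]),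
    hu _ (by rwa [abs_neg, abs_of_nonneg (by positivity)]), sub_zero] at e
  rw [← e]
  symm
  apply intervalIntegral.integral_eq_integral_of_support_subset
  intro x hx
  by_contra hc
  apply hx (hv x _)
  by_contra hlt
  push Not at hlt
  apply hc
  have := abs_le.1 hlt
  have h3 := le_abs_self R
  constructor <;> linarith

end HasLocDeriv

/-- `v` is locally square integrable. -/
def IsL2Loc (v : ℝ → ℂ) : Prop := ∀ R : ℝ, MemLp v 2 (volume.restrict (Icc (-R) R))

namespace IsL2Loc

variable {u v w : ℝ → ℂ}

theorem _root_.Continuous.isL2Loc (h : Continuous u) : IsL2Loc u := by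
  intro R
  obtain ⟨C, hC⟩ := isCompact_Icc.exists_bound_of_continuousOn (s := Icc (-R) R) h.continuousOn
  refine MemLp.of_bound h.aestronglyMeasurable C ?_
  exact (ae_restrict_iff' measurableSet_Icc).2 (Eventually.of_forall hC)

theorem _root_.MeasureTheory.MemLp.isL2Loc (h : MemLp u 2) : IsL2Loc u := fun _ => h.restrict _

theorem add (h : IsL2Loc u) (h' : IsL2Loc v) : IsL2Loc fun x => u x + v x :=
  fun R => (h R).add (h' R)

theorem sub (h : IsL2Loc u) (h' : IsL2Loc v) : IsL2Loc fun x => u x - v x :=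
  fun R => (h R).sub (h' R)

theorem const_mul (h : IsL2Loc u) (c : ℂ) : IsL2Loc fun x => c * u x :=
  fun R => (h R).const_mul c

theorem conj (h : IsL2Loc u) : IsL2Loc fun x => star (u x) :=
  fun R => (h R).star

theorem mul_continuous (h : IsL2Loc u) (hw : Continuous w) : IsL2Loc fun x => u x * w x := by
  intro R
  obtain ⟨C, hC⟩ := isCompact_Icc.exists_bound_of_continuousOn (s := Icc (-R) R) hw.continuousOn
  refine (h R).of_le_mul (c := C) ((h R).1.mul hw.aestronglyMeasurable) ?_
  refine (ae_restrict_iff' measurableSet_Icc).2 (Eventually.of_forall fun x hx => ?_)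
  rw [norm_mul, mul_comm]
  exact mul_le_mul_of_nonneg_right (hC x hx) (norm_nonneg _)

theorem continuous_mul (h : IsL2Loc u) (hw : Continuous w) : IsL2Loc fun x => w x * u x := by
  simpa only [mul_comm] using h.mul_continuous hw

theorem integrableOn_mul (h : IsL2Loc u) (h' : IsL2Loc v) (R : ℝ) :
    IntegrableOn (fun x => u x * v x) (Icc (-R) R) :=
  (h R).integrable_mul (h' R)

theorem _root_.MeasureTheory.IntegrableOn.integrable_of_abs_le {E : Type*} [NormedAddCommGroup E]
    {f : ℝ → E} {R : ℝ}
    (h : IntegrableOn f (Icc (-R) R)) (hf : ∀ x, R < |x| → f x = 0) : Integrable f := by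
  rw [← integrableOn_univ]
  refine h.of_forall_sdiff_eq_zero MeasurableSet.univ fun x hx => hf x ?_
  by_contra hlt
  exact hx.2 (abs_le.1 (not_lt.1 hlt))

theorem integrable_mul (h : IsL2Loc u) (h' : IsL2Loc v) {R : ℝ}
    (hv : ∀ x, R < |x| → v x = 0) : Integrable fun x => u x * v x :=
  (h.integrableOn_mul h' R).integrable_of_abs_le fun x hx => by rw [hv x hx, mul_zero]

theorem memLp (h : IsL2Loc u) {R : ℝ} (hu : ∀ x, R < |x| → u x = 0) : MemLp u 2 := by
  have e : u = (Icc (-R) R).indicator u := by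
    ext x
    by_cases hx : x ∈ Icc (-R) R
    · rw [indicator_of_mem hx]
    · rw [indicator_of_notMem hx, hu]
      by_contra hlt
      exact hx (abs_le.1 (not_lt.1 hlt))
  rw [e, memLp_indicator_iff_restrict measurableSet_Icc]
  exact h R

theorem locallyIntegrable (h : IsL2Loc u) : LocallyIntegrable u := by
  intro x
  refine ⟨Icc (-(|x| + 1)) (|x| + 1), ?_, (h _).integrable (by norm_num)⟩
  have := neg_abs_le x
  have := le_abs_self x
  exact Icc_mem_nhds (by linarith) (by linarith)

theorem restrict_compact (h : IsL2Loc u) {K : Set ℝ} (hK : IsCompact K) :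
    MemLp u 2 (volume.restrict K) := by
  obtain ⟨R, hR⟩ := hK.isBounded.subset_closedBall 0
  refine (h R).mono_measure (Measure.restrict_mono ?_ le_rfl)
  rwa [Real.closedBall_eq_Icc, zero_sub, zero_add] at hR

end IsL2Loc

theorem HasLocDeriv.isL2Loc {u v : ℝ → ℂ} (h : HasLocDeriv u v) : IsL2Loc u :=
  h.continuous.isL2Loc

end WhiteNoiseResolvent

noncomputable section
namespace WhiteNoiseResolvent

open TemperedDistribution FourierTransform LineDeriv

/-! ### Sobolev norms -/

/-- The symbol of `(4κ² - ∂²)^{s/2}`. -/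
def besselSymbol (s κ ξ : ℝ) : ℝ := (4 * κ ^ 2 + (2 * Real.pi * ξ) ^ 2) ^ (s / 2)

theorem besselBase_pos {κ : ℝ} (hκ : 0 < κ) (ξ : ℝ) : 0 < 4 * κ ^ 2 + (2 * Real.pi * ξ) ^ 2 := by
  positivity

theorem hasTemperateGrowth_besselSymbol (s : ℝ) {κ : ℝ} (hκ : 0 < κ) :
    (besselSymbol s κ).HasTemperateGrowth := by
  have h1 : (fun x : ℝ => (1 + ‖x‖ ^ 2) ^ (s / 2)).HasTemperateGrowth :=
    Function.hasTemperateGrowth_one_add_norm_sq_rpow ℝ (s / 2)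
  have h2 : (fun ξ : ℝ => (Real.pi / κ) * ξ).HasTemperateGrowth := by fun_prop
  have h3 := h1.comp h2
  have h4 := (Function.HasTemperateGrowth.const (E := ℝ) ((4 * κ ^ 2) ^ (s / 2))).mul h3
  convert! h4 using 1
  ext ξ
  simp only [besselSymbol, Pi.mul_apply, Function.comp_apply, Real.norm_eq_abs, sq_abs]
  rw [← Real.mul_rpow (by positivity) (by positivity)]
  congr 1
  field_simp
  ring

theorem hasTemperateGrowth_ofReal_besselSymbol (s : ℝ) {κ : ℝ} (hκ : 0 < κ) :
    (fun ξ => (besselSymbol s κ ξ : ℂ)).HasTemperateGrowth :=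
  Function.Complex.hasTemperateGrowth_ofReal.comp (hasTemperateGrowth_besselSymbol s hκ)

/-- Plancherel: on the Fourier side the operator multiplies by a bounded function. -/
theorem exists_fourierMultiplier_eq {g : ℝ → ℂ} (hg : g.HasTemperateGrowth) {C : ℝ}
    (hb : ∀ x, ‖g x‖ ≤ C) (G : Lp ℂ 2 (volume : Measure ℝ)) :
    ∃ G' : Lp ℂ 2 (volume : Measure ℝ),
      TemperedDistribution.fourierMultiplierCLM ℂ g (G : 𝓢'(ℝ, ℂ)) = (G' : 𝓢'(ℝ, ℂ)) ∧
        ‖G'‖ ≤ C * ‖G‖ := by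
  have hm : MemLp g ⊤ (volume : Measure ℝ) :=
    memLp_top_of_bound hg.1.continuous.aestronglyMeasurable C (Filter.Eventually.of_forall hb)
  let H : Lp ℂ 2 (volume : Measure ℝ) := hm.toLp g • (𝓕 G : Lp ℂ 2 (volume : Measure ℝ))
  refine ⟨𝓕⁻ H, ?_, ?_⟩
  · rw [TemperedDistribution.fourierMultiplierCLM_apply, Lp.fourier_toTemperedDistribution_eq,
      ← Lp.fourierInv_toTemperedDistribution_eq,
      MeasureTheory.Lp.toTemperedDistribution_smul_eq hg hm]
  · have h1 : ‖(𝓕⁻ H : Lp ℂ 2 (volume : Measure ℝ))‖ = ‖H‖ :=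
      (Lp.fourierTransformₗᵢ ℝ ℂ).symm.norm_map H
    have h2 : ‖(𝓕 G : Lp ℂ 2 (volume : Measure ℝ))‖ = ‖G‖ := Lp.norm_fourier_eq G
    rw [h1, ← h2]
    refine Lp.norm_le_mul_norm_of_ae_le_mul ?_
    filter_upwards [Lp.coeFn_lpSMul (r := 2) (hm.toLp g) (𝓕 G : Lp ℂ 2 (volume : Measure ℝ)),
      hm.coeFn_toLp] with x h3 h4
    rw [h3, Pi.smul_apply', h4, norm_smul]
    exact mul_le_mul_of_nonneg_right (hb x) (norm_nonneg _)

theorem toTemperedDistribution_injective {G G' : Lp ℂ 2 (volume : Measure ℝ)}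
    (h : (G : 𝓢'(ℝ, ℂ)) = (G' : 𝓢'(ℝ, ℂ))) : G = G' := by
  have := LinearMap.ker_eq_bot.1
    (MeasureTheory.Lp.ker_toTemperedDistributionCLM_eq_bot (E := ℝ) (F := ℂ) (μ := volume) (p := 2))
  exact this h

/-- The infimum defining the norm runs over at most one element, because `L²` embeds injectively
into tempered distributions. -/
theorem sobolevNorm_eq {s κ : ℝ} {T : 𝓢'(ℝ, ℂ)} {G : Lp ℂ 2 (volume : Measure ℝ)}
    (h : TemperedDistribution.fourierMultiplierCLM ℂ (fun ξ => (besselSymbol s κ ξ : ℂ)) T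
      = (G : 𝓢'(ℝ, ℂ))) : sobolevNorm s κ T = ‖G‖ₑ := by
  refine le_antisymm (iInf₂_le G h) (le_iInf₂ fun G' h' => ?_)
  have : G = G' := toTemperedDistribution_injective (h.symm.trans h')
  rw [this]

theorem sobolevNorm_add_le (s κ : ℝ) (T T' : 𝓢'(ℝ, ℂ)) :
    sobolevNorm s κ (T + T') ≤ sobolevNorm s κ T + sobolevNorm s κ T' := by
  unfold sobolevNorm
  refine ENNReal.le_iInf₂_add_iInf₂ fun G h G' h' => ?_
  refine (iInf₂_le (G + G') ?_).trans (enorm_add_le G G')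
  rw [map_add, h, h']
  exact ((MeasureTheory.Lp.toTemperedDistributionCLM ℂ volume 2).map_add G G').symm

theorem besselSymbol_mul (s t : ℝ) {κ : ℝ} (hκ : 0 < κ) (ξ : ℝ) :
    besselSymbol s κ ξ * besselSymbol t κ ξ = besselSymbol (s + t) κ ξ := by
  unfold besselSymbol
  rw [← Real.rpow_add (besselBase_pos hκ ξ)]
  congr 1; ring

theorem besselSymbol_zero (κ ξ : ℝ) : besselSymbol 0 κ ξ = 1 := by simp [besselSymbol]

theorem besselSymbol_two (κ ξ : ℝ) :
    besselSymbol 2 κ ξ = 4 * κ ^ 2 + (2 * Real.pi * ξ) ^ 2 := by simp [besselSymbol]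

theorem besselSymbol_pos (s : ℝ) {κ : ℝ} (hκ : 0 < κ) (ξ : ℝ) : 0 < besselSymbol s κ ξ :=
  Real.rpow_pos_of_pos (besselBase_pos hκ ξ) _

theorem besselSymbol_neg_one_le {κ : ℝ} (hκ : 0 < κ) (ξ : ℝ) :
    2 * κ * besselSymbol (-1) κ ξ ≤ 1 ∧ |2 * Real.pi * ξ| * besselSymbol (-1) κ ξ ≤ 1 := by
  have h1 : besselSymbol 1 κ ξ = Real.sqrt (4 * κ ^ 2 + (2 * Real.pi * ξ) ^ 2) := by
    rw [besselSymbol, Real.sqrt_eq_rpow]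
  have h2 : besselSymbol 1 κ ξ * besselSymbol (-1) κ ξ = 1 := by
    rw [besselSymbol_mul _ _ hκ, add_neg_cancel, besselSymbol_zero]
  have h3 := (besselSymbol_pos (-1) hκ ξ).le
  constructor <;> refine (mul_le_mul_of_nonneg_right ?_ h3).trans h2.le <;> rw [h1] <;>
    apply Real.le_sqrt_of_sq_le
  · nlinarith [sq_nonneg (2 * Real.pi * ξ)]
  · rw [sq_abs]; nlinarith [sq_nonneg κ]

theorem hasTemperateGrowth_linear : (fun ξ : ℝ => ((2 * Real.pi * ξ : ℝ) : ℂ)).HasTemperateGrowth := by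
  fun_prop

theorem fourierMultiplier_linear_eq (T : 𝓢'(ℝ, ℂ)) :
    TemperedDistribution.fourierMultiplierCLM ℂ (fun ξ : ℝ => ((2 * Real.pi * ξ : ℝ) : ℂ)) T
      = -Complex.I • ∂_{(1 : ℝ)} T := by
  rw [TemperedDistribution.lineDeriv_eq_fourierMultiplierCLM, smul_smul]
  have : (fun ξ : ℝ => ((2 * Real.pi * ξ : ℝ) : ℂ))
      = (2 * Real.pi : ℂ) • fun ξ : ℝ => ((inner ℝ ξ (1 : ℝ) : ℝ) : ℂ) := by
    ext ξ
    simp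
  rw [this, TemperedDistribution.fourierMultiplierCLM_smul (by fun_prop)]
  rw [smul_apply]
  congr 1
  linear_combination (2 * Real.pi : ℂ) * Complex.I_mul_I

theorem lineDeriv_one_apply (T : 𝓢'(ℝ, ℂ)) (φ : 𝓢(ℝ, ℂ)) :
    (∂_{(1 : ℝ)} T) φ = -T (SchwartzMap.derivCLM ℂ ℂ φ) := by
  rw [TemperedDistribution.lineDerivOp_apply_apply, map_neg]
  rfl

theorem distribution_add_apply (S T : 𝓢'(ℝ, ℂ)) (φ : 𝓢(ℝ, ℂ)) : (S + T) φ = S φ + T φ := rfl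

theorem distribution_smul_apply (c : ℂ) (T : 𝓢'(ℝ, ℂ)) (φ : 𝓢(ℝ, ℂ)) : (c • T) φ = c • T φ := rfl

theorem hasTemperateGrowth_linear_mul_besselSymbol {κ : ℝ} (hκ : 0 < κ) :
    (fun ξ : ℝ => ((2 * Real.pi * ξ * besselSymbol (-1) κ ξ : ℝ) : ℂ)).HasTemperateGrowth := by
  have := hasTemperateGrowth_linear.mul (hasTemperateGrowth_ofReal_besselSymbol (-1) hκ)
  convert! this using 1
  ext ξ; simp

/-- With `Λ² = 4κ² + ξ²` this is `Λ = 4κ² Λ⁻¹ + (ξ Λ⁻¹) ξ`. The multipliers `Λ⁻¹` and `ξ Λ⁻¹` are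
bounded, so the identity splits `H⁻¹` into `L²` and derivatives of `L²`, and bounds the `H¹` norm by
a function and its derivative. -/
theorem fourierMultiplier_besselSymbol_one {κ : ℝ} (hκ : 0 < κ) (T : 𝓢'(ℝ, ℂ)) :
    TemperedDistribution.fourierMultiplierCLM ℂ (fun ξ => (besselSymbol 1 κ ξ : ℂ)) T
      = (4 * κ ^ 2 : ℂ) • TemperedDistribution.fourierMultiplierCLM ℂ
          (fun ξ => (besselSymbol (-1) κ ξ : ℂ)) T
        + TemperedDistribution.fourierMultiplierCLM ℂ
          ((fun ξ : ℝ => ((2 * Real.pi * ξ * besselSymbol (-1) κ ξ : ℝ) : ℂ))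
            * fun ξ : ℝ => ((2 * Real.pi * ξ : ℝ) : ℂ)) T := by
  have t1 := hasTemperateGrowth_ofReal_besselSymbol (-1) hκ
  have t2 := hasTemperateGrowth_ofReal_besselSymbol 1 hκ
  have t4 := (hasTemperateGrowth_linear_mul_besselSymbol hκ).mul hasTemperateGrowth_linear
  ext φ
  rw [distribution_add_apply, distribution_smul_apply]
  simp only [TemperedDistribution.fourierMultiplierCLM_apply_apply]
  rw [← map_smul, ← map_add, ← FourierTransform.fourier_smul, ← FourierTransform.fourier_add]
  congr 2
  ext ξ
  rw [SchwartzMap.smulLeftCLM_apply_apply t2, _root_.add_apply, _root_.smul_apply,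
    SchwartzMap.smulLeftCLM_apply_apply t1, SchwartzMap.smulLeftCLM_apply_apply t4]
  have h2 : besselSymbol 1 κ ξ
      = 4 * κ ^ 2 * besselSymbol (-1) κ ξ
        + (2 * Real.pi * ξ * besselSymbol (-1) κ ξ) * (2 * Real.pi * ξ) := by
    have : besselSymbol 1 κ ξ = besselSymbol 2 κ ξ * besselSymbol (-1) κ ξ := by
      rw [besselSymbol_mul _ _ hκ]; norm_num
    rw [this, besselSymbol_two]; ring
  rw [h2]
  simp only [Pi.mul_apply, smul_eq_mul]
  push_cast
  ring

/-- Elements of `H^{-1}` are of the form `h - g'` with `g, h ∈ L²`. -/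
theorem exists_repr_of_memSobolev {κ : ℝ} (hκ : 0 < κ) {f : 𝓢'(ℝ, ℂ)}
    (hf : MemSobolev (-1) 2 f) :
    ∃ (Φ : ℝ) (g h : Lp ℂ 2 (volume : Measure ℝ)), 0 ≤ Φ ∧
      sobolevNorm (-1) κ f = ENNReal.ofReal Φ ∧ ‖g‖ ≤ Φ ∧ ‖h‖ ≤ 2 * κ * Φ ∧
      ∀ φ : 𝓢(ℝ, ℂ), f φ = (∫ x, h x * φ x) + ∫ x, g x * deriv φ x := by
  have t1 := hasTemperateGrowth_ofReal_besselSymbol (-1) hκ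
  have t2 := hasTemperateGrowth_ofReal_besselSymbol 1 hκ
  obtain ⟨G, hG⟩ : ∃ G : Lp ℂ 2 (volume : Measure ℝ),
      TemperedDistribution.fourierMultiplierCLM ℂ (fun ξ => (besselSymbol (-1) κ ξ : ℂ)) f
        = (G : 𝓢'(ℝ, ℂ)) := by
    obtain ⟨f', hf'⟩ := hf
    -- `MemSobolev` is formulated with the symbol `1 + ξ²`; the quotient of the two symbols is
    -- bounded, with a bound depending on `κ` that never enters the final estimate.
    let r : ℝ → ℂ := fun ξ => ((besselSymbol (-1) κ ξ * (1 + ‖ξ‖ ^ 2) ^ (1 / 2 : ℝ) : ℝ) : ℂ)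
    have hr : r.HasTemperateGrowth :=
      Function.Complex.hasTemperateGrowth_ofReal.comp ((hasTemperateGrowth_besselSymbol (-1) hκ).mul
        (Function.hasTemperateGrowth_one_add_norm_sq_rpow ℝ (1 / 2)))
    have hb : ∀ ξ, ‖r ξ‖ ≤ 1 / (2 * κ) + 1 / (2 * Real.pi) := by
      intro ξ
      have h0 := (besselSymbol_pos (-1) hκ ξ).le
      obtain ⟨h1, h2⟩ := besselSymbol_neg_one_le hκ ξ
      have hs : (1 + ‖ξ‖ ^ 2) ^ (1 / 2 : ℝ) ≤ 1 + |ξ| := by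
        rw [← Real.sqrt_eq_rpow, Real.norm_eq_abs]
        apply Real.sqrt_le_iff.2 ⟨by positivity, _⟩
        nlinarith [abs_nonneg ξ]
      rw [Complex.norm_real, Real.norm_eq_abs, abs_of_nonneg (by positivity)]
      calc _ ≤ besselSymbol (-1) κ ξ * (1 + |ξ|) := by gcongr
        _ = (2 * κ * besselSymbol (-1) κ ξ) / (2 * κ)
            + (|2 * Real.pi * ξ| * besselSymbol (-1) κ ξ) / (2 * Real.pi) := by
          rw [abs_mul, abs_of_pos (by positivity : (0 : ℝ) < 2 * Real.pi)]
          field_simp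
        _ ≤ _ := by gcongr
    obtain ⟨G, hG, -⟩ := exists_fourierMultiplier_eq hr hb f'
    refine ⟨G, ?_⟩
    rw [← hG, ← hf', besselPotential,
      TemperedDistribution.fourierMultiplierCLM_fourierMultiplierCLM_apply (by fun_prop) hr]
    congr 2
    ext ξ
    simp only [Pi.mul_apply, r]
    norm_cast
    have : ((1 : ℝ) + ‖ξ‖ ^ 2) ^ (-1 / 2 : ℝ) * (1 + ‖ξ‖ ^ 2) ^ (1 / 2 : ℝ) = 1 := by
      rw [← Real.rpow_add (by positivity)]; norm_num
    push_cast at this ⊢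
    linear_combination (-besselSymbol (-1) κ ξ) * this
  have hf' : f = TemperedDistribution.fourierMultiplierCLM ℂ
      (fun ξ => (besselSymbol 1 κ ξ : ℂ)) (G : 𝓢'(ℝ, ℂ)) := by
    rw [← hG, TemperedDistribution.fourierMultiplierCLM_fourierMultiplierCLM_apply t1 t2]
    have : ((fun ξ => (besselSymbol (-1) κ ξ : ℂ)) * fun ξ => (besselSymbol 1 κ ξ : ℂ))
        = fun _ : ℝ => (1 : ℂ) := by
      ext ξ
      simp only [Pi.mul_apply]
      rw [← Complex.ofReal_mul, besselSymbol_mul _ _ hκ, neg_add_cancel, besselSymbol_zero,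
        Complex.ofReal_one]
    rw [this]
    simp
  obtain ⟨a, ha, ha'⟩ := exists_fourierMultiplier_eq t1 (C := 1 / (2 * κ))
    (fun ξ => by
      rw [Complex.norm_real, Real.norm_eq_abs, abs_of_pos (besselSymbol_pos _ hκ ξ),
        le_div_iff₀ (by positivity)]
      linarith [(besselSymbol_neg_one_le hκ ξ).1]) G
  have t3 := hasTemperateGrowth_linear_mul_besselSymbol hκ
  obtain ⟨b, hb, hb'⟩ := exists_fourierMultiplier_eq t3 (C := 1)
    (fun ξ => by
      rw [Complex.norm_real, Real.norm_eq_abs, abs_mul, abs_of_pos (besselSymbol_pos _ hκ ξ)]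
      exact (besselSymbol_neg_one_le hκ ξ).2) G
  -- Here `a = Λ⁻¹ G` and `b = ξ Λ⁻¹ G`, so the representation has `h = 4κ² a` and `g = i b`; the
  -- bound `1 / (2κ)` for `Λ⁻¹` yields the factor `2κ` in the bound for `h`.
  have hdec : f = (4 * κ ^ 2 : ℂ) • (a : 𝓢'(ℝ, ℂ)) - Complex.I • ∂_{(1 : ℝ)} (b : 𝓢'(ℝ, ℂ)) := by
    rw [sub_eq_add_neg, ← neg_smul, ← fourierMultiplier_linear_eq, ← ha, ← hb,
      TemperedDistribution.fourierMultiplierCLM_fourierMultiplierCLM_apply t3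
        hasTemperateGrowth_linear, hf']
    exact fourierMultiplier_besselSymbol_one hκ _
  refine ⟨‖G‖, Complex.I • b, (4 * κ ^ 2 : ℂ) • a, norm_nonneg _, ?_, ?_, ?_, fun φ => ?_⟩
  · rw [sobolevNorm_eq hG, ofReal_norm]
  · rw [norm_smul, Complex.norm_I, one_mul]; linarith
  · rw [norm_smul]
    have : ‖(4 * κ ^ 2 : ℂ)‖ = 4 * κ ^ 2 := by
      rw [norm_mul, norm_pow, Complex.norm_real, Real.norm_eq_abs, abs_of_pos hκ]; norm_num
    rw [this]
    calc _ ≤ 4 * κ ^ 2 * (1 / (2 * κ) * ‖G‖) := by gcongr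
      _ = _ := by field_simp; ring
  · conv_lhs => rw [hdec]
    change (4 * κ ^ 2 : ℂ) • ((a : 𝓢'(ℝ, ℂ)) φ) - Complex.I • (∂_{(1 : ℝ)} (b : 𝓢'(ℝ, ℂ)) φ) = _
    rw [lineDeriv_one_apply, Lp.toTemperedDistribution_apply, Lp.toTemperedDistribution_apply,
      smul_neg, sub_neg_eq_add, ← integral_smul, ← integral_smul]
    congr 1
    · refine integral_congr_ae ?_
      filter_upwards [Lp.coeFn_smul (4 * κ ^ 2 : ℂ) a] with x hx
      rw [hx, Pi.smul_apply, smul_eq_mul, smul_eq_mul, smul_eq_mul]; ring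
    · refine integral_congr_ae ?_
      filter_upwards [Lp.coeFn_smul Complex.I b] with x hx
      rw [hx, Pi.smul_apply, smul_eq_mul, smul_eq_mul, smul_eq_mul, SchwartzMap.derivCLM_apply]
      ring

/-- The `H¹_κ` norm is controlled by the `L²` norms of a function and of its derivative. -/
theorem sobolevNorm_one_le {κ : ℝ} (hκ : 0 < κ) {w z : Lp ℂ 2 (volume : Measure ℝ)}
    (h : ∀ φ : 𝓢(ℝ, ℂ), ∫ x, w x * deriv φ x = -∫ x, z x * φ x) :
    sobolevNorm 1 κ (w : 𝓢'(ℝ, ℂ)) ≤ ENNReal.ofReal (2 * κ * ‖w‖ + ‖z‖) := by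
  have t1 := hasTemperateGrowth_ofReal_besselSymbol (-1) hκ
  have t3 := hasTemperateGrowth_linear_mul_besselSymbol hκ
  have hz : ∂_{(1 : ℝ)} (w : 𝓢'(ℝ, ℂ)) = (z : 𝓢'(ℝ, ℂ)) := by
    ext φ
    rw [lineDeriv_one_apply, Lp.toTemperedDistribution_apply, Lp.toTemperedDistribution_apply]
    have := h φ
    simp only [SchwartzMap.derivCLM_apply, smul_eq_mul]
    simp only [mul_comm (w _), mul_comm (z _)] at this
    rw [this, neg_neg]
  obtain ⟨a, ha, ha'⟩ := exists_fourierMultiplier_eq t1 (C := 1 / (2 * κ))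
    (fun ξ => by
      rw [Complex.norm_real, Real.norm_eq_abs, abs_of_pos (besselSymbol_pos _ hκ ξ),
        le_div_iff₀ (by positivity)]
      linarith [(besselSymbol_neg_one_le hκ ξ).1]) w
  obtain ⟨b, hb, hb'⟩ := exists_fourierMultiplier_eq t3 (C := 1)
    (fun ξ => by
      rw [Complex.norm_real, Real.norm_eq_abs, abs_mul, abs_of_pos (besselSymbol_pos _ hκ ξ)]
      exact (besselSymbol_neg_one_le hκ ξ).2) z
  have hdec : TemperedDistribution.fourierMultiplierCLM ℂ
      (fun ξ => (besselSymbol 1 κ ξ : ℂ)) (w : 𝓢'(ℝ, ℂ))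
        = (((4 * κ ^ 2 : ℂ) • a + (-Complex.I) • b : Lp ℂ 2 (volume : Measure ℝ)) : 𝓢'(ℝ, ℂ)) := by
    have e1 : (((4 * κ ^ 2 : ℂ) • a + (-Complex.I) • b : Lp ℂ 2 (volume : Measure ℝ)) : 𝓢'(ℝ, ℂ))
        = (4 * κ ^ 2 : ℂ) • (a : 𝓢'(ℝ, ℂ)) + (-Complex.I) • (b : 𝓢'(ℝ, ℂ)) := by
      have := (MeasureTheory.Lp.toTemperedDistributionCLM ℂ (volume : Measure ℝ) 2)
      simp only [← Lp.toTemperedDistributionCLM_apply, map_add, map_smul]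
    rw [e1, ← ha, ← hb, ← hz, ← map_smul _ (-Complex.I), ← fourierMultiplier_linear_eq,
      TemperedDistribution.fourierMultiplierCLM_fourierMultiplierCLM_apply
        hasTemperateGrowth_linear t3, mul_comm (fun ξ : ℝ => ((2 * Real.pi * ξ : ℝ) : ℂ))]
    exact fourierMultiplier_besselSymbol_one hκ _
  rw [sobolevNorm_eq hdec, ← ofReal_norm]
  refine ENNReal.ofReal_le_ofReal ((norm_add_le _ _).trans ?_)
  rw [norm_smul, norm_smul, norm_neg, Complex.norm_I, one_mul]
  have : ‖(4 * κ ^ 2 : ℂ)‖ = 4 * κ ^ 2 := by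
    rw [norm_mul, norm_pow, Complex.norm_real, Real.norm_eq_abs, abs_of_pos hκ]; norm_num
  rw [this]
  calc _ ≤ 4 * κ ^ 2 * (1 / (2 * κ) * ‖w‖) + ‖z‖ := by gcongr; linarith
    _ = _ := by field_simp; ring

end WhiteNoiseResolvent
end

namespace WhiteNoiseResolvent

open Set Filter Topology

/-! ### Rough potentials as forms -/

/-- The oscillation of `V` on the unit interval `[i, i + 1]` is bounded by the values of `β` on this
interval, for all integers `-R ≤ i < R`. -/
def OscLE (V : ℝ → ℝ) (R : ℕ) (β : ℝ → ℝ) : Prop :=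
  ∀ i : ℤ, -(R : ℤ) ≤ i → i < R → ∀ x ∈ Icc (i : ℝ) (i + 1), ∀ y ∈ Icc (i : ℝ) (i + 1),
    ∀ t ∈ Icc (i : ℝ) (i + 1), |V x - V y| ≤ β t

theorem OscLE.mono {V β : ℝ → ℝ} {R R' : ℕ} (h : OscLE V R β) (hR : R' ≤ R) : OscLE V R' β :=
  fun i h1 h2 => h i (by omega) (by omega)

/-- Let `ℓ` be the affine function agreeing with `V` at both endpoints. Then `V - ℓ` is a convex
combination of differences of values of `V`, hence at most `β`, and integration by parts turns `∫ ℓ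
Q` into the boundary term minus `c ∫ P`, where the slope `c` is also at most `β`. Subtracting a
constant instead of `ℓ` would leave boundary terms that do not match between neighbouring intervals.
-/
theorem HasLocDeriv.norm_integral_mul_sub_le {V β : ℝ → ℝ} (hV : Continuous V) (hβ : Continuous β)
    {P Q : ℝ → ℂ} (h : HasLocDeriv P Q) {a : ℝ}
    (hosc : ∀ x ∈ Icc a (a + 1), ∀ y ∈ Icc a (a + 1), ∀ t ∈ Icc a (a + 1), |V x - V y| ≤ β t) :
    ‖(∫ x in a..a + 1, (V x : ℂ) * Q x) - (V (a + 1) * P (a + 1) - V a * P a)‖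
      ≤ ∫ x in a..a + 1, β x * (‖P x‖ + ‖Q x‖) := by
  have ha : a ≤ a + 1 := by linarith
  set c : ℝ := V (a + 1) - V a with hc
  have hℓ : HasLocDeriv (fun x => ((V a + c * (x - a) : ℝ) : ℂ)) (fun _ => (c : ℂ)) := by
    refine HasLocDeriv.of_hasDerivAt (fun x => ?_) continuous_const
    have : HasDerivAt (fun x : ℝ => V a + c * (x - a)) c x := by
      simpa using (((hasDerivAt_id x).sub_const a).const_mul c).const_add (V a)
    exact this.ofReal_comp
  have hm := (hℓ.mul h).eq a (a + 1)
  have hQ : IntervalIntegrable (fun x => (V x : ℂ) * Q x) volume a (a + 1) :=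
    (h.loc.continuous_mul (Complex.continuous_ofReal.comp hV)).intervalIntegrable_real _ _
  have hm' := (hℓ.mul h).intervalIntegrable a (a + 1)
  have e : (V (a + 1) * P (a + 1) - V a * P a : ℂ)
      = ∫ x in a..a + 1, ((c : ℂ) * P x + ((V a + c * (x - a) : ℝ) : ℂ) * Q x) := by
    rw [hm]
    simp only [sub_self, mul_zero, add_zero, add_sub_cancel_left, mul_one, hc, add_sub_cancel]
  rw [e, ← intervalIntegral.integral_sub hQ hm']
  have hint : IntervalIntegrable (fun x => β x * (‖P x‖ + ‖Q x‖)) volume a (a + 1) := by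
    refine IntervalIntegrable.continuousOn_mul ?_ hβ.continuousOn
    exact (h.continuous.norm.intervalIntegrable _ _).add (h.intervalIntegrable _ _).norm
  refine intervalIntegral.norm_integral_le_of_norm_le ha ?_ hint
  refine Eventually.of_forall fun x hx => ?_
  have hx' : x ∈ Icc a (a + 1) := Ioc_subset_Icc_self hx
  have h0 : a ∈ Icc a (a + 1) := left_mem_Icc.2 ha
  have h1 : a + 1 ∈ Icc a (a + 1) := right_mem_Icc.2 ha
  have k1 := abs_le.1 (hosc x hx' a h0 x hx')
  have k2 := abs_le.1 (hosc x hx' (a + 1) h1 x hx')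
  have k3 := hosc (a + 1) h1 a h0 x hx'
  have k4 : |V x - (V a + c * (x - a))| ≤ β x := by
    have hs0 : 0 ≤ x - a := by linarith [hx'.1]
    have hs1 : 0 ≤ 1 - (x - a) := by linarith [hx'.2]
    have : V x - (V a + c * (x - a)) = (1 - (x - a)) * (V x - V a) + (x - a) * (V x - V (a + 1)) := by
      rw [hc]; ring
    rw [this, abs_le]
    constructor <;> nlinarith
  have : (V x : ℂ) * Q x - ((c : ℂ) * P x + ((V a + c * (x - a) : ℝ) : ℂ) * Q x)
      = ((V x - (V a + c * (x - a)) : ℝ) : ℂ) * Q x - (c : ℂ) * P x := by push_cast; ring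
  rw [this]
  refine (norm_sub_le _ _).trans ?_
  rw [norm_mul, norm_mul, Complex.norm_real, Complex.norm_real, Real.norm_eq_abs, Real.norm_eq_abs]
  nlinarith [norm_nonneg (P x), norm_nonneg (Q x)]

/-- The form bound for the distribution `V'`. -/
theorem HasLocDeriv.norm_integral_potential_le {V β : ℝ → ℝ} (hV : Continuous V)
    (hβ : Continuous β) {P Q : ℝ → ℂ} (h : HasLocDeriv P Q) {R : ℕ} (hosc : OscLE V R β)
    (hP : ∀ x, (R : ℝ) ≤ |x| → P x = 0) (hQ : ∀ x, (R : ℝ) ≤ |x| → Q x = 0) :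
    ‖∫ x, (V x : ℂ) * Q x‖ ≤ ∫ x, β x * (‖P x‖ + ‖Q x‖) := by
  have hR0 : (0 : ℝ) ≤ R := Nat.cast_nonneg R
  have hsub : ∀ {E : Type} [NormedAddCommGroup E] [NormedSpace ℝ E] (f : ℝ → E),
      (∀ x, (R : ℝ) ≤ |x| → f x = 0) → ∫ x, f x = ∫ x in (-R : ℝ)..R, f x := by
    intro E _ _ f hf
    symm
    apply intervalIntegral.integral_eq_integral_of_support_subset
    intro x hx
    have : ¬ (R : ℝ) ≤ |x| := fun hle => hx (hf x hle)
    have := abs_lt.1 (not_le.1 this)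
    exact ⟨this.1, this.2.le⟩
  rw [hsub _ fun x hx => by rw [hQ x hx, mul_zero],
    hsub _ fun x hx => by rw [hP x hx, hQ x hx]; simp]
  set a : ℕ → ℝ := fun i => -(R : ℝ) + i with ha
  have ha0 : a 0 = -R := by simp [ha]
  have haR : a (2 * R) = R := by simp only [ha]; push_cast; ring
  have has : ∀ i, a (i + 1) = a i + 1 := fun i => by simp only [ha]; push_cast; ring
  have i1 : ∀ i, IntervalIntegrable (fun x => (V x : ℂ) * Q x) volume (a i) (a (i + 1)) :=
    fun i => (h.loc.continuous_mul (Complex.continuous_ofReal.comp hV)).intervalIntegrable_real _ _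
  have i2 : ∀ i, IntervalIntegrable (fun x => β x * (‖P x‖ + ‖Q x‖)) volume (a i) (a (i + 1)) :=
    fun i => IntervalIntegrable.continuousOn_mul
      ((h.continuous.norm.intervalIntegrable _ _).add (h.intervalIntegrable _ _).norm)
      hβ.continuousOn
  rw [← ha0, ← haR, ← intervalIntegral.sum_integral_adjacent_intervals (fun i _ => i1 i),
    ← intervalIntegral.sum_integral_adjacent_intervals (fun i _ => i2 i)]
  -- The boundary terms involve the true values of `V` at the nodes, so they telescope, and `P`
  -- vanishes at `±R`.
  have htel : ∑ i ∈ Finset.range (2 * R), ((V (a (i + 1)) : ℂ) * P (a (i + 1)) - V (a i) * P (a i))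
      = 0 := by
    rw [Finset.sum_range_sub (fun i => (V (a i) : ℂ) * P (a i)), ha0, haR,
      hP R (by rw [abs_of_nonneg hR0]), hP (-R) (by rw [abs_neg, abs_of_nonneg hR0])]
    simp
  rw [← sub_zero (∑ i ∈ Finset.range (2 * R), _), ← htel, ← Finset.sum_sub_distrib]
  refine (norm_sum_le _ _).trans (Finset.sum_le_sum fun i hi => ?_)
  rw [has]
  refine h.norm_integral_mul_sub_le hV hβ ?_
  have hi' := Finset.mem_range.1 hi
  have := hosc (-(R : ℤ) + i) (by omega) (by omega)
  simpa only [ha, Int.cast_add, Int.cast_neg, Int.cast_natCast] using this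

/-! ### Weak solutions -/

/-- Compactly supported `H¹` test functions, together with their derivative. -/
structure IsTest (ψ ψ' : ℝ → ℂ) : Prop where
  hasLocDeriv : HasLocDeriv ψ ψ'
  isL2Loc : IsL2Loc ψ'
  support : ∃ R : ℝ, ∀ x, R ≤ |x| → ψ x = 0 ∧ ψ' x = 0

/-- `u ∈ H¹_loc`, with derivative `v`, is a solution of `-u'' + V' u + k² u = h - g'`. -/
structure IsWeakSol (V : ℝ → ℝ) (k : ℂ) (g h u v : ℝ → ℂ) : Prop where
  hasLocDeriv : HasLocDeriv u v
  isL2Loc : IsL2Loc v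
  eq : ∀ ψ ψ' : ℝ → ℂ, IsTest ψ ψ' →
    (∫ x, v x * ψ' x) - (∫ x, (V x : ℂ) * (v x * ψ x + u x * ψ' x)) + k ^ 2 * ∫ x, u x * ψ x
      = (∫ x, h x * ψ x) + ∫ x, g x * ψ' x

/-- A compactly supported real cutoff function, together with its derivative. -/
structure IsCutoff (η η' : ℝ → ℝ) (R : ℕ) : Prop where
  hasLocDeriv : HasLocDeriv (fun x => (η x : ℂ)) (fun x => (η' x : ℂ))
  isL2Loc : IsL2Loc (fun x => (η' x : ℂ))
  zero : ∀ x, (R : ℝ) ≤ |x| → η x = 0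

/-! ### Energy identity and Caccioppoli inequality. -/

section Energy

variable {V β : ℝ → ℝ} {k : ℂ} {g h u v : ℝ → ℂ} {η η' : ℝ → ℝ} {R : ℕ}

/-- The three parts of the test function `η² ū` and its derivative. -/
noncomputable def testFun (η : ℝ → ℝ) (u : ℝ → ℂ) (x : ℝ) : ℂ := (η x : ℂ) ^ 2 * star (u x)

noncomputable def testDerivLeft (η η' : ℝ → ℝ) (u : ℝ → ℂ) (x : ℝ) : ℂ := 2 * (η x : ℂ) * (η' x : ℂ) * star (u x)

theorem IsCutoff.hasLocDeriv_testFun (hη : IsCutoff η η' R) (hu : HasLocDeriv u v) :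
    HasLocDeriv (testFun η u) (fun x => testDerivLeft η η' u x + testFun η v x) := by
  have := (hη.hasLocDeriv.mul hη.hasLocDeriv).mul hu.conj
  convert this using 2 with x x
  · simp only [testFun]; ring
  · simp only [testFun, testDerivLeft]; ring

theorem IsCutoff.isL2Loc_testFun (hη : IsCutoff η η' R) (hv : IsL2Loc v) :
    IsL2Loc (testFun η v) := by
  have := hv.conj.continuous_mul (hη.hasLocDeriv.continuous.pow 2)
  exact this

theorem IsCutoff.isL2Loc_testDerivLeft (hη : IsCutoff η η' R) (hu : HasLocDeriv u v) :
    IsL2Loc (testDerivLeft η η' u) := by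
  have := (hη.isL2Loc.mul_continuous (hη.hasLocDeriv.continuous.mul hu.conj.continuous)).const_mul 2
  convert this using 2 with x
  simp only [testDerivLeft, Pi.mul_apply]; ring

theorem IsCutoff.testFun_eq_zero (hη : IsCutoff η η' R) {x : ℝ} (hx : (R : ℝ) ≤ |x|) :
    testFun η u x = 0 := by
  simp [testFun, hη.zero x hx]

theorem IsCutoff.testDerivLeft_eq_zero (hη : IsCutoff η η' R) {x : ℝ} (hx : (R : ℝ) ≤ |x|) :
    testDerivLeft η η' u x = 0 := by
  simp [testDerivLeft, hη.zero x hx]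

theorem IsCutoff.isTest (hη : IsCutoff η η' R) (hu : HasLocDeriv u v) (hv : IsL2Loc v) :
    IsTest (testFun η u) (fun x => testDerivLeft η η' u x + testFun η v x) where
  hasLocDeriv := hη.hasLocDeriv_testFun hu
  isL2Loc := (hη.isL2Loc_testDerivLeft hu).add (hη.isL2Loc_testFun hv)
  support := ⟨R, fun x hx => by
    simp [hη.testFun_eq_zero hx, hη.testDerivLeft_eq_zero hx]⟩

theorem norm_testFun (x : ℝ) : ‖testFun η u x‖ = η x ^ 2 * ‖u x‖ := by
  simp [testFun]

theorem norm_testDerivLeft (x : ℝ) :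
    ‖testDerivLeft η η' u x‖ = 2 * |η x| * |η' x| * ‖u x‖ := by
  simp [testDerivLeft]

theorem IsCutoff.integrable_mul_testFun (hη : IsCutoff η η' R) (hv : IsL2Loc v) {w : ℝ → ℂ}
    (hw : IsL2Loc w) : Integrable fun x => w x * testFun η v x :=
  hw.integrable_mul (hη.isL2Loc_testFun hv) (R := R) fun _ hx => hη.testFun_eq_zero hx.le

theorem IsCutoff.integrable_mul_testDerivLeft (hη : IsCutoff η η' R) (hu : HasLocDeriv u v)
    {w : ℝ → ℂ} (hw : IsL2Loc w) : Integrable fun x => w x * testDerivLeft η η' u x :=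
  hw.integrable_mul (hη.isL2Loc_testDerivLeft hu) (R := R)
    fun _ hx => hη.testDerivLeft_eq_zero hx.le

theorem Continuous.integrable_mul_of_abs_le {β : ℝ → ℝ} (hβ : Continuous β) {f : ℝ → ℝ}
    (hf : Integrable f) {R : ℝ} (hz : ∀ x, R ≤ |x| → f x = 0) : Integrable fun x => β x * f x := by
  obtain ⟨C, hC⟩ := isCompact_Icc.exists_bound_of_continuousOn (s := Icc (-R) R) hβ.continuousOn
  refine (hf.norm.const_mul |C|).mono' (hβ.aestronglyMeasurable.mul hf.1)
    (Eventually.of_forall fun x => ?_)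
  rw [norm_mul]
  by_cases hx : R ≤ |x|
  · rw [hz x hx]; simp
  · refine mul_le_mul_of_nonneg_right ((hC x ?_).trans (le_abs_self C)) (norm_nonneg _)
    exact abs_le.1 (not_le.1 hx).le

/-- The integral of the potential against the derivative of `η² |u|²` is real. -/
theorem im_integral_potential (V : ℝ → ℝ) (η η' : ℝ → ℝ) (u v : ℝ → ℂ) :
    (∫ x, (V x : ℂ) * (v x * testFun η u x + u x * (testDerivLeft η η' u x + testFun η v x))).im
      = 0 := by
  have : ∀ x, (V x : ℂ) * (v x * testFun η u x + u x * (testDerivLeft η η' u x + testFun η v x))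
      = ((V x * (2 * η x * η' x * Complex.normSq (u x)
          + η x ^ 2 * (2 * (v x * star (u x)).re)) : ℝ) : ℂ) := by
    intro x
    have h1 : ((Complex.normSq (u x) : ℝ) : ℂ) = u x * star (u x) := (Complex.mul_conj _).symm
    have h2 : ((2 * (v x * star (u x)).re : ℝ) : ℂ) = v x * star (u x) + star (v x) * u x := by
      have := Complex.add_conj (v x * star (u x))
      rw [← this]
      simp [mul_comm]
    push_cast at h2
    push_cast
    rw [h1, h2]
    simp only [testFun, testDerivLeft]
    ring
  simp_rw [this]
  rw [integral_complex_ofReal, Complex.ofReal_im]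

theorem IsCutoff.hasLocDeriv_density (hη : IsCutoff η η' R) (hu : HasLocDeriv u v) :
    HasLocDeriv (fun x => u x * testFun η u x)
      (fun x => v x * testFun η u x + u x * (testDerivLeft η η' u x + testFun η v x)) :=
  hu.mul (hη.hasLocDeriv_testFun hu)

/-- The weak equation tested with `η² ū`. -/
theorem IsWeakSol.energy_identity (hs : IsWeakSol V k g h u v) (hη : IsCutoff η η' R) :
    (∫ x, v x * testDerivLeft η η' u x) + ((∫ x, η x ^ 2 * ‖v x‖ ^ 2 : ℝ) : ℂ)
      - (∫ x, (V x : ℂ) *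
          (v x * testFun η u x + u x * (testDerivLeft η η' u x + testFun η v x)))
      + k ^ 2 * ((∫ x, η x ^ 2 * ‖u x‖ ^ 2 : ℝ) : ℂ)
      = (∫ x, h x * testFun η u x)
        + ∫ x, g x * (testDerivLeft η η' u x + testFun η v x) := by
  rw [← hs.eq _ _ (hη.isTest hs.hasLocDeriv hs.isL2Loc)]
  have key : ∀ w : ℝ → ℂ, ((∫ x, η x ^ 2 * ‖w x‖ ^ 2 : ℝ) : ℂ) = ∫ x, w x * testFun η w x := by
    intro w
    rw [← integral_complex_ofReal]
    refine integral_congr_ae (Eventually.of_forall fun x => ?_)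
    have : ((‖w x‖ : ℝ) : ℂ) ^ 2 = w x * star (w x) := (Complex.mul_conj' _).symm
    simp only [testFun]
    push_cast
    rw [this]; ring
  rw [key, key, ← integral_add (hη.integrable_mul_testDerivLeft hs.hasLocDeriv hs.isL2Loc)
    (hη.integrable_mul_testFun hs.isL2Loc hs.isL2Loc)]
  simp only [mul_add]

/-- The integrand which bounds the right hand side and the commutator terms. -/
noncomputable def errorDensity (η η' : ℝ → ℝ) (g h u v : ℝ → ℂ) (x : ℝ) : ℝ :=
  2 * |η x| * |η' x| * ‖u x‖ * ‖v x‖ + ‖h x‖ * (η x ^ 2 * ‖u x‖)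
    + ‖g x‖ * (2 * |η x| * |η' x| * ‖u x‖ + η x ^ 2 * ‖v x‖)

/-- The integrand which bounds the contribution of the potential. -/
noncomputable def potentialDensity (η η' : ℝ → ℝ) (u v : ℝ → ℂ) (x : ℝ) : ℝ :=
  η x ^ 2 * ‖u x‖ ^ 2 + 2 * |η x| * |η' x| * ‖u x‖ ^ 2 + 2 * η x ^ 2 * ‖u x‖ * ‖v x‖

theorem IsCutoff.integrable_errorDensity (hη : IsCutoff η η' R) (hu : HasLocDeriv u v)
    (hv : IsL2Loc v) (hg : IsL2Loc g) (hh : IsL2Loc h) : Integrable (errorDensity η η' g h u v) := by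
  have := (((hη.integrable_mul_testDerivLeft hu hv).norm.add
    (hη.integrable_mul_testFun hu.isL2Loc hh).norm).add
    ((hη.integrable_mul_testDerivLeft hu hg).norm.add (hη.integrable_mul_testFun hv hg).norm))
  refine this.congr (Eventually.of_forall fun x => ?_)
  simp only [Pi.add_apply, norm_mul, norm_testFun, norm_testDerivLeft, errorDensity]
  ring

theorem IsCutoff.integrable_potentialDensity (hη : IsCutoff η η' R) (hu : HasLocDeriv u v)
    (hv : IsL2Loc v) : Integrable (potentialDensity η η' u v) := by
  have := ((hη.integrable_mul_testFun hu.isL2Loc hu.isL2Loc).norm.add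
    (hη.integrable_mul_testDerivLeft hu hu.isL2Loc).norm).add
    ((hη.integrable_mul_testFun hv hu.isL2Loc).norm.add
      (hη.integrable_mul_testFun hu.isL2Loc hv).norm)
  refine this.congr (Eventually.of_forall fun x => ?_)
  simp only [Pi.add_apply, norm_mul, norm_testFun, norm_testDerivLeft, potentialDensity]
  ring

theorem IsCutoff.integrable_sq (hη : IsCutoff η η' R) (hv : IsL2Loc v) :
    Integrable fun x => η x ^ 2 * ‖v x‖ ^ 2 := by
  refine (hη.integrable_mul_testFun hv hv).norm.congr (Eventually.of_forall fun x => ?_)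
  simp only [norm_mul, norm_testFun]
  ring

theorem IsCutoff.norm_error_le (hη : IsCutoff η η' R) (hu : HasLocDeriv u v)
    (hv : IsL2Loc v) (hg : IsL2Loc g) (hh : IsL2Loc h) :
    ‖∫ x, v x * testDerivLeft η η' u x‖ + ‖∫ x, h x * testFun η u x‖
      + ‖∫ x, g x * (testDerivLeft η η' u x + testFun η v x)‖
      ≤ ∫ x, errorDensity η η' g h u v x := by
  have i1 := (hη.integrable_mul_testDerivLeft hu hv).norm
  have i2 := (hη.integrable_mul_testFun hu.isL2Loc hh).norm
  have i3 : Integrable fun x => ‖g x * testDerivLeft η η' u x‖ + ‖g x * testFun η v x‖ :=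
    (hη.integrable_mul_testDerivLeft hu hg).norm.add (hη.integrable_mul_testFun hv hg).norm
  have e : ∫ x, errorDensity η η' g h u v x
      = (∫ x, ‖v x * testDerivLeft η η' u x‖) + (∫ x, ‖h x * testFun η u x‖)
        + ∫ x, (‖g x * testDerivLeft η η' u x‖ + ‖g x * testFun η v x‖) := by
    rw [← integral_add i1 i2, ← integral_add (by exact i1.add i2) i3]
    refine integral_congr_ae (Eventually.of_forall fun x => ?_)
    simp only [norm_mul, norm_testFun, norm_testDerivLeft, errorDensity]
    ring
  rw [e]
  refine add_le_add (add_le_add (norm_integral_le_integral_norm _)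
    (norm_integral_le_integral_norm _)) ?_
  refine norm_integral_le_of_norm_le i3 (Eventually.of_forall fun x => ?_)
  rw [mul_add]
  exact norm_add_le _ _

/-- The imaginary part of the energy identity. -/
theorem IsWeakSol.im_energy_le (hs : IsWeakSol V k g h u v) (hη : IsCutoff η η' R)
    (hg : IsL2Loc g) (hh : IsL2Loc h) :
    (k ^ 2).im * ∫ x, η x ^ 2 * ‖u x‖ ^ 2 ≤ ∫ x, errorDensity η η' g h u v x := by
  have e := congrArg Complex.im (hs.energy_identity hη)
  simp only [Complex.add_im, Complex.sub_im, im_integral_potential, Complex.ofReal_im,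
    Complex.mul_im, Complex.ofReal_re, mul_zero, zero_add, add_zero, sub_zero] at e
  have h0 := hη.norm_error_le hs.hasLocDeriv hs.isL2Loc hg hh
  have h1 := abs_le.1 (Complex.abs_im_le_norm (∫ x, v x * testDerivLeft η η' u x))
  have h2 := abs_le.1 (Complex.abs_im_le_norm (∫ x, h x * testFun η u x))
  have h3 := abs_le.1 (Complex.abs_im_le_norm
    (∫ x, g x * (testDerivLeft η η' u x + testFun η v x)))
  linarith [h1.1, h2.2, h3.2]

/-- The real part of the energy identity. -/
theorem IsWeakSol.re_energy_le (hs : IsWeakSol V k g h u v) (hη : IsCutoff η η' R)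
    (hV : Continuous V) (hβ : Continuous β) (hosc : OscLE V R β)
    (hk : 0 ≤ (k ^ 2).re) (hβ0 : ∀ x, 0 ≤ β x) (hg : IsL2Loc g) (hh : IsL2Loc h) :
    ∫ x, η x ^ 2 * ‖v x‖ ^ 2
      ≤ (∫ x, errorDensity η η' g h u v x) + ∫ x, β x * potentialDensity η η' u v x := by
  have e := congrArg Complex.re (hs.energy_identity hη)
  simp only [Complex.add_re, Complex.sub_re, Complex.ofReal_im,
    Complex.mul_re, Complex.ofReal_re, mul_zero, sub_zero] at e
  have h0 := hη.norm_error_le hs.hasLocDeriv hs.isL2Loc hg hh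
  have h1 := abs_le.1 (Complex.abs_re_le_norm (∫ x, v x * testDerivLeft η η' u x))
  have h2 := abs_le.1 (Complex.abs_re_le_norm (∫ x, h x * testFun η u x))
  have h3 := abs_le.1 (Complex.abs_re_le_norm
    (∫ x, g x * (testDerivLeft η η' u x + testFun η v x)))
  have h4 := (hη.hasLocDeriv_density hs.hasLocDeriv).norm_integral_potential_le hV hβ hosc
    (fun x hx => by rw [hη.testFun_eq_zero hx, mul_zero])
    (fun x hx => by
      rw [hη.testFun_eq_zero hx, hη.testFun_eq_zero hx, hη.testDerivLeft_eq_zero hx]; simp)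
  have h5 := abs_le.1 ((Complex.abs_re_le_norm _).trans h4)
  have i1 := hη.integrable_potentialDensity hs.hasLocDeriv hs.isL2Loc
  have h6 : ∫ x, β x * (‖u x * testFun η u x‖
      + ‖v x * testFun η u x + u x * (testDerivLeft η η' u x + testFun η v x)‖)
      ≤ ∫ x, β x * potentialDensity η η' u v x := by
    refine integral_mono_of_nonneg (Eventually.of_forall fun x => ?_)
      (Continuous.integrable_mul_of_abs_le hβ i1 (R := R) fun x hx => by
        simp [potentialDensity, hη.zero x hx]) (Eventually.of_forall fun x => ?_)
    · exact mul_nonneg (hβ0 x) (by positivity)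
    · refine mul_le_mul_of_nonneg_left ?_ (hβ0 x)
      have a1 := norm_add_le (v x * testFun η u x) (u x * (testDerivLeft η η' u x + testFun η v x))
      have a2 : ‖u x * (testDerivLeft η η' u x + testFun η v x)‖
          ≤ ‖u x‖ * (‖testDerivLeft η η' u x‖ + ‖testFun η v x‖) := by
        rw [norm_mul]; gcongr; exact norm_add_le _ _
      simp only [norm_mul, norm_testFun, norm_testDerivLeft, potentialDensity] at a1 a2 ⊢
      nlinarith
  have h7 : 0 ≤ ∫ x, η x ^ 2 * ‖u x‖ ^ 2 := integral_nonneg fun x => by positivity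
  nlinarith [mul_nonneg hk h7, h1.1, h2.2, h3.2, h5.2]

theorem integral_le_of_le_five {f a₁ a₂ a₃ a₄ a₅ : ℝ → ℝ} (hf : Integrable f) (h₁ : Integrable a₁)
    (h₂ : Integrable a₂) (h₃ : Integrable a₃) (h₄ : Integrable a₄) (h₅ : Integrable a₅)
    {c₁ c₂ c₃ c₄ c₅ : ℝ}
    (h : ∀ x, f x ≤ c₁ * a₁ x + c₂ * a₂ x + c₃ * a₃ x + c₄ * a₄ x + c₅ * a₅ x) :
    ∫ x, f x ≤ c₁ * (∫ x, a₁ x) + c₂ * (∫ x, a₂ x) + c₃ * (∫ x, a₃ x) + c₄ * (∫ x, a₄ x)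
      + c₅ * ∫ x, a₅ x := by
  have i₂ : Integrable fun x => c₁ * a₁ x + c₂ * a₂ x := (h₁.const_mul c₁).add (h₂.const_mul c₂)
  have i₃ : Integrable fun x => c₁ * a₁ x + c₂ * a₂ x + c₃ * a₃ x := i₂.add (h₃.const_mul c₃)
  have i₄ : Integrable fun x => c₁ * a₁ x + c₂ * a₂ x + c₃ * a₃ x + c₄ * a₄ x :=
    i₃.add (h₄.const_mul c₄)
  refine (integral_mono hf (i₄.add (h₅.const_mul c₅)) h).trans (le_of_eq ?_)
  simp only [Pi.add_apply]
  rw [integral_add i₄ (h₅.const_mul c₅), integral_add i₃ (h₄.const_mul c₄),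
    integral_add i₂ (h₃.const_mul c₃), integral_add (h₁.const_mul c₁) (h₂.const_mul c₂)]
  simp only [integral_const_mul]

/-- Young's inequality for the right hand side of the real energy estimate. `N`, `n` are the cutoff
and the size of its derivative, `t` is the part of `n` not dominated by `N`, and `U, W, G, H` are
the sizes of `u, u', g, h`. Each square `s1`–`s8` is one application; the coefficient of `N² W²`
adds up to `1/2`, so that this term can be absorbed. -/
theorem energy_pointwise {N n t U W H G b κ : ℝ} (hN : 0 ≤ N)
    (hU : 0 ≤ U) (hW : 0 ≤ W) (hG : 0 ≤ G) (hb : 1 ≤ b)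
    (hκ : 1 ≤ κ) (hn' : n ≤ t + N) :
    (2 * N * n * U * W + H * (N ^ 2 * U) + G * (2 * N * n * U + N ^ 2 * W))
      + b * (N ^ 2 * U ^ 2 + 2 * N * n * U ^ 2 + 2 * N ^ 2 * U * W)
      ≤ N ^ 2 * W ^ 2 / 2 + (10 * t ^ 2 * U ^ 2 + 22 * b ^ 2 * κ ^ 2 * (N ^ 2 * U ^ 2)
        + 4 * (N ^ 2 * G ^ 2) + N ^ 2 * (H / κ) ^ 2 / 2) := by
  have hH : H = (H / κ) * κ := by field_simp
  set H' := H / κ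
  rw [hH]
  have e1 : 2 * N * n * U * W ≤ 2 * N * (t + N) * U * W := by gcongr
  have e2 : G * (2 * N * n * U) ≤ G * (2 * N * (t + N) * U) := by gcongr
  have e3 : b * (2 * N * n * U ^ 2) ≤ b * (2 * N * (t + N) * U ^ 2) := by gcongr
  have hNU : 0 ≤ (N * U) ^ 2 := sq_nonneg _
  have hb2 : 1 ≤ b ^ 2 := by nlinarith
  have hκ2 : 1 ≤ κ ^ 2 := by nlinarith
  have f1 : (N * U) ^ 2 ≤ b ^ 2 * κ ^ 2 * (N * U) ^ 2 := by
    have : 1 ≤ b ^ 2 * κ ^ 2 := by nlinarith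
    nlinarith
  have f2 : b * (N * U) ^ 2 ≤ b ^ 2 * κ ^ 2 * (N * U) ^ 2 := by
    have : b ≤ b ^ 2 * κ ^ 2 := by nlinarith
    nlinarith
  have f3 : κ ^ 2 * (N * U) ^ 2 ≤ b ^ 2 * κ ^ 2 * (N * U) ^ 2 := by
    have : κ ^ 2 ≤ b ^ 2 * κ ^ 2 := by nlinarith
    nlinarith
  have f4 : b ^ 2 * (N * U) ^ 2 ≤ b ^ 2 * κ ^ 2 * (N * U) ^ 2 := by
    have : b ^ 2 ≤ b ^ 2 * κ ^ 2 := by nlinarith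
    nlinarith
  have s1 := sq_nonneg (N * W / 2 - 4 * (t * U))
  have s2 := sq_nonneg (N * W / 2 - 4 * (N * U))
  have s3 := sq_nonneg (N * H' - κ * (N * U))
  have s4 := sq_nonneg (N * G - t * U)
  have s5 := sq_nonneg (N * G - N * U)
  have s6 := sq_nonneg (N * W / 2 - 2 * (N * G))
  have s7 := sq_nonneg (b * (N * U) - t * U)
  have s8 := sq_nonneg (N * W / 2 - 4 * b * (N * U))
  linarith

/-- A Caccioppoli inequality for the form domain. -/
theorem IsWeakSol.caccioppoli (hs : IsWeakSol V k g h u v) (hη : IsCutoff η η' R)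
    (hV : Continuous V) {b κ : ℝ} (hosc : OscLE V R fun _ => b) (hb : 1 ≤ b) (hκ : 1 ≤ κ)
    (hk : 0 ≤ (k ^ 2).re) (hη0 : ∀ x, 0 ≤ η x) {t : ℝ → ℝ}
    (htη : ∀ x, |η' x| ≤ t x + η x) (hg : IsL2Loc g) (hh : IsL2Loc h)
    (hti : Integrable fun x => t x ^ 2 * ‖u x‖ ^ 2) :
    ∫ x, η x ^ 2 * ‖v x‖ ^ 2 ≤ 20 * (∫ x, t x ^ 2 * ‖u x‖ ^ 2)
      + 44 * b ^ 2 * κ ^ 2 * (∫ x, η x ^ 2 * ‖u x‖ ^ 2)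
      + 8 * (∫ x, η x ^ 2 * ‖g x‖ ^ 2) + (∫ x, η x ^ 2 * ‖h x‖ ^ 2) / κ ^ 2 := by
  have h1 := hs.re_energy_le hη hV continuous_const hosc hk (fun _ => by linarith) hg hh
  have iE := hη.integrable_errorDensity hs.hasLocDeriv hs.isL2Loc hg hh
  have iP := (hη.integrable_potentialDensity hs.hasLocDeriv hs.isL2Loc).const_mul b
  have iv := hη.integrable_sq hs.isL2Loc
  have iu := hη.integrable_sq hs.hasLocDeriv.isL2Loc
  have ig := hη.integrable_sq hg
  have ih := hη.integrable_sq hh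
  rw [← integral_add iE iP] at h1
  have h2 := integral_le_of_le_five (iE.add iP) iv hti iu ig ih (c₁ := 1 / 2) (c₂ := 10)
    (c₃ := 22 * b ^ 2 * κ ^ 2) (c₄ := 4) (c₅ := 1 / 2 / κ ^ 2) (fun x => by
      have := energy_pointwise (N := η x) (n := |η' x|) (t := t x) (U := ‖u x‖) (W := ‖v x‖)
        (H := ‖h x‖) (G := ‖g x‖) (hη0 x) (norm_nonneg _) (norm_nonneg _) (norm_nonneg _)
        hb hκ (htη x)
      simp only [Pi.add_apply, errorDensity, potentialDensity, abs_of_nonneg (hη0 x)]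
      refine this.trans (le_of_eq ?_)
      rw [div_pow]
      ring)
  simp only [Pi.add_apply] at h2
  have : 1 / 2 / κ ^ 2 * (∫ x, η x ^ 2 * ‖h x‖ ^ 2) = (∫ x, η x ^ 2 * ‖h x‖ ^ 2) / κ ^ 2 / 2 := by
    field_simp
  rw [this] at h2
  linarith

end Energy

end WhiteNoiseResolvent

namespace WhiteNoiseResolvent

open Set Filter Topology

/-! ### Cutoffs and weights -/

/-- The piecewise linear cutoff which is `1` on `[-R, R]` and vanishes outside `[-2R, 2R]`. -/
noncomputable def tent (R : ℕ) (x : ℝ) : ℝ := max 0 (min 1 (2 - |x| / R))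

/-- The derivative of `tent R`. -/
noncomputable def tentDeriv (R : ℕ) (x : ℝ) : ℝ :=
  ({x : ℝ | (R : ℝ) < |x| ∧ |x| < 2 * R}).indicator (deriv (tent R)) x

theorem tent_nonneg (R : ℕ) (x : ℝ) : 0 ≤ tent R x := le_max_left _ _

theorem tent_le_one (R : ℕ) (x : ℝ) : tent R x ≤ 1 := max_le zero_le_one (min_le_left _ _)

theorem tent_eq_one {R : ℕ} (hR : 1 ≤ R) {x : ℝ} (hx : |x| ≤ R) : tent R x = 1 := by
  have hR' : (0 : ℝ) < R := by exact_mod_cast hR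
  have : |x| / R ≤ 1 := (div_le_one hR').2 hx
  rw [tent, min_eq_left (by linarith), max_eq_right zero_le_one]

theorem tent_eq_zero {R : ℕ} (hR : 1 ≤ R) {x : ℝ} (hx : 2 * (R : ℝ) ≤ |x|) : tent R x = 0 := by
  have hR' : (0 : ℝ) < R := by exact_mod_cast hR
  have : 2 ≤ |x| / R := (le_div_iff₀ hR').2 hx
  rw [tent, max_eq_left]
  exact (min_le_right _ _).trans (by linarith)

theorem lipschitzWith_tent {R : ℕ} : LipschitzWith (R : NNReal)⁻¹ (tent R) := by
  have h1 : LipschitzWith (R : NNReal)⁻¹ fun x : ℝ => 2 - |x| / R := by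
    refine LipschitzWith.of_dist_le_mul fun x y => ?_
    rw [Real.dist_eq, Real.dist_eq]
    have : (2 - |x| / R) - (2 - |y| / R) = (R : ℝ)⁻¹ * (|y| - |x|) := by ring
    rw [this, abs_mul, abs_of_nonneg (by positivity : (0 : ℝ) ≤ (R : ℝ)⁻¹)]
    simp only [NNReal.coe_inv, NNReal.coe_natCast]
    refine mul_le_mul_of_nonneg_left ?_ (by positivity)
    rw [abs_sub_comm x y]
    exact abs_abs_sub_abs_le _ _
  have h2 := (h1.const_min 1).const_max 0
  exact h2

theorem abs_tentDeriv_le (R : ℕ) (x : ℝ) : |tentDeriv R x| ≤ 1 / R := by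
  unfold tentDeriv
  rw [indicator_apply]
  split_ifs
  · have := norm_deriv_le_of_lipschitz (x₀ := x) (lipschitzWith_tent (R := R))
    simpa using this
  · simp

theorem tentDeriv_eq_zero_of_le {R : ℕ} {x : ℝ} (hx : |x| ≤ R) : tentDeriv R x = 0 :=
  indicator_of_notMem (fun h => not_lt.2 hx h.1) _

theorem tentDeriv_eq_zero_of_ge {R : ℕ} {x : ℝ} (hx : 2 * (R : ℝ) ≤ |x|) : tentDeriv R x = 0 :=
  indicator_of_notMem (fun h => not_lt.2 hx h.2) _

theorem abs_tentDeriv_le_one {R : ℕ} (hR : 1 ≤ R) (x : ℝ) : |tentDeriv R x| ≤ 1 := by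
  refine (abs_tentDeriv_le R x).trans ?_
  have hR' : (1 : ℝ) ≤ R := by exact_mod_cast hR
  exact (div_le_one (by linarith)).2 hR'

/-- Outside the two open annuli and away from the four corners `±R`, `±2R` the tent is locally
constant, so the indicator in `tentDeriv` changes the derivative at most on a null set. -/
theorem hasLocDeriv_tent {R : ℕ} (hR : 1 ≤ R) :
    HasLocDeriv (fun x => (tent R x : ℂ)) (fun x => (tentDeriv R x : ℂ)) := by
  refine (HasLocDeriv.of_lipschitz lipschitzWith_tent).congr_ae ?_
  have hf : ({(R : ℝ), -(R : ℝ), 2 * (R : ℝ), -(2 * (R : ℝ))} : Set ℝ).Finite := by simp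
  have h0 : ∀ᵐ x : ℝ, x ∉ ({(R : ℝ), -(R : ℝ), 2 * (R : ℝ), -(2 * (R : ℝ))} : Set ℝ) :=
    measure_eq_zero_iff_ae_notMem.1 (hf.measure_zero _)
  filter_upwards [h0] with x hx
  simp only [mem_insert_iff, mem_singleton_iff, not_or] at hx
  obtain ⟨h1, h2, h3, h4⟩ := hx
  congr 1
  unfold tentDeriv
  rw [indicator_apply]
  split_ifs with h
  · rfl
  · have h' : |x| < R ∨ 2 * (R : ℝ) < |x| := by
      by_contra hc
      push Not at hc
      apply h
      refine ⟨lt_of_le_of_ne hc.1 fun e => ?_, lt_of_le_of_ne hc.2 fun e => ?_⟩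
      · rcases abs_choice x with ha | ha <;> rw [ha] at e
        · exact h1 e.symm
        · exact h2 (by linarith)
      · rcases abs_choice x with ha | ha <;> rw [ha] at e
        · exact h3 e
        · exact h4 (by linarith)
    rcases h' with h' | h'
    · have : tent R =ᶠ[𝓝 x] fun _ => 1 := by
        filter_upwards [continuous_abs.continuousAt.eventually_lt_const h'] with y hy
        exact tent_eq_one hR hy.le
      rw [this.deriv_eq, deriv_const]
    · have : tent R =ᶠ[𝓝 x] fun _ => 0 := by
        filter_upwards [continuous_abs.continuousAt.eventually_const_lt h'] with y hy
        exact tent_eq_zero hR hy.le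
      rw [this.deriv_eq, deriv_const]

theorem isL2Loc_of_bounded {f : ℝ → ℂ} (hf : AEStronglyMeasurable f volume) {C : ℝ}
    (h : ∀ x, ‖f x‖ ≤ C) : IsL2Loc f :=
  fun _ => MemLp.of_bound hf.restrict C (Eventually.of_forall h)

/-- A bounded weight `E ≥ 1` with `|E'| ≤ s E`. -/
structure IsWeight (E E' : ℝ → ℝ) (s M : ℝ) : Prop where
  hasLocDeriv : HasLocDeriv (fun x => (E x : ℂ)) (fun x => (E' x : ℂ))
  one_le : ∀ x, 1 ≤ E x
  le : ∀ x, E x ≤ M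
  abs_deriv_le : ∀ x, |E' x| ≤ s * E x

theorem isWeight_one : IsWeight (fun _ => 1) (fun _ => 0) 0 1 where
  hasLocDeriv := by simpa using HasLocDeriv.const 1
  one_le _ := le_rfl
  le _ := le_rfl
  abs_deriv_le _ := by simp

theorem IsWeight.isCutoff_tent {E E' : ℝ → ℝ} {s M : ℝ} (hE : IsWeight E E' s M) (hs : 0 ≤ s)
    {R : ℕ} (hR : 1 ≤ R) :
    IsCutoff (fun x => tent R x * E x) (fun x => tentDeriv R x * E x + tent R x * E' x) (2 * R)
    where
  hasLocDeriv := by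
    have := (hasLocDeriv_tent hR).mul hE.hasLocDeriv
    simpa only [Complex.ofReal_mul, Complex.ofReal_add] using this
  isL2Loc := by
    have := ((hasLocDeriv_tent hR).mul hE.hasLocDeriv).loc.aestronglyMeasurable
    have h2 : AEStronglyMeasurable
        (fun x => ((tentDeriv R x * E x + tent R x * E' x : ℝ) : ℂ)) volume := by
      simpa only [Complex.ofReal_mul, Complex.ofReal_add] using this
    refine isL2Loc_of_bounded h2 (C := 1 * M + 1 * (s * M)) fun x => ?_
    rw [Complex.norm_real, Real.norm_eq_abs]
    refine (abs_add_le _ _).trans ?_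
    rw [abs_mul, abs_mul, abs_of_nonneg (tent_nonneg R x)]
    have h0 : 0 ≤ E x := zero_le_one.trans (hE.one_le x)
    rw [abs_of_nonneg h0]
    have hE' := (hE.abs_deriv_le x).trans (mul_le_mul_of_nonneg_left (hE.le x) hs)
    exact add_le_add (mul_le_mul (abs_tentDeriv_le_one hR x) (hE.le x) h0 zero_le_one)
      (mul_le_mul (tent_le_one R x) hE' (abs_nonneg _) zero_le_one)
  zero x hx := by
    rw [tent_eq_zero hR (by exact_mod_cast hx), zero_mul]

theorem _root_.MeasureTheory.MemLp.integrable_norm_sq {u : ℝ → ℂ} (hu : MemLp u 2) :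
    Integrable fun x => ‖u x‖ ^ 2 :=
  (memLp_two_iff_integrable_sq_norm hu.1).1 hu

theorem Integrable.bdd_sq_mul {f e : ℝ → ℝ} (hf : Integrable f) (he : AEStronglyMeasurable e volume)
    {C : ℝ} (hC : ∀ x, |e x| ≤ C) : Integrable fun x => e x ^ 2 * f x := by
  refine hf.bdd_mul (c := C ^ 2) (he.pow 2) (Eventually.of_forall fun x => ?_)
  rw [Real.norm_eq_abs, abs_pow]
  exact pow_le_pow_left₀ (abs_nonneg _) (hC x) 2

theorem HasLocDeriv.continuous_ofReal {E E' : ℝ → ℝ}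
    (h : HasLocDeriv (fun x => (E x : ℂ)) (fun x => (E' x : ℂ))) : Continuous E :=
  Complex.continuous_re.comp h.continuous

theorem aestronglyMeasurable_tentDeriv {R : ℕ} (hR : 1 ≤ R) :
    AEStronglyMeasurable (tentDeriv R) volume :=
  Complex.continuous_re.comp_aestronglyMeasurable (hasLocDeriv_tent hR).loc.aestronglyMeasurable

/-! ### The weighted resolvent estimate. -/

section Main

variable {V : ℝ → ℝ} {k : ℂ} {g h u v : ℝ → ℂ} {E E' : ℝ → ℝ} {s M b κ : ℝ} {r : ℕ}

/-- The local energy estimate with a weight. -/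
theorem IsWeakSol.local_energy_le (hsol : IsWeakSol V k g h u v) (hV : Continuous V)
    (hr : 1 ≤ r) (hosc : OscLE V (2 * r) fun _ => b) (hb : 1 ≤ b) (hκ : 1 ≤ κ)
    (hk : 0 ≤ (k ^ 2).re) (hE : IsWeight E E' s M) (hs0 : 0 ≤ s) (hs1 : s ≤ 1)
    (hu : MemLp u 2) (hg : MemLp g 2) (hh : MemLp h 2)
    (hgE : ∀ x, g x ≠ 0 → E x = 1) (hhE : ∀ x, h x ≠ 0 → E x = 1) :
    ∫ x, (tent r x * E x) ^ 2 * ‖v x‖ ^ 2 ≤ 64 * b ^ 2 * (κ ^ 2 * ∫ x, E x ^ 2 * ‖u x‖ ^ 2)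
      + 8 * ((∫ x, ‖g x‖ ^ 2) + (∫ x, ‖h x‖ ^ 2) / κ ^ 2) := by
  have hE0 : ∀ x, 0 ≤ E x := fun x => zero_le_one.trans (hE.one_le x)
  have hη := hE.isCutoff_tent hs0 hr
  have hEm : AEStronglyMeasurable E volume := hE.hasLocDeriv.continuous_ofReal.aestronglyMeasurable
  have iE : Integrable fun x => E x ^ 2 * ‖u x‖ ^ 2 :=
    Integrable.bdd_sq_mul hu.integrable_norm_sq hEm (C := M) fun x => by
      rw [abs_of_nonneg (hE0 x)]; exact hE.le x
  have it : Integrable fun x => (|tentDeriv r x| * E x) ^ 2 * ‖u x‖ ^ 2 := by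
    have := Integrable.bdd_sq_mul iE (aestronglyMeasurable_tentDeriv hr) (abs_tentDeriv_le_one hr)
    refine this.congr (Eventually.of_forall fun x => ?_)
    simp only [mul_pow, sq_abs]; ring
  have hc := hsol.caccioppoli hη hV hosc hb hκ hk
    (fun x => mul_nonneg (tent_nonneg r x) (hE0 x)) (t := fun x => |tentDeriv r x| * E x)
    (fun x => by
      refine (abs_add_le _ _).trans ?_
      rw [abs_mul, abs_mul, abs_of_nonneg (tent_nonneg r x), abs_of_nonneg (hE0 x)]
      have := (hE.abs_deriv_le x).trans (mul_le_of_le_one_left (hE0 x) hs1)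
      gcongr
      exact tent_nonneg r x) hg.isL2Loc hh.isL2Loc it
  have e1 : ∫ x, (|tentDeriv r x| * E x) ^ 2 * ‖u x‖ ^ 2 ≤ ∫ x, E x ^ 2 * ‖u x‖ ^ 2 := by
    refine integral_mono it iE fun x => ?_
    simp only
    have := mul_le_of_le_one_left (hE0 x) (abs_tentDeriv_le_one hr x)
    gcongr
    exact mul_nonneg (abs_nonneg _) (hE0 x)
  have e2 : ∫ x, (tent r x * E x) ^ 2 * ‖u x‖ ^ 2 ≤ ∫ x, E x ^ 2 * ‖u x‖ ^ 2 := by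
    refine integral_mono_of_nonneg (Eventually.of_forall fun x => by positivity) iE
      (Eventually.of_forall fun x => ?_)
    simp only
    have := mul_le_of_le_one_left (hE0 x) (tent_le_one r x)
    gcongr
    exact mul_nonneg (tent_nonneg r x) (hE0 x)
  have e3 : ∀ {f : ℝ → ℂ}, MemLp f 2 → (∀ x, f x ≠ 0 → E x = 1) →
      ∫ x, (tent r x * E x) ^ 2 * ‖f x‖ ^ 2 ≤ ∫ x, ‖f x‖ ^ 2 := by
    intro f hf hfE
    refine integral_mono_of_nonneg (Eventually.of_forall fun x => by positivity)
      hf.integrable_norm_sq (Eventually.of_forall fun x => ?_)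
    simp only
    by_cases hx : f x = 0
    · simp [hx]
    · rw [hfE x hx, mul_one]
      refine mul_le_of_le_one_left (by positivity) ?_
      exact pow_le_one₀ (tent_nonneg r x) (tent_le_one r x)
  have e4 := e3 hg hgE
  have e5 := e3 hh hhE
  have hκ2 : 1 ≤ κ ^ 2 := by nlinarith
  have hb2 : 1 ≤ b ^ 2 := by nlinarith
  have hI : 0 ≤ ∫ x, E x ^ 2 * ‖u x‖ ^ 2 := integral_nonneg fun x => by positivity
  have hH : 0 ≤ (∫ x, ‖h x‖ ^ 2) / κ ^ 2 :=
    div_nonneg (integral_nonneg fun x => by positivity) (by positivity)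
  have e6 : (∫ x, (tent r x * E x) ^ 2 * ‖h x‖ ^ 2) / κ ^ 2 ≤ (∫ x, ‖h x‖ ^ 2) / κ ^ 2 := by gcongr
  have e7 : 44 * b ^ 2 * κ ^ 2 * ∫ x, (tent r x * E x) ^ 2 * ‖u x‖ ^ 2
      ≤ 44 * b ^ 2 * κ ^ 2 * ∫ x, E x ^ 2 * ‖u x‖ ^ 2 := by gcongr
  have e8 : 20 * ∫ x, E x ^ 2 * ‖u x‖ ^ 2 ≤ 20 * b ^ 2 * κ ^ 2 * ∫ x, E x ^ 2 * ‖u x‖ ^ 2 := by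
    have : 1 ≤ b ^ 2 * κ ^ 2 := by nlinarith
    nlinarith
  linarith

/-- Young's inequality where the cutoff is `1` and the weight `N` satisfies `n ≤ s N`. The
commutator, the `G` term and the `H` term are each given `c₀ / 8` of the good term `κ² N² U²`; the
commutator leaves `8 s² / c₀` and the `G W` term leaves `δ` in front of `N² W²`. The hypotheses
`hGN`, `hHN` say that the sources live where the weight equals `1`, so no weight remains on them. -/
theorem weighted_pointwise {c₀ δ N n U W G H : ℝ} (hc : 0 < c₀) (hδ : 0 < δ) (hκ : 1 ≤ κ)
    (hs1 : s ≤ 1) (hN : 0 ≤ N) (hU : 0 ≤ U) (hW : 0 ≤ W)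
    (hG : 0 ≤ G) (hnN : n ≤ s * N) (hGN : G * N = G) (hHN : H * N = H) :
    2 * N * n * U * W + H * (N ^ 2 * U) + G * (2 * N * n * U + N ^ 2 * W)
      ≤ 3 * c₀ / 8 * κ ^ 2 * (N ^ 2 * U ^ 2) + (δ + 8 * s ^ 2 / c₀) * (N ^ 2 * W ^ 2)
        + (8 / c₀ + 1 / (4 * δ)) * G ^ 2 + 2 / c₀ * (H / κ) ^ 2 := by
  have hH : H = (H / κ) * κ := by field_simp
  have hHN' : (H / κ) * N = H / κ := by rw [div_mul_eq_mul_div, hHN]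
  set H' := H / κ
  have e1 : 2 * N * n * U * W ≤ 2 * N * (s * N) * U * W := by gcongr
  have e2 : G * (2 * N * n * U) ≤ G * (2 * N * (1 * N) * U) := by
    have : n ≤ 1 * N := hnN.trans (by gcongr)
    gcongr
  have e2' : G * (2 * N * (1 * N) * U) = 2 * G * (N * U) := by
    linear_combination 2 * N * U * hGN
  have e3 : H * (N ^ 2 * U) = H' * κ * (N * U) := by
    rw [hH]; linear_combination κ * N * U * hHN'
  have e4 : G * (N ^ 2 * W) = G * (N * W) := by linear_combination N * W * hGN
  have hκ2 : 1 ≤ κ ^ 2 := by nlinarith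
  have hNU : 0 ≤ c₀ / 8 * (N * U) ^ 2 := by positivity
  have hk' : c₀ / 8 * (N * U) ^ 2 ≤ c₀ / 8 * κ ^ 2 * (N * U) ^ 2 := by nlinarith
  have f1 : 2 * N * (s * N) * U * W ≤ c₀ / 8 * (N * U) ^ 2 + 8 * s ^ 2 / c₀ * (N * W) ^ 2 := by
    have : c₀ / 8 * (N * U) ^ 2 + 8 * s ^ 2 / c₀ * (N * W) ^ 2 - 2 * N * (s * N) * U * W
        = (c₀ * (N * U) - 8 * s * (N * W)) ^ 2 / (8 * c₀) := by field_simp; ring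
    have h2 : 0 ≤ (c₀ * (N * U) - 8 * s * (N * W)) ^ 2 / (8 * c₀) := by positivity
    linarith
  have f2 : 2 * G * (N * U) ≤ c₀ / 8 * (N * U) ^ 2 + 8 / c₀ * G ^ 2 := by
    have : c₀ / 8 * (N * U) ^ 2 + 8 / c₀ * G ^ 2 - 2 * G * (N * U)
        = (c₀ * (N * U) - 8 * G) ^ 2 / (8 * c₀) := by field_simp; ring
    have h2 : 0 ≤ (c₀ * (N * U) - 8 * G) ^ 2 / (8 * c₀) := by positivity
    linarith
  have f3 : H' * κ * (N * U) ≤ c₀ / 8 * κ ^ 2 * (N * U) ^ 2 + 2 / c₀ * H' ^ 2 := by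
    have : c₀ / 8 * κ ^ 2 * (N * U) ^ 2 + 2 / c₀ * H' ^ 2 - H' * κ * (N * U)
        = (c₀ * κ * (N * U) - 4 * H') ^ 2 / (8 * c₀) := by field_simp; ring
    have h2 : 0 ≤ (c₀ * κ * (N * U) - 4 * H') ^ 2 / (8 * c₀) := by positivity
    linarith
  have f4 : G * (N * W) ≤ δ * (N * W) ^ 2 + 1 / (4 * δ) * G ^ 2 := by
    have : δ * (N * W) ^ 2 + 1 / (4 * δ) * G ^ 2 - G * (N * W)
        = (2 * δ * (N * W) - G) ^ 2 / (4 * δ) := by field_simp; ring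
    have h2 : 0 ≤ (2 * δ * (N * W) - G) ^ 2 / (4 * δ) := by positivity
    linarith
  rw [e2'] at e2
  rw [e3]
  linarith

theorem tendsto_integral_tent_sq {f : ℝ → ℝ} (hf : Integrable f) :
    Tendsto (fun R : ℕ => ∫ x, tent R x ^ 2 * f x) atTop (𝓝 (∫ x, f x)) := by
  refine tendsto_integral_of_dominated_convergence (fun x => ‖f x‖) (fun R => ?_) hf.norm
    (fun R => Eventually.of_forall fun x => ?_) (Eventually.of_forall fun x => ?_)
  · exact (lipschitzWith_tent.continuous.pow 2).aestronglyMeasurable.mul hf.1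
  · rw [norm_mul]
    refine mul_le_of_le_one_left (norm_nonneg _) ?_
    rw [Real.norm_eq_abs, abs_of_nonneg (sq_nonneg _)]
    exact pow_le_one₀ (tent_nonneg R x) (tent_le_one R x)
  · refine tendsto_const_nhds.congr' ?_
    obtain ⟨n, hn⟩ := exists_nat_ge |x|
    filter_upwards [eventually_ge_atTop (max n 1)] with R hR
    rw [tent_eq_one ((le_max_right _ _).trans hR)
      (hn.trans (by exact_mod_cast (le_max_left _ _).trans hR))]
    simp

set_option maxHeartbeats 1000000 in
/-- The resolvent estimate with an exponential weight. -/
theorem IsWeakSol.weighted_estimate (hsol : IsWeakSol V k g h u v) (hV : Continuous V)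
    (hr : 1 ≤ r) (hosc : OscLE V (2 * r) fun _ => b) (hb : 1 ≤ b) (hκ : 1 ≤ κ)
    (hk : 0 ≤ (k ^ 2).re) {c₀ : ℝ} (hc₀ : 0 < c₀) (hc₁ : c₀ ≤ 1) (hk' : c₀ * κ ^ 2 ≤ (k ^ 2).im)
    {B : ℕ → ℝ} (hB : ∀ R, OscLE V R fun _ => B R) (hB1 : ∀ R, 1 ≤ B R)
    (hB' : Tendsto (fun R : ℕ => B (4 * R) / R) atTop (𝓝 0))
    (hE : IsWeight E E' s M) (hs0 : 0 ≤ s) (hs1 : s ≤ c₀ / (64 * b))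
    (hu : MemLp u 2) (hg : MemLp g 2) (hh : MemLp h 2)
    (hgE : ∀ x, g x ≠ 0 → E x = 1 ∧ |x| < r) (hhE : ∀ x, h x ≠ 0 → E x = 1 ∧ |x| < r)
    (hE'0 : ∀ x, (r : ℝ) ≤ |x| → E' x = 0) :
    κ ^ 2 * (∫ x, E x ^ 2 * ‖u x‖ ^ 2)
        ≤ 400 * b ^ 2 / c₀ ^ 2 * ((∫ x, ‖g x‖ ^ 2) + (∫ x, ‖h x‖ ^ 2) / κ ^ 2) ∧
      ∫ x, (tent r x * E x) ^ 2 * ‖v x‖ ^ 2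
        ≤ 26000 * b ^ 4 / c₀ ^ 2 * ((∫ x, ‖g x‖ ^ 2) + (∫ x, ‖h x‖ ^ 2) / κ ^ 2) := by
  set Φ := (∫ x, ‖g x‖ ^ 2) + (∫ x, ‖h x‖ ^ 2) / κ ^ 2 with hΦ
  set X := κ ^ 2 * ∫ x, E x ^ 2 * ‖u x‖ ^ 2 with hX
  set Y := ∫ x, (tent r x * E x) ^ 2 * ‖v x‖ ^ 2 with hY
  set U₀ := ∫ x, ‖u x‖ ^ 2 with hU₀
  have hb0 : 0 < b := by linarith
  have hκ0 : 0 < κ := by linarith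
  have hb2 : 1 ≤ b ^ 2 := by nlinarith
  have hs1' : s ≤ 1 := hs1.trans ((div_le_one (by positivity)).2 (by linarith))
  have hE0 : ∀ x, 0 ≤ E x := fun x => zero_le_one.trans (hE.one_le x)
  have hM0 : 0 ≤ M := (hE0 0).trans (hE.le 0)
  have hEm : AEStronglyMeasurable E volume := hE.hasLocDeriv.continuous_ofReal.aestronglyMeasurable
  have iU := hu.integrable_norm_sq
  have iG := hg.integrable_norm_sq
  have iH := hh.integrable_norm_sq
  have hG0 : 0 ≤ ∫ x, ‖g x‖ ^ 2 := integral_nonneg fun x => by positivity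
  have hH0 : 0 ≤ (∫ x, ‖h x‖ ^ 2) / κ ^ 2 :=
    div_nonneg (integral_nonneg fun x => by positivity) (by positivity)
  have hΦ0 : 0 ≤ Φ := add_nonneg hG0 hH0
  have hU0 : 0 ≤ U₀ := integral_nonneg fun x => by positivity
  have iE : Integrable fun x => E x ^ 2 * ‖u x‖ ^ 2 :=
    Integrable.bdd_sq_mul iU hEm (C := M) fun x => by
      rw [abs_of_nonneg (hE0 x)]; exact hE.le x
  have hYX : Y ≤ 64 * b ^ 2 * X + 8 * Φ := hsol.local_energy_le hV hr hosc hb hκ hk hE hs0 hs1'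
    hu hg hh (fun x hx => (hgE x hx).1) (fun x hx => (hhE x hx).1)
  -- Chosen so that `8 s² / c₀ ≤ δ` for `s ≤ c₀ / (64 b)`, and `2 δ · 64 b² = c₀ / 4` after
  -- inserting the local bound `hYX` for `Y`.
  set δ : ℝ := c₀ / (512 * b ^ 2) with hδ
  have hδ0 : 0 < δ := by positivity
  have iY : Integrable fun x => (tent r x * E x) ^ 2 * ‖v x‖ ^ 2 :=
    (hE.isCutoff_tent hs0 hr).integrable_sq hsol.isL2Loc
  -- the estimate with a cutoff at scale `R`
  have hmain : ∀ R : ℕ, r ≤ R → c₀ * (κ ^ 2 * ∫ x, tent R x ^ 2 * (E x ^ 2 * ‖u x‖ ^ 2))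
      ≤ (3 * c₀ / 8 * X + (δ + 8 * s ^ 2 / c₀) * Y + (8 / c₀ + 1 / (4 * δ) + 2 / c₀) * Φ)
        + (B (4 * R) / R) * (M ^ 2 * (65 * κ ^ 2 * U₀ + 8 * Φ)) := by
    intro R hrR
    have hR : 1 ≤ R := hr.trans hrR
    have hR0 : (0 : ℝ) < R := by exact_mod_cast hR
    have hrR' : (r : ℝ) ≤ R := by exact_mod_cast hrR
    set β := B (4 * R) with hβ
    have hβ1 : 1 ≤ β := hB1 _
    have hβ0 : 0 < β := by linarith
    have hη := hE.isCutoff_tent hs0 hR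
    have h1 := hsol.im_energy_le hη hg.isL2Loc hh.isL2Loc
    have iErr := hη.integrable_errorDensity hsol.hasLocDeriv hsol.isL2Loc hg.isL2Loc hh.isL2Loc
    have iZ : Integrable fun x => (tent (2 * R) x * 1) ^ 2 * ‖v x‖ ^ 2 :=
      (isWeight_one.isCutoff_tent le_rfl (by omega : 1 ≤ 2 * R)).integrable_sq hsol.isL2Loc
    have hZ : ∫ x, (tent (2 * R) x * 1) ^ 2 * ‖v x‖ ^ 2 ≤ 64 * β ^ 2 * (κ ^ 2 * U₀) + 8 * Φ := by
      have := hsol.local_energy_le (r := 2 * R) (E := fun _ => 1) hV (by omega)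
        ((hB (4 * R)).mono (by omega)) hβ1 hκ hk isWeight_one le_rfl zero_le_one hu hg hh
        (fun _ _ => rfl) (fun _ _ => rfl)
      simpa using this
    have iTail : Integrable fun x => M ^ 2 / R * (β * ‖u x‖ ^ 2
        + (tent (2 * R) x * 1) ^ 2 * ‖v x‖ ^ 2 / β) :=
      ((iU.const_mul β).add (iZ.div_const β)).const_mul _
    have hpt : ∀ x, errorDensity (fun x => tent R x * E x)
          (fun x => tentDeriv R x * E x + tent R x * E' x) g h u v x
        ≤ 3 * c₀ / 8 * κ ^ 2 * (E x ^ 2 * ‖u x‖ ^ 2)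
          + (δ + 8 * s ^ 2 / c₀) * ((tent r x * E x) ^ 2 * ‖v x‖ ^ 2)
          + (8 / c₀ + 1 / (4 * δ)) * ‖g x‖ ^ 2 + 2 / c₀ / κ ^ 2 * ‖h x‖ ^ 2
          + 1 * (M ^ 2 / R * (β * ‖u x‖ ^ 2 + (tent (2 * R) x * 1) ^ 2 * ‖v x‖ ^ 2 / β)) := by
      intro x
      -- For `|x| < r` the cutoff at scale `R` is constant and only the weight varies. For `|x| ≥ r`
      -- the weight is constant and the sources vanish, so only the derivative of the tent, of size
      -- `1 / R`, contributes.
      by_cases hx : |x| < r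
      · have t1 : tent R x = 1 := tent_eq_one hR (hx.le.trans hrR')
        have t2 : tent r x = 1 := tent_eq_one hr hx.le
        have t3 : tentDeriv R x = 0 := tentDeriv_eq_zero_of_le (hx.le.trans hrR')
        have := weighted_pointwise (κ := κ) (s := s) (c₀ := c₀) (δ := δ) (N := E x) (n := |E' x|)
          (U := ‖u x‖) (W := ‖v x‖) (G := ‖g x‖) (H := ‖h x‖) hc₀ hδ0 hκ hs1' (hE0 x)
          (norm_nonneg _) (norm_nonneg _) (norm_nonneg _) (hE.abs_deriv_le x)
          (by
            by_cases hgx : g x = 0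
            · simp [hgx]
            · rw [(hgE x hgx).1, mul_one])
          (by
            by_cases hhx : h x = 0
            · simp [hhx]
            · rw [(hhE x hhx).1, mul_one])
        simp only [errorDensity, t1, t2, t3, one_mul, zero_mul, zero_add, abs_of_nonneg (hE0 x)]
        have htail : 0 ≤ M ^ 2 / R * (β * ‖u x‖ ^ 2
          + (tent (2 * R) x * 1) ^ 2 * ‖v x‖ ^ 2 / β) := by positivity
        have e : 2 / c₀ / κ ^ 2 * ‖h x‖ ^ 2 = 2 / c₀ * (‖h x‖ / κ) ^ 2 := by
          rw [div_pow]; ring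
        rw [e]
        linarith
      · have hx' : (r : ℝ) ≤ |x| := not_lt.1 hx
        have hg0 : g x = 0 := by
          by_contra hne; exact hx (hgE x hne).2
        have hh0 : h x = 0 := by
          by_contra hne; exact hx (hhE x hne).2
        have hfirst : 0 ≤ 3 * c₀ / 8 * κ ^ 2 * (E x ^ 2 * ‖u x‖ ^ 2)
          + (δ + 8 * s ^ 2 / c₀) * ((tent r x * E x) ^ 2 * ‖v x‖ ^ 2) := by positivity
        simp only [errorDensity, hg0, hh0, hE'0 x hx', norm_zero, zero_mul, mul_zero, add_zero,
          one_mul]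
        refine le_trans ?_ (le_add_of_nonneg_left (by simpa using hfirst))
        by_cases ht : 2 * (R : ℝ) ≤ |x|
        · rw [tentDeriv_eq_zero_of_ge ht]
          simp only [zero_mul, abs_zero, mul_zero]
          positivity
        · have t1 : tent (2 * R) x = 1 := by
            refine tent_eq_one (by omega) ?_
            push_cast
            exact (not_le.1 ht).le
          rw [t1, abs_mul, abs_mul, abs_of_nonneg (tent_nonneg R x), abs_of_nonneg (hE0 x)]
          have a1 : tent R x * E x ≤ M := (mul_le_of_le_one_left (hE0 x) (tent_le_one R x)).trans
            (hE.le x)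
          have a2 : |tentDeriv R x| * E x ≤ 1 / R * M := mul_le_mul (abs_tentDeriv_le R x)
            (hE.le x) (hE0 x) (by positivity)
          have a3 : 2 * (tent R x * E x) * (|tentDeriv R x| * E x) * ‖u x‖ * ‖v x‖
              ≤ 2 * M * (1 / R * M) * ‖u x‖ * ‖v x‖ := by
            gcongr
            exact mul_nonneg (abs_nonneg _) (hE0 x)
          refine a3.trans ?_
          -- The parameter `β` balances the factor `β²` in `hZ`, so that the whole tail is of order
          -- `β / R`.
          have a4 : 2 * ‖u x‖ * ‖v x‖ ≤ β * ‖u x‖ ^ 2 + ‖v x‖ ^ 2 / β := by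
            have : β * ‖u x‖ ^ 2 + ‖v x‖ ^ 2 / β - 2 * ‖u x‖ * ‖v x‖
                = (β * ‖u x‖ - ‖v x‖) ^ 2 / β := by field_simp; ring
            have h2 : 0 ≤ (β * ‖u x‖ - ‖v x‖) ^ 2 / β := by positivity
            linarith
          calc 2 * M * (1 / R * M) * ‖u x‖ * ‖v x‖ = M ^ 2 / R * (2 * ‖u x‖ * ‖v x‖) := by ring
            _ ≤ M ^ 2 / R * (β * ‖u x‖ ^ 2 + ‖v x‖ ^ 2 / β) := by gcongr
            _ = _ := by ring
    have h2 := integral_le_of_le_five iErr iE iY iG iH iTail hpt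
    have hT : ∫ x, M ^ 2 / R * (β * ‖u x‖ ^ 2 + (tent (2 * R) x * 1) ^ 2 * ‖v x‖ ^ 2 / β)
        ≤ (β / R) * (M ^ 2 * (65 * κ ^ 2 * U₀ + 8 * Φ)) := by
      rw [integral_const_mul, integral_add (iU.const_mul β) (iZ.div_const β), integral_const_mul,
        integral_div]
      have b1 : (∫ x, (tent (2 * R) x * 1) ^ 2 * ‖v x‖ ^ 2) / β
          ≤ (64 * β ^ 2 * (κ ^ 2 * U₀) + 8 * Φ) / β := by gcongr
      have b2 : (64 * β ^ 2 * (κ ^ 2 * U₀) + 8 * Φ) / β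
          ≤ β * (64 * (κ ^ 2 * U₀) + 8 * Φ) := by
        rw [div_le_iff₀ hβ0]
        have : 1 ≤ β ^ 2 := by nlinarith
        nlinarith
      have b3 : U₀ ≤ κ ^ 2 * U₀ := by
        have : 1 ≤ κ ^ 2 := by nlinarith
        nlinarith
      have b4 : β * U₀ + (∫ x, (tent (2 * R) x * 1) ^ 2 * ‖v x‖ ^ 2) / β
          ≤ β * (65 * κ ^ 2 * U₀ + 8 * Φ) := by nlinarith
      calc _ ≤ M ^ 2 / R * (β * (65 * κ ^ 2 * U₀ + 8 * Φ)) := by gcongr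
        _ = _ := by ring
    have h3 : c₀ * (κ ^ 2 * ∫ x, tent R x ^ 2 * (E x ^ 2 * ‖u x‖ ^ 2))
        ≤ (k ^ 2).im * ∫ x, (tent R x * E x) ^ 2 * ‖u x‖ ^ 2 := by
      have e : ∀ x, (tent R x * E x) ^ 2 * ‖u x‖ ^ 2 = tent R x ^ 2 * (E x ^ 2 * ‖u x‖ ^ 2) :=
        fun x => by ring
      simp_rw [e]
      rw [← mul_assoc]
      exact mul_le_mul_of_nonneg_right hk' (integral_nonneg fun x => by positivity)
    have h4 : 2 / c₀ / κ ^ 2 * ∫ x, ‖h x‖ ^ 2 = 2 / c₀ * ((∫ x, ‖h x‖ ^ 2) / κ ^ 2) := by ring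
    have h5 : (8 / c₀ + 1 / (4 * δ)) * (∫ x, ‖g x‖ ^ 2) + 2 / c₀ * ((∫ x, ‖h x‖ ^ 2) / κ ^ 2)
        ≤ (8 / c₀ + 1 / (4 * δ) + 2 / c₀) * Φ := by
      have q1 : 0 ≤ 8 / c₀ + 1 / (4 * δ) := by positivity
      have q2 : 0 ≤ 2 / c₀ := by positivity
      rw [hΦ]
      nlinarith [mul_nonneg q1 hH0, mul_nonneg q2 hG0]
    rw [h4] at h2
    have h6 : 3 * c₀ / 8 * κ ^ 2 * (∫ x, E x ^ 2 * ‖u x‖ ^ 2) = 3 * c₀ / 8 * X := by rw [hX]; ring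
    rw [h6] at h2
    linarith
  -- Let `R → ∞`. This is the only use of the growth of `V` at infinity: `B (4R) / R → 0`.
  have hlim : c₀ * X ≤ 3 * c₀ / 8 * X + (δ + 8 * s ^ 2 / c₀) * Y
      + (8 / c₀ + 1 / (4 * δ) + 2 / c₀) * Φ := by
    have t1 := ((tendsto_integral_tent_sq iE).const_mul (κ ^ 2)).const_mul c₀
    have t2 := (hB'.mul_const (M ^ 2 * (65 * κ ^ 2 * U₀ + 8 * Φ))).const_add
      (3 * c₀ / 8 * X + (δ + 8 * s ^ 2 / c₀) * Y + (8 / c₀ + 1 / (4 * δ) + 2 / c₀) * Φ)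
    rw [zero_mul, add_zero] at t2
    exact le_of_tendsto_of_tendsto t1 t2
      ((eventually_ge_atTop r).mono fun R hR => hmain R hR)
  have hX0 : 0 ≤ X := mul_nonneg (by positivity) (integral_nonneg fun x => by positivity)
  have hY0 : 0 ≤ Y := integral_nonneg fun x => by positivity
  have hs2 : 8 * s ^ 2 / c₀ ≤ δ := by
    rw [hδ, div_le_div_iff₀ hc₀ (by positivity)]
    have : (64 * b * s) ^ 2 ≤ c₀ ^ 2 := by
      have h1 : 64 * b * s ≤ c₀ := by
        have := (le_div_iff₀ (by positivity : (0 : ℝ) < 64 * b)).1 hs1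
        linarith
      exact pow_le_pow_left₀ (by positivity) h1 2
    nlinarith
  have h1 : (δ + 8 * s ^ 2 / c₀) * Y ≤ 2 * δ * (64 * b ^ 2 * X + 8 * Φ) :=
    (mul_le_mul_of_nonneg_right (by linarith) hY0).trans
      (mul_le_mul_of_nonneg_left hYX (by positivity))
  have h2 : 2 * δ * (64 * b ^ 2 * X + 8 * Φ) = c₀ / 4 * X + c₀ / (32 * b ^ 2) * Φ := by
    rw [hδ]; field_simp; ring
  have h3 : 1 / (4 * δ) = 128 * b ^ 2 / c₀ := by rw [hδ]; field_simp; ring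
  rw [h3] at hlim
  have h4 : c₀ / (32 * b ^ 2) ≤ b ^ 2 / c₀ := by
    rw [div_le_div_iff₀ (by positivity) hc₀]
    nlinarith
  have h5 : 8 / c₀ + 128 * b ^ 2 / c₀ + 2 / c₀ ≤ 138 * (b ^ 2 / c₀) := by
    have : 1 / c₀ ≤ b ^ 2 / c₀ := by gcongr
    have e : 8 / c₀ + 128 * b ^ 2 / c₀ + 2 / c₀ = 10 * (1 / c₀) + 128 * (b ^ 2 / c₀) := by ring
    rw [e]; linarith
  -- Of the coefficient `c₀` on the left, `3c₀/8` is lost to `weighted_pointwise` and `c₀/4` to the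
  -- derivative term; `3c₀/8` remains.
  have h6 : 3 * c₀ / 8 * X ≤ 139 * (b ^ 2 / c₀) * Φ := by nlinarith
  have hXb : X ≤ 400 * b ^ 2 / c₀ ^ 2 * Φ := by
    have e : 400 * b ^ 2 / c₀ ^ 2 * Φ = (8 / (3 * c₀)) * (150 * (b ^ 2 / c₀) * Φ) := by
      field_simp; ring
    have e2 : X = (8 / (3 * c₀)) * (3 * c₀ / 8 * X) := by field_simp
    rw [e, e2]
    refine mul_le_mul_of_nonneg_left (h6.trans ?_) (by positivity)
    gcongr
    norm_num
  refine ⟨hXb, hYX.trans ?_⟩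
  have hc2 : c₀ ^ 2 ≤ 1 := by nlinarith
  have e3 : 8 * Φ ≤ 400 * b ^ 4 / c₀ ^ 2 * Φ := by
    refine mul_le_mul_of_nonneg_right ?_ hΦ0
    rw [le_div_iff₀ (by positivity)]
    nlinarith [sq_nonneg (b ^ 2 - 1)]
  have e4 : 64 * b ^ 2 * X ≤ 64 * b ^ 2 * (400 * b ^ 2 / c₀ ^ 2 * Φ) := by gcongr
  have e5 : 64 * b ^ 2 * (400 * b ^ 2 / c₀ ^ 2 * Φ) + 400 * b ^ 4 / c₀ ^ 2 * Φ
      = 26000 * b ^ 4 / c₀ ^ 2 * Φ := by ring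
  linarith

end Main

end WhiteNoiseResolvent

namespace WhiteNoiseResolvent

open Set Filter Topology

/-! ### The du Bois-Reymond lemma -/

theorem exists_forall_lt_abs_eq_zero {E : Type*} [Zero E] {f : ℝ → E} (hf : HasCompactSupport f) :
    ∃ R : ℝ, 0 ≤ R ∧ ∀ x, R < |x| → f x = 0 := by
  obtain ⟨R, hR⟩ := hf.isCompact.isBounded.subset_closedBall 0
  refine ⟨|R|, abs_nonneg R, fun x hx => image_eq_zero_of_notMem_tsupport fun h => ?_⟩
  have := hR h
  rw [Metric.mem_closedBall, dist_zero_right, Real.norm_eq_abs] at this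
  linarith [le_abs_self R]

theorem exists_primitive_of_integral_eq_zero {f : ℝ → ℝ} (hf : ContDiff ℝ (⊤ : ℕ∞) f)
    (hs : HasCompactSupport f) (h0 : ∫ x, f x = 0) :
    ∃ F : ℝ → ℝ, ContDiff ℝ (⊤ : ℕ∞) F ∧ HasCompactSupport F ∧ deriv F = f := by
  obtain ⟨R, hR0, hR⟩ := exists_forall_lt_abs_eq_zero hs
  have hi : Integrable f := hf.continuous.integrable_of_hasCompactSupport hs
  have hd : ∀ x, HasDerivAt (fun y => ∫ t in Iic y, f t) (f x) x := by
    intro x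
    have e : (fun y => ∫ t in Iic y, f t)
        = fun y => (∫ t in Iic (0 : ℝ), f t) + ∫ t in (0 : ℝ)..y, f t := by
      ext y
      rw [← intervalIntegral.integral_Iic_sub_Iic hi.integrableOn hi.integrableOn]
      ring
    rw [e]
    exact (intervalIntegral.integral_hasDerivAt_right hi.intervalIntegrable
      hf.continuous.stronglyMeasurable.stronglyMeasurableAtFilter
      hf.continuous.continuousAt).const_add _
  have hd' : deriv (fun y => ∫ t in Iic y, f t) = f := funext fun x => (hd x).deriv
  refine ⟨fun y => ∫ t in Iic y, f t, ?_, ?_, hd'⟩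
  · rw [contDiff_infty_iff_deriv, hd']
    exact ⟨fun x => (hd x).differentiableAt, hf⟩
  · refine HasCompactSupport.intro (isCompact_Icc (a := -R) (b := R)) fun x hx => ?_
    have hx' : R < |x| := by
      by_contra hlt
      exact hx (abs_le.1 (not_lt.1 hlt))
    rcases lt_abs.1 hx' with h | h
    · rw [← h0]
      refine setIntegral_eq_integral_of_forall_compl_eq_zero fun y hy => hR y ?_
      rw [mem_Iic, not_le] at hy
      exact lt_abs.2 (Or.inl (h.trans hy))
    · refine setIntegral_eq_zero_of_forall_eq_zero fun y hy => hR y ?_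
      rw [mem_Iic] at hy
      exact lt_abs.2 (Or.inr (by linarith))

/-- A test function minus its mass times a normalized bump has integral zero, hence is the
derivative of a test function. So pairing with `D` depends only on the mass, and the constant is the
pairing of `D` with the bump. -/
theorem ae_eq_const_of_integral_deriv_eq_zero {D : ℝ → ℂ} (hD : LocallyIntegrable D)
    (h : ∀ φ : ℝ → ℝ, ContDiff ℝ (⊤ : ℕ∞) φ → HasCompactSupport φ →
      ∫ x, deriv φ x • D x = 0) : ∃ c : ℂ, ∀ᵐ x, D x = c := by
  let η : ContDiffBump (0 : ℝ) := ⟨1, 2, one_pos, one_lt_two⟩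
  have hη : ContDiff ℝ (⊤ : ℕ∞) (η.normed volume) := η.contDiff_normed
  have hηs : HasCompactSupport (η.normed volume) := η.hasCompactSupport_normed
  refine ⟨∫ x, η.normed volume x • D x, ?_⟩
  set c := ∫ x, η.normed volume x • D x with hc
  have key := ae_eq_zero_of_integral_contDiff_smul_eq_zero (f := fun x => D x - c) (μ := volume)
    (hD.sub (locallyIntegrable_const c)) ?_
  · filter_upwards [key] with x hx using sub_eq_zero.1 hx
  intro ψ hψ hψs
  have hψi : Integrable ψ := hψ.continuous.integrable_of_hasCompactSupport hψs
  set a := ∫ x, ψ x with ha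
  obtain ⟨F, hF, hFs, hFd⟩ := exists_primitive_of_integral_eq_zero
    (f := fun x => ψ x - a * η.normed volume x) (hψ.sub (contDiff_const.mul hη))
    (hψs.sub (hηs.mul_left)) (by
      rw [integral_sub hψi ((hη.continuous.integrable_of_hasCompactSupport hηs).const_mul a),
        integral_const_mul, η.integral_normed, mul_one, sub_self])
  have e := h F hF hFs
  have i1 : Integrable fun x => ψ x • D x :=
    hD.integrable_smul_left_of_hasCompactSupport hψ.continuous hψs
  have i2 : Integrable fun x => η.normed volume x • D x :=
    hD.integrable_smul_left_of_hasCompactSupport hη.continuous hηs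
  have e2 : ∫ x, ψ x • D x = a • c := by
    have : ∀ x, deriv F x • D x = ψ x • D x - a • (η.normed volume x • D x) := by
      intro x
      rw [hFd, sub_smul, mul_smul]
    simp_rw [this] at e
    rw [integral_sub i1 (by exact i2.smul a), integral_smul] at e
    exact sub_eq_zero.1 e
  have : ∀ x, ψ x • (D x - c) = ψ x • D x - ψ x • c := fun x => smul_sub _ _ _
  simp_rw [this]
  rw [integral_sub i1 (hψi.smul_const c), e2, integral_smul_const, sub_self]

theorem IsTest.of_schwartz (φ : 𝓢(ℝ, ℂ)) (hφ : HasCompactSupport φ) : IsTest φ (deriv φ) where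
  hasLocDeriv := HasLocDeriv.of_hasDerivAt (fun x => (φ.differentiable x).hasDerivAt)
    ((φ.smooth 1).continuous_deriv le_rfl)
  isL2Loc := ((φ.smooth 1).continuous_deriv le_rfl).isL2Loc
  support := by
    obtain ⟨R, -, hR⟩ := exists_forall_lt_abs_eq_zero hφ
    obtain ⟨R', -, hR'⟩ := exists_forall_lt_abs_eq_zero hφ.deriv
    refine ⟨max R R' + 1, fun x hx => ⟨hR x ?_, hR' x ?_⟩⟩
    · linarith [le_max_left R R']
    · linarith [le_max_right R R']

/-- Integration by parts against a test function. -/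
theorem HasLocDeriv.integral_mul_test {u v ψ ψ' : ℝ → ℂ} (h : HasLocDeriv u v)
    (hψ : IsTest ψ ψ') : ∫ x, u x * ψ' x = -∫ x, v x * ψ x := by
  obtain ⟨R, hR⟩ := hψ.support
  have e := (h.mul hψ.hasLocDeriv).integral_eq_zero (R := R)
    (fun x hx => by rw [(hR x hx.le).1, mul_zero])
    (fun x hx => by rw [(hR x hx.le).1, (hR x hx.le).2, mul_zero, mul_zero, add_zero])
  have i2 : Integrable fun x => u x * ψ' x :=
    h.isL2Loc.integrable_mul hψ.isL2Loc (R := R) fun x hx => (hR x hx.le).2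
  have i1 : Integrable fun x => v x * ψ x := by
    have := (h.mul hψ.hasLocDeriv).loc.integrableOn_isCompact (isCompact_Icc (a := -R) (b := R))
    have hI : Integrable fun x => v x * ψ x + u x * ψ' x :=
      this.integrable_of_abs_le fun x hx => by
        rw [(hR x hx.le).1, (hR x hx.le).2, mul_zero, mul_zero, add_zero]
    exact (hI.sub i2).congr (Eventually.of_forall fun x => by simp)
  rw [integral_add i1 i2] at e
  rw [eq_neg_iff_add_eq_zero, add_comm]
  exact e

/-- `u` minus a primitive of `v` has vanishing weak derivative, so it is constant almost everywhere.
-/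
theorem exists_hasLocDeriv_of_weak {u v : ℝ → ℂ} (hu : LocallyIntegrable u)
    (hv : LocallyIntegrable v)
    (h : ∀ φ : 𝓢(ℝ, ℂ), HasCompactSupport φ → ∫ x, u x * deriv φ x = -∫ x, v x * φ x) :
    ∃ w : ℝ → ℂ, u =ᵐ[volume] w ∧ HasLocDeriv w v := by
  have hW := HasLocDeriv.integral hv 0
  set W : ℝ → ℂ := fun x => 0 + ∫ t in (0 : ℝ)..x, v t with hWdef
  obtain ⟨c, hc⟩ := ae_eq_const_of_integral_deriv_eq_zero
    (hu.sub hW.continuous.locallyIntegrable) (fun φ hφ hφs => by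
      have hφc : ContDiff ℝ (⊤ : ℕ∞) (fun x => (φ x : ℂ)) := Complex.ofRealCLM.contDiff.comp hφ
      have hφcs : HasCompactSupport (fun x => (φ x : ℂ)) := hφs.comp_left Complex.ofReal_zero
      set Φ : 𝓢(ℝ, ℂ) := hφcs.toSchwartzMap hφc with hΦ
      have hΦe : ∀ x, Φ x = (φ x : ℂ) := fun x => rfl
      have hΦs : HasCompactSupport Φ := hφcs
      have hΦd : ∀ x, deriv Φ x = ((deriv φ x : ℝ) : ℂ) := fun x =>
        ((hφ.differentiable (by simp) x).hasDerivAt.ofReal_comp).deriv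
      have h1 := h Φ hΦs
      have h2 := hW.integral_mul_test (IsTest.of_schwartz Φ hΦs)
      have hdc : Continuous (deriv φ) := hφ.continuous_deriv (by simp)
      have i1 := hu.integrable_smul_left_of_hasCompactSupport hdc hφs.deriv
      have i2 := hW.continuous.locallyIntegrable.integrable_smul_left_of_hasCompactSupport (μ := volume)
        hdc hφs.deriv
      have e : ∀ x, deriv φ x • (u - W) x = deriv φ x • u x - deriv φ x • W x := fun x => by
        rw [Pi.sub_apply, smul_sub]
      simp_rw [e]
      rw [integral_sub i1 i2, sub_eq_zero]
      have e1 : ∀ w : ℝ → ℂ, ∫ x, deriv φ x • w x = ∫ x, w x * deriv Φ x := fun w => by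
        congr 1; ext x; rw [hΦd, Complex.real_smul, mul_comm]
      rw [e1, e1, h1, h2])
  refine ⟨fun x => c + W x, ?_, ?_⟩
  · filter_upwards [hc] with x hx
    rw [← hx, Pi.sub_apply, sub_add_cancel]
  · simpa using (HasLocDeriv.const c).add hW

/-! ### Lions' theorem -/

/-- `T` is only defined on test functions and need not be bounded, so Lax–Milgram does not apply.
Coercivity bounds `j φ` by the projection `A φ` of `T φ` to the closure of the range of `j`;
therefore `A φ ↦ ⟨e, j φ⟩` is bounded, extends to the closure of the range of `A`, and is
represented by a vector there. That this vector lies in the closure of the range of `j` is what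
later links the two components of the solution. -/
theorem exists_forall_inner_eq_of_coercive {Φ K : Type*} [AddCommGroup Φ] [Module ℂ Φ]
    [NormedAddCommGroup K] [InnerProductSpace ℂ K] [CompleteSpace K] (j T : Φ →ₗ[ℂ] K) {c : ℝ}
    (hc : 0 < c) (h : ∀ φ, c * ‖j φ‖ ^ 2 ≤ (inner ℂ (j φ) (T φ)).re) (e : K) :
    ∃ u ∈ (LinearMap.range j).topologicalClosure, ∀ φ, inner ℂ u (T φ) = inner ℂ e (j φ) := by
  set H := (LinearMap.range j).topologicalClosure with hH
  have : CompleteSpace H := (LinearMap.range j).isClosed_topologicalClosure.completeSpace_coe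
  have hj : ∀ φ, j φ ∈ H := fun φ =>
    (LinearMap.range j).le_topologicalClosure (LinearMap.mem_range_self j φ)
  set A : Φ →ₗ[ℂ] H := H.orthogonalProjectionOnto.toLinearMap ∘ₗ T with hA
  have hAj : ∀ (x : H) φ, inner ℂ x (A φ) = inner ℂ (x : K) (T φ) := fun x φ =>
    Submodule.inner_orthogonalProjectionOnto_eq_of_mem_left x (T φ)
  have hbound : ∀ φ, c * ‖j φ‖ ≤ ‖A φ‖ := by
    intro φ
    rcases eq_or_lt_of_le (norm_nonneg (j φ)) with h0 | h0
    · rw [← h0, mul_zero]; exact norm_nonneg _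
    · have h1 := h φ
      rw [← hAj ⟨j φ, hj φ⟩ φ] at h1
      have h2 := (Complex.re_le_norm _).trans (norm_inner_le_norm (𝕜 := ℂ) (⟨j φ, hj φ⟩ : H) (A φ))
      have h3 : ‖(⟨j φ, hj φ⟩ : H)‖ = ‖j φ‖ := rfl
      rw [h3] at h2
      nlinarith
  set M := (LinearMap.range A).topologicalClosure with hM
  have : CompleteSpace M := (LinearMap.range A).isClosed_topologicalClosure.completeSpace_coe
  set A' : Φ →ₗ[ℂ] M := A.codRestrict M fun φ =>
    (LinearMap.range A).le_topologicalClosure (LinearMap.mem_range_self A φ) with hA'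
  have hdense : DenseRange A' := by
    intro x
    rw [Topology.IsEmbedding.subtypeVal.closure_eq_preimage_closure_image, mem_preimage, ← range_comp]
    exact x.2
  set ℓ : Φ →ₗ[ℂ] ℂ := (innerSL ℂ e).toLinearMap ∘ₗ j with hℓ
  have hℓb : ∀ φ, ‖ℓ φ‖ ≤ (‖e‖ / c) * ‖A' φ‖ := by
    intro φ
    have h1 : ‖ℓ φ‖ ≤ ‖e‖ * ‖j φ‖ := norm_inner_le_norm (𝕜 := ℂ) e (j φ)
    have h2 : ‖A' φ‖ = ‖A φ‖ := rfl
    rw [h2, div_mul_eq_mul_div, le_div_iff₀ hc]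
    nlinarith [hbound φ, norm_nonneg e, mul_le_mul_of_nonneg_left (hbound φ) (norm_nonneg e)]
  set L := ℓ.extendOfNorm A' with hL
  set z := (InnerProductSpace.toDual ℂ M).symm L with hz
  refine ⟨((z : H) : K), (z : H).2, fun φ => ?_⟩
  rw [← hAj]
  have h1 : inner ℂ (z : H) (A φ) = inner ℂ z (A' φ) := rfl
  rw [h1, hz, InnerProductSpace.toDual_symm_apply, hL,
    LinearMap.extendOfNorm_eq hdense ⟨_, hℓb⟩]
  rfl

/-! ### Existence of solutions -/

theorem IsTest.mul {θ θ' ψ ψ' : ℝ → ℂ} (hθ : HasLocDeriv θ θ') (hθ' : Continuous θ')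
    (hψ : IsTest ψ ψ') : IsTest (fun x => θ x * ψ x) (fun x => θ' x * ψ x + θ x * ψ' x) where
  hasLocDeriv := hθ.mul hψ.hasLocDeriv
  isL2Loc := (hψ.hasLocDeriv.isL2Loc.continuous_mul hθ').add
    (hψ.isL2Loc.continuous_mul hθ.continuous)
  support := by
    obtain ⟨R, hR⟩ := hψ.support
    exact ⟨R, fun x hx => by simp [hR x hx]⟩

/-- The space of test functions, together with their derivatives. -/
def testSpace : Submodule ℂ ((ℝ → ℂ) × (ℝ → ℂ)) where
  carrier := {p | IsTest p.1 p.2}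
  add_mem' := by
    rintro ⟨a, a'⟩ ⟨b, b'⟩ ⟨h1, h2, R, h3⟩ ⟨k1, k2, S, k3⟩
    refine ⟨h1.add k1, h2.add k2, max R S, fun x hx => ?_⟩
    have := h3 x ((le_max_left _ _).trans hx)
    have := k3 x ((le_max_right _ _).trans hx)
    simp_all
  zero_mem' := ⟨HasLocDeriv.const 0, (continuous_const (y := (0 : ℂ))).isL2Loc, 0,
    fun x _ => by simp⟩
  smul_mem' := by
    rintro c ⟨a, a'⟩ ⟨h1, h2, R, h3⟩
    refine ⟨h1.const_mul c, h2.const_mul c, R, fun x hx => ?_⟩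
    have := h3 x hx
    simp_all

theorem exists_linearMap_toLp {Φ : Type*} [AddCommGroup Φ] [Module ℂ Φ] (F G : Φ →ₗ[ℂ] (ℝ → ℂ))
    (hF : ∀ φ, MemLp (F φ) 2) (hG : ∀ φ, MemLp (G φ) 2) :
    ∃ T : Φ →ₗ[ℂ] WithLp 2 (Lp ℂ 2 (volume : Measure ℝ) × Lp ℂ 2 (volume : Measure ℝ)),
      ∀ φ, (T φ).fst =ᵐ[volume] F φ ∧ (T φ).snd =ᵐ[volume] G φ := by
  refine ⟨{ toFun := fun φ => WithLp.toLp 2 ((hF φ).toLp, (hG φ).toLp)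
            map_add' := fun φ ψ => ?_
            map_smul' := fun c φ => ?_ },
    fun φ => ⟨(hF φ).coeFn_toLp, (hG φ).coeFn_toLp⟩⟩
  · rw [← WithLp.toLp_add, Prod.mk_add_mk, ← MemLp.toLp_add, ← MemLp.toLp_add]
    simp only [map_add]
  · rw [RingHom.id_apply, ← WithLp.toLp_smul, Prod.smul_mk, ← MemLp.toLp_const_smul,
      ← MemLp.toLp_const_smul]
    simp only [map_smul]

theorem inner_withLp_eq {U W : WithLp 2 (Lp ℂ 2 (volume : Measure ℝ) × Lp ℂ 2 (volume : Measure ℝ))}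
    {f g a b : ℝ → ℂ} (hf : U.fst =ᵐ[volume] f) (hg : U.snd =ᵐ[volume] g)
    (ha : W.fst =ᵐ[volume] a) (hb : W.snd =ᵐ[volume] b) :
    inner ℂ U W = ∫ x, (star (f x) * a x + star (g x) * b x) := by
  rw [WithLp.prod_inner_apply, L2.inner_def, L2.inner_def, ← integral_add (L2.integrable_inner _ _)
    (L2.integrable_inner _ _)]
  refine integral_congr_ae ?_
  filter_upwards [hf, ha, hg, hb] with x h1 h2 h3 h4
  rw [← h1, ← h2, ← h3, ← h4, RCLike.inner_apply, RCLike.inner_apply, mul_comm,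
    mul_comm (W.ofLp.2 x)]
  rfl

theorem japaneseBracket_sq (x : ℝ) : japaneseBracket x ^ 2 = 1 + x ^ 2 :=
  Real.sq_sqrt (by positivity)

theorem japaneseBracket_pos (x : ℝ) : 0 < japaneseBracket x := Real.sqrt_pos.2 (by positivity)

theorem one_le_japaneseBracket (x : ℝ) : 1 ≤ japaneseBracket x :=
  Real.one_le_sqrt.2 (by nlinarith [sq_nonneg x])

theorem continuous_japaneseBracket : Continuous japaneseBracket := by
  unfold japaneseBracket; fun_prop

theorem hasDerivAt_weight (x : ℝ) :
    HasDerivAt (fun x : ℝ => (1 + x ^ 2)⁻¹) (-(2 * x) / (1 + x ^ 2) ^ 2) x := by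
  have h : HasDerivAt (fun x : ℝ => 1 + x ^ 2) (2 * x) x := by
    simpa using (hasDerivAt_pow 2 x).const_add 1
  exact h.inv (by positivity)

theorem continuous_weightDeriv : Continuous fun x : ℝ => -(2 * x) / (1 + x ^ 2) ^ 2 :=
  Continuous.div (by fun_prop) (by fun_prop) fun x => by positivity

theorem hasLocDeriv_weight (M : ℝ) :
    HasLocDeriv (fun x : ℝ => (((1 + x ^ 2)⁻¹ : ℝ) : ℂ) - M * Complex.I)
      (fun x => ((-(2 * x) / (1 + x ^ 2) ^ 2 : ℝ) : ℂ)) :=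
  HasLocDeriv.of_hasDerivAt (fun x => (hasDerivAt_weight x).ofReal_comp.sub_const _)
    (Complex.continuous_ofReal.comp continuous_weightDeriv)

-- The multiplier is `θ = ⟨x⟩⁻² - iM`. Its real part produces `∫ |φ'|² / ⟨x⟩²`, and the factor
-- `⟨x⟩⁻²` tames the oscillation `K ⟨x⟩` of the potential, whose cross term becomes `K |φ| |φ' /
-- ⟨x⟩|`. Its imaginary part contributes `M Im k² |φ|²`, whereas `|φ'|²` and the potential, being
-- real, contribute nothing through it. So `M` can be taken as large as necessary.
set_option maxHeartbeats 1000000 in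
theorem IsTest.coercive {V : ℝ → ℝ} (hV : Continuous V) {K : ℝ} (hK : 0 ≤ K)
    (hosc : ∀ R, OscLE V R fun t => K * japaneseBracket t) {k : ℂ} (hre : 0 ≤ (k ^ 2).re)
    (him : 1 ≤ (k ^ 2).im) {M : ℝ} (hM : 1 / 2 + 2 * K + (1 + 2 * K) ^ 2 / 2 ≤ M)
    {φ φ' : ℝ → ℂ} (hφ : IsTest φ φ') {ψ ψ' : ℝ → ℂ}
    (hψ : ψ = fun x => ((((1 + x ^ 2)⁻¹ : ℝ) : ℂ) - M * Complex.I) * φ x)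
    (hψ' : ψ' = fun x => ((-(2 * x) / (1 + x ^ 2) ^ 2 : ℝ) : ℂ) * φ x +
      ((((1 + x ^ 2)⁻¹ : ℝ) : ℂ) - M * Complex.I) * φ' x) :
    1 / 2 * ∫ x, (‖φ x‖ ^ 2 + ‖φ' x / japaneseBracket x‖ ^ 2)
      ≤ (∫ x, (star (φ x) * (-(V x : ℂ) * ψ' x + k ^ 2 * ψ x)
          + star (φ' x) * (ψ' x - V x * ψ x))).re := by
  have hψt : IsTest ψ ψ' := by
    rw [hψ, hψ']
    exact hφ.mul (hasLocDeriv_weight M) (Complex.continuous_ofReal.comp continuous_weightDeriv)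
  have hVc : Continuous fun x => (V x : ℂ) := Complex.continuous_ofReal.comp hV
  obtain ⟨R₀, hR₀⟩ := hφ.support
  obtain ⟨R, hR⟩ := exists_nat_ge R₀
  replace hR₀ : ∀ x, (R : ℝ) ≤ |x| → φ x = 0 ∧ φ' x = 0 := fun x hx => hR₀ x (hR.trans hx)
  set w : ℝ → ℝ := fun x => (1 + x ^ 2)⁻¹ with hw
  set w' : ℝ → ℝ := fun x => -(2 * x) / (1 + x ^ 2) ^ 2 with hw'
  set J := japaneseBracket with hJ
  have hJw : ∀ x, w x = (J x)⁻¹ ^ 2 := fun x => by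
    rw [inv_pow, hJ, japaneseBracket_sq]
  have hJ0 : ∀ x, 0 < (J x)⁻¹ := fun x => inv_pos.2 (japaneseBracket_pos x)
  have hJ1 : ∀ x, (J x)⁻¹ ≤ 1 := fun x => inv_le_one_of_one_le₀ (one_le_japaneseBracket x)
  have hw'w : ∀ x, |w' x| ≤ w x := by
    intro x
    have hp : 0 < 1 + x ^ 2 := by positivity
    simp only [hw, hw']
    rw [abs_div, abs_of_pos (pow_pos hp 2), div_le_iff₀ (pow_pos hp 2), sq (1 + x ^ 2), ← mul_assoc,
      inv_mul_cancel₀ hp.ne', one_mul, abs_le]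
    constructor <;> nlinarith [sq_nonneg (x - 1), sq_nonneg (x + 1)]
  set q : ℝ → ℝ := fun x => w' x * ‖φ x‖ ^ 2 + 2 * w x * (star (φ x) * φ' x).re with hq
  have hsq : ∀ z : ℂ, ((‖z‖ ^ 2 : ℝ) : ℂ) = z * star z := fun z => by
    rw [← Complex.normSq_eq_norm_sq]; exact (Complex.mul_conj z).symm
  have hPQ : HasLocDeriv (fun x => ((w x * ‖φ x‖ ^ 2 : ℝ) : ℂ)) (fun x => (q x : ℂ)) := by
    have h0 := (hasLocDeriv_weight 0).mul (hφ.hasLocDeriv.mul hφ.hasLocDeriv.conj)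
    convert h0 using 2 with x x
    · rw [Complex.ofReal_mul, hsq]; simp [hw]
    · have : ((2 * (star (φ x) * φ' x).re : ℝ) : ℂ)
          = φ' x * star (φ x) + φ x * star (φ' x) := by
        rw [← Complex.add_conj (star (φ x) * φ' x)]
        simp [mul_comm]
      simp only [hq]
      rw [mul_assoc 2, mul_left_comm, Complex.ofReal_add, Complex.ofReal_mul, Complex.ofReal_mul,
        this, hsq]
      simp [hw, hw']
  have hpot := hPQ.norm_integral_potential_le hV (β := fun t => K * japaneseBracket t)
    (continuous_const.mul continuous_japaneseBracket)
    (hosc R) (fun x hx => by simp [hR₀ x hx]) (fun x hx => by simp [hq, hR₀ x hx])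
  set S : ℝ → ℝ := fun x => w x * ‖φ' x‖ ^ 2 + w' x * (φ x * star (φ' x)).re
    + ((k ^ 2).re * w x + M * (k ^ 2).im) * ‖φ x‖ ^ 2 with hS
  have hpt : ∀ x, (star (φ x) * (-(V x : ℂ) * ψ' x + k ^ 2 * ψ x)
          + star (φ' x) * (ψ' x - V x * ψ x)).re = S x - V x * q x := by
    intro x
    simp only [hψ, hψ', hS, hq, ← Complex.normSq_eq_norm_sq, Complex.normSq_apply, Complex.add_re,
      Complex.mul_re, Complex.sub_re, Complex.neg_re, Complex.ofReal_re, Complex.ofReal_im,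
      Complex.add_im, Complex.mul_im, Complex.sub_im, Complex.neg_im, Complex.I_re, Complex.I_im,
      Complex.star_def, Complex.conj_re, Complex.conj_im]
    simp only [hw, hw']
    ring
  have hint : Integrable fun x => star (φ x) * (-(V x : ℂ) * ψ' x + k ^ 2 * ψ x)
          + star (φ' x) * (ψ' x - V x * ψ x) := by
    refine Integrable.add ?_ ?_
    · simp_rw [mul_comm (star (φ _))]
      exact ((hψt.isL2Loc.continuous_mul hVc.neg).add
        (hψt.hasLocDeriv.isL2Loc.const_mul (k ^ 2))).integrable_mul hφ.hasLocDeriv.isL2Loc.conj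
        (R := R) fun x hx => by simp [hR₀ x hx.le]
    · simp_rw [mul_comm (star (φ' _))]
      exact (hψt.isL2Loc.sub (hψt.hasLocDeriv.isL2Loc.continuous_mul hVc)).integrable_mul
        hφ.isL2Loc.conj (R := R) fun x hx => by simp [hR₀ x hx.le]
  have hVq : Integrable fun x => V x * q x := by
    have h1 : Integrable fun x => (V x : ℂ) * (q x : ℂ) := by
      have := (hPQ.loc.continuous_mul hVc).integrableOn_isCompact
        (isCompact_Icc (a := -(R : ℝ)) (b := R))
      exact this.integrable_of_abs_le fun x hx => by simp [hq, hR₀ x hx.le]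
    have := h1.re
    simpa [← Complex.ofReal_mul] using this
  have hSi : Integrable S := by
    refine (hint.re.add hVq).congr (Eventually.of_forall fun x => ?_)
    have := hpt x
    simp only [RCLike.re_to_complex, Pi.add_apply]
    rw [this]; ring
  have hβi : Integrable fun x => K * J x * (‖((w x * ‖φ x‖ ^ 2 : ℝ) : ℂ)‖ + ‖(q x : ℂ)‖) := by
    refine Continuous.integrable_mul_of_abs_le
      (continuous_const.mul continuous_japaneseBracket) (R := R) ?_
      (fun x hx => by simp [hq, hR₀ x hx])
    have h1 : IntegrableOn (fun x => ‖((w x * ‖φ x‖ ^ 2 : ℝ) : ℂ)‖ + ‖(q x : ℂ)‖)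
        (Icc (-(R : ℝ)) R) :=
      (hPQ.continuous.norm.locallyIntegrable.integrableOn_isCompact isCompact_Icc).add
        (hPQ.loc.integrableOn_isCompact isCompact_Icc).norm
    exact h1.integrable_of_abs_le fun x hx => by simp [hq, hR₀ x hx.le]
  have e1 : (∫ x, (star (φ x) * (-(V x : ℂ) * ψ' x + k ^ 2 * ψ x)
          + star (φ' x) * (ψ' x - V x * ψ x))).re = ∫ x, (S x - V x * q x) := by
    have := integral_re hint
    simp only [RCLike.re_to_complex] at this
    rw [← this]
    exact integral_congr_ae (Eventually.of_forall hpt)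
  have e2 : ‖∫ x, (V x : ℂ) * (q x : ℂ)‖ = |∫ x, V x * q x| := by
    simp_rw [← Complex.ofReal_mul]
    rw [integral_complex_ofReal, Complex.norm_real, Real.norm_eq_abs]
  rw [e2] at hpot
  rw [e1, integral_sub hSi hVq]
  refine le_trans ?_ (sub_le_sub_left ((le_abs_self _).trans hpot) _)
  rw [← integral_sub hSi hβi, ← integral_const_mul]
  refine integral_mono_of_nonneg (Eventually.of_forall fun x => by positivity) (hSi.sub hβi)
    (Eventually.of_forall fun x => ?_)
  simp only [hS, hq]
  set A := ‖φ x‖ with hA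
  set r := (J x)⁻¹ with hr
  set y := r * ‖φ' x‖ with hy
  have hA0 : 0 ≤ A := norm_nonneg _
  have hr0 : 0 < r := hJ0 x
  have hr1 : r ≤ 1 := hJ1 x
  have hy0 : 0 ≤ y := by positivity
  have hn : ‖φ' x / (J x : ℂ)‖ = y := by
    rw [norm_div, Complex.norm_real, Real.norm_of_nonneg (japaneseBracket_pos x).le, hy, hr,
      div_eq_inv_mul]
  have hz1 : |(φ x * star (φ' x)).re| ≤ A * ‖φ' x‖ := by
    refine (Complex.abs_re_le_norm _).trans ?_
    rw [norm_mul, norm_star]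
  have hz2 : |(star (φ x) * φ' x).re| ≤ A * ‖φ' x‖ := by
    refine (Complex.abs_re_le_norm _).trans ?_
    rw [norm_mul, norm_star]
  have hwr : w x = r ^ 2 := hJw x
  have hw0 : 0 ≤ w x := by rw [hwr]; positivity
  have hJr : K * J x * r = K := by
    rw [hr, mul_assoc, mul_inv_cancel₀ (japaneseBracket_pos x).ne', mul_one]
  have hKJ : 0 ≤ K * J x := mul_nonneg hK (japaneseBracket_pos x).le
  have b1 : |w' x * (φ x * star (φ' x)).re| ≤ A * y := by
    rw [abs_mul]
    calc |w' x| * |(φ x * star (φ' x)).re| ≤ w x * (A * ‖φ' x‖) :=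
          mul_le_mul (hw'w x) hz1 (abs_nonneg _) hw0
      _ = r * (A * y) := by rw [hwr, hy]; ring
      _ ≤ 1 * (A * y) := mul_le_mul_of_nonneg_right hr1 (by positivity)
      _ = A * y := one_mul _
  have b2 : ‖((w x * A ^ 2 : ℝ) : ℂ)‖ = r ^ 2 * A ^ 2 := by
    rw [Complex.norm_real, Real.norm_of_nonneg (by positivity), hwr]
  have b3 : ‖((w' x * A ^ 2 + 2 * w x * (star (φ x) * φ' x).re : ℝ) : ℂ)‖
      ≤ r ^ 2 * A ^ 2 + 2 * (r * (A * y)) := by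
    rw [Complex.norm_real, Real.norm_eq_abs]
    refine (abs_add_le _ _).trans (add_le_add ?_ ?_)
    · rw [abs_mul, abs_of_nonneg (sq_nonneg A), ← hwr]
      exact mul_le_mul_of_nonneg_right (hw'w x) (sq_nonneg A)
    · rw [abs_mul, abs_of_nonneg (by positivity : 0 ≤ 2 * w x), hwr]
      calc 2 * r ^ 2 * |(star (φ x) * φ' x).re| ≤ 2 * r ^ 2 * (A * ‖φ' x‖) :=
            mul_le_mul_of_nonneg_left hz2 (by positivity)
        _ = 2 * (r * (A * y)) := by rw [hy]; ring
  have b4 : K * J x * (‖((w x * A ^ 2 : ℝ) : ℂ)‖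
      + ‖((w' x * A ^ 2 + 2 * w x * (star (φ x) * φ' x).re : ℝ) : ℂ)‖)
      ≤ 2 * K * A ^ 2 + 2 * K * (A * y) := by
    calc _ ≤ K * J x * (r ^ 2 * A ^ 2 + (r ^ 2 * A ^ 2 + 2 * (r * (A * y)))) := by
          rw [b2]; exact mul_le_mul_of_nonneg_left (by linarith) hKJ
      _ = (K * J x * r) * (2 * (r * A ^ 2) + 2 * (A * y)) := by ring
      _ = K * (2 * (r * A ^ 2) + 2 * (A * y)) := by rw [hJr]
      _ ≤ K * (2 * (1 * A ^ 2) + 2 * (A * y)) := by gcongr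
      _ = _ := by ring
  have b5 : M * A ^ 2 ≤ ((k ^ 2).re * w x + M * (k ^ 2).im) * A ^ 2 := by
    refine mul_le_mul_of_nonneg_right ?_ (sq_nonneg A)
    have hM0 : 0 ≤ M := by nlinarith [sq_nonneg (1 + 2 * K)]
    nlinarith [mul_nonneg hre hw0]
  have b6 : w x * ‖φ' x‖ ^ 2 = y ^ 2 := by rw [hwr, hy]; ring
  have b7 := (abs_le.1 b1).1
  -- The lower bound for `M` has three shares: `1/2` is kept, `2K` pays for the potential acting on
  -- `|φ|²`, and `(1 + 2K)² / 2` completes the square for the cross terms `(1 + 2K) |φ| |φ' / ⟨x⟩|`.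
  have b8 : (1 / 2 + 2 * K + (1 + 2 * K) ^ 2 / 2) * A ^ 2 ≤ M * A ^ 2 :=
    mul_le_mul_of_nonneg_right hM (sq_nonneg A)
  rw [hn, b6]
  nlinarith [sq_nonneg (y - (1 + 2 * K) * A)]

/-- Multiplication of a test function and its derivative by given functions. -/
def testCombination (a b : ℝ → ℂ) : testSpace →ₗ[ℂ] (ℝ → ℂ) where
  toFun p x := a x * p.1.1 x + b x * p.1.2 x
  map_add' p q := by
    ext x
    simp only [Submodule.coe_add, Prod.fst_add, Prod.snd_add, Pi.add_apply]
    ring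
  map_smul' c p := by
    ext x
    simp only [Submodule.coe_smul, Prod.smul_fst, Prod.smul_snd, Pi.smul_apply, smul_eq_mul,
      RingHom.id_apply]
    ring

theorem memLp_testCombination {a b : ℝ → ℂ} (ha : Continuous a) (hb : Continuous b)
    (p : testSpace) : MemLp (testCombination a b p) 2 := by
  obtain ⟨R, hR⟩ := p.2.support
  exact ((p.2.hasLocDeriv.isL2Loc.continuous_mul ha).add
    (p.2.isL2Loc.continuous_mul hb)).memLp (R := R) fun x hx => by simp [hR x hx.le]

-- Lions' theorem with `j φ = (φ, φ' / ⟨x⟩)`, and with `T` defined so that pairing the solution with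
-- `T φ` is the weak form tested with `θ φ`. Inner products are conjugate linear in the first slot,
-- hence the conjugates in the source, in `u₀` and in `v`.
set_option maxHeartbeats 1000000 in
theorem exists_isWeakSol {V : ℝ → ℝ} (hV : Continuous V) {K : ℝ} (hK : 0 ≤ K)
    (hosc : ∀ R, OscLE V R fun t => K * japaneseBracket t) {k : ℂ} (hre : 0 ≤ (k ^ 2).re)
    (him : 1 ≤ (k ^ 2).im) {g h : ℝ → ℂ} (hg : IsL2Loc g) (hh : IsL2Loc h) {R : ℝ}
    (hg0 : ∀ x, R < |x| → g x = 0) (hh0 : ∀ x, R < |x| → h x = 0) :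
    ∃ u v : ℝ → ℂ, MemLp u 2 ∧ IsWeakSol V k g h u v := by
  set M : ℝ := 1 / 2 + 2 * K + (1 + 2 * K) ^ 2 / 2 with hM
  have hM0 : 0 < M := by positivity
  set θ : ℝ → ℂ := fun x => (((1 + x ^ 2)⁻¹ : ℝ) : ℂ) - M * Complex.I with hθ
  set θ' : ℝ → ℂ := fun x => ((-(2 * x) / (1 + x ^ 2) ^ 2 : ℝ) : ℂ) with hθ'
  have hθd : ∀ x, HasDerivAt θ (θ' x) x := fun x => (hasDerivAt_weight x).ofReal_comp.sub_const _
  have hθc : Continuous θ := (hasLocDeriv_weight M).continuous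
  have hθ'c : Continuous θ' := Complex.continuous_ofReal.comp continuous_weightDeriv
  have hθ0 : ∀ x, θ x ≠ 0 := fun x h0 => by
    have := congrArg Complex.im h0
    simp only [hθ, Complex.sub_im, Complex.ofReal_im, Complex.mul_im, Complex.ofReal_re,
      Complex.I_im, Complex.I_re, Complex.zero_im] at this
    linarith
  have hVc : Continuous fun x => (V x : ℂ) := Complex.continuous_ofReal.comp hV
  set J : ℝ → ℂ := fun x => (japaneseBracket x : ℂ) with hJ
  have hJc : Continuous J := Complex.continuous_ofReal.comp continuous_japaneseBracket
  have hJ0 : ∀ x, J x ≠ 0 := fun x => Complex.ofReal_ne_zero.2 (japaneseBracket_pos x).ne'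
  have hJs : ∀ x, star (J x) = J x := fun x => Complex.conj_ofReal _
  obtain ⟨j, hj⟩ := exists_linearMap_toLp _ _
    (memLp_testCombination (continuous_const (y := (1 : ℂ))) (continuous_const (y := (0 : ℂ))))
    (memLp_testCombination (b := fun x => (J x)⁻¹) (continuous_const (y := (0 : ℂ)))
      (hJc.inv₀ hJ0))
  obtain ⟨T, hT⟩ := exists_linearMap_toLp _ _
    (memLp_testCombination (a := fun x => -(V x : ℂ) * θ' x + k ^ 2 * θ x)
      (b := fun x => -(V x : ℂ) * θ x)
      ((hVc.neg.mul hθ'c).add (hθc.const_smul (k ^ 2))) (hVc.neg.mul hθc))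
    (memLp_testCombination (a := fun x => J x * (θ' x - V x * θ x)) (b := fun x => J x * θ x)
      (hJc.mul (hθ'c.sub (hVc.mul hθc))) (hJc.mul hθc))
  have hcoer : ∀ φ, 1 / 2 * ‖j φ‖ ^ 2 ≤ (inner ℂ (j φ) (T φ)).re := by
    intro φ
    have hφ : IsTest φ.1.1 φ.1.2 := φ.2
    have h1 := hφ.coercive hV hK hosc hre him hM.ge rfl rfl
    have e1 : ‖j φ‖ ^ 2 = ∫ x, (‖φ.1.1 x‖ ^ 2 + ‖φ.1.2 x / japaneseBracket x‖ ^ 2) := by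
      have := inner_self_eq_norm_sq_to_K (𝕜 := ℂ) (j φ)
      rw [inner_withLp_eq (hj φ).1 (hj φ).2 (hj φ).1 (hj φ).2] at this
      apply Complex.ofReal_injective
      rw [← integral_complex_ofReal]
      push_cast
      refine this.symm.trans (integral_congr_ae (Eventually.of_forall fun x => ?_))
      have hs : ∀ z : ℂ, star z * z = (‖z‖ : ℂ) ^ 2 := fun z => Complex.conj_mul' z
      simp only [testCombination, LinearMap.coe_mk, AddHom.coe_mk, hs, one_mul, zero_mul, add_zero,
        zero_add, hJ]
      rw [div_eq_inv_mul]
    have e2 : inner ℂ (j φ) (T φ) = ∫ x, (star (φ.1.1 x) * (-(V x : ℂ) *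
        (θ' x * φ.1.1 x + θ x * φ.1.2 x) + k ^ 2 * (θ x * φ.1.1 x))
        + star (φ.1.2 x) * ((θ' x * φ.1.1 x + θ x * φ.1.2 x) - V x * (θ x * φ.1.1 x))) := by
      rw [inner_withLp_eq (hj φ).1 (hj φ).2 (hT φ).1 (hT φ).2]
      refine integral_congr_ae (Eventually.of_forall fun x => ?_)
      simp only [testCombination, LinearMap.coe_mk, AddHom.coe_mk, one_mul, zero_mul, add_zero,
        zero_add, star_mul', star_inv₀, hJs]
      have := hJ0 x
      field_simp
      ring
    rw [e1, e2]
    exact h1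
  have he1 : IsL2Loc fun x => star (h x * θ x + g x * θ' x) :=
    ((hh.mul_continuous hθc).add (hg.mul_continuous hθ'c)).conj
  have he2 : IsL2Loc fun x => star (J x * (g x * θ x)) :=
    ((hg.mul_continuous hθc).continuous_mul hJc).conj
  have he1' := he1.memLp (R := R) fun x hx => by simp [hg0 x hx, hh0 x hx]
  have he2' := he2.memLp (R := R) fun x hx => by simp [hg0 x hx]
  obtain ⟨U, hU, hUe⟩ := exists_forall_inner_eq_of_coercive j T (by norm_num : (0 : ℝ) < 1 / 2)
    hcoer (WithLp.toLp 2 (he1'.toLp, he2'.toLp))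
  set u₀ : ℝ → ℂ := fun x => star (U.fst x) with hu₀
  set v : ℝ → ℂ := fun x => star (U.snd x) * J x with hv
  have hu₀L : MemLp u₀ 2 := (Lp.memLp U.fst).star
  have hvL : IsL2Loc v := (Lp.memLp U.snd).star.isL2Loc.mul_continuous hJc
  obtain ⟨u, hu, huv⟩ := exists_hasLocDeriv_of_weak hu₀L.isL2Loc.locallyIntegrable
    hvL.locallyIntegrable (fun φ hφ => by
      have hφt := IsTest.of_schwartz φ hφ
      obtain ⟨S, hS⟩ := hφt.support
      have m1 : MemLp (deriv φ) 2 := hφt.isL2Loc.memLp (R := S) fun x hx => (hS x hx.le).2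
      have m2 : MemLp (fun x => J x * φ x) 2 :=
        (hφt.hasLocDeriv.isL2Loc.continuous_mul hJc).memLp (R := S) fun x hx => by
          rw [(hS x hx.le).1, mul_zero]
      -- Integration by parts makes this functional vanish on the range of `j`, hence by continuity
      -- on its closure, which contains `U`. Thus `v` is the weak derivative of `u₀`.
      have hZ : inner ℂ U (WithLp.toLp 2 (m1.toLp, m2.toLp)) = 0 := by
        have hU' : U ∈ closure (LinearMap.range j : Set (WithLp 2 (Lp ℂ 2 (volume : Measure ℝ) ×
          Lp ℂ 2 (volume : Measure ℝ)))) := hU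
        refine closure_minimal (t := {U | inner ℂ U (WithLp.toLp 2 (m1.toLp, m2.toLp)) = 0}) ?_ ?_
          hU'
        · rintro _ ⟨p, rfl⟩
          rw [mem_ofPred_eq, inner_withLp_eq (W := WithLp.toLp 2 (m1.toLp, m2.toLp)) (hj p).1 (hj p).2 m1.coeFn_toLp m2.coeFn_toLp]
          have hp : IsTest p.1.1 p.1.2 := p.2
          have := hp.hasLocDeriv.conj.integral_mul_test hφt
          rw [← sub_eq_zero, sub_neg_eq_add, ← integral_add] at this
          · refine Eq.trans (integral_congr_ae (Eventually.of_forall fun x => ?_)) this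
            simp only [testCombination, LinearMap.coe_mk, AddHom.coe_mk, one_mul, zero_mul,
              add_zero, zero_add, star_mul', star_inv₀, hJs]
            have := hJ0 x
            field_simp
          · exact hp.hasLocDeriv.conj.isL2Loc.integrable_mul hφt.isL2Loc (R := S)
              fun x hx => (hS x hx.le).2
          · exact hp.isL2Loc.conj.integrable_mul hφt.hasLocDeriv.isL2Loc (R := S)
              fun x hx => (hS x hx.le).1
        · exact isClosed_eq (continuous_id.inner continuous_const) continuous_const
      rw [inner_withLp_eq (W := WithLp.toLp 2 (m1.toLp, m2.toLp)) (EventuallyEq.refl _ _)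
        (EventuallyEq.refl _ _) m1.coeFn_toLp
        m2.coeFn_toLp, integral_add] at hZ
      · rw [eq_neg_iff_add_eq_zero, ← hZ]
        simp only [hu₀, hv, mul_assoc]
      · exact hu₀L.integrable_mul m1
      · exact (Lp.memLp U.snd).star.integrable_mul m2)
  refine ⟨u, v, (memLp_congr_ae hu).1 hu₀L, huv, hvL, fun ψ ψ' hψ => ?_⟩
  -- `θ` has no zeros, so every test function is `ψ = θ φ` with the test function `φ = ψ / θ`.
  have hθi : HasLocDeriv (fun x => (θ x)⁻¹) (fun x => -θ' x / θ x ^ 2) :=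
    HasLocDeriv.of_hasDerivAt (fun x => (hθd x).inv (hθ0 x))
      (hθ'c.neg.div (hθc.pow 2) fun x => pow_ne_zero 2 (hθ0 x))
  have hφ := hψ.mul hθi (hθ'c.neg.div (hθc.pow 2) fun x => pow_ne_zero 2 (hθ0 x))
  have e := hUe ⟨(_, _), hφ⟩
  rw [inner_withLp_eq (EventuallyEq.refl _ _) (EventuallyEq.refl _ _) (hT _).1 (hT _).2,
    inner_withLp_eq (U := WithLp.toLp 2 (he1'.toLp, he2'.toLp)) he1'.coeFn_toLp he2'.coeFn_toLp (hj _).1 (hj _).2] at e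
  obtain ⟨S, hS⟩ := hψ.support
  have hψL := hψ.hasLocDeriv.isL2Loc
  have hψ0 : ∀ x, S < |x| → ψ x = 0 := fun x hx => (hS x hx.le).1
  have hψ'0 : ∀ x, S < |x| → ψ' x = 0 := fun x hx => (hS x hx.le).2
  have i1 := hvL.integrable_mul hψ.isL2Loc hψ'0
  have i2 : Integrable fun x => (V x : ℂ) * (v x * ψ x + u x * ψ' x) := by
    have j1 := (hvL.continuous_mul hVc).integrable_mul hψL hψ0
    have j2 := (huv.isL2Loc.continuous_mul hVc).integrable_mul hψ.isL2Loc hψ'0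
    exact (j1.add j2).congr (Eventually.of_forall fun x => by simp only [Pi.add_apply]; ring)
  have i3 := huv.isL2Loc.integrable_mul hψL hψ0
  have i4 := hh.integrable_mul hψL hψ0
  have i5 := hg.integrable_mul hψ.isL2Loc hψ'0
  rw [← integral_sub i1 i2, ← integral_const_mul, ← integral_add (by exact i1.sub i2)
    (i3.const_mul _), ← integral_add i4 i5]
  refine Eq.trans (Eq.trans (integral_congr_ae ?_) e) (integral_congr_ae ?_)
  · filter_upwards [hu] with x hx
    have h0 := hθ0 x
    simp only [testCombination, LinearMap.coe_mk, AddHom.coe_mk, hv]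
    rw [← hx]
    simp only [hu₀]
    field_simp
    ring
  · refine Eventually.of_forall fun x => ?_
    have h0 := hθ0 x
    have h1 := hJ0 x
    simp only [testCombination, LinearMap.coe_mk, AddHom.coe_mk, star_star]
    field_simp
    ring

end WhiteNoiseResolvent

namespace WhiteNoiseResolvent

open Set Filter Topology

/-! ### Resolvents and weak solutions -/

theorem IsWeakDeriv.of_hasLocDeriv {u v w : ℝ → ℂ} (h : HasLocDeriv u v) (hw : w =ᵐ[volume] u) :
    IsWeakDeriv w v where
  left := h.continuous.locallyIntegrable.congr hw.symm
  right := h.loc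
  eq φ hφ := by
    rw [← h.integral_mul_test (IsTest.of_schwartz φ hφ)]
    refine integral_congr_ae ?_
    filter_upwards [hw] with x hx
    rw [hx]

theorem hasLocDeriv_schwartz (φ : 𝓢(ℝ, ℂ)) : HasLocDeriv φ (deriv φ) :=
  HasLocDeriv.of_hasDerivAt (fun x => (φ.differentiable x).hasDerivAt)
    ((φ.smooth 1).continuous_deriv le_rfl)

/-- The right hand side `h - g'` as a functional on test functions. -/
def Represents (F : 𝓢'(ℝ, ℂ)) (g h : ℝ → ℂ) : Prop :=
  ∀ φ : 𝓢(ℝ, ℂ), HasCompactSupport φ → F φ = (∫ x, h x * φ x) + ∫ x, g x * deriv φ x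

section Resolvent

variable {V : ℝ → ℝ} {k : ℂ} {F : 𝓢'(ℝ, ℂ)} {g h u v : ℝ → ℂ}

theorem IsWeakSol.isResolventImage (hs : IsWeakSol V k g h u v) (hF : Represents F g h)
    {w : Lp ℂ 2 (volume : Measure ℝ)} (hw : w =ᵐ[volume] u) : IsResolventImage V k F w := by
  refine ⟨v, .of_hasLocDeriv hs.hasLocDeriv hw, fun K hK => hs.isL2Loc.restrict_compact hK,
    fun φ hφ => ?_⟩
  rw [hF φ hφ, ← hs.eq _ _ (IsTest.of_schwartz φ hφ)]
  congr 2
  · refine integral_congr_ae ?_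
    filter_upwards [hw] with x hx
    rw [hx]
  · refine integral_congr_ae ?_
    filter_upwards [hw] with x hx
    rw [hx]

theorem IsTest.integrable_left {ψ ψ' f : ℝ → ℂ} (hψ : IsTest ψ ψ') (hf : IsL2Loc f) :
    Integrable fun x => f x * ψ x := by
  obtain ⟨R, hR⟩ := hψ.support
  exact hf.integrable_mul hψ.hasLocDeriv.isL2Loc (R := R) fun x hx => (hR x hx.le).1

theorem IsTest.integrable_right {ψ ψ' f : ℝ → ℂ} (hψ : IsTest ψ ψ') (hf : IsL2Loc f) :
    Integrable fun x => f x * ψ' x := by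
  obtain ⟨R, hR⟩ := hψ.support
  exact hf.integrable_mul hψ.isL2Loc (R := R) fun x hx => (hR x hx.le).2

/-- The weak equation in the form `∫ (v - V u - g) ψ' = ∫ (V v - k² u + h) ψ`. -/
theorem weakEq_iff (hV : Continuous V) (hu : IsL2Loc u) (hv : IsL2Loc v) (hg : IsL2Loc g)
    (hh : IsL2Loc h) {ψ ψ' : ℝ → ℂ} (hψ : IsTest ψ ψ') :
    (∫ x, v x * ψ' x) - (∫ x, (V x : ℂ) * (v x * ψ x + u x * ψ' x)) + k ^ 2 * ∫ x, u x * ψ x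
        = (∫ x, h x * ψ x) + ∫ x, g x * ψ' x ↔
      ∫ x, (v x - V x * u x - g x) * ψ' x = -∫ x, (-((V x : ℂ) * v x) + k ^ 2 * u x - h x) * ψ x := by
  have hVc : Continuous fun x => (V x : ℂ) := Complex.continuous_ofReal.comp hV
  have i1 := hψ.integrable_right hv
  have i2 := hψ.integrable_right (hu.continuous_mul hVc)
  have i3 := hψ.integrable_right hg
  have i4 := hψ.integrable_left (hv.continuous_mul hVc)
  have i5 := hψ.integrable_left hu
  have i6 := hψ.integrable_left hh
  have e1 : ∫ x, (V x : ℂ) * (v x * ψ x + u x * ψ' x)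
      = (∫ x, (V x : ℂ) * v x * ψ x) + ∫ x, (V x : ℂ) * u x * ψ' x := by
    rw [← integral_add i4 i2]
    congr 1; ext x; ring
  have e2 : ∫ x, (v x - V x * u x - g x) * ψ' x
      = (∫ x, v x * ψ' x) - (∫ x, (V x : ℂ) * u x * ψ' x) - ∫ x, g x * ψ' x := by
    rw [← integral_sub i1 i2, ← integral_sub (by exact i1.sub i2) i3]
    congr 1; ext x; ring
  have e3 : ∫ x, (-((V x : ℂ) * v x) + k ^ 2 * u x - h x) * ψ x
      = -(∫ x, (V x : ℂ) * v x * ψ x) + k ^ 2 * (∫ x, u x * ψ x) - ∫ x, h x * ψ x := by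
    rw [← integral_neg, ← integral_const_mul,
      ← integral_add (by exact i4.neg) (by exact i5.const_mul _),
      ← integral_sub (by exact i4.neg.add (i5.const_mul _)) i6]
    congr 1; ext x; ring
  rw [e1, e2, e3]
  constructor <;> intro hyp <;> linear_combination hyp

/-- The definition allows only smooth test functions. Written as `y' = z` with `y = v - V u - g`,
the equation shows that `y` is locally absolutely continuous, and integration by parts then gives it
for all compactly supported `H¹` test functions, in particular for `η² ū`. -/
theorem IsResolventImage.exists_isWeakSol (hV : Continuous V) (hF : Represents F g h)
    (hg : IsL2Loc g) (hh : IsL2Loc h) {w : Lp ℂ 2 (volume : Measure ℝ)}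
    (hw : IsResolventImage V k F w) : ∃ u v : ℝ → ℂ, w =ᵐ[volume] u ∧ IsWeakSol V k g h u v := by
  obtain ⟨v, hd, hv2, he⟩ := hw
  have hv : IsL2Loc v := fun R => hv2 _ isCompact_Icc
  obtain ⟨u, hwu, huv⟩ := exists_hasLocDeriv_of_weak hd.left hd.right hd.eq
  refine ⟨u, v, hwu, huv, hv, fun ψ ψ' hψ => ?_⟩
  have hVc : Continuous fun x => (V x : ℂ) := Complex.continuous_ofReal.comp hV
  have hy : IsL2Loc fun x => v x - V x * u x - g x :=
    (hv.sub (huv.isL2Loc.continuous_mul hVc)).sub hg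
  have hz : IsL2Loc fun x => -((V x : ℂ) * v x) + k ^ 2 * u x - h x := by
    have := (((hv.continuous_mul hVc).const_mul (-1)).add (huv.isL2Loc.const_mul (k ^ 2))).sub hh
    simpa using this
  obtain ⟨y, hyy, hyz⟩ := exists_hasLocDeriv_of_weak hy.locallyIntegrable hz.locallyIntegrable
    (fun φ hφ => by
      have hφt := IsTest.of_schwartz φ hφ
      rw [← weakEq_iff hV huv.isL2Loc hv hg hh hφt, ← hF φ hφ, ← he φ hφ]
      congr 2
      · refine integral_congr_ae ?_
        filter_upwards [hwu] with x hx
        rw [hx]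
      · refine integral_congr_ae ?_
        filter_upwards [hwu] with x hx
        rw [hx])
  rw [weakEq_iff hV huv.isL2Loc hv hg hh hψ, ← hyz.integral_mul_test hψ]
  refine integral_congr_ae ?_
  filter_upwards [hyy] with x hx
  rw [hx]

/-- With `d` the new primitive minus the old one, the difference solves the new equation with source
`-d' u = d v - (d u)'`, which is again of the form `h - g'`. -/
theorem IsWeakSol.sub {V' : ℝ → ℝ} {u' v' : ℝ → ℂ} (hV : Continuous V) (hV' : Continuous V')
    (hs : IsWeakSol V k g h u v) (hs' : IsWeakSol V' k g h u' v') (hg : IsL2Loc g)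
    (hh : IsL2Loc h) :
    IsWeakSol V' k (fun x => ((V' x - V x : ℝ) : ℂ) * u x) (fun x => ((V' x - V x : ℝ) : ℂ) * v x)
      (fun x => u' x - u x) (fun x => v' x - v x) where
  hasLocDeriv := hs'.hasLocDeriv.sub hs.hasLocDeriv
  isL2Loc := hs'.isL2Loc.sub hs.isL2Loc
  eq ψ ψ' hψ := by
    have hDc : Continuous fun x => ((V' x - V x : ℝ) : ℂ) :=
      Complex.continuous_ofReal.comp (hV'.sub hV)
    have hVc : Continuous fun x => (V x : ℂ) := Complex.continuous_ofReal.comp hV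
    have hVc' : Continuous fun x => (V' x : ℂ) := Complex.continuous_ofReal.comp hV'
    have hu := hs.hasLocDeriv.isL2Loc
    have hu' := hs'.hasLocDeriv.isL2Loc
    have e := (weakEq_iff hV hu hs.isL2Loc hg hh hψ).1 (hs.eq ψ ψ' hψ)
    have e' := (weakEq_iff hV' hu' hs'.isL2Loc hg hh hψ).1 (hs'.eq ψ ψ' hψ)
    rw [weakEq_iff hV' (hu'.sub hu) (hs'.isL2Loc.sub hs.isL2Loc) (hu.continuous_mul hDc)
      (hs.isL2Loc.continuous_mul hDc) hψ]
    have i1 := hψ.integrable_right ((hs.isL2Loc.sub (hu.continuous_mul hVc)).sub hg)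
    have i1' := hψ.integrable_right ((hs'.isL2Loc.sub (hu'.continuous_mul hVc')).sub hg)
    have i2 := hψ.integrable_left ((((hs.isL2Loc.continuous_mul hVc).const_mul (-1)).add
      (hu.const_mul (k ^ 2))).sub hh)
    have i2' := hψ.integrable_left ((((hs'.isL2Loc.continuous_mul hVc').const_mul (-1)).add
      (hu'.const_mul (k ^ 2))).sub hh)
    simp only [neg_one_mul] at i2 i2'
    have e1 := congrArg₂ (· - ·) e' e
    rw [← integral_sub i1' i1, ← neg_sub', ← integral_sub i2' i2] at e1
    refine Eq.trans (Eq.trans ?_ e1) ?_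
    · congr 1; ext x; push_cast; ring
    · congr 2; ext x; push_cast; ring

end Resolvent

/-! ### Potentials of square root growth -/

/-- The oscillation of `V` on unit intervals grows at most like a square root. -/
structure HasSqrtGrowth (V : ℝ → ℝ) (K : ℝ) : Prop where
  continuous : Continuous V
  one_le : 1 ≤ K
  osc : ∀ R : ℕ, OscLE V R fun _ => K * √(R + 1)

/-- The existence theory tolerates linear growth of the oscillation, which square root growth
satisfies with room to spare. -/
theorem HasSqrtGrowth.oscLE_japaneseBracket {V : ℝ → ℝ} {K : ℝ} (hV : HasSqrtGrowth V K) (R : ℕ) :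
    OscLE V R fun t => 2 * K * japaneseBracket t := by
  intro i h1 h2 x hx y hy t ht
  have hK := hV.one_le
  have := hV.osc (i.natAbs + 1) i (by omega) (by omega) x hx y hy t ht
  refine this.trans ?_
  change K * √(((i.natAbs + 1 : ℕ) : ℝ) + 1) ≤ 2 * K * japaneseBracket t
  rw [mul_comm 2 K, mul_assoc]
  refine mul_le_mul_of_nonneg_left ?_ (by linarith)
  rw [Real.sqrt_le_left (by have := japaneseBracket_pos t; positivity), mul_pow,
    japaneseBracket_sq]
  have hi : ((i.natAbs : ℕ) : ℝ) = |(i : ℝ)| := by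
    rw [← Int.cast_abs, Int.abs_eq_natAbs, Int.cast_natCast]
  have h3 : |(i : ℝ)| ≤ |t| + 1 := by
    rw [abs_le]
    constructor
    · linarith [ht.1, neg_abs_le t, ht.2]
    · linarith [ht.1, le_abs_self t]
  push_cast
  rw [hi, ← sq_abs t]
  nlinarith [sq_nonneg (|t| - 1), abs_nonneg t]

/-- Spectral parameters in a sector, away from the origin. -/
structure IsSectorial (k : ℂ) (κ c₀ : ℝ) : Prop where
  one_le : 1 ≤ κ
  re_nonneg : 0 ≤ (k ^ 2).re
  pos : 0 < c₀
  le_one : c₀ ≤ 1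
  le_im : c₀ * κ ^ 2 ≤ (k ^ 2).im
  one_le_im : 1 ≤ (k ^ 2).im

/-- The growth function of a potential in `HasSqrtGrowth V K`. -/
noncomputable def growthBound (K : ℝ) (R : ℕ) : ℝ := K * √(R + 1)

theorem one_le_growthBound {K : ℝ} (hK : 1 ≤ K) (R : ℕ) : 1 ≤ growthBound K R := by
  have : 1 ≤ √((R : ℝ) + 1) := Real.one_le_sqrt.2 (by simp)
  unfold growthBound
  nlinarith

theorem tendsto_growthBound_div (K : ℝ) (a : ℕ) :
    Tendsto (fun R : ℕ => growthBound K (a * R) / R) atTop (𝓝 0) := by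
  have h1 : Tendsto (fun R : ℕ => |K| * √(a + 1) * (√(R : ℝ))⁻¹) atTop (𝓝 0) := by
    have := (Real.tendsto_sqrt_atTop.comp
      (tendsto_natCast_atTop_atTop (R := ℝ))).inv_tendsto_atTop.const_mul (|K| * √(a + 1))
    simpa using this
  refine squeeze_zero_norm' ?_ h1
  filter_upwards [eventually_ge_atTop 1] with R hR
  have hR' : (1 : ℝ) ≤ R := by exact_mod_cast hR
  have hs : 0 < √(R : ℝ) := Real.sqrt_pos.2 (by linarith)
  rw [growthBound, norm_div, norm_mul, Real.norm_eq_abs, Real.norm_eq_abs, Real.norm_eq_abs,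
    abs_of_nonneg (Real.sqrt_nonneg _), abs_of_nonneg (by linarith : (0 : ℝ) ≤ R),
    div_le_iff₀ (by linarith)]
  have e : |K| * √(a + 1) * (√(R : ℝ))⁻¹ * R = |K| * √((a + 1) * R) := by
    rw [Real.sqrt_mul (by positivity)]
    have : (√(R : ℝ)) * √(R : ℝ) = R := Real.mul_self_sqrt (by linarith)
    field_simp
    rw [sq, this]
  rw [e]
  refine mul_le_mul_of_nonneg_left (Real.sqrt_le_sqrt ?_) (abs_nonneg K)
  push_cast
  nlinarith

section Unique

variable {V : ℝ → ℝ} {K κ c₀ : ℝ} {k : ℂ} {g h u v : ℝ → ℂ}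

/-- The weighted estimate, for potentials of square root growth. -/
theorem IsWeakSol.weighted_estimate_of_growth (hsol : IsWeakSol V k g h u v)
    (hV : HasSqrtGrowth V K) (hk : IsSectorial k κ c₀) {r : ℕ} (hr : 1 ≤ r) {b : ℝ} (hb : 1 ≤ b)
    (hosc : OscLE V (2 * r) fun _ => b) {E E' : ℝ → ℝ} {s M : ℝ} (hE : IsWeight E E' s M)
    (hs0 : 0 ≤ s) (hs1 : s ≤ c₀ / (64 * b))
    (hu : MemLp u 2) (hg : MemLp g 2) (hh : MemLp h 2)
    (hgE : ∀ x, g x ≠ 0 → E x = 1 ∧ |x| < r) (hhE : ∀ x, h x ≠ 0 → E x = 1 ∧ |x| < r)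
    (hE'0 : ∀ x, (r : ℝ) ≤ |x| → E' x = 0) :
    κ ^ 2 * (∫ x, E x ^ 2 * ‖u x‖ ^ 2)
        ≤ 400 * b ^ 2 / c₀ ^ 2 * ((∫ x, ‖g x‖ ^ 2) + (∫ x, ‖h x‖ ^ 2) / κ ^ 2) ∧
      ∫ x, (tent r x * E x) ^ 2 * ‖v x‖ ^ 2
        ≤ 26000 * b ^ 4 / c₀ ^ 2 * ((∫ x, ‖g x‖ ^ 2) + (∫ x, ‖h x‖ ^ 2) / κ ^ 2) :=
  hsol.weighted_estimate hV.continuous hr hosc hb hk.one_le hk.re_nonneg hk.pos hk.le_one hk.le_im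
    hV.osc (one_le_growthBound hV.one_le) (tendsto_growthBound_div K 4) hE hs0 hs1 hu hg hh hgE hhE
    hE'0

/-- The difference of two solutions has zero source, and the weighted estimate with weight `1`
forces it to vanish. -/
theorem IsWeakSol.ae_eq (hV : HasSqrtGrowth V K) (hk : IsSectorial k κ c₀) {u' v' : ℝ → ℂ}
    (hs : IsWeakSol V k g h u v) (hs' : IsWeakSol V k g h u' v') (hg : IsL2Loc g) (hh : IsL2Loc h)
    (hu : MemLp u 2) (hu' : MemLp u' 2) : u =ᵐ[volume] u' := by
  have hd := hs.sub hV.continuous hV.continuous hs' hg hh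
  simp only [sub_self, Complex.ofReal_zero, zero_mul] at hd
  have h0 : MemLp (fun _ : ℝ => (0 : ℂ)) 2 := MemLp.zero
  have hb : 1 ≤ growthBound K (2 * 1) := one_le_growthBound hV.one_le _
  have hc := hk.pos
  have key := (hd.weighted_estimate_of_growth hV hk le_rfl hb (hV.osc (2 * 1)) isWeight_one le_rfl
    (by positivity) (hu'.sub hu) h0 h0 (fun x hx => absurd rfl hx) (fun x hx => absurd rfl hx)
    (fun x _ => rfl)).1
  simp only [norm_zero, ne_eq, OfNat.ofNat_ne_zero, not_false_eq_true, zero_pow, integral_zero,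
    zero_div, add_zero, mul_zero, one_pow, one_mul] at key
  have hκ := hk.one_le
  have h1 : ∫ x, ‖u' x - u x‖ ^ 2 = 0 :=
    le_antisymm (nonpos_of_mul_nonpos_right key (by positivity))
      (integral_nonneg fun x => by positivity)
  rw [integral_eq_zero_iff_of_nonneg (fun x => by positivity) (by
    exact (hu'.sub hu).integrable_norm_sq)] at h1
  filter_upwards [h1] with x hx
  have : ‖u' x - u x‖ = 0 := by simpa using hx
  exact (sub_eq_zero.1 (norm_eq_zero.1 this)).symm

theorem exists_resolventImage_iff (hV : HasSqrtGrowth V K) (hk : IsSectorial k κ c₀)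
    {F : 𝓢'(ℝ, ℂ)} (hF : Represents F g h) (hg : IsL2Loc g) (hh : IsL2Loc h) {R : ℝ}
    (hg0 : ∀ x, R < |x| → g x = 0) (hh0 : ∀ x, R < |x| → h x = 0) :
    ∃ (u v : ℝ → ℂ) (hu : MemLp u 2), IsWeakSol V k g h u v ∧
      ∀ w, IsResolventImage V k F w ↔ w = hu.toLp := by
  have hK := hV.one_le
  obtain ⟨u, v, hu, hs⟩ := exists_isWeakSol hV.continuous (K := 2 * K) (by positivity)
    hV.oscLE_japaneseBracket hk.re_nonneg hk.one_le_im hg hh hg0 hh0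
  refine ⟨u, v, hu, hs, fun w => ⟨fun hw => ?_, fun hw => ?_⟩⟩
  · obtain ⟨u', v', hwu, hs'⟩ := hw.exists_isWeakSol hV.continuous hF hg hh
    have hu' : MemLp u' 2 := (memLp_congr_ae hwu).1 (Lp.memLp w)
    exact Lp.ext ((hwu.trans (hs'.ae_eq hV hk hs hg hh hu' hu)).trans hu.coeFn_toLp.symm)
  · rw [hw]
    exact hs.isResolventImage hF hu.coeFn_toLp

end Unique

/-! ### Localization -/

/-- A smooth compactly supported cutoff with values in the unit disc. -/
structure IsSmoothCutoff (χ : ℝ → ℂ) (D : ℝ) : Prop where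
  smooth : ContDiff ℝ (⊤ : ℕ∞) χ
  compact : HasCompactSupport χ
  norm_le : ∀ x, ‖χ x‖ ≤ 1
  norm_deriv_le : ∀ x, ‖deriv χ x‖ ≤ D

theorem norm_toLp_sq {f : ℝ → ℂ} (hf : MemLp f 2) : ‖hf.toLp‖ ^ 2 = ∫ x, ‖f x‖ ^ 2 := by
  have := inner_self_eq_norm_sq_to_K (𝕜 := ℂ) hf.toLp
  rw [L2.inner_def] at this
  apply Complex.ofReal_injective
  rw [← integral_complex_ofReal]
  push_cast
  refine this.symm.trans (integral_congr_ae ?_)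
  filter_upwards [hf.coeFn_toLp] with x hx
  rw [hx]
  simp

section Localization

variable {χ : ℝ → ℂ} {D : ℝ}

theorem IsSmoothCutoff.hasTemperateGrowth (hχ : IsSmoothCutoff χ D) : χ.HasTemperateGrowth :=
  hχ.compact.hasTemperateGrowth hχ.smooth

theorem IsSmoothCutoff.hasDerivAt (hχ : IsSmoothCutoff χ D) (x : ℝ) :
    HasDerivAt χ (deriv χ x) x :=
  (hχ.smooth.differentiable (by simp) x).hasDerivAt

theorem IsSmoothCutoff.continuous_deriv (hχ : IsSmoothCutoff χ D) : Continuous (deriv χ) :=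
  hχ.smooth.continuous_deriv (by simp)

theorem IsSmoothCutoff.hasLocDeriv (hχ : IsSmoothCutoff χ D) : HasLocDeriv χ (deriv χ) :=
  HasLocDeriv.of_hasDerivAt hχ.hasDerivAt hχ.continuous_deriv

theorem IsSmoothCutoff.isTest_mul (hχ : IsSmoothCutoff χ D) {u v : ℝ → ℂ} (huv : HasLocDeriv u v)
    (hv : IsL2Loc v) : IsTest (fun x => χ x * u x) (fun x => deriv χ x * u x + χ x * v x) where
  hasLocDeriv := hχ.hasLocDeriv.mul huv
  isL2Loc := (huv.isL2Loc.continuous_mul hχ.continuous_deriv).add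
    (hv.continuous_mul hχ.smooth.continuous)
  support := by
    obtain ⟨R, -, hR⟩ := exists_forall_lt_abs_eq_zero hχ.compact
    obtain ⟨R', -, hR'⟩ := exists_forall_lt_abs_eq_zero hχ.compact.deriv
    refine ⟨max R R' + 1, fun x hx => ?_⟩
    rw [hR x (by linarith [le_max_left R R']), hR' x (by linarith [le_max_right R R'])]
    simp

theorem IsTest.memLp {ψ ψ' : ℝ → ℂ} (h : IsTest ψ ψ') : MemLp ψ 2 ∧ MemLp ψ' 2 := by
  obtain ⟨R, hR⟩ := h.support
  exact ⟨h.hasLocDeriv.isL2Loc.memLp (R := R) fun x hx => (hR x hx.le).1,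
    h.isL2Loc.memLp (R := R) fun x hx => (hR x hx.le).2⟩

theorem IsSmoothCutoff.sobolevNorm_le (hχ : IsSmoothCutoff χ D) {κ : ℝ} (hκ : 0 < κ)
    {u v : ℝ → ℂ} (huv : HasLocDeriv u v) (hv : IsL2Loc v) {w : Lp ℂ 2 (volume : Measure ℝ)}
    (hw : w =ᵐ[volume] u) {a b : ℝ} (ha : 0 ≤ a) (hb : 0 ≤ b)
    (h1 : ∫ x, ‖χ x * u x‖ ^ 2 ≤ a ^ 2)
    (h2 : ∫ x, ‖deriv χ x * u x + χ x * v x‖ ^ 2 ≤ b ^ 2) :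
    sobolevNorm 1 κ (TemperedDistribution.smulLeftCLM ℂ χ (w : 𝓢'(ℝ, ℂ)))
      ≤ ENNReal.ofReal (2 * κ * a + b) := by
  have ht := hχ.isTest_mul huv hv
  obtain ⟨m1, m2⟩ := ht.memLp
  have e : TemperedDistribution.smulLeftCLM ℂ χ (w : 𝓢'(ℝ, ℂ)) = (m1.toLp : 𝓢'(ℝ, ℂ)) := by
    ext φ
    rw [TemperedDistribution.smulLeftCLM_apply_apply, Lp.toTemperedDistribution_apply,
      Lp.toTemperedDistribution_apply]
    refine integral_congr_ae ?_
    filter_upwards [hw, m1.coeFn_toLp] with x hx hx'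
    rw [hx, hx', SchwartzMap.smulLeftCLM_apply hχ.hasTemperateGrowth]
    simp only [smul_eq_mul]
    ring
  rw [e]
  have hs := sobolevNorm_one_le hκ (w := m1.toLp) (z := m2.toLp) fun φ => by
    have := (hasLocDeriv_schwartz φ).integral_mul_test ht
    rw [eq_neg_iff_add_eq_zero, add_comm, ← eq_neg_iff_add_eq_zero] at this
    refine Eq.trans (Eq.trans (integral_congr_ae ?_) this) (congrArg Neg.neg (integral_congr_ae ?_))
    · filter_upwards [m1.coeFn_toLp] with x hx
      rw [hx]; ring
    · filter_upwards [m2.coeFn_toLp] with x hx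
      rw [hx]; ring
  refine hs.trans (ENNReal.ofReal_le_ofReal ?_)
  have k1 : ‖m1.toLp‖ ≤ a := by
    rw [← norm_toLp_sq m1] at h1
    exact le_of_sq_le_sq h1 ha
  have k2 : ‖m2.toLp‖ ≤ b := by
    rw [← norm_toLp_sq m2] at h2
    exact le_of_sq_le_sq h2 hb
  gcongr

/-- Leibniz: `χ (h - g') = (h χ + g χ') - (g χ)'`. -/
theorem IsSmoothCutoff.represents (hχ : IsSmoothCutoff χ D) {f : 𝓢'(ℝ, ℂ)}
    {g h : Lp ℂ 2 (volume : Measure ℝ)}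
    (hf : ∀ φ : 𝓢(ℝ, ℂ), f φ = (∫ x, h x * φ x) + ∫ x, g x * deriv φ x) :
    Represents (TemperedDistribution.smulLeftCLM ℂ χ f) (fun x => g x * χ x)
      (fun x => h x * χ x + g x * deriv χ x) := by
  intro φ hφ
  have hφt := IsTest.of_schwartz φ hφ
  have hgL := (Lp.memLp g).isL2Loc
  have hhL := (Lp.memLp h).isL2Loc
  rw [TemperedDistribution.smulLeftCLM_apply_apply, hf]
  have e : ∀ x, SchwartzMap.smulLeftCLM ℂ χ φ x = χ x * φ x := fun x => by
    rw [SchwartzMap.smulLeftCLM_apply hχ.hasTemperateGrowth]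
    rfl
  have e' : ∀ x, deriv (SchwartzMap.smulLeftCLM ℂ χ φ) x = deriv χ x * φ x + χ x * deriv φ x := by
    intro x
    have : ⇑(SchwartzMap.smulLeftCLM ℂ χ φ) = fun x => χ x * φ x := funext e
    rw [this]
    exact ((hχ.hasDerivAt x).mul (φ.differentiable x).hasDerivAt).deriv
  simp_rw [e, e']
  have i1 := hφt.integrable_left (hhL.mul_continuous hχ.smooth.continuous)
  have i2 := hφt.integrable_left (hgL.mul_continuous hχ.continuous_deriv)
  have i3 := hφt.integrable_right (hgL.mul_continuous hχ.smooth.continuous)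
  have e1 : ∫ x, (h x * χ x + g x * deriv χ x) * φ x
      = (∫ x, h x * χ x * φ x) + ∫ x, g x * deriv χ x * φ x := by
    rw [← integral_add i1 i2]; congr 1; ext x; ring
  have e2 : ∫ x, g x * (deriv χ x * φ x + χ x * deriv φ x)
      = (∫ x, g x * deriv χ x * φ x) + ∫ x, g x * χ x * deriv φ x := by
    rw [← integral_add i2 i3]; congr 1; ext x; ring
  rw [e1, e2, add_assoc]
  simp_rw [mul_assoc]

end Localization

end WhiteNoiseResolvent

/-! ### From estimates for solutions to bounds for the localized resolvent. -/

namespace WhiteNoiseResolvent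

open Set Filter Topology

/-- Admissible sources: square integrable and supported in the support of the cutoff `η`. -/
structure IsSource (η : ℝ → ℂ) (g h : ℝ → ℂ) : Prop where
  left : MemLp g 2
  right : MemLp h 2
  left_zero : ∀ x, x ∉ tsupport η → g x = 0
  right_zero : ∀ x, x ∉ tsupport η → h x = 0

/-- The size of a source. -/
noncomputable def sourceSq (κ : ℝ) (g h : ℝ → ℂ) : ℝ := (∫ x, ‖g x‖ ^ 2) + (∫ x, ‖h x‖ ^ 2) / κ ^ 2

theorem sourceSq_nonneg (κ : ℝ) (g h : ℝ → ℂ) : 0 ≤ sourceSq κ g h :=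
  add_nonneg (integral_nonneg fun x => by positivity)
    (div_nonneg (integral_nonneg fun x => by positivity) (sq_nonneg κ))

theorem norm_add_sq_le (a b : ℂ) : ‖a + b‖ ^ 2 ≤ 2 * ‖a‖ ^ 2 + 2 * ‖b‖ ^ 2 := by
  have := pow_le_pow_left₀ (norm_nonneg _) (norm_add_le a b) 2
  nlinarith [sq_nonneg (‖a‖ - ‖b‖)]

section Bounds

variable {V V' : ℝ → ℝ} {K κ c₀ D : ℝ} {k : ℂ} {χ η : ℝ → ℂ}

theorem exists_forall_notMem_tsupport {η : ℝ → ℂ} (h : HasCompactSupport η) :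
    ∃ R : ℝ, 0 ≤ R ∧ ∀ x, R < |x| → x ∉ tsupport η := by
  obtain ⟨R, hR⟩ := h.isCompact.isBounded.subset_closedBall 0
  refine ⟨|R|, abs_nonneg R, fun x hx h => ?_⟩
  have := hR h
  rw [Metric.mem_closedBall, dist_zero_right, Real.norm_eq_abs] at this
  linarith [le_abs_self R]

theorem deriv_eq_zero_of_notMem_tsupport {η : ℝ → ℂ} {x : ℝ} (hx : x ∉ tsupport η) :
    deriv η x = 0 :=
  image_eq_zero_of_notMem_tsupport fun h => hx (tsupport_deriv_subset h)

/-- In the constant, `1` comes from `g`, `8` from `h`, whose norm is at most `2κ Φ`, and `2 D²` from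
the term `g η'`. Division by `κ²` in `sourceSq` matches the scaling of `h`. -/
theorem IsSmoothCutoff.exists_source (hη : IsSmoothCutoff η D) (hκ : 1 ≤ κ) {f : 𝓢'(ℝ, ℂ)}
    (hf : TemperedDistribution.MemSobolev (-1) 2 f) :
    ∃ (Φ : ℝ) (g h : ℝ → ℂ), 0 ≤ Φ ∧ sobolevNorm (-1) κ f = ENNReal.ofReal Φ ∧ IsSource η g h ∧
      sourceSq κ g h ≤ (9 + 2 * D ^ 2) * Φ ^ 2 ∧
      Represents (TemperedDistribution.smulLeftCLM ℂ η f) g h := by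
  have hκ0 : 0 < κ := by linarith
  obtain ⟨Φ, g, h, hΦ, hn, hg, hh, hf'⟩ := exists_repr_of_memSobolev hκ0 hf
  have hD : 0 ≤ D := (norm_nonneg _).trans (hη.norm_deriv_le 0)
  have hηc := hη.smooth.continuous
  have mg : MemLp g 2 := Lp.memLp g
  have mh : MemLp h 2 := Lp.memLp h
  have m1 : MemLp (fun x => g x * η x) 2 :=
    mg.of_le_mul (c := 1) (mg.1.mul hηc.aestronglyMeasurable) (Eventually.of_forall fun x => by
      rw [norm_mul, mul_comm]; exact mul_le_mul_of_nonneg_right (hη.norm_le x) (norm_nonneg _))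
  have m2 : MemLp (fun x => h x * η x) 2 :=
    mh.of_le_mul (c := 1) (mh.1.mul hηc.aestronglyMeasurable) (Eventually.of_forall fun x => by
      rw [norm_mul, mul_comm]; exact mul_le_mul_of_nonneg_right (hη.norm_le x) (norm_nonneg _))
  have m3 : MemLp (fun x => g x * deriv η x) 2 :=
    mg.of_le_mul (c := D) (mg.1.mul hη.continuous_deriv.aestronglyMeasurable)
      (Eventually.of_forall fun x => by
        rw [norm_mul, mul_comm]
        exact mul_le_mul_of_nonneg_right (hη.norm_deriv_le x) (norm_nonneg _))
  refine ⟨Φ, _, _, hΦ, hn, ⟨m1, m2.add m3, fun x hx => ?_, fun x hx => ?_⟩, ?_, hη.represents hf'⟩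
  · rw [image_eq_zero_of_notMem_tsupport hx, mul_zero]
  · rw [Pi.add_apply, image_eq_zero_of_notMem_tsupport hx, deriv_eq_zero_of_notMem_tsupport hx,
      mul_zero, mul_zero, add_zero]
  · have sq1 : ∫ x, ‖g x‖ ^ 2 ≤ Φ ^ 2 := by
      have e := norm_toLp_sq mg
      rw [Lp.toLp_coeFn] at e
      rw [← e]
      exact pow_le_pow_left₀ (norm_nonneg _) hg 2
    have sq2 : ∫ x, ‖h x‖ ^ 2 ≤ (2 * κ * Φ) ^ 2 := by
      have e := norm_toLp_sq mh
      rw [Lp.toLp_coeFn] at e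
      rw [← e]
      exact pow_le_pow_left₀ (norm_nonneg _) hh 2
    have b1 : ∫ x, ‖g x * η x‖ ^ 2 ≤ ∫ x, ‖g x‖ ^ 2 := by
      refine integral_mono m1.integrable_norm_sq mg.integrable_norm_sq fun x => ?_
      have := mul_le_mul_of_nonneg_left (hη.norm_le x) (norm_nonneg (g x))
      simp only [norm_mul]
      exact pow_le_pow_left₀ (by positivity) (by linarith) 2
    have b2 : ∫ x, ‖h x * η x + g x * deriv η x‖ ^ 2
        ≤ 2 * (∫ x, ‖h x‖ ^ 2) + 2 * D ^ 2 * ∫ x, ‖g x‖ ^ 2 := by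
      rw [← integral_const_mul, ← integral_const_mul, ← integral_add
        (mh.integrable_norm_sq.const_mul _) (mg.integrable_norm_sq.const_mul _)]
      refine integral_mono (m2.add m3).integrable_norm_sq
        ((mh.integrable_norm_sq.const_mul _).add (mg.integrable_norm_sq.const_mul _)) fun x => ?_
      refine (norm_add_sq_le _ _).trans ?_
      have k1 : ‖h x * η x‖ ^ 2 ≤ ‖h x‖ ^ 2 := by
        have := mul_le_mul_of_nonneg_left (hη.norm_le x) (norm_nonneg (h x))
        rw [norm_mul]
        exact pow_le_pow_left₀ (by positivity) (by linarith) 2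
      have k2 : ‖g x * deriv η x‖ ^ 2 ≤ D ^ 2 * ‖g x‖ ^ 2 := by
        have := mul_le_mul_of_nonneg_left (hη.norm_deriv_le x) (norm_nonneg (g x))
        rw [norm_mul, ← mul_pow]
        exact pow_le_pow_left₀ (by positivity) (by linarith) 2
      linarith
    have hκ2 : 1 ≤ κ ^ 2 := one_le_pow₀ hκ
    unfold sourceSq
    have b3 : (∫ x, ‖h x * η x + g x * deriv η x‖ ^ 2) / κ ^ 2 ≤ (8 + 2 * D ^ 2) * Φ ^ 2 := by
      rw [div_le_iff₀ (by positivity)]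
      have : D ^ 2 * ∫ x, ‖g x‖ ^ 2 ≤ D ^ 2 * Φ ^ 2 := mul_le_mul_of_nonneg_left sq1 (sq_nonneg D)
      have : D ^ 2 * Φ ^ 2 * 1 ≤ D ^ 2 * Φ ^ 2 * κ ^ 2 :=
        mul_le_mul_of_nonneg_left hκ2 (by positivity)
      nlinarith
    have b4 := b1.trans sq1
    simp only [Pi.add_apply]
    linarith

theorem IsSource.isL2Loc {g h : ℝ → ℂ} (hs : IsSource η g h) : IsL2Loc g ∧ IsL2Loc h :=
  ⟨hs.left.isL2Loc, hs.right.isL2Loc⟩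

theorem sobolevNorm_localized_le (hχ : IsSmoothCutoff χ D) (hκ : 1 ≤ κ) {u v : ℝ → ℂ}
    (huv : HasLocDeriv u v) (hv : IsL2Loc v) {w : Lp ℂ 2 (volume : Measure ℝ)}
    (hw : w =ᵐ[volume] u) {A C Φ S : ℝ} (hA : 0 ≤ A) (hΦ : 0 ≤ Φ) (hS : S ≤ C * Φ ^ 2)
    (h1 : κ ^ 2 * ∫ x, ‖χ x * u x‖ ^ 2 ≤ A ^ 2 * S)
    (h2 : ∫ x, ‖deriv χ x * u x + χ x * v x‖ ^ 2 ≤ A ^ 2 * S) (hC : 0 ≤ C) :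
    sobolevNorm 1 κ (TemperedDistribution.smulLeftCLM ℂ χ (w : 𝓢'(ℝ, ℂ)))
      ≤ ENNReal.ofReal (3 * √C * A) * ENNReal.ofReal Φ := by
  have hκ0 : 0 < κ := by linarith
  have e : A ^ 2 * S ≤ (√C * A * Φ) ^ 2 := by
    rw [mul_pow, mul_pow, Real.sq_sqrt hC]
    nlinarith [mul_le_mul_of_nonneg_left hS (sq_nonneg A)]
  have key := hχ.sobolevNorm_le hκ0 huv hv hw (a := √C * A * Φ / κ) (b := √C * A * Φ)
    (by positivity) (by positivity) (by
      rw [div_pow, le_div_iff₀ (by positivity)]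
      linarith) (h2.trans e)
  refine key.trans (le_of_eq ?_)
  rw [← ENNReal.ofReal_mul (by positivity)]
  congr 1
  field_simp
  ring

/-- A bound for solutions is a bound for the localized resolvent. -/
theorem localizedResolventNorm_le (hV : HasSqrtGrowth V K) (hk : IsSectorial k κ c₀)
    (hχ : IsSmoothCutoff χ D) (hη : IsSmoothCutoff η D) {A : ℝ} (hA : 0 ≤ A)
    (H : ∀ g h u v, IsSource η g h → IsWeakSol V k g h u v → MemLp u 2 →
      κ ^ 2 * (∫ x, ‖χ x * u x‖ ^ 2) ≤ A ^ 2 * sourceSq κ g h ∧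
      ∫ x, ‖deriv χ x * u x + χ x * v x‖ ^ 2 ≤ A ^ 2 * sourceSq κ g h) :
    localizedResolventNorm V k κ χ η ≤ ENNReal.ofReal (3 * √(9 + 2 * D ^ 2) * A) := by
  refine sInf_le fun f hf => ?_
  obtain ⟨Φ, g, h, hΦ, hn, hs, hle, hF⟩ := hη.exists_source hk.one_le hf
  obtain ⟨R, -, hR⟩ := exists_forall_notMem_tsupport hη.compact
  obtain ⟨u, v, hu, hsol, hiff⟩ := exists_resolventImage_iff hV hk hF hs.isL2Loc.1 hs.isL2Loc.2
    (fun x hx => hs.left_zero x (hR x hx)) (fun x hx => hs.right_zero x (hR x hx))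
  refine ⟨hu.toLp, hiff, ?_⟩
  rw [hn]
  obtain ⟨h1, h2⟩ := H g h u v hs hsol hu
  exact sobolevNorm_localized_le hχ hk.one_le hsol.hasLocDeriv hsol.isL2Loc hu.coeFn_toLp hA hΦ hle
    h1 h2 (by positivity)

/-- A bound for differences of solutions is a bound for differences of localized resolvents. -/
theorem localizedResolventNorm_le_add (hV : HasSqrtGrowth V K) (hV' : HasSqrtGrowth V' K)
    (hk : IsSectorial k κ c₀)
    (hχ : IsSmoothCutoff χ D) (hη : IsSmoothCutoff η D) {A : ℝ} (hA : 0 ≤ A)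
    (H : ∀ g h u v u' v', IsSource η g h → IsWeakSol V k g h u v → MemLp u 2 →
      IsWeakSol V' k g h u' v' → MemLp u' 2 →
      κ ^ 2 * (∫ x, ‖χ x * (u' x - u x)‖ ^ 2) ≤ A ^ 2 * sourceSq κ g h ∧
      ∫ x, ‖deriv χ x * (u' x - u x) + χ x * (v' x - v x)‖ ^ 2 ≤ A ^ 2 * sourceSq κ g h) :
    localizedResolventNorm V' k κ χ η
      ≤ localizedResolventNorm V k κ χ η + ENNReal.ofReal (3 * √(9 + 2 * D ^ 2) * A) := by
  rw [localizedResolventNorm, localizedResolventNorm, ENNReal.sInf_add]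
  refine le_iInf₂ fun M hM => sInf_le fun f hf => ?_
  obtain ⟨Φ, g, h, hΦ, hn, hs, hle, hF⟩ := hη.exists_source hk.one_le hf
  obtain ⟨R, -, hR⟩ := exists_forall_notMem_tsupport hη.compact
  obtain ⟨u, v, hu, hsol, hiff⟩ := exists_resolventImage_iff hV hk hF hs.isL2Loc.1 hs.isL2Loc.2
    (fun x hx => hs.left_zero x (hR x hx)) (fun x hx => hs.right_zero x (hR x hx))
  obtain ⟨u', v', hu', hsol', hiff'⟩ := exists_resolventImage_iff hV' hk hF hs.isL2Loc.1
    hs.isL2Loc.2 (fun x hx => hs.left_zero x (hR x hx)) (fun x hx => hs.right_zero x (hR x hx))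
  obtain ⟨w, hw, hwM⟩ := hM f hf
  have hwu : w = hu.toLp := (hiff w).1 ((hw w).2 rfl)
  refine ⟨hu'.toLp, hiff', ?_⟩
  obtain ⟨h1, h2⟩ := H g h u v u' v' hs hsol hu hsol' hu'
  have hd := sobolevNorm_localized_le hχ hk.one_le (hsol'.hasLocDeriv.sub hsol.hasLocDeriv)
    (hsol'.isL2Loc.sub hsol.isL2Loc) (hu'.sub hu).coeFn_toLp hA hΦ hle h1 h2 (by positivity)
  have e : TemperedDistribution.smulLeftCLM ℂ χ (hu'.toLp : 𝓢'(ℝ, ℂ))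
      = TemperedDistribution.smulLeftCLM ℂ χ (w : 𝓢'(ℝ, ℂ))
        + TemperedDistribution.smulLeftCLM ℂ χ ((hu'.sub hu).toLp : 𝓢'(ℝ, ℂ)) := by
    rw [← map_add, hwu]
    congr 1
    rw [MemLp.toLp_sub hu' hu]
    simp only [← Lp.toTemperedDistributionCLM_apply, map_sub]
    abel
  rw [e, add_mul]
  refine (sobolevNorm_add_le _ _ _ _).trans (add_le_add hwM ?_)
  rw [hn]
  exact hd

/-- The constant in the deterministic bound for the localized resolvent. -/
noncomputable def blockConst (D c₀ : ℝ) : ℝ :=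
  3 * √(9 + 2 * D ^ 2) * (√(800 * D ^ 2 + 52000) / c₀)

/-- The weight is `1` on the source and at least `L` on the target, so the weighted estimate gains
`1 / L`. The power `b²` is the square root of the `b⁴` in the bound for the derivative. -/
theorem localizedResolventNorm_le_of_weight (hV : HasSqrtGrowth V K) (hk : IsSectorial k κ c₀)
    (hχ : IsSmoothCutoff χ D) (hη : IsSmoothCutoff η D) {r : ℕ} (hr : 1 ≤ r) {b : ℝ} (hb : 1 ≤ b)
    (hosc : OscLE V (2 * r) fun _ => b) {E E' : ℝ → ℝ} {s M : ℝ} (hE : IsWeight E E' s M)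
    (hs0 : 0 ≤ s) (hs1 : s ≤ c₀ / (64 * b)) (hηE : ∀ x ∈ tsupport η, E x = 1 ∧ |x| < r)
    (hE'0 : ∀ x, (r : ℝ) ≤ |x| → E' x = 0) {L : ℝ} (hL : 0 < L)
    (hχE : ∀ x ∈ tsupport χ, L ≤ E x ∧ |x| ≤ r) :
    localizedResolventNorm V k κ χ η ≤ ENNReal.ofReal (blockConst D c₀ * b ^ 2 / L) := by
  have hc₀ := hk.pos
  have hκ := hk.one_le
  have hD : 0 ≤ D := (norm_nonneg _).trans (hη.norm_deriv_le 0)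
  set C := 800 * D ^ 2 + 52000 with hC
  have hC0 : 0 ≤ C := by positivity
  have key := localizedResolventNorm_le hV hk hχ hη (A := √C / c₀ * b ^ 2 / L) (by positivity)
    fun g h u v hs hsol hu => ?_
  · refine key.trans (le_of_eq ?_)
    rw [blockConst]
    congr 1
    ring
  obtain ⟨e1, e2⟩ := hsol.weighted_estimate_of_growth hV hk hr hb hosc hE hs0 hs1 hu hs.left
    hs.right (fun x hx => hηE x (by by_contra h; exact hx (hs.left_zero x h)))
    (fun x hx => hηE x (by by_contra h; exact hx (hs.right_zero x h))) hE'0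
  change _ ≤ _ * sourceSq κ g h at e1 e2
  set S := sourceSq κ g h with hS
  have hS0 : 0 ≤ S := sourceSq_nonneg κ g h
  have hA : (√C / c₀ * b ^ 2 / L) ^ 2 * S = C * b ^ 4 / c₀ ^ 2 * S / L ^ 2 := by
    rw [div_pow, mul_pow, div_pow, Real.sq_sqrt hC0]; ring
  rw [hA]
  have hE0 : ∀ x, 0 ≤ E x := fun x => zero_le_one.trans (hE.one_le x)
  have hη' := hE.isCutoff_tent hs0 hr
  have iu : Integrable fun x => E x ^ 2 * ‖u x‖ ^ 2 :=
    Integrable.bdd_sq_mul hu.integrable_norm_sq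
      hE.hasLocDeriv.continuous_ofReal.aestronglyMeasurable (C := M) fun x => by
      rw [abs_of_nonneg (hE0 x)]; exact hE.le x
  have iv : Integrable fun x => (tent r x * E x) ^ 2 * ‖v x‖ ^ 2 := hη'.integrable_sq hsol.isL2Loc
  have p1 : ∀ x, ‖χ x‖ ^ 2 ≤ (E x) ^ 2 / L ^ 2 := fun x => by
    by_cases hx : x ∈ tsupport χ
    · rw [le_div_iff₀ (by positivity), ← mul_pow]
      refine pow_le_pow_left₀ (by positivity) ?_ 2
      nlinarith [hχ.norm_le x, (hχE x hx).1, norm_nonneg (χ x)]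
    · rw [image_eq_zero_of_notMem_tsupport hx]; simp; positivity
  have p2 : ∀ x, ‖χ x‖ ^ 2 ≤ (tent r x * E x) ^ 2 / L ^ 2 := fun x => by
    by_cases hx : x ∈ tsupport χ
    · rw [tent_eq_one hr (hχE x hx).2, one_mul]; exact p1 x
    · rw [image_eq_zero_of_notMem_tsupport hx]; simp; positivity
  have p3 : ∀ x, ‖deriv χ x‖ ^ 2 ≤ D ^ 2 * (E x) ^ 2 / L ^ 2 := fun x => by
    by_cases hx : x ∈ tsupport χ
    · rw [le_div_iff₀ (by positivity), ← mul_pow, ← mul_pow]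
      refine pow_le_pow_left₀ (by positivity) ?_ 2
      exact mul_le_mul (hχ.norm_deriv_le x) (hχE x hx).1 hL.le hD
    · rw [deriv_eq_zero_of_notMem_tsupport hx]; simp; positivity
  have hb4 : b ^ 2 ≤ b ^ 4 := pow_le_pow_right₀ hb (by norm_num)
  constructor
  · have : ∫ x, ‖χ x * u x‖ ^ 2 ≤ (∫ x, E x ^ 2 * ‖u x‖ ^ 2) / L ^ 2 := by
      rw [← integral_div]
      refine integral_mono_of_nonneg (Eventually.of_forall fun x => by positivity)
        (iu.div_const _) (Eventually.of_forall fun x => ?_)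
      simp only [norm_mul, mul_pow]
      rw [mul_div_right_comm]
      exact mul_le_mul_of_nonneg_right (p1 x) (by positivity)
    calc κ ^ 2 * ∫ x, ‖χ x * u x‖ ^ 2 ≤ κ ^ 2 * ((∫ x, E x ^ 2 * ‖u x‖ ^ 2) / L ^ 2) := by gcongr
      _ = (κ ^ 2 * ∫ x, E x ^ 2 * ‖u x‖ ^ 2) / L ^ 2 := by ring
      _ ≤ (400 * b ^ 2 / c₀ ^ 2 * S) / L ^ 2 := by gcongr
      _ ≤ (C * b ^ 4 / c₀ ^ 2 * S) / L ^ 2 := by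
        gcongr
        rw [hC]; nlinarith [sq_nonneg D]
  · have h1 : ∫ x, ‖deriv χ x * u x + χ x * v x‖ ^ 2
        ≤ (2 * D ^ 2 * (∫ x, E x ^ 2 * ‖u x‖ ^ 2)
          + 2 * ∫ x, (tent r x * E x) ^ 2 * ‖v x‖ ^ 2) / L ^ 2 := by
      rw [← integral_const_mul, ← integral_const_mul, ← integral_add (iu.const_mul _)
        (iv.const_mul _), ← integral_div]
      refine integral_mono_of_nonneg (Eventually.of_forall fun x => by positivity)
        (((iu.const_mul _).add (iv.const_mul _)).div_const _) (Eventually.of_forall fun x => ?_)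
      refine (norm_add_sq_le _ _).trans ?_
      simp only [norm_mul, mul_pow]
      have q1 := mul_le_mul_of_nonneg_right (p3 x) (sq_nonneg ‖u x‖)
      have q2 := mul_le_mul_of_nonneg_right (p2 x) (sq_nonneg ‖v x‖)
      rw [mul_pow] at q2
      have : (2 * D ^ 2 * (E x ^ 2 * ‖u x‖ ^ 2) + 2 * (tent r x ^ 2 * E x ^ 2 * ‖v x‖ ^ 2)) / L ^ 2
        = 2 * (D ^ 2 * E x ^ 2 / L ^ 2 * ‖u x‖ ^ 2)
          + 2 * (tent r x ^ 2 * E x ^ 2 / L ^ 2 * ‖v x‖ ^ 2) := by ring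
      rw [this]
      linarith
    refine h1.trans ?_
    have hκ2 : 1 ≤ κ ^ 2 := one_le_pow₀ hκ
    have hU : ∫ x, E x ^ 2 * ‖u x‖ ^ 2 ≤ 400 * b ^ 2 / c₀ ^ 2 * S := by
      have : 0 ≤ ∫ x, E x ^ 2 * ‖u x‖ ^ 2 := integral_nonneg fun x => by positivity
      nlinarith
    gcongr
    calc 2 * D ^ 2 * (∫ x, E x ^ 2 * ‖u x‖ ^ 2) + 2 * ∫ x, (tent r x * E x) ^ 2 * ‖v x‖ ^ 2
        ≤ 2 * D ^ 2 * (400 * b ^ 4 / c₀ ^ 2 * S) + 2 * (26000 * b ^ 4 / c₀ ^ 2 * S) := by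
          gcongr
          exact hU.trans (by gcongr)
      _ = C * b ^ 4 / c₀ ^ 2 * S := by rw [hC]; ring

end Bounds

end WhiteNoiseResolvent

namespace WhiteNoiseResolvent

open Set Filter Topology

/-! ### Dependence on the potential -/

theorem isCutoff_tent {R : ℕ} (hR : 1 ≤ R) : IsCutoff (tent R) (tentDeriv R) (2 * R) := by
  simpa using isWeight_one.isCutoff_tent le_rfl hR

/-- The constant in the energy bound for sources supported in `[-r, r]`. -/
noncomputable def energyConst (K c₀ : ℝ) (r : ℕ) : ℝ := 400 * growthBound K (2 * r) ^ 2 / c₀ ^ 2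

/-- The constant in the local bound for the derivative on `[-R, R]`. -/
noncomputable def derivConst (K c₀ : ℝ) (r R : ℕ) : ℝ :=
  64 * growthBound K (2 * R) ^ 2 * energyConst K c₀ r + 8

/-- The constant in the bound for differences of solutions. -/
noncomputable def perturbConst (K c₀ : ℝ) (r R : ℕ) (δ : ℝ) : ℝ :=
  4 * √(derivConst K c₀ r R) / R * (energyConst K c₀ r + 1)
    + δ * (5 * derivConst K c₀ r R + 10 * energyConst K c₀ r)

section Perturbation

variable {V V' : ℝ → ℝ} {K κ c₀ D δ : ℝ} {k : ℂ} {χ η g h u v u' v' : ℝ → ℂ} {r R : ℕ}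

theorem energyConst_nonneg : 0 ≤ energyConst K c₀ r := by unfold energyConst; positivity

theorem one_le_derivConst : 1 ≤ derivConst K c₀ r R := by
  have := energyConst_nonneg (K := K) (c₀ := c₀) (r := r)
  have : 0 ≤ 64 * growthBound K (2 * R) ^ 2 * energyConst K c₀ r := by positivity
  unfold derivConst
  linarith

theorem IsWeakSol.energy_le (hsol : IsWeakSol V k g h u v) (hV : HasSqrtGrowth V K)
    (hk : IsSectorial k κ c₀) (hs : IsSource η g h) (hr : 1 ≤ r)
    (hη : ∀ x ∈ tsupport η, |x| < r) (hu : MemLp u 2) :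
    κ ^ 2 * (∫ x, ‖u x‖ ^ 2) ≤ energyConst K c₀ r * sourceSq κ g h := by
  have hb : 1 ≤ growthBound K (2 * r) := one_le_growthBound hV.one_le _
  have hc := hk.pos
  have := (hsol.weighted_estimate_of_growth hV hk hr hb (hV.osc (2 * r)) isWeight_one le_rfl
    (by positivity) hu hs.left hs.right
    (fun x hx => ⟨rfl, hη x (by by_contra h; exact hx (hs.left_zero x h))⟩)
    (fun x hx => ⟨rfl, hη x (by by_contra h; exact hx (hs.right_zero x h))⟩) (fun x _ => rfl)).1
  simp only [one_pow, one_mul] at this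
  exact this

theorem IsWeakSol.deriv_le (hsol : IsWeakSol V k g h u v) (hV : HasSqrtGrowth V K)
    (hk : IsSectorial k κ c₀) (hs : IsSource η g h) (hr : 1 ≤ r)
    (hη : ∀ x ∈ tsupport η, |x| < r) (hu : MemLp u 2) (hR : 1 ≤ R) :
    ∫ x, tent R x ^ 2 * ‖v x‖ ^ 2 ≤ derivConst K c₀ r R * sourceSq κ g h := by
  have hb : 1 ≤ growthBound K (2 * R) := one_le_growthBound hV.one_le _
  have h1 := hsol.local_energy_le hV.continuous hR (hV.osc (2 * R)) hb hk.one_le hk.re_nonneg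
    isWeight_one le_rfl zero_le_one hu hs.left hs.right (fun x _ => rfl) (fun x _ => rfl)
  have h2 := hsol.energy_le hV hk hs hr hη hu
  simp only [mul_one, one_pow, one_mul] at h1
  change _ ≤ 64 * growthBound K (2 * R) ^ 2 * _ + 8 * sourceSq κ g h at h1
  refine h1.trans ?_
  unfold derivConst
  nlinarith [mul_le_mul_of_nonneg_left h2 (by positivity : 0 ≤ 64 * growthBound K (2 * R) ^ 2)]

/-- Here `m` bounds the derivative of the cutoff, of size `1 / R`, and the sources are `δ` times `p`
and `q`. The parameter `lam` is left free because the local `L²` bound for the derivative grows with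
`R`. -/
theorem errorDensity_le {δ lam m : ℝ} (hδ : 0 ≤ δ) (hlam : 0 < lam) {e e' a b x y p q : ℝ}
    (he0 : 0 ≤ e) (he1 : e ≤ 1) (he' : |e'| ≤ m) (hm : m ≤ 1) (hx : 0 ≤ x) (hy : 0 ≤ y) (hp : 0 ≤ p)
    (hq : 0 ≤ q) (ha : a ≤ δ * p) (hb : b ≤ δ * q) :
    2 * |e| * |e'| * x * y + b * (e ^ 2 * x) + a * (2 * |e| * |e'| * x + e ^ 2 * y)
      ≤ m * (lam * x ^ 2 + lam⁻¹ * (e ^ 2 * y ^ 2))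
        + δ * (e ^ 2 * q ^ 2 + 2 * x ^ 2 + 2 * p ^ 2 + e ^ 2 * y ^ 2) := by
  rw [abs_of_nonneg he0]
  have hm0 : 0 ≤ m := (abs_nonneg _).trans he'
  have hlam' : 0 < lam⁻¹ := inv_pos.2 hlam
  have e1 : 2 * x * (e * y) ≤ lam * x ^ 2 + lam⁻¹ * (e ^ 2 * y ^ 2) := by
    have : lam * x ^ 2 + lam⁻¹ * (e ^ 2 * y ^ 2) - 2 * x * (e * y) = lam⁻¹ * (lam * x - e * y) ^ 2 := by
      field_simp; ring
    nlinarith [mul_nonneg hlam'.le (sq_nonneg (lam * x - e * y))]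
  have e2 : 2 * e * |e'| * x * y ≤ m * (lam * x ^ 2 + lam⁻¹ * (e ^ 2 * y ^ 2)) := by
    calc 2 * e * |e'| * x * y = |e'| * (2 * x * (e * y)) := by ring
      _ ≤ m * (2 * x * (e * y)) := mul_le_mul_of_nonneg_right he' (by positivity)
      _ ≤ _ := mul_le_mul_of_nonneg_left e1 hm0
  have e3 : b * (e ^ 2 * x) ≤ δ * (e ^ 2 * q ^ 2 + x ^ 2) := by
    calc b * (e ^ 2 * x) ≤ δ * q * (e ^ 2 * x) := mul_le_mul_of_nonneg_right hb (by positivity)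
      _ = δ * (e * (e * q * x)) := by ring
      _ ≤ δ * (1 * (e * q * x)) := by gcongr
      _ ≤ δ * (e ^ 2 * q ^ 2 + x ^ 2) := by
        refine mul_le_mul_of_nonneg_left ?_ hδ
        nlinarith [sq_nonneg (e * q - x), mul_nonneg (mul_nonneg he0 hq) hx]
  have e4 : a * (2 * e * |e'| * x + e ^ 2 * y) ≤ δ * (2 * p ^ 2 + x ^ 2 + e ^ 2 * y ^ 2) := by
    have i1 : 2 * e * |e'| * x ≤ 2 * x := by
      have : e * |e'| ≤ 1 := mul_le_one₀ he1 (abs_nonneg _) (he'.trans hm)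
      nlinarith
    have i2 : e ^ 2 * y ≤ e * y := by nlinarith [mul_nonneg he0 hy]
    calc a * (2 * e * |e'| * x + e ^ 2 * y) ≤ δ * p * (2 * x + e * y) := by
          refine mul_le_mul ha (by linarith) (by positivity) (by positivity)
      _ = δ * (p * (2 * x + e * y)) := by ring
      _ ≤ _ := by
        refine mul_le_mul_of_nonneg_left ?_ hδ
        nlinarith [sq_nonneg (p - x), sq_nonneg (p - e * y), mul_nonneg hp (mul_nonneg he0 hy)]
  nlinarith

-- The difference of the solutions has a source of size `δ` on `[-2R, 2R]`, with no smallness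
-- beyond, so its energy is localized by a tent at scale `R`. The commutator is bounded through a
-- priori bounds for both solutions: the derivative on this scale costs `√(derivConst K c₀ r R)`, of
-- order `√R`, against the factor `1 / R`. Caccioppoli at scale `r` then controls the derivative;
-- `2r ≤ R` ensures that the tent at scale `R` is `1` on the support of the one at scale `r`.
set_option maxHeartbeats 1000000 in
theorem perturbation_le (hV : HasSqrtGrowth V K) (hV' : HasSqrtGrowth V' K)
    (hk : IsSectorial k κ c₀) (hs : IsSource η g h) (hr : 1 ≤ r) (hη : ∀ x ∈ tsupport η, |x| < r)
    (hsol : IsWeakSol V k g h u v) (hu : MemLp u 2) (hsol' : IsWeakSol V' k g h u' v')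
    (hu' : MemLp u' 2) (hR : 2 * r ≤ R) (hδ : 0 ≤ δ)
    (hVV : ∀ x : ℝ, |x| ≤ 2 * R → |V' x - V x| ≤ δ) :
    ∫ x, tent R x ^ 2 * ‖u' x - u x‖ ^ 2 ≤ perturbConst K c₀ r R δ * sourceSq κ g h ∧
    ∫ x, tent r x ^ 2 * ‖v' x - v x‖ ^ 2 ≤
      ((20 + 44 * growthBound K (2 * r) ^ 2 * κ ^ 2) * perturbConst K c₀ r R δ
        + δ ^ 2 * (8 * energyConst K c₀ r + derivConst K c₀ r R)) * sourceSq κ g h := by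
  have hR1 : 1 ≤ R := by omega
  have hR0 : (0 : ℝ) < R := by exact_mod_cast hR1
  have hκ := hk.one_le
  have hκ2 : 1 ≤ κ ^ 2 := one_le_pow₀ hκ
  set S := sourceSq κ g h with hS
  set A := energyConst K c₀ r with hA
  set B := derivConst K c₀ r R with hB
  have hS0 : 0 ≤ S := sourceSq_nonneg κ g h
  have hA0 : 0 ≤ A := energyConst_nonneg
  have hB1 : 1 ≤ B := one_le_derivConst
  have bu : ∫ x, ‖u x‖ ^ 2 ≤ A * S := by
    have := hsol.energy_le hV hk hs hr hη hu
    have : 0 ≤ ∫ x, ‖u x‖ ^ 2 := integral_nonneg fun x => by positivity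
    nlinarith
  have bu' : ∫ x, ‖u' x‖ ^ 2 ≤ A * S := by
    have := hsol'.energy_le hV' hk hs hr hη hu'
    have : 0 ≤ ∫ x, ‖u' x‖ ^ 2 := integral_nonneg fun x => by positivity
    nlinarith
  have bv := hsol.deriv_le hV hk hs hr hη hu hR1
  have bv' := hsol'.deriv_le hV' hk hs hr hη hu' hR1
  have hd := hsol.sub hV.continuous hV'.continuous hsol' hs.isL2Loc.1 hs.isL2Loc.2
  have hDc : Continuous fun x => ((V' x - V x : ℝ) : ℂ) :=
    Complex.continuous_ofReal.comp (hV'.continuous.sub hV.continuous)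
  have hgL := hu.isL2Loc.continuous_mul hDc
  have hhL := hsol.isL2Loc.continuous_mul hDc
  have hηR := isCutoff_tent hR1
  have iu := hu.integrable_norm_sq
  have iu' := hu'.integrable_norm_sq
  have iy := (hu'.sub hu).integrable_norm_sq
  have iv := hηR.integrable_sq hsol.isL2Loc
  have iv' := hηR.integrable_sq hsol'.isL2Loc
  have iz := hηR.integrable_sq hd.isL2Loc
  simp only [Pi.sub_apply] at iy
  have nsub : ∀ a b : ℂ, ‖a - b‖ ^ 2 ≤ 2 * ‖a‖ ^ 2 + 2 * ‖b‖ ^ 2 := fun a b => by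
    have := norm_add_sq_le a (-b)
    rwa [norm_neg, ← sub_eq_add_neg] at this
  have by' : ∫ x, ‖u' x - u x‖ ^ 2 ≤ 4 * (A * S) := by
    calc ∫ x, ‖u' x - u x‖ ^ 2 ≤ ∫ x, (2 * ‖u' x‖ ^ 2 + 2 * ‖u x‖ ^ 2) :=
          integral_mono iy ((iu'.const_mul 2).add (iu.const_mul 2)) fun x => nsub _ _
      _ = 2 * (∫ x, ‖u' x‖ ^ 2) + 2 * ∫ x, ‖u x‖ ^ 2 := by
        rw [integral_add (iu'.const_mul 2) (iu.const_mul 2), integral_const_mul,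
          integral_const_mul]
      _ ≤ _ := by linarith
  have bz : ∫ x, tent R x ^ 2 * ‖v' x - v x‖ ^ 2 ≤ 4 * (B * S) := by
    calc ∫ x, tent R x ^ 2 * ‖v' x - v x‖ ^ 2
        ≤ ∫ x, (2 * (tent R x ^ 2 * ‖v' x‖ ^ 2) + 2 * (tent R x ^ 2 * ‖v x‖ ^ 2)) :=
          integral_mono iz ((iv'.const_mul 2).add (iv.const_mul 2)) fun x => by
            have := mul_le_mul_of_nonneg_left (nsub (v' x) (v x)) (sq_nonneg (tent R x))
            simp only
            linarith
      _ = 2 * (∫ x, tent R x ^ 2 * ‖v' x‖ ^ 2) + 2 * ∫ x, tent R x ^ 2 * ‖v x‖ ^ 2 := by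
        rw [integral_add (iv'.const_mul 2) (iv.const_mul 2), integral_const_mul,
          integral_const_mul]
      _ ≤ _ := by linarith
  -- This balances `lam` against `lam⁻¹ B`.
  set lam := √B with hlam
  have hlam0 : 0 < lam := Real.sqrt_pos.2 (by linarith)
  have hlam1 : 1 ≤ lam := Real.one_le_sqrt.2 hB1
  have hlamB : lam⁻¹ * B = lam := by
    have : lam * lam = B := Real.mul_self_sqrt (by linarith)
    rw [← this]; field_simp
  have hin : ∀ x, tent R x ≠ 0 → |x| ≤ 2 * R := fun x hx => by
    by_contra hlt
    exact hx (tent_eq_zero hR1 (not_le.1 hlt).le)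
  have hsmall : ∀ x : ℝ, |x| ≤ 2 * R → ∀ z : ℂ, ‖((V' x - V x : ℝ) : ℂ) * z‖ ≤ δ * ‖z‖ := by
    intro x hx z
    rw [norm_mul, Complex.norm_real, Real.norm_eq_abs]
    exact mul_le_mul_of_nonneg_right (hVV x hx) (norm_nonneg _)
  have first : ∫ x, tent R x ^ 2 * ‖u' x - u x‖ ^ 2 ≤ perturbConst K c₀ r R δ * S := by
    have e1 := hd.im_energy_le hηR hgL hhL
    have e0 : 0 ≤ ∫ x, tent R x ^ 2 * ‖u' x - u x‖ ^ 2 := integral_nonneg fun x => by positivity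
    have e2 : ∫ x, tent R x ^ 2 * ‖u' x - u x‖ ^ 2 ≤ ∫ x, errorDensity (tent R) (tentDeriv R)
        (fun x => ((V' x - V x : ℝ) : ℂ) * u x) (fun x => ((V' x - V x : ℝ) : ℂ) * v x)
        (fun x => u' x - u x) (fun x => v' x - v x) x := by
      nlinarith [hk.one_le_im]
    refine e2.trans ?_
    have iE := hηR.integrable_errorDensity hd.hasLocDeriv hd.isL2Loc hgL hhL
    have j1 := ((iy.const_mul lam).add (iz.const_mul lam⁻¹)).const_mul (1 / (R : ℝ))
    have j2 := (((iv.add (iy.const_mul 2)).add (iu.const_mul 2)).add iz).const_mul δ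
    refine (integral_mono iE (j1.add j2) fun x => ?_).trans ?_
    · by_cases hx : |x| ≤ 2 * R
      · exact errorDensity_le hδ hlam0 (tent_nonneg R x) (tent_le_one R x) (abs_tentDeriv_le R x)
          ((div_le_one hR0).2 (by exact_mod_cast hR1)) (norm_nonneg _) (norm_nonneg _)
          (norm_nonneg _) (norm_nonneg _) (hsmall x hx _)
          (hsmall x hx _)
      · have h0 : tent R x = 0 := tent_eq_zero hR1 (not_le.1 hx).le
        simp only [errorDensity, h0, Pi.add_apply]
        simp only [abs_zero, mul_zero, zero_mul, ne_eq, OfNat.ofNat_ne_zero, not_false_eq_true,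
          zero_pow, add_zero, zero_add]
        positivity
    · simp only [Pi.add_apply] at j1 j2 ⊢
      rw [integral_add j1 j2, integral_const_mul, integral_const_mul,
        integral_add (iy.const_mul lam) (iz.const_mul lam⁻¹),
        integral_add (by exact (iv.add (iy.const_mul 2)).add (iu.const_mul 2)) iz,
        integral_add (by exact iv.add (iy.const_mul 2)) (iu.const_mul 2),
        integral_add iv (iy.const_mul 2)]
      simp only [integral_const_mul]
      have t1 : 1 / (R : ℝ) * (lam * (∫ x, ‖u' x - u x‖ ^ 2)
          + lam⁻¹ * ∫ x, tent R x ^ 2 * ‖v' x - v x‖ ^ 2)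
          ≤ 1 / (R : ℝ) * (lam * (4 * (A * S)) + lam⁻¹ * (4 * (B * S))) := by gcongr
      have t2 : 1 / (R : ℝ) * (lam * (4 * (A * S)) + lam⁻¹ * (4 * (B * S)))
          = 4 * lam / R * (A + 1) * S := by
        have : lam⁻¹ * (4 * (B * S)) = 4 * lam * S := by
          calc lam⁻¹ * (4 * (B * S)) = 4 * (lam⁻¹ * B) * S := by ring
            _ = _ := by rw [hlamB]
        rw [this]; ring
      have t3 : δ * ((∫ x, tent R x ^ 2 * ‖v x‖ ^ 2) + 2 * (∫ x, ‖u' x - u x‖ ^ 2)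
          + 2 * (∫ x, ‖u x‖ ^ 2) + ∫ x, tent R x ^ 2 * ‖v' x - v x‖ ^ 2)
          ≤ δ * ((5 * B + 10 * A) * S) := mul_le_mul_of_nonneg_left (by linarith) hδ
      unfold perturbConst
      rw [← hA, ← hB, ← hlam]
      linarith
  refine ⟨first, ?_⟩
  have hηr := isCutoff_tent hr
  have htent : ∀ x : ℝ, |x| ≤ 2 * r → tent R x = 1 := fun x hx =>
    tent_eq_one hR1 (hx.trans (by exact_mod_cast hR))
  have it : Integrable fun x => |tentDeriv r x| ^ 2 * ‖u' x - u x‖ ^ 2 := by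
    have := Integrable.bdd_sq_mul iy (aestronglyMeasurable_tentDeriv hr) (abs_tentDeriv_le_one hr)
    refine this.congr (Eventually.of_forall fun x => ?_)
    simp only [sq_abs]
  have hc := hd.caccioppoli hηr hV'.continuous (hV'.osc (2 * r)) (one_le_growthBound hV'.one_le _)
    hκ hk.re_nonneg (tent_nonneg r) (t := fun x => |tentDeriv r x|)
    (fun x => le_add_of_nonneg_right (tent_nonneg r x)) hgL hhL it
  have iyR := hηR.integrable_sq hd.hasLocDeriv.isL2Loc
  have c1 : ∫ x, |tentDeriv r x| ^ 2 * ‖u' x - u x‖ ^ 2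
      ≤ ∫ x, tent R x ^ 2 * ‖u' x - u x‖ ^ 2 := by
    refine integral_mono it iyR fun x => mul_le_mul_of_nonneg_right ?_ (by positivity)
    by_cases hx : |x| ≤ 2 * r
    · rw [htent x hx]
      exact pow_le_pow_left₀ (abs_nonneg _) (abs_tentDeriv_le_one hr x) 2
    · rw [tentDeriv_eq_zero_of_ge (not_le.1 hx).le]; simp; positivity
  have htt : ∀ x, tent r x ^ 2 ≤ tent R x ^ 2 := fun x => by
    by_cases hx : |x| ≤ 2 * r
    · rw [htent x hx]
      exact pow_le_pow_left₀ (tent_nonneg r x) (tent_le_one r x) 2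
    · rw [tent_eq_zero hr (not_le.1 hx).le]; simp; positivity
  have c2 : ∫ x, tent r x ^ 2 * ‖u' x - u x‖ ^ 2 ≤ ∫ x, tent R x ^ 2 * ‖u' x - u x‖ ^ 2 :=
    integral_mono (hηr.integrable_sq hd.hasLocDeriv.isL2Loc) iyR fun x =>
      mul_le_mul_of_nonneg_right (htt x) (by positivity)
  have hrR : (2 * r : ℝ) ≤ 2 * R := by
    have : (2 * r : ℝ) ≤ R := by exact_mod_cast hR
    linarith
  have hz : ∀ x : ℝ, ¬ |x| ≤ 2 * r → tent r x = 0 := fun x hx => tent_eq_zero hr (not_le.1 hx).le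
  have c3 : ∫ x, tent r x ^ 2 * ‖((V' x - V x : ℝ) : ℂ) * u x‖ ^ 2 ≤ δ ^ 2 * (A * S) := by
    refine le_trans ?_ (mul_le_mul_of_nonneg_left bu (sq_nonneg δ))
    rw [← integral_const_mul]
    refine integral_mono (hηr.integrable_sq hgL) (iu.const_mul _) fun x => ?_
    by_cases hx : |x| ≤ 2 * r
    · simp only
      rw [← mul_pow, ← mul_pow]
      refine pow_le_pow_left₀ (mul_nonneg (tent_nonneg r x) (norm_nonneg _)) ?_ 2
      have := hsmall x (hx.trans hrR) (u x)
      nlinarith [tent_nonneg r x, tent_le_one r x, norm_nonneg (((V' x - V x : ℝ) : ℂ) * u x)]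
    · simp only [hz x hx]; simp; positivity
  have c4 : ∫ x, tent r x ^ 2 * ‖((V' x - V x : ℝ) : ℂ) * v x‖ ^ 2 ≤ δ ^ 2 * (B * S) := by
    refine le_trans ?_ (mul_le_mul_of_nonneg_left bv (sq_nonneg δ))
    rw [← integral_const_mul]
    refine integral_mono (hηr.integrable_sq hhL) (iv.const_mul _) fun x => ?_
    by_cases hx : |x| ≤ 2 * r
    · simp only
      rw [htent x hx, one_pow, one_mul, ← mul_pow, ← mul_pow]
      refine pow_le_pow_left₀ (mul_nonneg (tent_nonneg r x) (norm_nonneg _)) ?_ 2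
      have := hsmall x (hx.trans hrR) (v x)
      nlinarith [tent_nonneg r x, tent_le_one r x, norm_nonneg (((V' x - V x : ℝ) : ℂ) * v x)]
    · simp only [hz x hx]; simp; positivity
  have c5 : (∫ x, tent r x ^ 2 * ‖((V' x - V x : ℝ) : ℂ) * v x‖ ^ 2) / κ ^ 2
      ≤ δ ^ 2 * (B * S) := by
    refine (div_le_self (integral_nonneg fun x => by positivity) hκ2).trans c4
  change _ ≤ _ + 44 * growthBound K (2 * r) ^ 2 * κ ^ 2 * _ + _ + _ at hc
  have d1 := c1.trans first
  have d2 := mul_le_mul_of_nonneg_left (c2.trans first)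
    (by positivity : 0 ≤ 44 * growthBound K (2 * r) ^ 2 * κ ^ 2)
  refine hc.trans ?_
  linarith

theorem tendsto_perturbConst (K c₀ : ℝ) (r : ℕ) :
    Tendsto (fun R : ℕ => perturbConst K c₀ r R 0) atTop (𝓝 0) := by
  have h0 := tendsto_growthBound_div K 2
  set A := energyConst K c₀ r with hA
  have hA0 : 0 ≤ A := energyConst_nonneg
  have hR : Tendsto (fun R : ℕ => ((R : ℝ))⁻¹) atTop (𝓝 0) := tendsto_inv_atTop_nhds_zero_nat
  have h1 : Tendsto (fun R : ℕ => 4 * √(64 * (growthBound K (2 * R) / R) ^ 2 * A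
      + 8 * ((R : ℝ)⁻¹) ^ 2) * (A + 1)) atTop (𝓝 (4 * √(64 * 0 ^ 2 * A + 8 * 0 ^ 2) * (A + 1))) :=
    ((((((h0.pow 2).const_mul 64).mul_const A).add ((hR.pow 2).const_mul 8)).sqrt.const_mul
      4).mul_const (A + 1))
  simp only [ne_eq, OfNat.ofNat_ne_zero, not_false_eq_true, zero_pow, mul_zero, zero_mul, add_zero,
    Real.sqrt_zero] at h1
  refine h1.congr' ?_
  filter_upwards [eventually_ge_atTop 1] with R hR1
  have hR0 : (0 : ℝ) < R := by exact_mod_cast hR1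
  have e : 64 * (growthBound K (2 * R) / R) ^ 2 * A + 8 * ((R : ℝ)⁻¹) ^ 2
      = derivConst K c₀ r R / R ^ 2 := by
    rw [derivConst, ← hA]; field_simp
  rw [perturbConst, zero_mul, add_zero, e, Real.sqrt_div' _ (sq_nonneg _), Real.sqrt_sq hR0.le]
  ring

/-- The localized resolvent depends continuously on the potential. -/
theorem exists_localizedResolventNorm_le_add (hk : IsSectorial k κ c₀)
    (hχ : IsSmoothCutoff χ D) (hη : IsSmoothCutoff η D) {ε : ℝ} (hε : 0 < ε) :
    ∃ (R : ℝ) (δ : ℝ), 0 < δ ∧ ∀ V V' : ℝ → ℝ, HasSqrtGrowth V K → HasSqrtGrowth V' K →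
      (∀ x, |x| ≤ R → |V' x - V x| ≤ δ) →
      localizedResolventNorm V' k κ χ η ≤ localizedResolventNorm V k κ χ η + ENNReal.ofReal ε := by
  have hκ := hk.one_le
  obtain ⟨r₁, -, hr₁⟩ := exists_forall_notMem_tsupport hη.compact
  obtain ⟨r₂, -, hr₂⟩ := exists_forall_notMem_tsupport hχ.compact
  obtain ⟨r, hr⟩ := exists_nat_gt (max (max r₁ r₂) 0)
  have hr1 : 1 ≤ r := by
    have : (0 : ℝ) < r := (le_max_right _ _).trans_lt hr
    exact_mod_cast this
  have hηr : ∀ x ∈ tsupport η, |x| < r := fun x hx => by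
    by_contra hlt
    exact hr₁ x (((le_max_left _ _).trans (le_max_left _ _)).trans_lt (hr.trans_le
      (not_lt.1 hlt))) hx
  have hχr : ∀ x ∈ tsupport χ, |x| ≤ r := fun x hx => by
    by_contra hlt
    exact hr₂ x (((le_max_right _ _).trans (le_max_left _ _)).trans_lt (hr.trans
      (not_le.1 hlt))) hx
  set N := 3 * √(9 + 2 * D ^ 2) with hN
  have hN0 : 0 < N := by positivity
  set ε' := ε / N with hε'
  have hε'0 : 0 < ε' := by positivity
  set Q := κ ^ 2 + 2 * D ^ 2 + 2 * (20 + 44 * growthBound K (2 * r) ^ 2 * κ ^ 2) with hQ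
  have hQ0 : 0 < Q := by positivity
  -- The order of choices matters: `R` first makes the commutator small at `δ = 0`, then `δ` is
  -- chosen depending on `R`, since its coefficient grows with `R`.
  obtain ⟨R, hR, hRr⟩ := (((tendsto_perturbConst K c₀ r).eventually
    (gt_mem_nhds (by positivity : 0 < ε' ^ 2 / (2 * Q)))).and (eventually_ge_atTop (2 * r))).exists
  have hδt : Tendsto (fun δ : ℝ => Q * perturbConst K c₀ r R δ
      + 2 * (δ ^ 2 * (8 * energyConst K c₀ r + derivConst K c₀ r R))) (𝓝[>] 0)
      (𝓝 (Q * perturbConst K c₀ r R 0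
        + 2 * (0 ^ 2 * (8 * energyConst K c₀ r + derivConst K c₀ r R)))) := by
    have : Continuous fun δ : ℝ => Q * perturbConst K c₀ r R δ
      + 2 * (δ ^ 2 * (8 * energyConst K c₀ r + derivConst K c₀ r R)) := by
      unfold perturbConst; fun_prop
    exact (this.tendsto 0).mono_left nhdsWithin_le_nhds
  have hlt : Q * perturbConst K c₀ r R 0
      + 2 * (0 ^ 2 * (8 * energyConst K c₀ r + derivConst K c₀ r R)) < ε' ^ 2 := by
    have h1 := mul_lt_mul_of_pos_left hR hQ0
    have h2 : Q * (ε' ^ 2 / (2 * Q)) = ε' ^ 2 / 2 := by field_simp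
    rw [h2] at h1
    have : 0 < ε' ^ 2 := by positivity
    simp only [ne_eq, OfNat.ofNat_ne_zero, not_false_eq_true, zero_pow, zero_mul, mul_zero,
      add_zero]
    linarith
  obtain ⟨δ, hδ, hδ0⟩ := ((hδt.eventually (gt_mem_nhds hlt)).and self_mem_nhdsWithin).exists
  have hδ0 : 0 < δ := hδ0
  refine ⟨2 * R, δ, hδ0, fun V V' hV hV' hVV => ?_⟩
  have key := localizedResolventNorm_le_add hV hV' hk hχ hη hε'0.le
    fun g h u v u' v' hs hsol hu hsol' hu' => ?_
  · have e : 3 * √(9 + 2 * D ^ 2) * ε' = ε := by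
      rw [← hN, hε']; field_simp
    rwa [e] at key
  obtain ⟨p1, p2⟩ := perturbation_le hV hV' hk hs hr1 hηr hsol hu hsol' hu' hRr hδ0.le hVV
  set S := sourceSq κ g h with hS
  have hS0 : 0 ≤ S := sourceSq_nonneg κ g h
  have hR1 : 1 ≤ R := by omega
  have hd := hsol.sub hV.continuous hV'.continuous hsol' hs.isL2Loc.1 hs.isL2Loc.2
  have i1 := (isCutoff_tent hR1).integrable_sq hd.hasLocDeriv.isL2Loc
  have i2 := (isCutoff_tent hr1).integrable_sq hd.isL2Loc
  have hD : 0 ≤ D := (norm_nonneg _).trans (hχ.norm_deriv_le 0)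
  have q1 : ∀ x, ‖χ x‖ ^ 2 ≤ tent R x ^ 2 := fun x => by
    by_cases hx : x ∈ tsupport χ
    · rw [tent_eq_one hR1 ((hχr x hx).trans (by exact_mod_cast (by omega : r ≤ R)))]
      exact pow_le_pow_left₀ (norm_nonneg _) (hχ.norm_le x) 2
    · rw [image_eq_zero_of_notMem_tsupport hx]; simp; positivity
  have q2 : ∀ x, ‖χ x‖ ^ 2 ≤ tent r x ^ 2 := fun x => by
    by_cases hx : x ∈ tsupport χ
    · rw [tent_eq_one hr1 (hχr x hx)]
      exact pow_le_pow_left₀ (norm_nonneg _) (hχ.norm_le x) 2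
    · rw [image_eq_zero_of_notMem_tsupport hx]; simp; positivity
  have q3 : ∀ x, ‖deriv χ x‖ ^ 2 ≤ D ^ 2 * tent R x ^ 2 := fun x => by
    by_cases hx : x ∈ tsupport χ
    · rw [tent_eq_one hR1 ((hχr x hx).trans (by exact_mod_cast (by omega : r ≤ R))), one_pow,
        mul_one]
      exact pow_le_pow_left₀ (norm_nonneg _) (hχ.norm_deriv_le x) 2
    · rw [deriv_eq_zero_of_notMem_tsupport hx]; simp; positivity
  have r1 : ∫ x, ‖χ x * (u' x - u x)‖ ^ 2 ≤ ∫ x, tent R x ^ 2 * ‖u' x - u x‖ ^ 2 := by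
    refine integral_mono_of_nonneg (Eventually.of_forall fun x => by positivity) i1
      (Eventually.of_forall fun x => ?_)
    simp only [norm_mul, mul_pow]
    exact mul_le_mul_of_nonneg_right (q1 x) (sq_nonneg _)
  have r2 : ∫ x, ‖deriv χ x * (u' x - u x) + χ x * (v' x - v x)‖ ^ 2
      ≤ 2 * D ^ 2 * (∫ x, tent R x ^ 2 * ‖u' x - u x‖ ^ 2)
        + 2 * ∫ x, tent r x ^ 2 * ‖v' x - v x‖ ^ 2 := by
    rw [← integral_const_mul, ← integral_const_mul, ← integral_add (i1.const_mul _)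
      (i2.const_mul _)]
    refine integral_mono_of_nonneg (Eventually.of_forall fun x => by positivity)
      ((i1.const_mul _).add (i2.const_mul _)) (Eventually.of_forall fun x => ?_)
    refine (norm_add_sq_le _ _).trans ?_
    simp only [norm_mul, mul_pow]
    have q4 := mul_le_mul_of_nonneg_right (q3 x) (sq_nonneg ‖u' x - u x‖)
    have q5 := mul_le_mul_of_nonneg_right (q2 x) (sq_nonneg ‖v' x - v x‖)
    linarith
  set T := perturbConst K c₀ r R δ with hT
  set W := δ ^ 2 * (8 * energyConst K c₀ r + derivConst K c₀ r R) with hW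
  have hW0 : 0 ≤ W := by
    have := energyConst_nonneg (K := K) (c₀ := c₀) (r := r)
    have := one_le_derivConst (K := K) (c₀ := c₀) (r := r) (R := R)
    positivity
  have hT0 : 0 ≤ T := by
    have := energyConst_nonneg (K := K) (c₀ := c₀) (r := r)
    have := one_le_derivConst (K := K) (c₀ := c₀) (r := r) (R := R)
    rw [hT, perturbConst]
    positivity
  have hfin : (Q * T + 2 * W) * S ≤ ε' ^ 2 * S := mul_le_mul_of_nonneg_right hδ.le hS0
  constructor
  · have a1 : κ ^ 2 * ∫ x, ‖χ x * (u' x - u x)‖ ^ 2 ≤ κ ^ 2 * (T * S) :=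
      mul_le_mul_of_nonneg_left (r1.trans p1) (sq_nonneg κ)
    have a2 : 0 ≤ (2 * D ^ 2 + 2 * (20 + 44 * growthBound K (2 * r) ^ 2 * κ ^ 2)) * (T * S)
      + 2 * W * S := by positivity
    have a3 : (Q * T + 2 * W) * S = κ ^ 2 * (T * S) + ((2 * D ^ 2
      + 2 * (20 + 44 * growthBound K (2 * r) ^ 2 * κ ^ 2)) * (T * S) + 2 * W * S) := by
      rw [hQ]; ring
    linarith
  · have a1 := mul_le_mul_of_nonneg_left p1 (by positivity : 0 ≤ 2 * D ^ 2)
    have a2 : 0 ≤ κ ^ 2 * (T * S) := by positivity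
    have a3 : (Q * T + 2 * W) * S = κ ^ 2 * (T * S) + 2 * D ^ 2 * (T * S)
      + 2 * (((20 + 44 * growthBound K (2 * r) ^ 2 * κ ^ 2) * T + W) * S) := by
      rw [hQ]; ring
    linarith

end Perturbation

end WhiteNoiseResolvent

namespace WhiteNoiseResolvent

open Set Filter Topology

/-! ### Dyadic blocks -/

theorem abs_exp_sub_exp_le {x y B : ℝ} (hx : x ≤ B) (hy : y ≤ B) :
    |Real.exp x - Real.exp y| ≤ Real.exp B * |x - y| := by
  have key : ∀ {x y : ℝ}, y ≤ x → x ≤ B → Real.exp x - Real.exp y ≤ Real.exp B * (x - y) := by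
    intro x y hxy hx
    have h1 := Real.add_one_le_exp (y - x)
    have h2 : Real.exp y = Real.exp x * Real.exp (y - x) := by rw [← Real.exp_add]; ring_nf
    have h3 := Real.exp_le_exp.2 hx
    have h4 := mul_le_mul_of_nonneg_right h3 (sub_nonneg.2 hxy)
    nlinarith [mul_le_mul_of_nonneg_left h1 (Real.exp_pos x).le]
  rcases le_total y x with h | h
  · rw [abs_of_nonneg (sub_nonneg.2 (Real.exp_le_exp.2 h)), abs_of_nonneg (sub_nonneg.2 h)]
    exact key h hx
  · rw [abs_sub_comm, abs_sub_comm x, abs_of_nonneg (sub_nonneg.2 (Real.exp_le_exp.2 h)),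
      abs_of_nonneg (sub_nonneg.2 h)]
    exact key h hy

theorem isWeight_exp {φ : ℝ → ℝ} (hφ : LipschitzWith 1 φ) {a s : ℝ} (h0 : ∀ x, 0 ≤ φ x)
    (ha : ∀ x, φ x ≤ a) (hs : 0 ≤ s) :
    IsWeight (fun x => Real.exp (s * φ x)) (fun x => s * deriv φ x * Real.exp (s * φ x)) s
      (Real.exp (s * a)) where
  hasLocDeriv := by
    have hl : LipschitzWith (Real.toNNReal (Real.exp (s * a) * s)) fun x => Real.exp (s * φ x) := by
      refine LipschitzWith.of_dist_le_mul fun x y => ?_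
      rw [Real.coe_toNNReal _ (by positivity), Real.dist_eq]
      refine (abs_exp_sub_exp_le (mul_le_mul_of_nonneg_left (ha x) hs)
        (mul_le_mul_of_nonneg_left (ha y) hs)).trans ?_
      rw [← mul_sub, abs_mul, abs_of_nonneg hs, mul_assoc]
      have := hφ.dist_le_mul x y
      rw [NNReal.coe_one, one_mul, Real.dist_eq] at this
      gcongr
    refine (HasLocDeriv.of_lipschitz hl).congr_ae ?_
    filter_upwards [hφ.ae_differentiableAt_real] with x hx
    have := ((hx.hasDerivAt.const_mul s).exp).deriv
    rw [this]
    congr 1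
    ring
  one_le x := Real.one_le_exp (mul_nonneg hs (h0 x))
  le x := Real.exp_le_exp.2 (mul_le_mul_of_nonneg_left (ha x) hs)
  abs_deriv_le x := by
    have h1 : |deriv φ x| ≤ 1 := by simpa using norm_deriv_le_of_lipschitz (x₀ := x) hφ
    rw [abs_mul, abs_mul, abs_of_nonneg hs, abs_of_pos (Real.exp_pos _)]
    refine mul_le_mul_of_nonneg_right ?_ (Real.exp_pos _).le
    nlinarith

theorem IsBump.nonneg {χ₁ : ℝ → ℝ} (h : IsBump χ₁) (x : ℝ) : 0 ≤ χ₁ x :=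
  (indicator_nonneg (fun _ _ => zero_le_one) x).trans (h.lower x)

theorem IsBump.le_one {χ₁ : ℝ → ℝ} (h : IsBump χ₁) (x : ℝ) : χ₁ x ≤ 1 :=
  (h.upper x).trans (indicator_le_self' (fun _ _ => zero_le_one) x)

theorem IsBump.eq_one {χ₁ : ℝ → ℝ} (h : IsBump χ₁) {x : ℝ} (hx : |x| ≤ 1) : χ₁ x = 1 := by
  refine le_antisymm (h.le_one x) ?_
  have := h.lower x
  rwa [indicator_of_mem (show x ∈ Icc (-1 : ℝ) 1 from abs_le.1 hx)] at this

theorem IsBump.eq_zero {χ₁ : ℝ → ℝ} (h : IsBump χ₁) {x : ℝ} (hx : 2 < |x|) : χ₁ x = 0 := by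
  refine le_antisymm ?_ (h.nonneg x)
  have := h.upper x
  rwa [indicator_of_notMem (show x ∉ Icc (-2 : ℝ) 2 from fun hm => not_le.2 hx (abs_le.2 hm))]
    at this

theorem IsBump.hasCompactSupport {χ₁ : ℝ → ℝ} (h : IsBump χ₁) : HasCompactSupport χ₁ :=
  HasCompactSupport.intro (isCompact_Icc (a := (-2 : ℝ)) (b := 2)) fun x hx => h.eq_zero (by
    by_contra hlt
    exact hx (abs_le.1 (not_lt.1 hlt)))

theorem IsDyadic.two_le {n : ℕ} (h : IsDyadic n) : 2 ≤ n := by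
  obtain ⟨i, hi, rfl⟩ := h
  calc 2 = 2 ^ 1 := by norm_num
    _ ≤ 2 ^ i := Nat.pow_le_pow_right (by norm_num) hi

/-- Dyadicity upgrades `m > 4n` to `m ≥ 8n`. The supports then lie in `|x| ≤ 2n ≤ m/4` and `|x| ≥
m/2`, separated by at least `m/4`. -/
theorem IsDyadic.eight_mul_le {m n : ℕ} (hm : IsDyadic m) (hn : IsDyadic n) (h : 4 * n < m) :
    8 * n ≤ m := by
  obtain ⟨i, -, rfl⟩ := hm
  obtain ⟨j, -, rfl⟩ := hn
  have e1 : 4 * 2 ^ j = 2 ^ (j + 2) := by ring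
  have e2 : 8 * 2 ^ j = 2 ^ (j + 3) := by ring
  rw [e1] at h
  rw [e2]
  have := (Nat.pow_lt_pow_iff_right (by norm_num : 1 < 2)).1 h
  exact Nat.pow_le_pow_right (by norm_num) this

theorem tsupport_dyadicCutoff {χ₁ : ℝ → ℝ} (hχ : IsBump χ₁) {n : ℕ} (hn : 2 ≤ n) {x : ℝ}
    (hx : x ∈ tsupport (dyadicCutoff χ₁ n)) : (n : ℝ) / 2 ≤ |x| ∧ |x| ≤ 2 * n := by
  have hn0 : (0 : ℝ) < n := by exact_mod_cast (by omega : 0 < n)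
  have hcl : IsClosed {x : ℝ | (n : ℝ) / 2 ≤ |x| ∧ |x| ≤ 2 * n} :=
    (isClosed_le continuous_const continuous_abs).inter (isClosed_le continuous_abs continuous_const)
  refine closure_minimal (fun y hy => ?_) hcl hx
  by_contra hne
  apply hy
  have hor : |y| < n / 2 ∨ 2 * n < |y| := by
    by_contra hc
    push Not at hc
    exact hne hc
  have e1 : |y / n| = |y| / n := by rw [abs_div, abs_of_pos hn0]
  have e2 : |2 * y / n| = 2 * |y| / n := by rw [abs_div, abs_mul, abs_of_pos hn0, abs_two]
  rcases hor with h | h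
  · rw [dyadicCutoff, hχ.eq_one, hχ.eq_one, sub_self, Complex.ofReal_zero]
    · rw [e2, div_le_one hn0]; linarith
    · rw [e1, div_le_one hn0]; linarith
  · rw [dyadicCutoff, hχ.eq_zero, hχ.eq_zero, sub_self, Complex.ofReal_zero]
    · rw [e2, lt_div_iff₀ hn0]; linarith
    · rw [e1, lt_div_iff₀ hn0]; linarith

/-- Dilation by `n` divides derivatives by `n`, so one constant serves all scales. -/
theorem IsBump.exists_isSmoothCutoff {χ₁ : ℝ → ℝ} (hχ : IsBump χ₁) :
    ∃ D : ℝ, ∀ n : ℕ, 2 ≤ n → IsSmoothCutoff (dyadicCutoff χ₁ n) D := by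
  obtain ⟨C, hC⟩ := (hχ.smooth.continuous_deriv (by simp)).bounded_above_of_compact_support
    hχ.hasCompactSupport.deriv
  refine ⟨2 * C, fun n hn => ?_⟩
  have hn0 : (2 : ℝ) ≤ n := by exact_mod_cast hn
  have hC0 : 0 ≤ C := (norm_nonneg _).trans (hC 0)
  refine ⟨?_, ?_, fun x => ?_, fun x => ?_⟩
  · refine Complex.ofRealCLM.contDiff.comp (ContDiff.sub ?_ ?_)
    · exact hχ.smooth.comp (contDiff_id.div_const _)
    · exact hχ.smooth.comp ((contDiff_const.mul contDiff_id).div_const _)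
  · refine HasCompactSupport.intro (isCompact_Icc (a := (-(2 * n) : ℝ)) (b := 2 * n)) fun x hx => ?_
    exact image_eq_zero_of_notMem_tsupport fun h =>
      hx (abs_le.1 (tsupport_dyadicCutoff hχ hn h).2)
  · rw [dyadicCutoff, Complex.norm_real, Real.norm_eq_abs, abs_le]
    have h1 := hχ.nonneg (x / n)
    have h2 := hχ.le_one (x / n)
    have h3 := hχ.nonneg (2 * x / n)
    have h4 := hχ.le_one (2 * x / n)
    constructor <;> linarith
  · have hd : ∀ y, HasDerivAt χ₁ (deriv χ₁ y) y := fun y =>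
      (hχ.smooth.differentiable (by simp) y).hasDerivAt
    have h1 : HasDerivAt (fun x : ℝ => χ₁ (x / n)) (deriv χ₁ (x / n) * (1 / n)) x :=
      (hd (x / n)).comp x ((hasDerivAt_id x).div_const (n : ℝ))
    have h2 : HasDerivAt (fun x : ℝ => χ₁ (2 * x / n)) (deriv χ₁ (2 * x / n) * (2 * 1 / n)) x :=
      (hd (2 * x / n)).comp x (((hasDerivAt_id x).const_mul 2).div_const (n : ℝ))
    have h3 : HasDerivAt (dyadicCutoff χ₁ n) _ x := (h1.sub h2).ofReal_comp
    rw [h3.deriv, Complex.norm_real]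
    refine (norm_sub_le _ _).trans ?_
    rw [norm_mul, norm_mul]
    have e1 : ‖(1 / n : ℝ)‖ ≤ 1 / 2 := by
      rw [Real.norm_of_nonneg (by positivity)]
      exact one_div_le_one_div_of_le two_pos hn0
    have e2 : ‖(2 * 1 / n : ℝ)‖ ≤ 1 := by
      rw [Real.norm_of_nonneg (by positivity), div_le_one (by linarith)]
      linarith
    have := mul_le_mul (hC (x / n)) e1 (norm_nonneg _) hC0
    have := mul_le_mul (hC (2 * x / n)) e2 (norm_nonneg _) hC0
    linarith

/-- The argument of `k²` lies strictly between `π/8` and `3π/8`, which gives `Re k² ≥ 0` and `Im k²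
≥ sin (π/8) κ²`. -/
theorem StrictlyAdmissible.isSectorial {C₀ : ℝ} (hC₀ : 1 ≤ C₀) {k : ℂ}
    (h : StrictlyAdmissible C₀ k) : IsSectorial k ‖k‖ (Real.sin (Real.pi / 8)) := by
  have hπ := Real.pi_pos
  have hk2 : k ^ 2 = ((‖k‖ ^ 2 : ℝ) : ℂ) * Complex.exp ((2 * k.arg : ℝ) * Complex.I) := by
    conv_lhs => rw [← Complex.norm_mul_exp_arg_mul_I k]
    rw [mul_pow, ← Complex.exp_nat_mul]
    push_cast
    ring_nf
  have him : (k ^ 2).im = ‖k‖ ^ 2 * Real.sin (2 * k.arg) := by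
    rw [hk2, Complex.im_ofReal_mul, Complex.exp_ofReal_mul_I_im]
  have hre : (k ^ 2).re = ‖k‖ ^ 2 * Real.cos (2 * k.arg) := by
    rw [hk2, Complex.re_ofReal_mul, Complex.exp_ofReal_mul_I_re]
  obtain ⟨h1, h2⟩ := abs_lt.1 h.arg_close
  have hs : Real.sin (Real.pi / 8) ≤ Real.sin (2 * k.arg) :=
    Real.sin_le_sin_of_le_of_le_pi_div_two (by linarith) (by linarith) (by linarith)
  have him1 : 1 ≤ (k ^ 2).im := hC₀.trans h.le_im_sq
  refine ⟨?_, ?_, Real.sin_pos_of_pos_of_lt_pi (by linarith) (by linarith), Real.sin_le_one _, ?_,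
    him1⟩
  · rw [him] at him1
    have := Real.sin_le_one (2 * k.arg)
    have h3 : 1 ≤ ‖k‖ ^ 2 := by nlinarith [sq_nonneg ‖k‖]
    exact (one_le_sq_iff₀ (norm_nonneg _)).1 h3
  · rw [hre]
    exact mul_nonneg (sq_nonneg _) (Real.cos_nonneg_of_mem_Icc ⟨by linarith, by linarith⟩)
  · rw [him, mul_comm]
    exact mul_le_mul_of_nonneg_left hs (sq_nonneg _)

/-! ### Block estimates from exponential weights. -/

section Blocks

variable {V χ₁ : ℝ → ℝ} {K κ c₀ D b : ℝ} {k : ℂ} {m n : ℕ}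

theorem block_le (hV : HasSqrtGrowth V K) (hk : IsSectorial k κ c₀) (hχ : IsBump χ₁)
    (hm : IsSmoothCutoff (dyadicCutoff χ₁ m) D) (hn : IsSmoothCutoff (dyadicCutoff χ₁ n) D)
    (hm2 : 2 ≤ m) (hn2 : 2 ≤ n) (hb : 1 ≤ b) (hosc : OscLE V (5 * max m n) fun _ => b) :
    localizedResolventNorm V k κ (dyadicCutoff χ₁ m) (dyadicCutoff χ₁ n)
      ≤ ENNReal.ofReal (blockConst D c₀ * b ^ 2) := by
  have hc := hk.pos
  have hmM : (m : ℝ) ≤ (max m n : ℕ) := by exact_mod_cast le_max_left m n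
  have hnM : (n : ℝ) ≤ (max m n : ℕ) := by exact_mod_cast le_max_right m n
  set M := max m n with hM
  -- `2M + 1` strictly exceeds the radius `2M` of the supports, and the required window `2 (2M + 1)`
  -- fits into `5M` because `M ≥ 2`.
  have := localizedResolventNorm_le_of_weight hV hk hm hn (r := 2 * M + 1) (by omega) hb
    (hosc.mono (by have := le_max_left m n; omega)) isWeight_one le_rfl (by positivity)
    (fun x hx => ⟨rfl, by
      have := (tsupport_dyadicCutoff hχ hn2 hx).2
      push_cast; linarith⟩) (fun x _ => rfl) one_pos
    (fun x hx => ⟨le_rfl, by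
      have := (tsupport_dyadicCutoff hχ hm2 hx).2
      push_cast; linarith⟩)
  rwa [div_one] at this

theorem lipschitzWith_clamp (a c : ℝ) : LipschitzWith 1 fun x : ℝ => max 0 (min a (|x| - c)) := by
  have h1 : LipschitzWith 1 fun x : ℝ => |x| - c := by
    refine LipschitzWith.of_dist_le_mul fun x y => ?_
    rw [NNReal.coe_one, one_mul, Real.dist_eq, Real.dist_eq, sub_sub_sub_cancel_right]
    exact abs_abs_sub_abs_le _ _
  exact (h1.const_min a).const_max 0

theorem lipschitzWith_clamp' (a c : ℝ) : LipschitzWith 1 fun x : ℝ => max 0 (min a (c - |x|)) := by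
  have h1 : LipschitzWith 1 fun x : ℝ => c - |x| := by
    refine LipschitzWith.of_dist_le_mul fun x y => ?_
    rw [NNReal.coe_one, one_mul, Real.dist_eq, Real.dist_eq, sub_sub_sub_cancel_left, abs_sub_comm x]
    exact abs_abs_sub_abs_le _ _
  exact (h1.const_min a).const_max 0

/-- The weight `exp (s φ)` at the largest admissible rate `s = c₀ / (64 b)` gains `exp (-s M / 4)`.
Constancy of `φ` beyond `2M` stops the weight from varying where `b` does not control the potential.
-/
theorem block_le_of_far (hV : HasSqrtGrowth V K) (hk : IsSectorial k κ c₀) (hχ : IsBump χ₁)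
    (hm : IsSmoothCutoff (dyadicCutoff χ₁ m) D) (hn : IsSmoothCutoff (dyadicCutoff χ₁ n) D)
    (hm2 : 2 ≤ m) (hn2 : 2 ≤ n) (hb : 1 ≤ b) (hosc : OscLE V (5 * max m n) fun _ => b)
    {φ : ℝ → ℝ} (hφ : LipschitzWith 1 φ) (h0 : ∀ x, 0 ≤ φ x)
    (ha : ∀ x, φ x ≤ (max m n : ℕ) / 4) (hφn : ∀ x, (n : ℝ) / 2 ≤ |x| → |x| ≤ 2 * n → φ x = 0)
    (hφm : ∀ x, (m : ℝ) / 2 ≤ |x| → |x| ≤ 2 * m → (max m n : ℕ) / 4 ≤ φ x)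
    {c : ℝ} (hφc : ∀ x, 2 * ((max m n : ℕ) : ℝ) < |x| → φ x = c) :
    localizedResolventNorm V k κ (dyadicCutoff χ₁ m) (dyadicCutoff χ₁ n)
      ≤ ENNReal.ofReal (blockConst D c₀ * b ^ 2 * Real.exp (-(c₀ * (max m n : ℕ) / (256 * b)))) := by
  have hc := hk.pos
  have hb0 : 0 < b := by linarith
  have hmM : (m : ℝ) ≤ (max m n : ℕ) := by exact_mod_cast le_max_left m n
  have hnM : (n : ℝ) ≤ (max m n : ℕ) := by exact_mod_cast le_max_right m n
  set M := max m n with hM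
  set s := c₀ / (64 * b) with hs
  have hs0 : 0 ≤ s := by positivity
  have := localizedResolventNorm_le_of_weight hV hk hm hn (r := 2 * M + 1) (by omega) hb
    (hosc.mono (by have := le_max_left m n; omega)) (isWeight_exp hφ h0 ha hs0) hs0 le_rfl
    (fun x hx => by
      obtain ⟨h1, h2⟩ := tsupport_dyadicCutoff hχ hn2 hx
      refine ⟨?_, ?_⟩
      · simp only [hφn x h1 h2, mul_zero, Real.exp_zero]
      · push_cast; linarith)
    (fun x hx => by
      have hev : φ =ᶠ[𝓝 x] fun _ => c := by
        have : {y : ℝ | 2 * (M : ℝ) < |y|} ∈ 𝓝 x :=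
          (isOpen_lt continuous_const continuous_abs).mem_nhds (by
            push_cast at hx
            change 2 * (M : ℝ) < |x|
            linarith)
        filter_upwards [this] with y hy using hφc y hy
      simp only [hev.deriv_eq, deriv_const, mul_zero, zero_mul])
    (L := Real.exp (s * (M / 4))) (Real.exp_pos _)
    (fun x hx => by
      obtain ⟨h1, h2⟩ := tsupport_dyadicCutoff hχ hm2 hx
      refine ⟨Real.exp_le_exp.2 (mul_le_mul_of_nonneg_left (hφm x h1 h2) hs0), ?_⟩
      push_cast; linarith)
  refine this.trans (le_of_eq ?_)
  rw [Real.exp_neg, div_eq_mul_inv]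
  have : c₀ * M / (256 * b) = s * (M / 4) := by
    rw [hs]
    field_simp
    ring
  rw [this]

/-- The phase increases outwards from `2n` to `2n + m/4` when `m` is the larger scale, and inwards
from `n/2` to `n/4` when `n` is. -/
theorem block_le_exp (hV : HasSqrtGrowth V K) (hk : IsSectorial k κ c₀) (hχ : IsBump χ₁)
    (hm : IsSmoothCutoff (dyadicCutoff χ₁ m) D) (hn : IsSmoothCutoff (dyadicCutoff χ₁ n) D)
    (hmd : IsDyadic m) (hnd : IsDyadic n) (hb : 1 ≤ b) (hosc : OscLE V (5 * max m n) fun _ => b)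
    (hfar : 4 * n < m ∨ 4 * m < n) :
    localizedResolventNorm V k κ (dyadicCutoff χ₁ m) (dyadicCutoff χ₁ n)
      ≤ ENNReal.ofReal (blockConst D c₀ * b ^ 2 * Real.exp (-(c₀ * (max m n : ℕ) / (256 * b)))) := by
  have hm2 := hmd.two_le
  have hn2 := hnd.two_le
  rcases hfar with h | h
  · have h8 := hmd.eight_mul_le hnd h
    have h8' : 8 * (n : ℝ) ≤ m := by exact_mod_cast h8
    have hmax : max m n = m := max_eq_left (by omega)
    rw [hmax] at hosc ⊢
    have hm0 : (0 : ℝ) ≤ m / 4 := by positivity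
    have := block_le_of_far hV hk hχ hm hn hm2 hn2 hb (by rwa [hmax])
      (lipschitzWith_clamp (m / 4) (2 * n)) (fun x => le_max_left _ _)
      (fun x => by rw [hmax]; exact max_le hm0 (min_le_left _ _))
      (fun x h1 h2 => max_eq_left ((min_le_right _ _).trans (by linarith)))
      (fun x h1 h2 => by
        rw [hmax]
        exact (le_min le_rfl (by linarith)).trans (le_max_right _ _))
      (c := m / 4) (fun x hx => by
        rw [hmax] at hx
        rw [min_eq_left (by linarith), max_eq_right hm0])
    rwa [hmax] at this
  · have h8 := hnd.eight_mul_le hmd h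
    have h8' : 8 * (m : ℝ) ≤ n := by exact_mod_cast h8
    have hmax : max m n = n := max_eq_right (by omega)
    rw [hmax] at hosc ⊢
    have hn0 : (0 : ℝ) ≤ n / 4 := by positivity
    have := block_le_of_far hV hk hχ hm hn hm2 hn2 hb (by rwa [hmax])
      (lipschitzWith_clamp' (n / 4) (n / 2)) (fun x => le_max_left _ _)
      (fun x => by rw [hmax]; exact max_le hn0 (min_le_left _ _))
      (fun x h1 h2 => max_eq_left ((min_le_right _ _).trans (by linarith)))
      (fun x h1 h2 => by
        rw [hmax]
        exact (le_min le_rfl (by linarith)).trans (le_max_right _ _))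
      (c := 0) (fun x hx => by
        rw [hmax] at hx
        exact max_eq_left ((min_le_right _ _).trans (by linarith)))
    rwa [hmax] at this

end Blocks

end WhiteNoiseResolvent

namespace WhiteNoiseResolvent
open Set Filter Topology ProbabilityTheory
open scoped NNReal

/-! ### The Gaussian law of white noise and its extension to `L²` -/

/-- The exact value is `(1 - 2cv)^(-1/2)`, at most `√2` for `cv ≤ 1/4`. -/
theorem lintegral_exp_sq_gaussianReal_le {v : ℝ≥0} {c : ℝ} (hcv : c * v ≤ 1 / 4) :
    ∫⁻ x, ENNReal.ofReal (Real.exp (c * x ^ 2)) ∂gaussianReal 0 v ≤ ENNReal.ofReal √2 := by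
  rcases eq_or_ne v 0 with rfl | hv
  · rw [gaussianReal_zero_var, lintegral_dirac]
    simp
  have hv0 : (0 : ℝ) < v := lt_of_le_of_ne v.coe_nonneg (by exact_mod_cast hv.symm)
  rw [gaussianReal_of_var_ne_zero _ hv,
    lintegral_withDensity_eq_lintegral_mul _ (measurable_gaussianPDF 0 v) (by fun_prop)]
  set b : ℝ := 1 / (2 * v) - c with hb
  have hbv : 2 * v * b ≥ 1 / 2 := by
    rw [hb, mul_sub, mul_one_div_cancel (by positivity)]
    linarith
  have hb0 : 0 < b := by
    by_contra hcon
    have : 2 * (v : ℝ) * b ≤ 0 := mul_nonpos_of_nonneg_of_nonpos (by positivity) (not_lt.1 hcon)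
    linarith
  have hpt : ∀ x : ℝ, (gaussianPDF 0 v * fun x => ENNReal.ofReal (Real.exp (c * x ^ 2))) x
      = ENNReal.ofReal ((√(2 * Real.pi * v))⁻¹ * Real.exp (-b * x ^ 2)) := by
    intro x
    rw [Pi.mul_apply, gaussianPDF, ← ENNReal.ofReal_mul (gaussianPDFReal_nonneg _ _ _),
      gaussianPDFReal, mul_assoc, ← Real.exp_add]
    congr 3
    rw [hb]
    field_simp
    ring
  rw [lintegral_congr hpt, ← ofReal_integral_eq_lintegral_ofReal
    ((integrable_exp_neg_mul_sq hb0).const_mul _) (Eventually.of_forall fun x => by positivity),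
    integral_const_mul, integral_gaussian]
  refine ENNReal.ofReal_le_ofReal ?_
  rw [← Real.sqrt_inv, ← Real.sqrt_mul (by positivity)]
  refine Real.sqrt_le_sqrt ?_
  rw [inv_mul_eq_div, div_div, div_le_iff₀ (by positivity)]
  nlinarith [Real.pi_pos]

section Law

variable {Ω : Type*} [MeasurableSpace Ω] {P : Measure Ω} [IsProbabilityMeasure P]
  {q : Ω → (𝓢(ℝ, ℝ) →L[ℝ] ℝ)}

theorem IsWhiteNoise.map_eq_gaussianReal (hq : IsWhiteNoise P q) (f : 𝓢(ℝ, ℝ)) :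
    P.map (fun ω => q ω f) = gaussianReal 0 (∫ x, f x ^ 2).toNNReal := by
  have hP : IsProbabilityMeasure (P.map fun ω => q ω f) :=
    Measure.isProbabilityMeasure_map (hq.measurable f).aemeasurable
  refine Measure.ext_of_charFun (funext fun t => ?_)
  rw [charFun_apply_real, charFun_gaussianReal, integral_map (hq.measurable f).aemeasurable
    (by fun_prop)]
  have h := hq.charFun (t • f)
  have h1 : ∫ x, (t • f) x ^ 2 = t ^ 2 * ∫ x, f x ^ 2 := by
    rw [← integral_const_mul]
    exact integral_congr_ae (Eventually.of_forall fun x => by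
      simp only [_root_.smul_apply, smul_eq_mul]; ring)
  rw [h1] at h
  have hpos : 0 ≤ ∫ x, f x ^ 2 := integral_nonneg fun x => sq_nonneg _
  have h2 : (((∫ x, f x ^ 2).toNNReal : ℝ≥0) : ℂ) = ((∫ x, f x ^ 2 : ℝ) : ℂ) := by
    have := Real.coe_toNNReal _ hpos
    exact_mod_cast congrArg (fun r : ℝ => (r : ℂ)) this
  rw [h2]
  refine Eq.trans (integral_congr_ae (Eventually.of_forall fun ω => ?_)) (h.trans ?_)
  · simp only [map_smul, smul_eq_mul]
    push_cast
    congr 1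
    ring
  · push_cast
    congr 1
    ring

theorem IsWhiteNoise.memLp (hq : IsWhiteNoise P q) (f : 𝓢(ℝ, ℝ)) :
    MemLp (fun ω => q ω f) 2 P := by
  have h := memLp_id_gaussianReal (μ := 0) (v := (∫ x, f x ^ 2).toNNReal) 2
  rw [← hq.map_eq_gaussianReal f] at h
  exact h.comp_of_map (hq.measurable f).aemeasurable

theorem IsWhiteNoise.integral_sq (hq : IsWhiteNoise P q) (f : 𝓢(ℝ, ℝ)) :
    ∫ ω, q ω f ^ 2 ∂P = ∫ x, f x ^ 2 := by
  have hpos : 0 ≤ ∫ x, f x ^ 2 := integral_nonneg fun x => sq_nonneg _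
  have h := variance_fun_id_gaussianReal (μ := 0) (v := (∫ x, f x ^ 2).toNNReal)
  rw [variance_of_integral_eq_zero (by fun_prop) (by simp), ← hq.map_eq_gaussianReal f,
    integral_map (hq.measurable f).aemeasurable (by fun_prop), Real.coe_toNNReal _ hpos] at h
  exact h

theorem IsWhiteNoise.lintegral_exp_sq_le (hq : IsWhiteNoise P q) (f : 𝓢(ℝ, ℝ)) {c : ℝ}
    (hc : c * ∫ x, f x ^ 2 ≤ 1 / 4) :
    ∫⁻ ω, ENNReal.ofReal (Real.exp (c * q ω f ^ 2)) ∂P ≤ ENNReal.ofReal √2 := by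
  have hpos : 0 ≤ ∫ x, f x ^ 2 := integral_nonneg fun x => sq_nonneg _
  have h := lintegral_exp_sq_gaussianReal_le (v := (∫ x, f x ^ 2).toNNReal) (c := c)
    (by rwa [Real.coe_toNNReal _ hpos])
  rw [← hq.map_eq_gaussianReal f, lintegral_map (by fun_prop) (hq.measurable f)] at h
  exact h

theorem norm_toLp_sq_real (f : 𝓢(ℝ, ℝ)) :
    ‖f.toLp 2 (volume : Measure ℝ)‖ ^ 2 = ∫ x, f x ^ 2 := by
  rw [← real_inner_self_eq_norm_sq, L2.inner_def]
  refine integral_congr_ae ?_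
  filter_upwards [f.coeFn_toLp 2 volume] with x hx
  rw [hx]
  simp [sq]

/-- White noise as a linear map from Schwartz functions to random variables. -/
noncomputable def IsWhiteNoise.toL2 (hq : IsWhiteNoise P q) : 𝓢(ℝ, ℝ) →ₗ[ℝ] Lp ℝ 2 P where
  toFun f := (hq.memLp f).toLp _
  map_add' f g := by
    rw [← MemLp.toLp_add]
    exact MemLp.toLp_congr _ _ (Eventually.of_forall fun ω => by simp)
  map_smul' c f := by
    rw [RingHom.id_apply, ← MemLp.toLp_const_smul]
    exact MemLp.toLp_congr _ _ (Eventually.of_forall fun ω => by simp)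

theorem IsWhiteNoise.norm_toL2 (hq : IsWhiteNoise P q) (f : 𝓢(ℝ, ℝ)) :
    ‖hq.toL2 f‖ = ‖f.toLp 2 (volume : Measure ℝ)‖ := by
  rw [← sq_eq_sq₀ (norm_nonneg _) (norm_nonneg _), norm_toLp_sq_real, ← hq.integral_sq,
    ← real_inner_self_eq_norm_sq, L2.inner_def]
  refine integral_congr_ae ?_
  filter_upwards [(hq.memLp f).coeFn_toLp] with ω hω
  change inner ℝ ((hq.memLp f).toLp _ ω) ((hq.memLp f).toLp _ ω) = _
  rw [hω]
  simp [sq]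

/-- The Wiener integral: the isometric extension of white noise to `L²`. -/
noncomputable def IsWhiteNoise.wiener (hq : IsWhiteNoise P q) : Lp ℝ 2 (volume : Measure ℝ) →L[ℝ] Lp ℝ 2 P :=
  hq.toL2.extendOfNorm (SchwartzMap.toLpCLM ℝ ℝ 2 (volume : Measure ℝ)).toLinearMap

theorem IsWhiteNoise.wiener_toLp (hq : IsWhiteNoise P q) (f : 𝓢(ℝ, ℝ)) :
    hq.wiener (f.toLp 2 volume) = hq.toL2 f :=
  LinearMap.extendOfNorm_eq (SchwartzMap.denseRange_toLpCLM (by norm_num))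
    ⟨1, fun x => by rw [one_mul, hq.norm_toL2]; rfl⟩ f

theorem IsWhiteNoise.wiener_toLp_ae (hq : IsWhiteNoise P q) (f : 𝓢(ℝ, ℝ)) :
    hq.wiener (f.toLp 2 volume) =ᵐ[P] fun ω => q ω f := by
  rw [hq.wiener_toLp]
  exact (hq.memLp f).coeFn_toLp

theorem IsWhiteNoise.norm_wiener_le (hq : IsWhiteNoise P q) (g : Lp ℝ 2 (volume : Measure ℝ)) :
    ‖hq.wiener g‖ ≤ ‖g‖ := by
  have := LinearMap.norm_extendOfNorm_apply_le (f := hq.toL2)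
    (e := (SchwartzMap.toLpCLM ℝ ℝ 2 (volume : Measure ℝ)).toLinearMap)
    (SchwartzMap.denseRange_toLpCLM (by norm_num)) 1
    (fun x => by rw [one_mul, hq.norm_toL2]; rfl) g
  rwa [one_mul] at this

theorem IsWhiteNoise.exists_seq_wiener (hq : IsWhiteNoise P q) (g : Lp ℝ 2 (volume : Measure ℝ)) :
    ∃ f : ℕ → 𝓢(ℝ, ℝ), Tendsto (fun n => (f n).toLp 2 (volume : Measure ℝ)) atTop (𝓝 g) ∧
      ∀ᵐ ω ∂P, Tendsto (fun n => q ω (f n)) atTop (𝓝 (hq.wiener g ω)) := by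
  have hd := SchwartzMap.denseRange_toLpCLM (E := ℝ) (F := ℝ) (p := 2)
    (μ := (volume : Measure ℝ)) (by norm_num)
  obtain ⟨u, hu, hug⟩ := mem_closure_iff_seq_limit.1 (hd g)
  choose f hf using hu
  have hfg : Tendsto (fun n => (f n).toLp 2 (volume : Measure ℝ)) atTop (𝓝 g) :=
    hug.congr fun n => (hf n).symm
  have h1 : Tendsto (fun n => hq.wiener ((f n).toLp 2 (volume : Measure ℝ))) atTop
      (𝓝 (hq.wiener g)) := (hq.wiener.continuous.tendsto g).comp hfg
  obtain ⟨ns, hns, hae⟩ := (tendstoInMeasure_of_tendsto_Lp h1).exists_seq_tendsto_ae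
  refine ⟨f ∘ ns, hfg.comp hns.tendsto_atTop, ?_⟩
  filter_upwards [hae, ae_all_iff.2 fun n => hq.wiener_toLp_ae (f (ns n))] with ω h h'
  exact h.congr h'

/-- Fatou along Schwartz approximations; the law of the Wiener integral itself is not needed. The
threshold `1/8` instead of `1/4` leaves room for the norms of the approximations. -/
theorem IsWhiteNoise.lintegral_exp_wiener_sq_le (hq : IsWhiteNoise P q)
    (g : Lp ℝ 2 (volume : Measure ℝ)) {c : ℝ} (hc : c * ‖g‖ ^ 2 ≤ 1 / 8) :
    ∫⁻ ω, ENNReal.ofReal (Real.exp (c * hq.wiener g ω ^ 2)) ∂P ≤ ENNReal.ofReal √2 := by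
  obtain ⟨f, hf, hae⟩ := hq.exists_seq_wiener g
  have hmeas : ∀ n, Measurable fun ω => ENNReal.ofReal (Real.exp (c * q ω (f n) ^ 2)) := fun n => by
    have := hq.measurable (f n)
    fun_prop
  have h1 : ∫⁻ ω, ENNReal.ofReal (Real.exp (c * hq.wiener g ω ^ 2)) ∂P
      = ∫⁻ ω, liminf (fun n => ENNReal.ofReal (Real.exp (c * q ω (f n) ^ 2))) atTop ∂P := by
    refine lintegral_congr_ae ?_
    filter_upwards [hae] with ω hω
    refine (Tendsto.liminf_eq ?_).symm
    have hcont : Continuous fun x : ℝ => ENNReal.ofReal (Real.exp (c * x ^ 2)) :=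
      ENNReal.continuous_ofReal.comp (by fun_prop)
    exact (hcont.tendsto _).comp hω
  rw [h1]
  refine (lintegral_liminf_le hmeas).trans ?_
  refine liminf_le_of_frequently_le' (Eventually.frequently ?_)
  have h2 : Tendsto (fun n => c * ‖(f n).toLp 2 (volume : Measure ℝ)‖ ^ 2) atTop
      (𝓝 (c * ‖g‖ ^ 2)) := (hf.norm.pow 2).const_mul c
  filter_upwards [h2.eventually (eventually_le_nhds (lt_of_le_of_lt hc (by norm_num :
    (1 / 8 : ℝ) < 1 / 4)))] with n hn
  exact hq.lintegral_exp_sq_le (f n) (by rwa [← norm_toLp_sq_real])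

end Law

end WhiteNoiseResolvent

namespace WhiteNoiseResolvent
open Set Filter Topology

/-! ### Chaining along dyadic points -/

/-- The left endpoint of the dyadic interval of length `2⁻ⁿ` containing `x`. -/
noncomputable def dyadicFloor (n : ℕ) (x : ℝ) : ℝ := (⌊2 ^ n * x⌋ : ℝ) / 2 ^ n

theorem dyadicFloor_le (n : ℕ) (x : ℝ) : dyadicFloor n x ≤ x := by
  rw [dyadicFloor, div_le_iff₀ (by positivity), mul_comm]
  exact Int.floor_le _

theorem lt_dyadicFloor_add (n : ℕ) (x : ℝ) : x < dyadicFloor n x + (2 ^ n)⁻¹ := by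
  have h := Int.lt_floor_add_one ((2 : ℝ) ^ n * x)
  rw [dyadicFloor, ← one_div, ← add_div, lt_div_iff₀ (by positivity), mul_comm]
  exact h

theorem tendsto_dyadicFloor (x : ℝ) : Tendsto (fun n => dyadicFloor n x) atTop (𝓝 x) := by
  have h0 : Tendsto (fun n : ℕ => x - ((2 : ℝ) ^ n)⁻¹) atTop (𝓝 (x - 0)) := by
    refine Tendsto.const_sub _ ?_
    simpa only [inv_pow] using tendsto_pow_atTop_nhds_zero_of_lt_one (r := (2 : ℝ)⁻¹)
      (by norm_num) (by norm_num)
  rw [sub_zero] at h0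
  exact tendsto_of_tendsto_of_tendsto_of_le_of_le h0 tendsto_const_nhds
    (fun n => by dsimp only; linarith [lt_dyadicFloor_add n x]) (fun n => dyadicFloor_le n x)

theorem dyadicFloor_eq_self_of_int (n : ℕ) (j : ℤ) : dyadicFloor n j = j := by
  have : (2 : ℝ) ^ n * j = ((2 ^ n * j : ℤ) : ℝ) := by push_cast; ring
  rw [dyadicFloor, this, Int.floor_intCast]
  push_cast
  field_simp

/-- The dyadic increments of `X` at scale `2⁻ⁿ` in `[j, j + 1]` are at most `a j (3/4)ⁿ`. -/
def HasDyadicIncrements (X : ℝ → ℝ) (a : ℤ → ℝ) : Prop :=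
  ∀ (n : ℕ) (i : ℤ), |X ((i + 1 : ℤ) / 2 ^ n) - X (i / 2 ^ n)| ≤ a (i / 2 ^ n) * (3 / 4) ^ n

variable {X : ℝ → ℝ} {a : ℤ → ℝ}

/-- The quotient `i / 2 ^ n` in the argument of `a` in `HasDyadicIncrements` is integer division;
this identifies it with the unit interval containing the point. -/
theorem floor_two_pow_mul_ediv (n : ℕ) (x : ℝ) : ⌊(2 : ℝ) ^ n * x⌋ / (2 : ℤ) ^ n = ⌊x⌋ := by
  have h : ((2 ^ n : ℕ) : ℤ) = (2 : ℤ) ^ n := by push_cast; rfl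
  rw [← h, ← Int.floor_div_natCast]
  congr 1
  push_cast
  field_simp

theorem HasDyadicIncrements.nonneg (h : HasDyadicIncrements X a) (j : ℤ) : 0 ≤ a j := by
  simpa using (abs_nonneg _).trans (h 0 j)

theorem HasDyadicIncrements.abs_succ_sub_le (h : HasDyadicIncrements X a) (n : ℕ) (x : ℝ) :
    |X (dyadicFloor (n + 1) x) - X (dyadicFloor n x)| ≤ a ⌊x⌋ * (3 / 4) ^ (n + 1) := by
  set i : ℤ := ⌊(2 : ℝ) ^ n * x⌋ with hi
  have h1 : (i : ℝ) ≤ 2 ^ n * x := Int.floor_le _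
  have h2 : (2 : ℝ) ^ n * x < i + 1 := Int.lt_floor_add_one _
  have hj : (⌊(2 : ℝ) ^ (n + 1) * x⌋) / (2 : ℤ) ^ (n + 1) = ⌊x⌋ := floor_two_pow_mul_ediv _ _
  have hd : dyadicFloor n x = ((2 * i : ℤ) : ℝ) / 2 ^ (n + 1) := by
    rw [dyadicFloor, ← hi, pow_succ]
    push_cast
    field_simp
  rw [hd]
  -- Halving the interval leaves the left endpoint in place or moves it to the midpoint.
  have hcases : ⌊(2 : ℝ) ^ (n + 1) * x⌋ = 2 * i ∨ ⌊(2 : ℝ) ^ (n + 1) * x⌋ = 2 * i + 1 := by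
    have h3 : 2 * i ≤ ⌊(2 : ℝ) ^ (n + 1) * x⌋ := Int.le_floor.2 (by push_cast; rw [pow_succ]; linarith)
    have h4 : ⌊(2 : ℝ) ^ (n + 1) * x⌋ < 2 * i + 2 :=
      Int.floor_lt.2 (by push_cast; rw [pow_succ]; linarith)
    omega
  rcases hcases with hc | hc
  · rw [dyadicFloor, hc, sub_self, abs_zero]
    exact mul_nonneg (h.nonneg _) (by positivity)
  · have hdiv : (2 * i) / (2 : ℤ) ^ (n + 1) = ⌊x⌋ := by
      rw [← hj, hc, pow_succ', ← Int.ediv_ediv_of_nonneg (by norm_num),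
        ← Int.ediv_ediv_of_nonneg (by norm_num)]
      congr 1
      omega
    have := h (n + 1) (2 * i)
    rwa [hdiv, ← hc] at this

theorem HasDyadicIncrements.exists_limit (h : HasDyadicIncrements X a) (x : ℝ) :
    ∃ w, Tendsto (fun n => X (dyadicFloor n x)) atTop (𝓝 w) ∧
      ∀ n, |X (dyadicFloor n x) - w| ≤ a ⌊x⌋ * (3 * (3 / 4) ^ n) := by
  have hd : ∀ n, dist (X (dyadicFloor n x)) (X (dyadicFloor (n + 1) x))
      ≤ (a ⌊x⌋ * (3 / 4)) * (3 / 4) ^ n := fun n => by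
    rw [dist_comm, Real.dist_eq]
    exact (h.abs_succ_sub_le n x).trans_eq (by ring)
  have hc := cauchySeq_of_le_geometric (3 / 4) _ (by norm_num) hd
  obtain ⟨w, hw⟩ := cauchySeq_tendsto_of_complete hc
  refine ⟨w, hw, fun n => ?_⟩
  have := dist_le_of_le_geometric_of_tendsto (3 / 4) _ (by norm_num) hd hw n
  rw [Real.dist_eq] at this
  exact this.trans_eq (by ring)

/-- The limit of the values of `X` along the dyadic approximations of a point. -/
noncomputable def dyadicLimit (X : ℝ → ℝ) (x : ℝ) : ℝ := limUnder atTop fun n => X (dyadicFloor n x)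

theorem HasDyadicIncrements.tendsto (h : HasDyadicIncrements X a) (x : ℝ) :
    Tendsto (fun n => X (dyadicFloor n x)) atTop (𝓝 (dyadicLimit X x)) := by
  obtain ⟨w, hw, -⟩ := h.exists_limit x
  rwa [dyadicLimit, hw.limUnder_eq]

theorem HasDyadicIncrements.abs_sub_dyadicLimit_le (h : HasDyadicIncrements X a) (n : ℕ) (x : ℝ) :
    |X (dyadicFloor n x) - dyadicLimit X x| ≤ a ⌊x⌋ * (3 * (3 / 4) ^ n) := by
  obtain ⟨w, hw, hb⟩ := h.exists_limit x
  rw [dyadicLimit, hw.limUnder_eq]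
  exact hb n

theorem dyadicLimit_int (X : ℝ → ℝ) (j : ℤ) : dyadicLimit X j = X j := by
  rw [dyadicLimit]
  simp only [dyadicFloor_eq_self_of_int]
  exact tendsto_const_nhds.limUnder_eq

theorem HasDyadicIncrements.abs_dyadicLimit_sub_int_le (h : HasDyadicIncrements X a) {j : ℤ} {x : ℝ}
    (hx : x ∈ Icc (j : ℝ) (j + 1)) : |X j - dyadicLimit X x| ≤ 3 * a j := by
  -- The right endpoint has integer part `j + 1` and is therefore treated by the increment at level
  -- `0`.
  rcases eq_or_lt_of_le hx.2 with hx1 | hx1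
  · have h0 := h 0 j
    have h1 := h.nonneg j
    have h2 : x = ((j + 1 : ℤ) : ℝ) := by rw [hx1]; push_cast; rfl
    simp only [pow_zero, div_one, Int.ediv_one, mul_one] at h0
    rw [h2, dyadicLimit_int, abs_sub_comm]
    linarith
  · have hfl : ⌊x⌋ = j := Int.floor_eq_iff.2 ⟨hx.1, hx1⟩
    have := h.abs_sub_dyadicLimit_le 0 x
    rw [hfl, dyadicFloor, pow_zero, one_mul, hfl, div_one] at this
    linarith

theorem HasDyadicIncrements.abs_dyadicLimit_sub_le (h : HasDyadicIncrements X a) {j : ℤ} {x y : ℝ}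
    (hx : x ∈ Icc (j : ℝ) (j + 1)) (hy : y ∈ Icc (j : ℝ) (j + 1)) :
    |dyadicLimit X x - dyadicLimit X y| ≤ 6 * a j := by
  have h1 := h.abs_dyadicLimit_sub_int_le hx
  have h2 := h.abs_dyadicLimit_sub_int_le hy
  rw [abs_le] at *
  constructor <;> linarith [h1.1, h1.2, h2.1, h2.2]

/-- If `|x - y| < 2⁻ⁿ`, the level `n` approximations of `x` and `y` coincide or are adjacent, so the
limits differ by at most `3 + 1 + 3 = 7` times `A (3/4)ⁿ`. -/
theorem HasDyadicIncrements.continuous (h : HasDyadicIncrements X a) :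
    Continuous (dyadicLimit X) := by
  refine continuous_iff_continuousAt.2 fun x => Metric.continuousAt_iff.2 fun ε hε => ?_
  -- Points at distance less than `1` from `x` lie in the unit interval of `x` or one of its two
  -- neighbours.
  set A : ℝ := a (⌊x⌋ - 1) + a ⌊x⌋ + a (⌊x⌋ + 1) with hA
  have ha : ∀ j, 0 ≤ a j := h.nonneg
  have hA0 : 0 ≤ A := add_nonneg (add_nonneg (ha _) (ha _)) (ha _)
  have hle : ∀ y, |y - x| < 1 → a ⌊y⌋ ≤ A := fun y hy => by
    rw [abs_lt] at hy
    have h1 := Int.floor_le x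
    have h2 := Int.lt_floor_add_one x
    have h3 : ⌊x⌋ - 1 ≤ ⌊y⌋ := Int.le_floor.2 (by push_cast; linarith)
    have h4 : ⌊y⌋ < ⌊x⌋ + 2 := Int.floor_lt.2 (by push_cast; linarith)
    have h5 : ⌊y⌋ = ⌊x⌋ - 1 ∨ ⌊y⌋ = ⌊x⌋ ∨ ⌊y⌋ = ⌊x⌋ + 1 := by omega
    rcases h5 with h5 | h5 | h5 <;> rw [h5, hA] <;>
      linarith [ha (⌊x⌋ - 1), ha ⌊x⌋, ha (⌊x⌋ + 1)]
  obtain ⟨n, hn⟩ : ∃ n : ℕ, A * (7 * (3 / 4) ^ n) < ε := by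
    have : Tendsto (fun n : ℕ => A * (7 * (3 / 4 : ℝ) ^ n)) atTop (𝓝 (A * (7 * 0))) :=
      ((tendsto_pow_atTop_nhds_zero_of_lt_one (by norm_num) (by norm_num)).const_mul _).const_mul _
    rw [mul_zero, mul_zero] at this
    exact (this.eventually (gt_mem_nhds hε)).exists
  have hp : (0 : ℝ) < 2 ^ n := by positivity
  refine ⟨(2 ^ n)⁻¹, by positivity, fun {y} hy => ?_⟩
  rw [Real.dist_eq] at hy ⊢
  have hy1 : |y - x| < 1 := hy.trans_le (inv_le_one_of_one_le₀ (one_le_pow₀ (by norm_num)))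
  have hx0 : |x - x| < 1 := by simp
  -- neighbouring dyadic points at level `n`
  have hadj : ∀ u v : ℝ, u ≤ v → v - u < (2 ^ n)⁻¹ → |u - x| < 1 →
      |X (dyadicFloor n v) - X (dyadicFloor n u)| ≤ A * (3 / 4) ^ n := by
    intro u v huv hvu hu
    have h1 := Int.floor_le ((2 : ℝ) ^ n * u)
    have h2 := Int.lt_floor_add_one ((2 : ℝ) ^ n * u)
    have h3 : (2 : ℝ) ^ n * (v - u) < 1 := by
      calc (2 : ℝ) ^ n * (v - u) < 2 ^ n * (2 ^ n)⁻¹ := (mul_lt_mul_iff_right₀ hp).2 hvu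
        _ = 1 := mul_inv_cancel₀ hp.ne'
    have h4 : ⌊(2 : ℝ) ^ n * u⌋ ≤ ⌊(2 : ℝ) ^ n * v⌋ :=
      Int.floor_le_floor (mul_le_mul_of_nonneg_left huv hp.le)
    have h5 : ⌊(2 : ℝ) ^ n * v⌋ < ⌊(2 : ℝ) ^ n * u⌋ + 2 :=
      Int.floor_lt.2 (by push_cast; linarith)
    have h6 : ⌊(2 : ℝ) ^ n * v⌋ = ⌊(2 : ℝ) ^ n * u⌋ ∨
        ⌊(2 : ℝ) ^ n * v⌋ = ⌊(2 : ℝ) ^ n * u⌋ + 1 := by omega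
    rcases h6 with h6 | h6
    · rw [dyadicFloor, dyadicFloor, h6, sub_self, abs_zero]
      positivity
    · rw [dyadicFloor, dyadicFloor, h6]
      refine (h n _).trans ?_
      rw [floor_two_pow_mul_ediv]
      exact mul_le_mul_of_nonneg_right (hle u hu) (by positivity)
  have hmid : |X (dyadicFloor n y) - X (dyadicFloor n x)| ≤ A * (3 / 4) ^ n := by
    rcases le_total x y with hxy | hxy
    · exact hadj x y hxy (lt_of_abs_lt hy) hx0
    · rw [abs_sub_comm]
      exact hadj y x hxy (lt_of_abs_lt (by rwa [abs_sub_comm])) hy1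
  have h1 : |X (dyadicFloor n y) - dyadicLimit X y| ≤ A * (3 * (3 / 4) ^ n) :=
    (h.abs_sub_dyadicLimit_le n y).trans (mul_le_mul_of_nonneg_right (hle y hy1) (by positivity))
  have h2 : |X (dyadicFloor n x) - dyadicLimit X x| ≤ A * (3 * (3 / 4) ^ n) :=
    (h.abs_sub_dyadicLimit_le n x).trans (mul_le_mul_of_nonneg_right (hle x hx0) (by positivity))
  refine lt_of_le_of_lt ?_ hn
  rw [abs_le] at *
  constructor <;> linarith [h1.1, h1.2, h2.1, h2.2, hmid.1, hmid.2]

/-- The exponential functional controlling the dyadic increments of `X` in `[j, j + 1]`. -/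
noncomputable def chainingSum (X : ℝ → ℝ) (j : ℤ) : ℝ≥0∞ :=
  ∑' n : ℕ, ∑ i ∈ Finset.range (2 ^ n), ENNReal.ofReal (((4 : ℝ) ^ n)⁻¹ * Real.exp (2 ^ n / 8 *
    (X ((j * 2 ^ n + (i : ℤ) + 1 : ℤ) / 2 ^ n) - X ((j * 2 ^ n + (i : ℤ) : ℤ) / 2 ^ n)) ^ 2))

theorem ofReal_exp_le_chainingSum (X : ℝ → ℝ) (n : ℕ) (i : ℤ) :
    ENNReal.ofReal (((4 : ℝ) ^ n)⁻¹ * Real.exp (2 ^ n / 8 *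
      (X ((i + 1 : ℤ) / 2 ^ n) - X (i / 2 ^ n)) ^ 2)) ≤ chainingSum X (i / 2 ^ n) := by
  have hp : (0 : ℤ) < 2 ^ n := by positivity
  have h0 : 0 ≤ i % 2 ^ n := Int.emod_nonneg _ hp.ne'
  have h1 : i % 2 ^ n < 2 ^ n := Int.emod_lt_of_pos _ hp
  obtain ⟨r, hr⟩ := Int.eq_ofNat_of_zero_le h0
  have hrn : r < 2 ^ n := by
    rw [hr] at h1
    exact_mod_cast h1
  have hi : i / 2 ^ n * 2 ^ n + (r : ℤ) = i := by
    rw [← hr, mul_comm]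
    exact Int.mul_ediv_add_emod i (2 ^ n)
  refine le_trans ?_ (ENNReal.le_tsum n)
  refine le_trans (le_of_eq ?_) (Finset.single_le_sum (f := fun r : ℕ =>
    ENNReal.ofReal (((4 : ℝ) ^ n)⁻¹ * Real.exp (2 ^ n / 8 *
    (X ((i / 2 ^ n * 2 ^ n + (r : ℤ) + 1 : ℤ) / 2 ^ n) -
      X ((i / 2 ^ n * 2 ^ n + (r : ℤ) : ℤ) / 2 ^ n)) ^ 2))) (fun _ _ => zero_le)
      (Finset.mem_range.2 hrn))
  rw [hi]

theorem one_le_chainingSum (X : ℝ → ℝ) (j : ℤ) : 1 ≤ chainingSum X j := by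
  have h := ofReal_exp_le_chainingSum X 0 j
  rw [pow_zero (2 : ℤ), Int.ediv_one] at h
  refine le_trans ?_ h
  rw [ENNReal.one_le_ofReal, pow_zero, inv_one, one_mul]
  exact Real.one_le_exp (by positivity)

/-- The bound for the oscillation of `X` in terms of the functional `chainingSum`. -/
noncomputable def logBound (g : ℝ) : ℝ := 12 * √(1 + Real.log g)

/-- Taking logarithms gives `2ⁿ d² / 8 ≤ n log 4 + log g`. The linear factor in `n` is absorbed by
`(9/8)ⁿ = 2ⁿ (3/4)²ⁿ`; this is why the increments decay like `(3/4)ⁿ` and not like `2^(-n/2)`. -/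
theorem abs_increment_le {n : ℕ} {d g : ℝ} (hg : 1 ≤ g)
    (h : ((4 : ℝ) ^ n)⁻¹ * Real.exp (2 ^ n / 8 * d ^ 2) ≤ g) :
    |d| ≤ logBound g * (3 / 4) ^ n := by
  have hl : 0 ≤ Real.log g := Real.log_nonneg hg
  have h1 : 2 ^ n / 8 * d ^ 2 ≤ n * Real.log 4 + Real.log g := by
    rw [inv_mul_le_iff₀ (by positivity)] at h
    have := Real.log_le_log (Real.exp_pos _) h
    rwa [Real.log_exp, Real.log_mul (by positivity) (by positivity), Real.log_pow] at this
  have hlog4 : Real.log 4 ≤ 2 := by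
    have : (4 : ℝ) = 2 ^ 2 := by norm_num
    rw [this, Real.log_pow]
    push_cast
    linarith [Real.log_two_lt_d9]
  have h2 : (2 : ℝ) ^ n / 8 * d ^ 2 ≤ (2 * n + 1) * (1 + Real.log g) := by
    have hn : (0 : ℝ) ≤ n := n.cast_nonneg
    nlinarith [mul_nonneg hn hl, mul_le_mul_of_nonneg_left hlog4 hn]
  have hb : (2 * n + 1 : ℝ) ≤ 16 * (9 / 8) ^ n := by
    have := one_add_mul_le_pow (a := (1 / 8 : ℝ)) (by norm_num) n
    norm_num at this ⊢
    linarith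
  refine abs_le_of_sq_le_sq ?_ (by unfold logBound; positivity)
  rw [mul_pow, logBound, mul_pow, Real.sq_sqrt (by positivity), ← pow_mul, mul_comm n 2, pow_mul]
  have hp : (0 : ℝ) < 2 ^ n := by positivity
  have h3 : (2 : ℝ) ^ n * ((3 / 4) ^ 2) ^ n = (9 / 8) ^ n := by
    rw [← mul_pow]; norm_num
  refine le_of_mul_le_mul_left ?_ hp
  calc (2 : ℝ) ^ n * d ^ 2 = 8 * (2 ^ n / 8 * d ^ 2) := by ring
    _ ≤ 8 * ((2 * n + 1) * (1 + Real.log g)) := by linarith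
    _ ≤ 8 * ((16 * (9 / 8) ^ n) * (1 + Real.log g)) := by gcongr
    _ ≤ 144 * (9 / 8) ^ n * (1 + Real.log g) := by
        have : 0 ≤ (9 / 8 : ℝ) ^ n * (1 + Real.log g) := by positivity
        linarith
    _ = 2 ^ n * (12 ^ 2 * (1 + Real.log g) * ((3 / 4) ^ 2) ^ n) := by
        rw [← h3]; ring

theorem hasDyadicIncrements_of_chainingSum_ne_top (h : ∀ j, chainingSum X j ≠ ⊤) :
    HasDyadicIncrements X fun j => logBound (chainingSum X j).toReal := by
  intro n i
  refine abs_increment_le ?_ ?_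
  · simpa using ENNReal.toReal_mono (h _) (one_le_chainingSum X (i / 2 ^ n))
  · exact (ENNReal.ofReal_le_iff_le_toReal (h _)).1 (ofReal_exp_le_chainingSum X n i)

end WhiteNoiseResolvent

namespace WhiteNoiseResolvent
open Set Filter Topology

/-! ### The Brownian path of white noise -/

/-- The signed indicator function of the interval between `0` and `x`. -/
noncomputable def intervalKernel (x : ℝ) : Lp ℝ 2 (volume : Measure ℝ) :=
  indicatorConstLp 2 (measurableSet_Ioc (a := 0) (b := x)) measure_Ioc_lt_top.ne 1
    - indicatorConstLp 2 (measurableSet_Ioc (a := x) (b := 0)) measure_Ioc_lt_top.ne 1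

theorem intervalKernel_zero : intervalKernel 0 = 0 := sub_self _

theorem intervalKernel_sub {x y : ℝ} (hxy : x ≤ y) : intervalKernel y - intervalKernel x
    = indicatorConstLp 2 (measurableSet_Ioc (a := x) (b := y)) measure_Ioc_lt_top.ne 1 := by
  refine Lp.ext ?_
  have hi : ∀ a b : ℝ, indicatorConstLp 2 (measurableSet_Ioc (a := a) (b := b))
      (measure_Ioc_lt_top (μ := volume)).ne (1 : ℝ) =ᵐ[volume] (Ioc a b).indicator fun _ => 1 :=
    fun a b => indicatorConstLp_coeFn
  filter_upwards [Lp.coeFn_sub (intervalKernel y) (intervalKernel x), hi x y, hi 0 y, hi y 0, hi 0 x,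
    hi x 0, Lp.coeFn_sub (indicatorConstLp 2 (measurableSet_Ioc (a := 0) (b := y))
      (measure_Ioc_lt_top (μ := volume)).ne (1 : ℝ)) (indicatorConstLp 2 (measurableSet_Ioc (a := y)
      (b := 0)) (measure_Ioc_lt_top (μ := volume)).ne (1 : ℝ)),
    Lp.coeFn_sub (indicatorConstLp 2 (measurableSet_Ioc (a := 0) (b := x))
      (measure_Ioc_lt_top (μ := volume)).ne (1 : ℝ)) (indicatorConstLp 2 (measurableSet_Ioc (a := x)
      (b := 0)) (measure_Ioc_lt_top (μ := volume)).ne (1 : ℝ))] with t h1 h2 h3 h4 h5 h6 h7 h8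
  rw [h1, Pi.sub_apply]
  change (intervalKernel y t = _) at h7
  change (intervalKernel x t = _) at h8
  rw [h7, h8, h2, Pi.sub_apply, Pi.sub_apply, h3, h4, h5, h6]
  simp only [indicator, mem_Ioc]
  clear hi h1 h2 h3 h4 h5 h6 h7 h8
  split_ifs <;> first | (norm_num; done) | (exfalso; grind)

theorem norm_intervalKernel_sub_sq {x y : ℝ} (hxy : x ≤ y) :
    ‖intervalKernel y - intervalKernel x‖ ^ 2 = y - x := by
  rw [intervalKernel_sub hxy, norm_indicatorConstLp (by norm_num) (by norm_num)]
  rw [norm_one, one_mul, Measure.real, Real.volume_Ioc, ENNReal.toReal_ofReal (by linarith),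
    ENNReal.toReal_ofNat, ← Real.sqrt_eq_rpow, Real.sq_sqrt (by linarith)]

section

variable {Ω : Type*} [MeasurableSpace Ω] {P : Measure Ω} [IsProbabilityMeasure P]
  {q : Ω → (𝓢(ℝ, ℝ) →L[ℝ] ℝ)}

/-- The values of the Brownian path, without continuity in the space variable. -/
noncomputable def IsWhiteNoise.path (hq : IsWhiteNoise P q) (ω : Ω) (x : ℝ) : ℝ :=
  hq.wiener (intervalKernel x) ω

theorem IsWhiteNoise.measurable_path (hq : IsWhiteNoise P q) (x : ℝ) :
    Measurable fun ω => hq.path ω x :=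
  (Lp.stronglyMeasurable _).measurable

theorem IsWhiteNoise.path_zero_ae (hq : IsWhiteNoise P q) : ∀ᵐ ω ∂P, hq.path ω 0 = 0 := by
  have : hq.wiener (intervalKernel 0) = 0 := by rw [intervalKernel_zero, map_zero]
  filter_upwards [Lp.coeFn_zero ℝ 2 P] with ω hω
  rw [IsWhiteNoise.path, this, hω, Pi.zero_apply]

theorem IsWhiteNoise.lintegral_exp_increment_le (hq : IsWhiteNoise P q) {x y c : ℝ} (hxy : x ≤ y)
    (hc : c * (y - x) ≤ 1 / 8) :
    ∫⁻ ω, ENNReal.ofReal (Real.exp (c * (hq.path ω y - hq.path ω x) ^ 2)) ∂P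
      ≤ ENNReal.ofReal √2 := by
  refine le_trans (le_of_eq ?_) (hq.lintegral_exp_wiener_sq_le
    (intervalKernel y - intervalKernel x) (c := c) (by rwa [norm_intervalKernel_sub_sq hxy]))
  rw [map_sub]
  refine lintegral_congr_ae ?_
  filter_upwards [Lp.coeFn_sub (hq.wiener (intervalKernel y)) (hq.wiener (intervalKernel x))]
    with ω hω
  rw [hω]
  rfl

theorem IsWhiteNoise.measurable_chainingSum (hq : IsWhiteNoise P q) (j : ℤ) :
    Measurable fun ω => chainingSum (hq.path ω) j := by
  have := hq.measurable_path
  unfold chainingSum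
  exact Measurable.tsum fun n => Finset.measurable_sum _ fun i _ => by fun_prop

/-- At level `n` there are `2ⁿ` increments of length `2⁻ⁿ`, for which `c = 2ⁿ / 8` is exactly the
admissible exponent. With the weight `4⁻ⁿ` the level contributes at most `√2 · 2⁻ⁿ`, and `2√2 ≤ 3`.
-/
theorem IsWhiteNoise.lintegral_chainingSum_le (hq : IsWhiteNoise P q) (j : ℤ) :
    ∫⁻ ω, chainingSum (hq.path ω) j ∂P ≤ 3 := by
  have hm := hq.measurable_path
  unfold chainingSum
  rw [lintegral_tsum fun n => (Finset.measurable_sum _ fun i _ => by fun_prop).aemeasurable]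
  have hterm : ∀ n : ℕ, ∫⁻ ω, ∑ i ∈ Finset.range (2 ^ n), ENNReal.ofReal (((4 : ℝ) ^ n)⁻¹ *
      Real.exp (2 ^ n / 8 * (hq.path ω ((j * 2 ^ n + (i : ℤ) + 1 : ℤ) / 2 ^ n)
        - hq.path ω ((j * 2 ^ n + (i : ℤ) : ℤ) / 2 ^ n)) ^ 2)) ∂P
      ≤ ENNReal.ofReal (√2 * (1 / 2) ^ n) := by
    intro n
    rw [lintegral_finsetSum _ fun i _ => by fun_prop]
    have hi : ∀ i ∈ Finset.range (2 ^ n), ∫⁻ ω, ENNReal.ofReal (((4 : ℝ) ^ n)⁻¹ *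
      Real.exp (2 ^ n / 8 * (hq.path ω ((j * 2 ^ n + (i : ℤ) + 1 : ℤ) / 2 ^ n)
        - hq.path ω ((j * 2 ^ n + (i : ℤ) : ℤ) / 2 ^ n)) ^ 2)) ∂P
        ≤ ENNReal.ofReal (((4 : ℝ) ^ n)⁻¹ * √2) := by
      intro i _
      simp only [ENNReal.ofReal_mul (inv_nonneg.2 (by positivity : (0 : ℝ) ≤ 4 ^ n))]
      rw [lintegral_const_mul _ (by fun_prop)]
      refine mul_le_mul_right (hq.lintegral_exp_increment_le ?_ ?_) _
      · exact div_le_div_of_nonneg_right (by push_cast; linarith) (by positivity)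
      · rw [← sub_div]
        push_cast
        field_simp
        norm_num
    refine (Finset.sum_le_sum hi).trans (le_of_eq ?_)
    rw [Finset.sum_const, Finset.card_range, nsmul_eq_mul]
    have : (((2 ^ n : ℕ) : ℝ≥0∞)) = ENNReal.ofReal (2 ^ n) := by
      rw [← ENNReal.ofReal_natCast]; push_cast; rfl
    rw [this, ← ENNReal.ofReal_mul (by positivity)]
    congr 1
    have h4 : (4 : ℝ) ^ n = 2 ^ n * 2 ^ n := by rw [← mul_pow]; norm_num
    rw [h4, one_div, inv_pow]
    field_simp
  refine (ENNReal.tsum_le_tsum hterm).trans ?_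
  rw [← ENNReal.ofReal_tsum_of_nonneg (fun n => by positivity)
    (summable_geometric_two.mul_left _), tsum_mul_left, tsum_geometric_two]
  rw [← ENNReal.ofReal_ofNat]
  refine ENNReal.ofReal_le_ofReal ?_
  have : √2 ≤ 3 / 2 := Real.sqrt_le_iff.2 ⟨by norm_num, by norm_num⟩
  linarith

theorem IsWhiteNoise.chainingSum_ne_top_ae (hq : IsWhiteNoise P q) :
    ∀ᵐ ω ∂P, ∀ j, chainingSum (hq.path ω) j ≠ ⊤ := by
  refine ae_all_iff.2 fun j => ?_
  filter_upwards [ae_lt_top (hq.measurable_chainingSum j)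
    (ne_top_of_le_ne_top (by norm_num) (hq.lintegral_chainingSum_le j))] with ω hω
  exact hω.ne

/-- The samples for which chaining yields a continuous path. -/
def IsWhiteNoise.regularSet (hq : IsWhiteNoise P q) : Set Ω :=
  {ω | (∀ j, chainingSum (hq.path ω) j ≠ ⊤) ∧ hq.path ω 0 = 0}

theorem IsWhiteNoise.regularSet_ae (hq : IsWhiteNoise P q) : ∀ᵐ ω ∂P, ω ∈ hq.regularSet :=
  hq.chainingSum_ne_top_ae.and hq.path_zero_ae

theorem IsWhiteNoise.measurableSet_regularSet (hq : IsWhiteNoise P q) :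
    MeasurableSet hq.regularSet := by
  have h0 : {ω | ∀ j, chainingSum (hq.path ω) j ≠ ⊤}
      = ⋂ j, {ω | chainingSum (hq.path ω) j = ⊤}ᶜ := by ext; simp
  have h1 : MeasurableSet {ω | ∀ j, chainingSum (hq.path ω) j ≠ ⊤} := by
    rw [h0]
    exact MeasurableSet.iInter fun j =>
      (measurableSet_eq_fun (hq.measurable_chainingSum j) measurable_const).compl
  exact h1.inter (measurableSet_eq_fun (hq.measurable_path 0) measurable_const)

open scoped Classical in
/-- The continuous Brownian path whose derivative is the white noise. -/
noncomputable def IsWhiteNoise.brownian (hq : IsWhiteNoise P q) (ω : Ω) : ℝ → ℝ :=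
  if ω ∈ hq.regularSet then dyadicLimit (hq.path ω) else 0

theorem IsWhiteNoise.brownian_of_mem (hq : IsWhiteNoise P q) {ω : Ω} (hω : ω ∈ hq.regularSet) :
    hq.brownian ω = dyadicLimit (hq.path ω) :=
  if_pos hω

theorem IsWhiteNoise.brownian_of_notMem (hq : IsWhiteNoise P q) {ω : Ω} (hω : ω ∉ hq.regularSet) :
    hq.brownian ω = 0 :=
  if_neg hω

theorem IsWhiteNoise.continuous_brownian (hq : IsWhiteNoise P q) (ω : Ω) :
    Continuous (hq.brownian ω) := by
  by_cases hω : ω ∈ hq.regularSet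
  · rw [hq.brownian_of_mem hω]
    exact (hasDyadicIncrements_of_chainingSum_ne_top hω.1).continuous
  · rw [hq.brownian_of_notMem hω]
    exact continuous_zero

theorem IsWhiteNoise.brownian_zero (hq : IsWhiteNoise P q) (ω : Ω) : hq.brownian ω 0 = 0 := by
  by_cases hω : ω ∈ hq.regularSet
  · rw [hq.brownian_of_mem hω]
    simpa only [Int.cast_zero, hω.2] using dyadicLimit_int (hq.path ω) 0
  · rw [hq.brownian_of_notMem hω, Pi.zero_apply]

theorem IsWhiteNoise.abs_brownian_sub_le (hq : IsWhiteNoise P q) (ω : Ω) {j : ℤ} {x y : ℝ}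
    (hx : x ∈ Icc (j : ℝ) (j + 1)) (hy : y ∈ Icc (j : ℝ) (j + 1)) :
    |hq.brownian ω x - hq.brownian ω y| ≤ 6 * logBound (chainingSum (hq.path ω) j).toReal := by
  by_cases hω : ω ∈ hq.regularSet
  · rw [hq.brownian_of_mem hω]
    exact (hasDyadicIncrements_of_chainingSum_ne_top hω.1).abs_dyadicLimit_sub_le hx hy
  · rw [hq.brownian_of_notMem hω]
    simp only [Pi.zero_apply, sub_self, abs_zero, logBound]
    positivity

theorem IsWhiteNoise.measurable_brownian (hq : IsWhiteNoise P q) (x : ℝ) :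
    Measurable fun ω => hq.brownian ω x := by
  classical
  have h1 : ∀ n, Measurable (hq.regularSet.indicator fun ω => hq.path ω (dyadicFloor n x)) :=
    fun n => (hq.measurable_path _).indicator hq.measurableSet_regularSet
  refine measurable_of_tendsto_metrizable h1 (tendsto_pi_nhds.2 fun ω => ?_)
  by_cases hω : ω ∈ hq.regularSet
  · simp only [indicator_of_mem hω, hq.brownian_of_mem hω]
    exact (hasDyadicIncrements_of_chainingSum_ne_top hω.1).tendsto x
  · simp only [indicator_of_notMem hω, hq.brownian_of_notMem hω]
    exact tendsto_const_nhds

/-- The Wiener integral of `intervalKernel` is continuous in `L²`, so along a subsequence its values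
at the dyadic approximations of `x` converge almost surely to the value at `x`, while they also
converge to the continuous path. -/
theorem IsWhiteNoise.brownian_ae_eq_path (hq : IsWhiteNoise P q) (x : ℝ) :
    (fun ω => hq.brownian ω x) =ᵐ[P] hq.wiener (intervalKernel x) := by
  have h0 : Tendsto (fun n => intervalKernel (dyadicFloor n x)) atTop (𝓝 (intervalKernel x)) := by
    rw [tendsto_iff_norm_sub_tendsto_zero]
    have h1 : ∀ n, ‖intervalKernel (dyadicFloor n x) - intervalKernel x‖
        = √(x - dyadicFloor n x) := fun n => by
      rw [← norm_intervalKernel_sub_sq (dyadicFloor_le n x), Real.sqrt_sq (norm_nonneg _),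
        norm_sub_rev]
    simp only [h1]
    have h2 : Tendsto (fun n => √(x - dyadicFloor n x)) atTop (𝓝 √(x - x)) :=
      ((tendsto_dyadicFloor x).const_sub x).sqrt
    rwa [sub_self, Real.sqrt_zero] at h2
  have h1 := (hq.wiener.continuous.tendsto _).comp h0
  obtain ⟨ns, hns, hae⟩ := (tendstoInMeasure_of_tendsto_Lp h1).exists_seq_tendsto_ae
  filter_upwards [hae, hq.regularSet_ae] with ω h hω
  rw [hq.brownian_of_mem hω]
  exact tendsto_nhds_unique (((hasDyadicIncrements_of_chainingSum_ne_top hω.1).tendsto x).comp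
    hns.tendsto_atTop) h

end

end WhiteNoiseResolvent

namespace WhiteNoiseResolvent
open Set Filter Topology

/-! ### White noise is the derivative of its Brownian path -/

/-- Integration by parts for real test functions and locally integrable derivatives. -/
theorem integral_deriv_mul_primitive {z : ℝ → ℝ} (hz : LocallyIntegrable z) (φ : 𝓢(ℝ, ℝ))
    (hφ : HasCompactSupport φ) :
    ∫ x, deriv φ x * ∫ t in (0 : ℝ)..x, z t = -∫ x, φ x * z x := by
  have hzc : LocallyIntegrable fun x => (z x : ℂ) := fun x => by
    obtain ⟨s, hs, hi⟩ := hz x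
    exact ⟨s, hs, hi.ofReal⟩
  have hφc : ContDiff ℝ (⊤ : ℕ∞) (fun x => (φ x : ℂ)) := Complex.ofRealCLM.contDiff.comp (φ.smooth _)
  have hφcs : HasCompactSupport (fun x => (φ x : ℂ)) := hφ.comp_left Complex.ofReal_zero
  set Φ : 𝓢(ℝ, ℂ) := hφcs.toSchwartzMap hφc with hΦ
  have hΦe : ∀ x, Φ x = (φ x : ℂ) := fun x => rfl
  have hΦd : ∀ x, deriv Φ x = ((deriv φ x : ℝ) : ℂ) := fun x =>
    ((φ.differentiableAt (x := x)).hasDerivAt.ofReal_comp).deriv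
  have h := (HasLocDeriv.integral hzc 0).integral_mul_test (IsTest.of_schwartz Φ hφcs)
  have h1 : ∀ x, (0 + ∫ t in (0 : ℝ)..x, (z t : ℂ)) * deriv Φ x
      = ((deriv φ x * ∫ t in (0 : ℝ)..x, z t : ℝ) : ℂ) := fun x => by
    rw [hΦd, intervalIntegral.integral_ofReal]
    push_cast
    ring
  have h2 : ∀ x, (z x : ℂ) * Φ x = ((φ x * z x : ℝ) : ℂ) := fun x => by
    rw [hΦe]
    push_cast
    ring
  simp only [h1, h2, integral_complex_ofReal] at h
  exact_mod_cast h

theorem inner_intervalKernel (z : Lp ℝ 2 (volume : Measure ℝ)) (x : ℝ) :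
    inner ℝ z (intervalKernel x) = ∫ t in (0 : ℝ)..x, z t := by
  rw [real_inner_comm, intervalKernel, inner_sub_left, L2.inner_indicatorConstLp_one,
    L2.inner_indicatorConstLp_one, intervalIntegral]

section

variable {Ω : Type*} [MeasurableSpace Ω] {P : Measure Ω} [IsProbabilityMeasure P]
  {q : Ω → (𝓢(ℝ, ℝ) →L[ℝ] ℝ)}

theorem IsWhiteNoise.memLp_brownian (hq : IsWhiteNoise P q) (x : ℝ) :
    MemLp (fun ω => hq.brownian ω x) 2 P :=
  (Lp.memLp _).ae_eq (hq.brownian_ae_eq_path x).symm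

theorem IsWhiteNoise.integral_brownian_sq_le (hq : IsWhiteNoise P q) (x : ℝ) :
    ∫ ω, hq.brownian ω x ^ 2 ∂P ≤ |x| := by
  have h1 : ∫ ω, hq.brownian ω x ^ 2 ∂P = ‖hq.wiener (intervalKernel x)‖ ^ 2 := by
    rw [← real_inner_self_eq_norm_sq, L2.inner_def]
    refine integral_congr_ae ?_
    filter_upwards [hq.brownian_ae_eq_path x] with ω hω
    simp only [hω, real_inner_self_eq_norm_sq, Real.norm_eq_abs, sq_abs]
  have h2 : ‖intervalKernel x‖ ^ 2 = |x| := by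
    rcases le_total 0 x with hx | hx
    · have := norm_intervalKernel_sub_sq hx
      rw [abs_of_nonneg hx]
      rwa [intervalKernel_zero, sub_zero, sub_zero] at this
    · have := norm_intervalKernel_sub_sq hx
      rw [abs_of_nonpos hx]
      rwa [intervalKernel_zero, zero_sub, zero_sub, norm_neg] at this
  rw [h1, ← h2]
  exact pow_le_pow_left₀ (norm_nonneg _) (hq.norm_wiener_le _) 2

/-- This is needed for Fubini. Joint measurability comes from continuity in `x` and measurability in
`ω`, integrability from the second moment bound `|x|`. -/
theorem IsWhiteNoise.integrable_mul_brownian (hq : IsWhiteNoise P q) {ψ : ℝ → ℝ}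
    (hψ : Continuous ψ) (hψs : HasCompactSupport ψ) :
    Integrable (Function.uncurry fun x ω => ψ x * hq.brownian ω x)
      ((volume : Measure ℝ).prod P) := by
  have hm : Measurable (Function.uncurry fun x ω => ψ x * hq.brownian ω x) :=
    measurable_uncurry_of_continuous_of_measurable
      (fun ω => hψ.mul (hq.continuous_brownian ω)) (fun x => (hq.measurable_brownian x).const_mul _)
  have hi : ∀ x, Integrable (fun ω => hq.brownian ω x) P := fun x =>
    (hq.memLp_brownian x).integrable (by norm_num)
  refine (integrable_prod_iff hm.aestronglyMeasurable).2
    ⟨Eventually.of_forall fun x => (hi x).const_mul (ψ x), ?_⟩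
  have hint : Integrable fun x : ℝ => |ψ x| * (1 + |x|) :=
    (by fun_prop : Continuous fun x : ℝ => |ψ x| * (1 + |x|)).integrable_of_hasCompactSupport
      ((hψs.comp_left abs_zero).mul_right)
  refine hint.mono' hm.aestronglyMeasurable.norm.integral_prod_right' (Eventually.of_forall fun x => ?_)
  rw [Real.norm_eq_abs, abs_of_nonneg (integral_nonneg fun ω => norm_nonneg _)]
  have hb : ∫ ω, |hq.brownian ω x| ∂P ≤ 1 + |x| := by
    have h2 : Integrable (fun ω => hq.brownian ω x ^ 2) P := (hq.memLp_brownian x).integrable_sq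
    calc ∫ ω, |hq.brownian ω x| ∂P ≤ ∫ ω, (1 + hq.brownian ω x ^ 2) ∂P :=
          integral_mono (hi x).abs ((integrable_const 1).add h2) fun ω => by
            dsimp only
            nlinarith [sq_abs (hq.brownian ω x), sq_nonneg (|hq.brownian ω x| - 1)]
      _ = 1 + ∫ ω, hq.brownian ω x ^ 2 ∂P := by
          rw [integral_add (integrable_const 1) h2]; simp
      _ ≤ 1 + |x| := by linarith [hq.integral_brownian_sq_le x]
  calc ∫ ω, ‖Function.uncurry (fun x ω => ψ x * hq.brownian ω x) (x, ω)‖ ∂P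
      = |ψ x| * ∫ ω, |hq.brownian ω x| ∂P := by
        rw [← integral_const_mul]
        exact integral_congr_ae (Eventually.of_forall fun ω => abs_mul _ _)
    _ ≤ |ψ x| * (1 + |x|) := mul_le_mul_of_nonneg_left hb (abs_nonneg _)

/-- Integrate both sides over an event `A` and let `z` be the adjoint of the Wiener map applied to
the indicator of `A`. Then `q φ` integrates to `∫ φ z` and the path at `x` to `∫₀ˣ z`, so the
identity becomes a deterministic integration by parts. -/
theorem IsWhiteNoise.apply_ae_eq_neg_integral (hq : IsWhiteNoise P q) (φ : 𝓢(ℝ, ℝ))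
    (hφ : HasCompactSupport φ) :
    ∀ᵐ ω ∂P, q ω φ = -∫ x, hq.brownian ω x * deriv φ x := by
  have hψ : Continuous (deriv φ) := φ.smooth'.continuous_deriv (by simp)
  have hprod := hq.integrable_mul_brownian hψ hφ.deriv
  have hY : Integrable (fun ω => ∫ x, deriv φ x * hq.brownian ω x) P := hprod.integral_prod_right
  have hqi : Integrable (fun ω => q ω φ) P := (hq.memLp φ).integrable (by norm_num)
  have key : (fun ω => q ω φ + ∫ x, deriv φ x * hq.brownian ω x) =ᵐ[P] 0 := by
    refine (hqi.add hY).ae_eq_zero_of_forall_setIntegral_eq_zero fun A hA hPA => ?_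
    set e : Lp ℝ 2 P := indicatorConstLp 2 hA hPA.ne 1 with he
    set z : Lp ℝ 2 (volume : Measure ℝ) := ContinuousLinearMap.adjoint hq.wiener e with hzdef
    have hz : ∀ g, inner ℝ z g = ∫ ω in A, hq.wiener g ω ∂P := fun g => by
      rw [hzdef, ContinuousLinearMap.adjoint_inner_left, he, L2.inner_indicatorConstLp_one]
    have hzl : LocallyIntegrable z := (Lp.memLp z).locallyIntegrable (by norm_num)
    have h1 : ∫ ω in A, q ω φ ∂P = ∫ x, φ x * z x := by
      rw [← integral_congr_ae (ae_restrict_of_ae (hq.wiener_toLp_ae φ)), ← hz, L2.inner_def]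
      refine integral_congr_ae ?_
      filter_upwards [φ.coeFn_toLp 2 volume] with x hx
      rw [hx]
      rfl
    have h2 : ∀ x, ∫ ω in A, hq.brownian ω x ∂P = ∫ t in (0 : ℝ)..x, z t := fun x => by
      rw [← inner_intervalKernel, hz]
      exact integral_congr_ae (ae_restrict_of_ae (hq.brownian_ae_eq_path x))
    have hprodA : Integrable (Function.uncurry fun x ω => deriv φ x * hq.brownian ω x)
        ((volume : Measure ℝ).prod (P.restrict A)) := by
      refine hprod.mono_measure ?_
      exact Measure.prod_mono le_rfl Measure.restrict_le_self
    have h3 : ∫ ω in A, (∫ x, deriv φ x * hq.brownian ω x) ∂P = -∫ x, φ x * z x := by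
      rw [← integral_integral_swap hprodA, ← integral_deriv_mul_primitive hzl φ hφ]
      refine integral_congr_ae (Eventually.of_forall fun x => ?_)
      dsimp only
      rw [integral_const_mul, h2]
    refine (integral_add hqi.integrableOn hY.integrableOn).trans ?_
    rw [h1, h3, add_neg_cancel]
  filter_upwards [key] with ω hω
  rw [eq_neg_of_add_eq_zero_left hω]
  congr 1
  exact integral_congr_ae (Eventually.of_forall fun x => mul_comm _ _)

end

/-! ### One null set for all test functions. -/

/-- In a space mapped to a second countable one, a countable set is sequentially dense with respect
to the induced topology. -/
theorem exists_countable_seq_dense {A B : Type*} [TopologicalSpace B] [SecondCountableTopology B]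
    (ι : A → B) : ∃ D : Set A, D.Countable ∧ ∀ a, ∃ u : ℕ → A, (∀ n, u n ∈ D) ∧
      Tendsto (fun n => ι (u n)) atTop (𝓝 (ι a)) := by
  obtain ⟨s, hs, hd⟩ := TopologicalSpace.exists_countable_dense (range ι)
  choose g hg using fun b : range ι => b.2
  refine ⟨g '' s, hs.image g, fun a => ?_⟩
  obtain ⟨v, hv, hva⟩ := mem_closure_iff_seq_limit.1 (hd ⟨ι a, mem_range_self a⟩)
  refine ⟨fun n => g (v n), fun n => mem_image_of_mem _ (hv n), ?_⟩
  have := (continuous_subtype_val.tendsto _).comp hva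
  refine this.congr fun n => ?_
  exact (hg (v n)).symm

/-- The restriction of a derivative of a Schwartz function to `[-R, R]`. -/
noncomputable def restrictIteratedDeriv (R : ℕ) (φ : 𝓢(ℝ, ℝ)) (n : ℕ) :
    C(Icc (-(R : ℝ)) R, ℝ) where
  toFun x := iteratedDeriv n φ x
  continuous_toFun := ((φ.smooth n).continuous_iteratedDeriv n le_rfl).comp continuous_subtype_val

theorem iteratedDeriv_eq_zero_of_lt_abs {φ : ℝ → ℝ} {R : ℝ} (hφ : ∀ x, R < |x| → φ x = 0) (n : ℕ)
    {x : ℝ} (hx : R < |x|) : iteratedDeriv n φ x = 0 := by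
  have h : φ =ᶠ[𝓝 x] fun _ => 0 := by
    filter_upwards [(isOpen_lt continuous_const continuous_abs).mem_nhds hx] with y hy
    exact hφ y hy
  rw [h.iteratedDeriv_eq n]
  simp

theorem abs_iteratedDeriv_sub_le {R : ℕ} {φ ψ : 𝓢(ℝ, ℝ)} (hφ : ∀ x, (R : ℝ) < |x| → φ x = 0)
    (hψ : ∀ x, (R : ℝ) < |x| → ψ x = 0) (n : ℕ) (x : ℝ) :
    |iteratedDeriv n φ x - iteratedDeriv n ψ x|
      ≤ dist (restrictIteratedDeriv R φ n) (restrictIteratedDeriv R ψ n) := by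
  rcases le_or_gt |x| R with hx | hx
  · have := ContinuousMap.dist_apply_le_dist (f := restrictIteratedDeriv R φ n)
      (g := restrictIteratedDeriv R ψ n) (⟨x, abs_le.1 hx⟩ : Icc (-(R : ℝ)) R)
    rwa [Real.dist_eq] at this
  · rw [iteratedDeriv_eq_zero_of_lt_abs hφ n hx, iteratedDeriv_eq_zero_of_lt_abs hψ n hx, sub_self,
      abs_zero]
    exact dist_nonneg

theorem tendsto_schwartz_of_restrict {R : ℕ} {u : ℕ → 𝓢(ℝ, ℝ)} {φ : 𝓢(ℝ, ℝ)}
    (hu : ∀ i, ∀ x, (R : ℝ) < |x| → u i x = 0) (hφ : ∀ x, (R : ℝ) < |x| → φ x = 0)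
    (h : Tendsto (fun i => restrictIteratedDeriv R (u i)) atTop (𝓝 (restrictIteratedDeriv R φ))) :
    Tendsto u atTop (𝓝 φ) := by
  refine ((schwartz_withSeminorms ℝ ℝ ℝ).tendsto_nhds u φ).2 fun ⟨k, n⟩ ε hε => ?_
  have hd : Tendsto (fun i => (R : ℝ) ^ k *
      dist (restrictIteratedDeriv R (u i) n) (restrictIteratedDeriv R φ n)) atTop
      (𝓝 ((R : ℝ) ^ k * 0)) :=
    ((tendsto_iff_dist_tendsto_zero.1 ((tendsto_pi_nhds.1 h) n)).const_mul _)
  rw [mul_zero] at hd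
  filter_upwards [hd.eventually (gt_mem_nhds hε)] with i hi
  refine lt_of_le_of_lt (SchwartzMap.seminorm_le_bound' ℝ k n _ (by positivity) fun x => ?_) hi
  have hsub : iteratedDeriv n (u i - φ : 𝓢(ℝ, ℝ)) x
      = iteratedDeriv n (u i) x - iteratedDeriv n φ x :=
    iteratedDeriv_sub ((u i).smooth n).contDiffAt (φ.smooth n).contDiffAt
  rw [hsub, Real.norm_eq_abs]
  rcases le_or_gt |x| R with hx | hx
  · gcongr
    exact abs_iteratedDeriv_sub_le (hu i) hφ n x
  · rw [iteratedDeriv_eq_zero_of_lt_abs (hu i) n hx, iteratedDeriv_eq_zero_of_lt_abs hφ n hx,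
      sub_self, abs_zero, mul_zero]
    positivity

theorem tendsto_integral_mul_deriv {R : ℕ} {u : ℕ → 𝓢(ℝ, ℝ)} {φ : 𝓢(ℝ, ℝ)}
    (hu : ∀ i, ∀ x, (R : ℝ) < |x| → u i x = 0) (hφ : ∀ x, (R : ℝ) < |x| → φ x = 0)
    (h : Tendsto (fun i => restrictIteratedDeriv R (u i)) atTop (𝓝 (restrictIteratedDeriv R φ)))
    {W : ℝ → ℝ} (hW : Continuous W) :
    Tendsto (fun i => ∫ x, W x * deriv (u i) x) atTop (𝓝 (∫ x, W x * deriv φ x)) := by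
  have hset : ∀ ψ : 𝓢(ℝ, ℝ), (∀ x, (R : ℝ) < |x| → ψ x = 0) →
      ∫ x, W x * deriv ψ x = ∫ x in Icc (-(R : ℝ)) R, W x * iteratedDeriv 1 ψ x := by
    intro ψ hψ
    rw [iteratedDeriv_one, setIntegral_eq_integral_of_forall_compl_eq_zero]
    intro x hx
    have hx' : (R : ℝ) < |x| := by
      by_contra hcon
      exact hx (abs_le.1 (not_lt.1 hcon))
    rw [← iteratedDeriv_one, iteratedDeriv_eq_zero_of_lt_abs hψ 1 hx', mul_zero]
  have hd := (tendsto_pi_nhds.1 h) 1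
  simp only [hset _ (hu _), hset _ hφ]
  refine tendsto_integral_filter_of_dominated_convergence
    (fun x => |W x| * (|iteratedDeriv 1 φ x| + 1)) (Eventually.of_forall fun i => ?_) ?_ ?_ ?_
  · exact (hW.mul (((u i).smooth 1).continuous_iteratedDeriv 1 le_rfl)).aestronglyMeasurable
  · filter_upwards [(tendsto_iff_dist_tendsto_zero.1 hd).eventually (gt_mem_nhds one_pos)] with i hi
    refine Eventually.of_forall fun x => ?_
    rw [norm_mul]
    refine mul_le_mul_of_nonneg_left ?_ (norm_nonneg _)
    have h1 := (abs_iteratedDeriv_sub_le (hu i) hφ 1 x).trans hi.le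
    have h2 := abs_sub_abs_le_abs_sub (iteratedDeriv 1 (u i) x) (iteratedDeriv 1 φ x)
    rw [Real.norm_eq_abs]
    linarith
  · exact (hW.abs.mul (((φ.smooth 1).continuous_iteratedDeriv 1 le_rfl).abs.add
      continuous_const)).integrableOn_Icc
  · refine Eventually.of_forall fun x => Tendsto.const_mul _ ?_
    refine tendsto_iff_dist_tendsto_zero.2 (squeeze_zero (fun _ => dist_nonneg) (fun i => ?_)
      (tendsto_iff_dist_tendsto_zero.1 hd))
    rw [Real.dist_eq]
    exact abs_iteratedDeriv_sub_le (hu i) hφ 1 x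

/-- The identity holds almost surely for each test function. On `[-R, R]` test functions embed,
through all their derivatives, into a countable product of separable spaces of continuous functions,
and both sides are sequentially continuous for the induced topology. A countable set of test
functions therefore suffices. -/
theorem IsWhiteNoise.isPrimitive_brownian_ae {Ω : Type*} [MeasurableSpace Ω] {P : Measure Ω}
    [IsProbabilityMeasure P] {q : Ω → (𝓢(ℝ, ℝ) →L[ℝ] ℝ)} (hq : IsWhiteNoise P q) :
    ∀ᵐ ω ∂P, IsPrimitive (q ω) (hq.brownian ω) := by
  have hR : ∀ R : ℕ, ∀ᵐ ω ∂P, ∀ φ : 𝓢(ℝ, ℝ), (∀ x, (R : ℝ) < |x| → φ x = 0) →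
      q ω φ = -∫ x, hq.brownian ω x * deriv φ x := by
    intro R
    obtain ⟨D, hD, hdense⟩ := exists_countable_seq_dense
      (fun φ : {φ : 𝓢(ℝ, ℝ) // ∀ x, (R : ℝ) < |x| → φ x = 0} => restrictIteratedDeriv R φ.1)
    have hcs : ∀ φ : {φ : 𝓢(ℝ, ℝ) // ∀ x, (R : ℝ) < |x| → φ x = 0}, HasCompactSupport φ.1 :=
      fun φ => HasCompactSupport.intro (isCompact_Icc (a := -(R : ℝ)) (b := R)) fun x hx =>
        φ.2 x (by
          by_contra hcon
          exact hx (abs_le.1 (not_lt.1 hcon)))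
    have h1 : ∀ᵐ ω ∂P, ∀ φ ∈ D, q ω φ.1 = -∫ x, hq.brownian ω x * deriv φ.1 x :=
      (ae_ball_iff hD).2 fun φ _ => hq.apply_ae_eq_neg_integral φ.1 (hcs φ)
    filter_upwards [h1] with ω hω φ hφ
    obtain ⟨u, hu, hlim⟩ := hdense ⟨φ, hφ⟩
    have h2 : Tendsto (fun i => q ω (u i).1) atTop (𝓝 (q ω φ)) :=
      ((q ω).continuous.tendsto φ).comp
        (tendsto_schwartz_of_restrict (fun i => (u i).2) hφ hlim)
    have h3 := (tendsto_integral_mul_deriv (fun i => (u i).2) hφ hlim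
      (hq.continuous_brownian ω)).neg
    exact tendsto_nhds_unique h2 (h3.congr fun i => (hω _ (hu i)).symm)
  filter_upwards [ae_all_iff.2 hR] with ω hω
  refine ⟨hq.continuous_brownian ω, hq.brownian_zero ω, fun φ hφ => ?_⟩
  obtain ⟨R, -, hR⟩ := exists_forall_lt_abs_eq_zero hφ
  obtain ⟨N, hN⟩ := exists_nat_ge R
  exact hω N φ fun x hx => hR x (hN.trans_lt hx)

/-- The difference is constant by du Bois-Reymond and vanishes at `0`. Hence the arbitrary choice in
`primitive` must return the Brownian path. -/
theorem IsPrimitive.unique {q : 𝓢(ℝ, ℝ) →L[ℝ] ℝ} {W W' : ℝ → ℝ} (h : IsPrimitive q W)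
    (h' : IsPrimitive q W') : W = W' := by
  have hc : Continuous fun x => ((W x - W' x : ℝ) : ℂ) :=
    Complex.continuous_ofReal.comp (h.continuous.sub h'.continuous)
  obtain ⟨c, hcae⟩ := ae_eq_const_of_integral_deriv_eq_zero hc.locallyIntegrable fun φ hφ hφs => by
    set Φ : 𝓢(ℝ, ℝ) := hφs.toSchwartzMap hφ with hΦ
    have hΦe : (Φ : ℝ → ℝ) = φ := rfl
    have e1 := h.deriv_eq Φ hφs
    have e2 := h'.deriv_eq Φ hφs
    rw [hΦe] at e1 e2
    have hd : Continuous (deriv φ) := hφ.continuous_deriv (by simp)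
    have i1 : Integrable fun x => W x * deriv φ x :=
      (h.continuous.mul hd).integrable_of_hasCompactSupport hφs.deriv.mul_left
    have i2 : Integrable fun x => W' x * deriv φ x :=
      (h'.continuous.mul hd).integrable_of_hasCompactSupport hφs.deriv.mul_left
    have e3 : ∫ x, (W x * deriv φ x - W' x * deriv φ x) = 0 := by
      rw [integral_sub i1 i2]
      linarith
    have e4 : ∀ x, deriv φ x • ((W x - W' x : ℝ) : ℂ)
        = ((W x * deriv φ x - W' x * deriv φ x : ℝ) : ℂ) := fun x => by
      rw [Complex.real_smul]
      push_cast
      ring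
    simp only [e4, integral_complex_ofReal, e3, Complex.ofReal_zero]
  have heq : (fun x => ((W x - W' x : ℝ) : ℂ)) = fun _ => c :=
    hc.ae_eq_iff_eq volume continuous_const |>.1 hcae
  have h0 : c = 0 := by
    have := congrFun heq 0
    simp only [h.zero, h'.zero, sub_self, Complex.ofReal_zero] at this
    exact this.symm
  funext x
  have := congrFun heq x
  simp only [h0, Complex.ofReal_eq_zero] at this
  linarith

theorem IsPrimitive.primitive_eq {q : 𝓢(ℝ, ℝ) →L[ℝ] ℝ} {W : ℝ → ℝ} (h : IsPrimitive q W) :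
    primitive q = W := by
  have hex : ∃ W, IsPrimitive q W := ⟨W, h⟩
  rw [primitive, dif_pos hex]
  exact hex.choose_spec.unique h

end WhiteNoiseResolvent

namespace WhiteNoiseResolvent
open Set Filter Topology

/-! ### The periodized potential -/

/-- The restriction of `W` to `[-L, L]`, extended by constants. -/
def clampPath (L : ℕ) (W : ℝ → ℝ) (x : ℝ) : ℝ := W (max (-(L : ℝ)) (min (L : ℝ) x))

section

variable {L : ℕ} {W : ℝ → ℝ}

theorem clampPath_of_le {x : ℝ} (hx : (L : ℝ) ≤ x) : clampPath L W x = W L := by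
  rw [clampPath, min_eq_left hx, max_eq_right (by linarith [L.cast_nonneg (α := ℝ)])]

theorem clampPath_of_ge {x : ℝ} (hx : x ≤ -L) : clampPath L W x = W (-L) := by
  rw [clampPath, max_eq_left]
  exact (min_le_right _ _).trans hx

theorem clampPath_of_mem {x : ℝ} (hx : x ∈ Icc (-(L : ℝ)) L) : clampPath L W x = W x := by
  rw [clampPath, min_eq_right hx.2, max_eq_right hx.1]

theorem potentialPrimitive_coe (L : ℕ) (W : ℝ → ℝ) (x : ℝ) : potentialPrimitive (L : ℕ∞) W x
    = ∑' j : ℤ, (clampPath L W (x - 2 * j * L) - clampPath L W (-(2 * j * L))) := rfl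

/-- For `|j| ≥ N + 2` both arguments lie on the same side of `[-L, L]`, where the clamped path is
constant. -/
theorem clampPath_sub_eq_zero (hL : 1 ≤ L) {x : ℝ} {N : ℕ} (hx : |x| ≤ N) {j : ℤ}
    (hj : j ∉ Finset.Icc (-(N + 1 : ℤ)) (N + 1)) :
    clampPath L W (x - 2 * j * L) - clampPath L W (-(2 * j * L)) = 0 := by
  have hL' : (1 : ℝ) ≤ L := by exact_mod_cast hL
  have hN : (0 : ℝ) ≤ N := N.cast_nonneg
  rw [abs_le] at hx
  have hj' : j ≤ -(N + 2 : ℤ) ∨ (N + 2 : ℤ) ≤ j := by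
    rw [Finset.mem_Icc] at hj
    omega
  rcases hj' with hj' | hj'
  · have h1 : (j : ℝ) ≤ -(N + 2) := by exact_mod_cast hj'
    have h2 : 2 * (j : ℝ) * L ≤ -(N + L) := by nlinarith
    rw [clampPath_of_le (by linarith), clampPath_of_le (by linarith), sub_self]
  · have h1 : (N + 2 : ℝ) ≤ j := by exact_mod_cast hj'
    have h2 : (N + L : ℝ) ≤ 2 * (j : ℝ) * L := by nlinarith
    rw [clampPath_of_ge (by linarith), clampPath_of_ge (by linarith), sub_self]

theorem potentialPrimitive_eq_sum (hL : 1 ≤ L) {x : ℝ} {N : ℕ} (hx : |x| ≤ N) :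
    potentialPrimitive (L : ℕ∞) W x = ∑ j ∈ Finset.Icc (-(N + 1 : ℤ)) (N + 1),
      (clampPath L W (x - 2 * j * L) - clampPath L W (-(2 * j * L))) := by
  rw [potentialPrimitive_coe]
  exact tsum_eq_sum fun j hj => clampPath_sub_eq_zero hL hx hj

theorem continuous_clampPath (hW : Continuous W) : Continuous (clampPath L W) :=
  hW.comp (by fun_prop)

theorem continuous_potentialPrimitive (hL : 1 ≤ L) (hW : Continuous W) :
    Continuous (potentialPrimitive (L : ℕ∞) W) := by
  refine continuous_iff_continuousAt.2 fun x₀ => ?_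
  obtain ⟨N, hN⟩ := exists_nat_gt |x₀|
  have hc : Continuous fun x => ∑ j ∈ Finset.Icc (-(N + 1 : ℤ)) (N + 1),
      (clampPath L W (x - 2 * j * L) - clampPath L W (-(2 * j * L))) :=
    continuous_finsetSum _ fun j _ =>
      ((continuous_clampPath hW).comp (by fun_prop)).sub continuous_const
  refine hc.continuousAt.congr ?_
  filter_upwards [(isOpen_lt continuous_abs continuous_const).mem_nhds hN] with x hx
  exact (potentialPrimitive_eq_sum hL (le_of_lt hx)).symm

/-- As `L` is an integer, the cell `[i, i + 1]` lies inside a single period, the `J`th; all other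
terms are constant on it. -/
theorem potentialPrimitive_sub (hL : 1 ≤ L) {i : ℤ} {x y : ℝ} (hx : x ∈ Icc (i : ℝ) (i + 1))
    (hy : y ∈ Icc (i : ℝ) (i + 1)) {J : ℤ} (hJ1 : -(L : ℤ) ≤ i - 2 * J * L)
    (hJ2 : i - 2 * J * L < L) :
    potentialPrimitive (L : ℕ∞) W x - potentialPrimitive (L : ℕ∞) W y
      = W (x - 2 * J * L) - W (y - 2 * J * L) := by
  have hL' : (1 : ℝ) ≤ L := by exact_mod_cast hL
  obtain ⟨N, hN⟩ := exists_nat_ge (max |x| |y|)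
  obtain ⟨N', hN'⟩ : ∃ N' : ℕ, N ≤ N' ∧ J.natAbs ≤ N' := ⟨max N J.natAbs, le_max_left _ _,
    le_max_right _ _⟩
  have hxN : |x| ≤ N' := (le_max_left _ _).trans (hN.trans (by exact_mod_cast hN'.1))
  have hyN : |y| ≤ N' := (le_max_right _ _).trans (hN.trans (by exact_mod_cast hN'.1))
  rw [potentialPrimitive_eq_sum hL hxN, potentialPrimitive_eq_sum hL hyN, ← Finset.sum_sub_distrib]
  have h1 : -(L : ℝ) ≤ i - 2 * J * L := by exact_mod_cast hJ1
  have h2 : (i - 2 * J * L : ℝ) + 1 ≤ L := by exact_mod_cast hJ2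
  have hmem : ∀ z ∈ Icc (i : ℝ) (i + 1), z - 2 * J * L ∈ Icc (-(L : ℝ)) L := fun z hz =>
    ⟨by linarith [hz.1], by linarith [hz.2]⟩
  rw [Finset.sum_eq_single J]
  · rw [sub_sub_sub_cancel_right, clampPath_of_mem (hmem x hx), clampPath_of_mem (hmem y hy)]
  · intro j _ hj
    rw [sub_sub_sub_cancel_right]
    rcases lt_or_gt_of_ne hj with hj | hj
    · have h3 : (j : ℝ) + 1 ≤ J := by exact_mod_cast hj
      have h4 : 2 * (j : ℝ) * L + 2 * L ≤ 2 * J * L := by nlinarith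
      rw [clampPath_of_le (by linarith [hx.1]), clampPath_of_le (by linarith [hy.1]), sub_self]
    · have h3 : (J : ℝ) + 1 ≤ j := by exact_mod_cast hj
      have h4 : 2 * (J : ℝ) * L + 2 * L ≤ 2 * j * L := by nlinarith
      rw [clampPath_of_ge (by linarith [hx.2]), clampPath_of_ge (by linarith [hy.2]), sub_self]
  · intro hJ
    exact absurd (Finset.mem_Icc.2 (by omega)) hJ

theorem OscLE.potentialPrimitive_coe (hL : 1 ≤ L) {R : ℕ} {b : ℝ} (h : OscLE W R fun _ => b) :
    OscLE (potentialPrimitive (L : ℕ∞) W) R fun _ => b := by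
  intro i hi1 hi2 x hx y hy t ht
  have hL' : (0 : ℤ) < 2 * L := by omega
  set J : ℤ := (i + L) / (2 * L) with hJ
  have h0 := Int.mul_ediv_add_emod (i + L) (2 * L)
  have hm0 := Int.emod_nonneg (i + L) hL'.ne'
  have hm1 := Int.emod_lt_of_pos (i + L) hL'
  rw [← hJ] at h0
  have hcomm : (2 : ℤ) * L * J = 2 * J * L := by ring
  rw [hcomm] at h0
  have hJ1 : -(L : ℤ) ≤ i - 2 * J * L := by omega
  have hJ2 : i - 2 * J * L < L := by omega
  rw [potentialPrimitive_sub hL hx hy hJ1 hJ2]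
  -- If `J ≠ 0`, the original cell lies outside `[-L, L]`, so the window contains `[-L, L]` and with
  -- it the translated cell. Periodizing thus never requires a larger window.
  have hrange : -(R : ℤ) ≤ i - 2 * J * L ∧ i - 2 * J * L < R := by
    rcases lt_trichotomy J 0 with hneg | hz | hpos
    · have : 2 * J * L ≤ -(2 * L) := by nlinarith
      omega
    · rw [hz]
      simpa using ⟨hi1, hi2⟩
    · have : 2 * (L : ℤ) ≤ 2 * J * L := by nlinarith
      omega
  have hmem : ∀ z ∈ Icc (i : ℝ) (i + 1),
      z - 2 * J * L ∈ Icc ((i - 2 * J * L : ℤ) : ℝ) ((i - 2 * J * L : ℤ) + 1) := fun z hz => by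
    push_cast
    exact ⟨by linarith [hz.1], by linarith [hz.2]⟩
  exact h _ hrange.1 hrange.2 _ (hmem x hx) _ (hmem y hy) _ (hmem t ht)

end

section

variable {L₀ : ℕ∞} {W : ℝ → ℝ}

theorem IsDyadicOrInfinite.eq_top_or (hL : IsDyadicOrInfinite L₀) :
    L₀ = ⊤ ∨ ∃ L : ℕ, 1 ≤ L ∧ L₀ = L := by
  rcases hL with h | ⟨L, ⟨i, -, hi⟩, h⟩
  · exact Or.inl h
  · exact Or.inr ⟨L, hi ▸ Nat.one_le_two_pow, h⟩

theorem OscLE.potentialPrimitive (hL : IsDyadicOrInfinite L₀) {R : ℕ} {b : ℝ}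
    (h : OscLE W R fun _ => b) : OscLE (potentialPrimitive L₀ W) R fun _ => b := by
  rcases hL.eq_top_or with rfl | ⟨L, hL1, rfl⟩
  · exact h
  · exact h.potentialPrimitive_coe hL1

theorem HasSqrtGrowth.potentialPrimitive (hL : IsDyadicOrInfinite L₀) {K : ℝ}
    (h : HasSqrtGrowth W K) : HasSqrtGrowth (potentialPrimitive L₀ W) K where
  continuous := by
    rcases hL.eq_top_or with rfl | ⟨L, hL1, rfl⟩
    · exact h.continuous
    · exact continuous_potentialPrimitive hL1 h.continuous
  one_le := h.one_le
  osc R := (h.osc R).potentialPrimitive hL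

theorem measurable_potentialPrimitive {Ω : Type*} [MeasurableSpace Ω] {W : Ω → ℝ → ℝ}
    (hW : ∀ x, Measurable fun ω => W ω x) (hL : IsDyadicOrInfinite L₀) (x : ℝ) :
    Measurable fun ω => WhiteNoiseResolvent.potentialPrimitive L₀ (W ω) x := by
  rcases hL.eq_top_or with rfl | ⟨L, hL1, rfl⟩
  · exact hW x
  · obtain ⟨N, hN⟩ := exists_nat_ge |x|
    simp only [potentialPrimitive_eq_sum hL1 hN, clampPath]
    exact Finset.measurable_sum _ fun j _ => (hW _).sub (hW _)

end

/-! ### Measurability of functionals of random continuous functions -/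

theorem measurableSet_forall_abs_sub_le {Ω : Type*} [MeasurableSpace Ω] {V : Ω → ℝ → ℝ}
    (hV : ∀ x, Measurable fun ω => V ω x) (hVc : ∀ ω, Continuous (V ω)) {V' : ℝ → ℝ}
    (hV' : Continuous V') {R δ : ℝ} (hR : 0 < R) :
    MeasurableSet {ω | ∀ x : ℝ, |x| ≤ R → |V ω x - V' x| ≤ δ} := by
  have h : {ω | ∀ x : ℝ, |x| ≤ R → |V ω x - V' x| ≤ δ}
      = ⋂ r : ℚ, {ω | |(r : ℝ)| < R → |V ω r - V' r| ≤ δ} := by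
    ext ω
    simp only [mem_iInter]
    refine ⟨fun h r hr => h r hr.le, fun h x hx => ?_⟩
    have hdense : Dense {x : ℝ | ∃ r : ℚ, (r : ℝ) = x} := Rat.denseRange_cast
    have hcl : IsClosed {x : ℝ | |V ω x - V' x| ≤ δ} :=
      isClosed_le (((hVc ω).sub hV').abs) continuous_const
    have hsub : Ioo (-R) R ∩ {x : ℝ | ∃ r : ℚ, (r : ℝ) = x} ⊆ {x : ℝ | |V ω x - V' x| ≤ δ} := by
      rintro _ ⟨hx, r, rfl⟩
      exact h r (abs_lt.2 hx)
    have h1 : Ioo (-R) R ⊆ {x : ℝ | |V ω x - V' x| ≤ δ} :=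
      (hdense.open_subset_closure_inter isOpen_Ioo).trans (hcl.closure_subset_iff.2 hsub)
    have h2 := hcl.closure_subset_iff.2 h1
    rw [closure_Ioo (by linarith)] at h2
    exact h2 (abs_le.1 hx)
  rw [h]
  refine MeasurableSet.iInter fun r => ?_
  by_cases hr : |(r : ℝ)| < R
  · simp only [hr, true_imp_iff]
    exact measurableSet_le (((hV r).sub_const _).abs) measurable_const
  · simp only [hr, false_imp_iff]
    exact MeasurableSet.univ

/-- On `A k` the condition `N (V ω) ≤ c` means that for each precision some potential from a
countable dense family is close to `V ω` and nearly satisfies it. This is a countable combination of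
events about values of `V ω`. The comparison of `N` is used in both directions. -/
theorem aemeasurable_of_uniformContinuous {Ω : Type*} [MeasurableSpace Ω] {P : Measure Ω}
    {V : Ω → ℝ → ℝ} (hV : ∀ x, Measurable fun ω => V ω x) (hVc : ∀ ω, Continuous (V ω))
    {A : ℕ → Set Ω} (hA : ∀ k, MeasurableSet (A k)) {K : ℕ → ℝ}
    (hAK : ∀ k, ∀ ω ∈ A k, HasSqrtGrowth (V ω) (K k)) (hAe : ∀ᵐ ω ∂P, ∃ k, ω ∈ A k)
    {N : (ℝ → ℝ) → ℝ≥0∞} (hN : ∀ k, ∀ ε : ℝ, 0 < ε → ∃ R δ : ℝ, 0 < δ ∧ ∀ V V' : ℝ → ℝ,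
      HasSqrtGrowth V (K k) → HasSqrtGrowth V' (K k) → (∀ x : ℝ, |x| ≤ R → |V' x - V x| ≤ δ) →
      N V' ≤ N V + ENNReal.ofReal ε) :
    AEMeasurable (fun ω => N (V ω)) P := by
  have hmeas : ∀ k, Measurable ((A k).indicator fun ω => N (V ω)) := by
    intro k
    obtain ⟨D, hD, hdense⟩ := exists_countable_seq_dense
      (fun v : {v : ℝ → ℝ // HasSqrtGrowth v (K k)} => (⟨v.1, v.2.continuous⟩ : C(ℝ, ℝ)))
    choose R δ hδ hRδ using fun n : ℕ => hN k (1 / (n + 1)) (by positivity)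
    refine measurable_of_Iic fun c => ?_
    -- The maximum with `1` is taken because `R n` need not be positive.
    have hpre : (A k).indicator (fun ω => N (V ω)) ⁻¹' Iic c = (A k)ᶜ ∪ (A k ∩ ⋂ n : ℕ, ⋃ v ∈ D,
        {ω | N v.1 ≤ c + ENNReal.ofReal (1 / (n + 1)) ∧
          ∀ x : ℝ, |x| ≤ max (R n) 1 → |V ω x - v.1 x| ≤ δ n}) := by
      ext ω
      simp only [mem_preimage, mem_Iic, mem_union, mem_compl_iff, mem_inter_iff, mem_iInter,
        mem_iUnion, exists_prop]
      by_cases hω : ω ∈ A k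
      · simp only [indicator_of_mem hω, hω, not_true_eq_false, true_and, false_or]
        have hVω := hAK k ω hω
        constructor
        · intro hc n
          obtain ⟨u, hu, hlim⟩ := hdense ⟨V ω, hVω⟩
          have hunif := ContinuousMap.tendsto_iff_forall_isCompact_tendstoUniformlyOn.1 hlim
            (Icc (-(max (R n) 1)) (max (R n) 1)) isCompact_Icc
          obtain ⟨i, hi⟩ := ((Metric.tendstoUniformlyOn_iff.1 hunif) (δ n) (hδ n)).exists
          have hclose : ∀ x : ℝ, |x| ≤ max (R n) 1 → |V ω x - (u i).1 x| ≤ δ n := fun x hx => by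
            have := hi x (abs_le.1 hx)
            rw [Real.dist_eq] at this
            exact this.le
          refine ⟨u i, hu i, (hRδ n (V ω) (u i).1 hVω (u i).2 fun x hx => ?_).trans
            (add_le_add_left hc _), hclose⟩
          rw [abs_sub_comm]
          exact hclose x (hx.trans (le_max_left _ _))
        · intro h
          have hb : ∀ n : ℕ, N (V ω) ≤ c + ENNReal.ofReal (2 * (1 / (n + 1))) := fun n => by
            obtain ⟨v, -, hv1, hv2⟩ := h n
            calc N (V ω) ≤ N v.1 + ENNReal.ofReal (1 / (n + 1)) :=
                  hRδ n v.1 (V ω) v.2 hVω fun x hx => hv2 x (hx.trans (le_max_left _ _))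
              _ ≤ c + ENNReal.ofReal (1 / (n + 1)) + ENNReal.ofReal (1 / (n + 1)) := by gcongr
              _ = c + ENNReal.ofReal (2 * (1 / (n + 1))) := by
                  rw [add_assoc, ← ENNReal.ofReal_add (by positivity) (by positivity), two_mul]
          have ht : Tendsto (fun n : ℕ => c + ENNReal.ofReal (2 * (1 / ((n : ℝ) + 1)))) atTop
              (𝓝 (c + ENNReal.ofReal (2 * 0))) :=
            tendsto_const_nhds.add (ENNReal.tendsto_ofReal
              (tendsto_one_div_add_atTop_nhds_zero_nat.const_mul 2))
          rw [mul_zero, ENNReal.ofReal_zero, add_zero] at ht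
          exact ge_of_tendsto' ht hb
      · simp [hω]
    rw [hpre]
    refine (hA k).compl.union ((hA k).inter (MeasurableSet.iInter fun n =>
      MeasurableSet.biUnion hD fun v _ => ?_))
    exact (MeasurableSet.const _).inter (measurableSet_forall_abs_sub_le hV hVc
      v.2.continuous (lt_max_of_lt_right one_pos))
  refine ⟨fun ω => ⨆ k, (A k).indicator (fun ω => N (V ω)) ω, Measurable.iSup hmeas, ?_⟩
  filter_upwards [hAe] with ω ⟨k, hk⟩
  refine le_antisymm ?_ (iSup_le fun k => indicator_le_self' (fun _ _ => zero_le) ω)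
  exact le_iSup_of_le k (by rw [indicator_of_mem hk])

end WhiteNoiseResolvent

namespace WhiteNoiseResolvent
open Set Filter Topology

/-! ### Growth of Brownian paths and measurability of the block norms -/

theorem logBound_mono {g g' : ℝ} (hg : 1 ≤ g) (h : g ≤ g') : logBound g ≤ logBound g' := by
  unfold logBound
  gcongr

section

variable {Ω : Type*} [MeasurableSpace Ω] {P : Measure Ω} [IsProbabilityMeasure P]
  {q : Ω → (𝓢(ℝ, ℝ) →L[ℝ] ℝ)} {L₀ : ℕ∞}

theorem IsWhiteNoise.one_le_toReal_chainingSum (hq : IsWhiteNoise P q) {ω : Ω} {j : ℤ}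
    (h : chainingSum (hq.path ω) j ≠ ⊤) : 1 ≤ (chainingSum (hq.path ω) j).toReal := by
  simpa using ENNReal.toReal_mono h (one_le_chainingSum (hq.path ω) j)

/-- The samples for which the increments over unit intervals are controlled with constant `k`. -/
def IsWhiteNoise.growthSet (hq : IsWhiteNoise P q) (k : ℕ) : Set Ω :=
  {ω | ∀ j : ℤ, ENNReal.ofReal ((1 / 2) ^ j.natAbs) * chainingSum (hq.path ω) j ≤ k}

theorem IsWhiteNoise.measurableSet_growthSet (hq : IsWhiteNoise P q) (k : ℕ) :
    MeasurableSet (hq.growthSet k) := by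
  have : hq.growthSet k
      = ⋂ j : ℤ, {ω | ENNReal.ofReal ((1 / 2) ^ j.natAbs) * chainingSum (hq.path ω) j ≤ k} := by
    ext; simp [IsWhiteNoise.growthSet]
  rw [this]
  exact MeasurableSet.iInter fun j =>
    measurableSet_le ((hq.measurable_chainingSum j).const_mul _) measurable_const

/-- The weights `2^(-|j|)` make the sum over `j` of finite mean, hence almost surely finite. Such
weak weights suffice because only the logarithm of `chainingSum` enters the oscillation. -/
theorem IsWhiteNoise.exists_mem_growthSet_ae (hq : IsWhiteNoise P q) :
    ∀ᵐ ω ∂P, ∃ k, ω ∈ hq.growthSet k := by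
  have hs : Summable fun j : ℤ => (1 / 2 : ℝ) ^ j.natAbs := by
    refine Summable.of_nat_of_neg ?_ ?_ <;> simpa using summable_geometric_two
  have hm : ∀ j : ℤ, Measurable fun ω =>
      ENNReal.ofReal ((1 / 2) ^ j.natAbs) * chainingSum (hq.path ω) j :=
    fun j => (hq.measurable_chainingSum j).const_mul _
  have hfin : ∫⁻ ω, ∑' j : ℤ, ENNReal.ofReal ((1 / 2) ^ j.natAbs) * chainingSum (hq.path ω) j ∂P
      ≠ ⊤ := by
    rw [lintegral_tsum fun j => (hm j).aemeasurable]
    refine ne_top_of_le_ne_top (b := (∑' j : ℤ, ENNReal.ofReal ((1 / 2) ^ j.natAbs)) * 3)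
      (ENNReal.mul_ne_top hs.tsum_ofReal_ne_top (by norm_num)) ?_
    rw [← ENNReal.tsum_mul_right]
    refine ENNReal.tsum_le_tsum fun j => ?_
    rw [lintegral_const_mul _ (hq.measurable_chainingSum j)]
    exact mul_le_mul_right (hq.lintegral_chainingSum_le j) _
  filter_upwards [ae_lt_top (Measurable.tsum hm) hfin] with ω hω
  obtain ⟨k, hk⟩ := ENNReal.exists_nat_gt hω.ne
  exact ⟨k, fun j => (ENNReal.le_tsum j).trans hk.le⟩

/-- On the growth set `log g ≤ k + |i|`, and `1 + k + R ≤ (k + 1)(R + 1)` separates the two square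
roots. -/
theorem IsWhiteNoise.hasSqrtGrowth_brownian (hq : IsWhiteNoise P q) {k : ℕ} {ω : Ω}
    (hω : ω ∈ hq.growthSet k) : HasSqrtGrowth (hq.brownian ω) (72 * √(k + 1)) where
  continuous := hq.continuous_brownian ω
  one_le := by
    have : 1 ≤ √((k : ℝ) + 1) := Real.one_le_sqrt.2 (by linarith [k.cast_nonneg (α := ℝ)])
    linarith
  osc R i hi1 hi2 x hx y hy t ht := by
    have h0 := hω i
    have hpos : (0 : ℝ) < (1 / 2) ^ i.natAbs := by positivity
    have hne : chainingSum (hq.path ω) i ≠ ⊤ := fun htop => by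
      rw [htop, ENNReal.mul_top (by simp)] at h0
      exact absurd h0 (by simp)
    set g := (chainingSum (hq.path ω) i).toReal with hg
    have hg1 : 1 ≤ g := hq.one_le_toReal_chainingSum hne
    have h1 : (1 / 2) ^ i.natAbs * g ≤ k := by
      have := ENNReal.toReal_mono (by simp) h0
      rwa [ENNReal.toReal_mul, ENNReal.toReal_ofReal hpos.le, ENNReal.toReal_natCast] at this
    have hk : (0 : ℝ) < k := lt_of_lt_of_le (by positivity) h1
    have hlog : Real.log g ≤ k + i.natAbs := by
      have h2 := Real.log_le_log (by positivity) h1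
      rw [Real.log_mul (by positivity) (by positivity), Real.log_pow, one_div, Real.log_inv] at h2
      have h3 := Real.log_le_sub_one_of_pos hk
      have h4 : (i.natAbs : ℝ) * Real.log 2 ≤ i.natAbs * 1 :=
        mul_le_mul_of_nonneg_left (by linarith [Real.log_two_lt_d9]) (Nat.cast_nonneg _)
      linarith
    have hiR : (i.natAbs : ℝ) ≤ R := by
      have : i.natAbs ≤ R := by omega
      exact_mod_cast this
    refine (hq.abs_brownian_sub_le ω hx hy).trans ?_
    rw [logBound, ← hg, mul_assoc, ← Real.sqrt_mul (by positivity), ← mul_assoc]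
    norm_num
    refine Real.sqrt_le_sqrt ?_
    nlinarith [mul_nonneg hk.le (R.cast_nonneg (α := ℝ))]

/-- The maximum over the cells is replaced by the sum, whose mean is linear in `R`; under the
logarithm this costs only `log R`. -/
theorem IsWhiteNoise.oscLE_brownian (hq : IsWhiteNoise P q) {R : ℕ} {ω : Ω}
    (h : ∑ j ∈ Finset.Ico (-(R : ℤ)) R, chainingSum (hq.path ω) j ≠ ⊤) :
    OscLE (hq.brownian ω) R fun _ => 72 * √(1 + Real.log
      (∑ j ∈ Finset.Ico (-(R : ℤ)) R, chainingSum (hq.path ω) j).toReal) := by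
  intro i hi1 hi2 x hx y hy t ht
  have hle : chainingSum (hq.path ω) i ≤ ∑ j ∈ Finset.Ico (-(R : ℤ)) R, chainingSum (hq.path ω) j :=
    Finset.single_le_sum (f := fun j => chainingSum (hq.path ω) j) (fun _ _ => zero_le)
      (Finset.mem_Ico.2 ⟨hi1, hi2⟩)
  have h2 := logBound_mono (hq.one_le_toReal_chainingSum (ne_top_of_le_ne_top h hle))
    (ENNReal.toReal_mono h hle)
  refine (hq.abs_brownian_sub_le ω hx hy).trans ?_
  simp only [logBound] at h2 ⊢
  linarith

theorem IsWhiteNoise.one_le_toReal_sum (hq : IsWhiteNoise P q) {R : ℕ} (hR : 1 ≤ R) {ω : Ω}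
    (h : ∑ j ∈ Finset.Ico (-(R : ℤ)) R, chainingSum (hq.path ω) j ≠ ⊤) :
    1 ≤ (∑ j ∈ Finset.Ico (-(R : ℤ)) R, chainingSum (hq.path ω) j).toReal := by
  have hle : chainingSum (hq.path ω) 0 ≤ ∑ j ∈ Finset.Ico (-(R : ℤ)) R, chainingSum (hq.path ω) j :=
    Finset.single_le_sum (f := fun j => chainingSum (hq.path ω) j) (fun _ _ => zero_le)
      (Finset.mem_Ico.2 ⟨by omega, by omega⟩)
  exact (hq.one_le_toReal_chainingSum (ne_top_of_le_ne_top h hle)).trans (ENNReal.toReal_mono h hle)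

theorem IsWhiteNoise.lintegral_sum_le (hq : IsWhiteNoise P q) (R : ℕ) :
    ∫⁻ ω, ∑ j ∈ Finset.Ico (-(R : ℤ)) R, chainingSum (hq.path ω) j ∂P
      ≤ ENNReal.ofReal (6 * R) := by
  rw [lintegral_finsetSum _ fun j _ => hq.measurable_chainingSum j]
  refine (Finset.sum_le_sum fun j _ => hq.lintegral_chainingSum_le j).trans (le_of_eq ?_)
  rw [Finset.sum_const, Int.card_Ico, nsmul_eq_mul]
  have : (((R : ℤ) - -(R : ℤ)).toNat) = 2 * R := by omega
  rw [this, ENNReal.ofReal_mul (by norm_num), ENNReal.ofReal_natCast, ENNReal.ofReal_ofNat]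
  push_cast
  ring

theorem IsWhiteNoise.blockNorm_ae_eq (hq : IsWhiteNoise P q) (χ₁ : ℝ → ℝ) (L₀ : ℕ∞) (k : ℂ)
    (m n : ℕ) : ∀ᵐ ω ∂P, blockNorm χ₁ L₀ k m n (q ω)
      = localizedResolventNorm (potentialPrimitive L₀ (hq.brownian ω)) k ‖k‖
        (dyadicCutoff χ₁ m) (dyadicCutoff χ₁ n) := by
  filter_upwards [hq.isPrimitive_brownian_ae] with ω hω
  rw [blockNorm, hω.primitive_eq]

theorem IsWhiteNoise.aemeasurable_blockNorm (hq : IsWhiteNoise P q) {χ₁ : ℝ → ℝ} {k : ℂ}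
    {m n : ℕ} {c₀ D : ℝ} (hL : IsDyadicOrInfinite L₀) (hk : IsSectorial k ‖k‖ c₀)
    (hm : IsSmoothCutoff (dyadicCutoff χ₁ m) D) (hn : IsSmoothCutoff (dyadicCutoff χ₁ n) D) :
    AEMeasurable (fun ω => blockNorm χ₁ L₀ k m n (q ω)) P := by
  have hc : ∀ ω, Continuous (potentialPrimitive L₀ (hq.brownian ω)) := fun ω => by
    rcases hL.eq_top_or with rfl | ⟨L, hL1, rfl⟩
    · exact hq.continuous_brownian ω
    · exact continuous_potentialPrimitive hL1 (hq.continuous_brownian ω)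
  refine AEMeasurable.congr (aemeasurable_of_uniformContinuous
    (N := fun V => localizedResolventNorm V k ‖k‖ (dyadicCutoff χ₁ m) (dyadicCutoff χ₁ n))
    (measurable_potentialPrimitive hq.measurable_brownian hL) hc hq.measurableSet_growthSet
    (K := fun k => 72 * √(k + 1))
    (fun k ω hω => (hq.hasSqrtGrowth_brownian hω).potentialPrimitive hL)
    hq.exists_mem_growthSet_ae
    (fun _ ε hε => exists_localizedResolventNorm_le_add hk hm hn hε)) ?_
  filter_upwards [hq.blockNorm_ae_eq χ₁ L₀ k m n] with ω hω
  exact hω.symm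

end

/-- Since the bound is linear in `S`, only the mean of `S` is needed. -/
theorem lintegral_rpow_le_of_le {Ω : Type*} [MeasurableSpace Ω] {P : Measure Ω}
    [IsProbabilityMeasure P] {X S : Ω → ℝ≥0∞} {A T p : ℝ} (hp : 0 ≤ p) (hA : 0 ≤ A) (hT : 0 < T)
    (hS : Measurable S) (hES : ∫⁻ ω, S ω ∂P ≤ ENNReal.ofReal T)
    (h : ∀ᵐ ω ∂P, ∃ F : ℝ, 0 ≤ F ∧ X ω ≤ ENNReal.ofReal F ∧ F ^ p ≤ A * (1 + (S ω).toReal / T)) :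
    ∫⁻ ω, X ω ^ p ∂P ≤ ENNReal.ofReal (2 * A) := by
  have hT' : ENNReal.ofReal T ≠ 0 := by simpa using hT
  calc ∫⁻ ω, X ω ^ p ∂P
      ≤ ∫⁻ ω, ENNReal.ofReal A * (1 + S ω * (ENNReal.ofReal T)⁻¹) ∂P := by
        refine lintegral_mono_ae ?_
        filter_upwards [h] with ω ⟨F, hF0, hXF, hF⟩
        refine (ENNReal.rpow_le_rpow hXF hp).trans ?_
        rw [ENNReal.ofReal_rpow_of_nonneg hF0 hp]
        refine (ENNReal.ofReal_le_ofReal hF).trans ?_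
        rw [ENNReal.ofReal_mul hA, ENNReal.ofReal_add zero_le_one (by positivity),
          ENNReal.ofReal_one, ENNReal.ofReal_div_of_pos hT, div_eq_mul_inv]
        gcongr
        exact ENNReal.ofReal_toReal_le
    _ = ENNReal.ofReal A * (1 + (∫⁻ ω, S ω ∂P) * (ENNReal.ofReal T)⁻¹) := by
        rw [lintegral_const_mul _ (by fun_prop), lintegral_add_left measurable_const,
          lintegral_mul_const _ hS]
        simp
    _ ≤ ENNReal.ofReal A * (1 + ENNReal.ofReal T * (ENNReal.ofReal T)⁻¹) := by gcongr
    _ = ENNReal.ofReal (2 * A) := by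
        rw [ENNReal.mul_inv_cancel hT' ENNReal.ofReal_ne_top, mul_comm 2 A, ENNReal.ofReal_mul hA,
          ENNReal.ofReal_ofNat, one_add_one_eq_two]

end WhiteNoiseResolvent

namespace WhiteNoiseResolvent
open Set Filter Topology

/-! ### Moment bounds -/

theorem exists_rpow_le_exp (p : ℝ) : ∃ C : ℝ, 0 < C ∧ ∀ u : ℝ, 1 ≤ u →
    u ^ p ≤ C * Real.exp u := by
  refine ⟨(⌈p⌉₊.factorial : ℝ), by positivity, fun u hu => ?_⟩
  calc u ^ p ≤ u ^ (⌈p⌉₊ : ℝ) := Real.rpow_le_rpow_of_exponent_le hu (Nat.le_ceil p)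
    _ = u ^ ⌈p⌉₊ := Real.rpow_natCast u _
    _ ≤ _ := by
        have := Real.pow_div_factorial_le_exp u (by linarith) ⌈p⌉₊
        rwa [div_le_iff₀' (by positivity)] at this

/-- From `log s ≤ log T + log (1 + s/T)` follows `1 + log s ≤ (1 + log T)(1 + log (1 + s/T))`, and
the `p`th power of the last factor is dominated by the exponential of its own base, a multiple of `1
+ s/T`. -/
theorem exists_log_rpow_le {p : ℝ} (hp : 0 ≤ p) : ∃ C : ℝ, 0 < C ∧ ∀ s T : ℝ, 1 ≤ s → 1 ≤ T →
    (1 + Real.log s) ^ p ≤ C * (1 + Real.log T) ^ p * (1 + s / T) := by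
  obtain ⟨C, hC, h⟩ := exists_rpow_le_exp p
  refine ⟨C * Real.exp 1, by positivity, fun s T hs hT => ?_⟩
  have hlT : 0 ≤ Real.log T := Real.log_nonneg hT
  have hls : 0 ≤ Real.log s := Real.log_nonneg hs
  have hsT : 0 < s / T := by positivity
  have hl : 0 ≤ Real.log (1 + s / T) := Real.log_nonneg (by linarith)
  have h1 : Real.log s ≤ Real.log T + Real.log (1 + s / T) := by
    rw [← Real.log_mul (by positivity) (by positivity)]
    refine Real.log_le_log (by positivity) ?_
    rw [mul_add, mul_div_cancel₀ _ (by positivity)]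
    linarith
  calc (1 + Real.log s) ^ p ≤ ((1 + Real.log T) * (1 + Real.log (1 + s / T))) ^ p := by
        refine Real.rpow_le_rpow (by linarith) ?_ hp
        nlinarith [mul_nonneg hlT hl]
    _ = (1 + Real.log T) ^ p * (1 + Real.log (1 + s / T)) ^ p :=
        Real.mul_rpow (by linarith) (by linarith)
    _ ≤ (1 + Real.log T) ^ p * (C * Real.exp (1 + Real.log (1 + s / T))) := by
        gcongr
        exact h _ (by linarith)
    _ = C * Real.exp 1 * (1 + Real.log T) ^ p * (1 + s / T) := by
        rw [Real.exp_add, Real.exp_log (by linarith)]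
        ring

theorem exists_diagonal_moment_const {p B : ℝ} (hp : 0 ≤ p) (hB : 0 < B) :
    ∃ C : ℝ, 0 < C ∧ ∀ m n : ℕ, 2 ≤ m → n ≤ 4 * m → ∀ s : ℝ, 1 ≤ s →
      (B * (72 * √(1 + Real.log s)) ^ 2) ^ p
        ≤ C * Real.log m ^ p * (1 + s / (30 * (max m n : ℕ))) := by
  obtain ⟨C, hC, h⟩ := exists_log_rpow_le hp
  -- Chosen so that `1 + log (30 max m n) ≤ c log m`, where `n ≤ 4m` gives `30 · 4 = 120` and `m ≥
  -- 2` lets `log m` absorb constants.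
  set c := (1 + Real.log 120) / Real.log 2 + 1 with hc
  have hl2 : 0 < Real.log 2 := Real.log_pos (by norm_num)
  have hl120 : 0 < Real.log 120 := Real.log_pos (by norm_num)
  have hc0 : 0 < c := by positivity
  refine ⟨(B * 72 ^ 2) ^ p * (C * c ^ p), by positivity, fun m n hm hn s hs => ?_⟩
  have hm' : (2 : ℝ) ≤ m := by exact_mod_cast hm
  have hM : ((max m n : ℕ) : ℝ) ≤ 4 * m := by
    have : max m n ≤ 4 * m := max_le (by omega) hn
    exact_mod_cast this
  have hM1 : (1 : ℝ) ≤ (max m n : ℕ) := by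
    have : 1 ≤ max m n := le_max_of_le_left (by omega)
    exact_mod_cast this
  have hls : 0 ≤ Real.log s := Real.log_nonneg hs
  have hlm : Real.log 2 ≤ Real.log m := Real.log_le_log (by norm_num) hm'
  have hlT : 0 ≤ Real.log (30 * (max m n : ℕ)) := Real.log_nonneg (by linarith)
  have hT : 1 + Real.log (30 * (max m n : ℕ)) ≤ c * Real.log m := by
    have h1 : Real.log (30 * (max m n : ℕ)) ≤ Real.log 120 + Real.log m := by
      rw [← Real.log_mul (by norm_num) (by positivity)]
      exact Real.log_le_log (by positivity) (by linarith)
    have h2 : 1 + Real.log 120 ≤ (1 + Real.log 120) / Real.log 2 * Real.log m := by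
      rw [div_mul_eq_mul_div, le_div_iff₀ hl2]
      gcongr
    rw [hc, add_mul]
    linarith
  calc (B * (72 * √(1 + Real.log s)) ^ 2) ^ p = (B * 72 ^ 2) ^ p * (1 + Real.log s) ^ p := by
        rw [← Real.mul_rpow (by positivity) (by positivity), mul_pow, Real.sq_sqrt (by linarith),
          mul_assoc]
    _ ≤ (B * 72 ^ 2) ^ p * (C * (1 + Real.log (30 * (max m n : ℕ))) ^ p *
          (1 + s / (30 * (max m n : ℕ)))) := by
        gcongr
        exact h s _ hs (by linarith)
    _ ≤ (B * 72 ^ 2) ^ p * (C * (c * Real.log m) ^ p * (1 + s / (30 * (max m n : ℕ)))) := by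
        gcongr
    _ = _ := by
        rw [Real.mul_rpow hc0.le (by linarith)]
        ring

/-- Half of the exponent `a √x` absorbs the factor `x`, the other half dominates `12 p x^α` for
large `x` because `α < 1/2`. Bounded `x` go into the constant, and `⟨x⟩^α ≤ 2 x^α`. -/
theorem exists_mul_exp_rpow_le {α p a : ℝ} (hα : 0 < α) (hα' : α < 1 / 2) (hp : 0 < p)
    (ha : 0 < a) : ∃ C : ℝ, 0 < C ∧ ∀ x : ℝ, 1 ≤ x →
      x * Real.exp (-(a * √x)) ≤ C * Real.exp (-6 * p * japaneseBracket x ^ α) := by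
  have hlim : Tendsto (fun x : ℝ => x ^ (1 / 2 - α)) atTop atTop :=
    tendsto_rpow_atTop (by linarith)
  obtain ⟨X, hX⟩ := (hlim.eventually (eventually_ge_atTop (24 * p / a))).exists_forall_of_atTop
  refine ⟨8 / a ^ 2 * Real.exp (12 * p * max X 1 ^ α), by positivity, fun x hx => ?_⟩
  have hx0 : 0 < x := by linarith
  have hsq : √x * √x = x := Real.mul_self_sqrt hx0.le
  have hs0 : 0 ≤ √x := Real.sqrt_nonneg x
  have hexp : x ≤ 8 / a ^ 2 * Real.exp (a / 2 * √x) := by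
    have := Real.pow_div_factorial_le_exp (a / 2 * √x) (by positivity) 2
    rw [div_mul_eq_mul_div, le_div_iff₀ (by positivity)]
    have h2 : (a / 2 * √x) ^ 2 / ((2 : ℕ).factorial : ℝ) = x * a ^ 2 / 8 := by
      rw [mul_pow, sq (√x), hsq]
      norm_num
      ring
    rw [h2] at this
    linarith
  have hJ : japaneseBracket x ^ α ≤ 2 * x ^ α := by
    have h1 : japaneseBracket x ≤ 2 * x := by
      rw [japaneseBracket]
      exact Real.sqrt_le_iff.2 ⟨by linarith, by nlinarith⟩
    calc japaneseBracket x ^ α ≤ (2 * x) ^ α :=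
          Real.rpow_le_rpow (japaneseBracket_pos x).le h1 hα.le
      _ = 2 ^ α * x ^ α := Real.mul_rpow (by norm_num) hx0.le
      _ ≤ 2 ^ (1 : ℝ) * x ^ α := by
          gcongr
          · norm_num
          · linarith
      _ = 2 * x ^ α := by rw [Real.rpow_one]
  have hα2 : 12 * p * x ^ α ≤ a / 2 * √x + 12 * p * max X 1 ^ α := by
    rcases le_total X x with h | h
    · have h1 := hX x h
      have h2 : √x = x ^ α * x ^ (1 / 2 - α) := by
        rw [← Real.rpow_add hx0, Real.sqrt_eq_rpow]
        congr 1
        ring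
      have h3 : 12 * p ≤ a / 2 * x ^ (1 / 2 - α) := by
        rw [div_le_iff₀ ha] at h1
        linarith
      have h4 : 0 < x ^ α := by positivity
      have h5 : 0 ≤ 12 * p * max X 1 ^ α := by positivity
      rw [h2]
      nlinarith [mul_le_mul_of_nonneg_left h3 h4.le]
    · have h1 : x ^ α ≤ max X 1 ^ α := Real.rpow_le_rpow hx0.le (h.trans (le_max_left _ _)) hα.le
      have h2 : 0 ≤ a / 2 * √x := by positivity
      have h3 : 12 * p * x ^ α ≤ 12 * p * max X 1 ^ α := by gcongr
      linarith
  calc x * Real.exp (-(a * √x)) ≤ 8 / a ^ 2 * Real.exp (a / 2 * √x) * Real.exp (-(a * √x)) := by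
        gcongr
    _ = 8 / a ^ 2 * Real.exp (-(a / 2 * √x)) := by
        rw [mul_assoc, ← Real.exp_add]
        congr 2
        ring
    _ ≤ 8 / a ^ 2 * (Real.exp (12 * p * max X 1 ^ α) *
          Real.exp (-6 * p * japaneseBracket x ^ α)) := by
        rw [← Real.exp_add]
        gcongr
        have := mul_le_mul_of_nonneg_left hJ (by positivity : 0 ≤ 6 * p)
        linarith
    _ = _ := by ring

/-- If `b ≤ √x` the first term on the right is at least `c √x`; otherwise `b² ≥ √x`, and the second
term suffices. -/
theorem min_mul_sqrt_le {c ε b x : ℝ} (hc : 0 < c) (hε : 0 < ε) (hb : 0 < b) (hx : 1 ≤ x) :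
    min c ε * √x ≤ c * x / b + ε * b ^ 2 := by
  have hx0 : 0 < x := by linarith
  have hsq : √x * √x = x := Real.mul_self_sqrt hx0.le
  have hs1 : 1 ≤ √x := Real.one_le_sqrt.2 hx
  rcases le_total b (√x) with h | h
  · have h1 : √x ≤ x / b := by
      rw [le_div_iff₀ hb]
      nlinarith
    have h2 : min c ε * √x ≤ c * (x / b) := mul_le_mul (min_le_left _ _) h1 (by positivity) hc.le
    have h3 : 0 ≤ ε * b ^ 2 := by positivity
    rw [← mul_div_assoc] at h2
    linarith
  · have h1 : √x ≤ b ^ 2 := by nlinarith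
    have h2 : min c ε * √x ≤ ε * b ^ 2 := mul_le_mul (min_le_right _ _) h1 (by positivity) hε.le
    have h3 : 0 ≤ c * x / b := by positivity
    linarith

theorem exists_offDiagonal_moment_const {p B c₀ α : ℝ} (hp : 0 < p) (hB : 0 < B) (hc₀ : 0 < c₀)
    (hα : 0 < α) (hα' : α < 1 / 2) :
    ∃ C : ℝ, 0 < C ∧ ∀ M : ℕ, 1 ≤ M → ∀ s : ℝ, 1 ≤ s →
      (B * (72 * √(1 + Real.log s)) ^ 2 *
          Real.exp (-(c₀ * M / (256 * (72 * √(1 + Real.log s)))))) ^ p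
        ≤ C * Real.exp (-6 * p * japaneseBracket M ^ α) * (1 + s / (30 * M)) := by
  -- Since `b² = 5184 (1 + log s)`, this makes `2 p ε b² = 1 + log s`. So `exp (2 p ε b²) = e s` is
  -- linear in `s`: one `ε b²` pays for the factor `b²`, the other for large `b` in
  -- `min_mul_sqrt_le`.
  set ε := 1 / (10368 * p) with hε
  have hε0 : 0 < ε := by positivity
  set c := min (c₀ / 256) ε with hc
  have hc0 : 0 < c := lt_min (by positivity) hε0
  obtain ⟨C, hC, h⟩ := exists_mul_exp_rpow_le hα hα' hp (mul_pos hp hc0)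
  refine ⟨(B / ε) ^ p * Real.exp 1 * 30 * C, by positivity, fun M hM s hs => ?_⟩
  have hM' : (1 : ℝ) ≤ M := by exact_mod_cast hM
  have hls : 0 ≤ Real.log s := Real.log_nonneg hs
  set b := 72 * √(1 + Real.log s) with hb
  have hb0 : 0 < b := by positivity
  have hb2 : b ^ 2 = 5184 * (1 + Real.log s) := by
    rw [hb, mul_pow, Real.sq_sqrt (by linarith)]
    norm_num
  have h1 : b ^ 2 ≤ 1 / ε * Real.exp (ε * b ^ 2) := by
    rw [one_div_mul_eq_div, le_div_iff₀ hε0, mul_comm]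
    linarith [Real.add_one_le_exp (ε * b ^ 2)]
  have h2 := min_mul_sqrt_le (c := c₀ / 256) (by positivity) hε0 hb0 hM'
  have h3 : B * b ^ 2 * Real.exp (-(c₀ * M / (256 * b)))
      ≤ B / ε * Real.exp (2 * (ε * b ^ 2) - c * √M) := by
    calc B * b ^ 2 * Real.exp (-(c₀ * M / (256 * b)))
        ≤ B * (1 / ε * Real.exp (ε * b ^ 2)) * Real.exp (-(c₀ * M / (256 * b))) := by gcongr
      _ = B / ε * Real.exp (ε * b ^ 2 + -(c₀ * M / (256 * b))) := by
          rw [Real.exp_add]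
          ring
      _ ≤ B / ε * Real.exp (2 * (ε * b ^ 2) - c * √M) := by
          gcongr
          have h4 : c₀ * M / (256 * b) = c₀ / 256 * M / b := by
            field_simp
          rw [h4]
          linarith
  have h5 : p * (2 * (ε * b ^ 2) - c * √M) = 1 + Real.log s + -(p * c * √M) := by
    rw [hb2, hε]
    field_simp
    ring
  -- Normalizing `s` by its mean costs a factor `M`, which `exists_mul_exp_rpow_le` absorbs.
  have hs30 : s ≤ 30 * M * (1 + s / (30 * M)) := by
    rw [mul_add, mul_div_cancel₀ _ (by positivity)]
    linarith
  calc (B * b ^ 2 * Real.exp (-(c₀ * M / (256 * b)))) ^ p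
      ≤ (B / ε * Real.exp (2 * (ε * b ^ 2) - c * √M)) ^ p :=
        Real.rpow_le_rpow (by positivity) h3 hp.le
    _ = (B / ε) ^ p * (Real.exp 1 * s * Real.exp (-(p * c * √M))) := by
        rw [Real.mul_rpow (by positivity) (by positivity), ← Real.exp_mul, mul_comm _ p, h5,
          Real.exp_add, Real.exp_add, Real.exp_log (by linarith)]
    _ ≤ (B / ε) ^ p * (Real.exp 1 * (30 * M * (1 + s / (30 * M))) *
          Real.exp (-(p * c * √M))) := by gcongr
    _ = (B / ε) ^ p * Real.exp 1 * 30 * (1 + s / (30 * M)) *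
          (M * Real.exp (-(p * c * √M))) := by ring
    _ ≤ (B / ε) ^ p * Real.exp 1 * 30 * (1 + s / (30 * M)) *
          (C * Real.exp (-6 * p * japaneseBracket M ^ α)) :=
        mul_le_mul_of_nonneg_left (h M hM') (by positivity)
    _ = _ := by ring

/-- The block norm is almost surely bounded by the deterministic estimate with the oscillation bound
`b = 72 √(1 + log S)`, where `S` has mean at most `30 max(m, n)`. -/
theorem IsWhiteNoise.lintegral_blockNorm_rpow_le {Ω : Type*} [MeasurableSpace Ω] {P : Measure Ω}
    [IsProbabilityMeasure P] {q : Ω → (𝓢(ℝ, ℝ) →L[ℝ] ℝ)} (hq : IsWhiteNoise P q) {χ₁ : ℝ → ℝ}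
    {L₀ : ℕ∞} (hL : IsDyadicOrInfinite L₀) {k : ℂ} {m n : ℕ} (hm : 2 ≤ m) {p A : ℝ} (hp : 0 ≤ p)
    (hA : 0 ≤ A) {F : ℝ → ℝ} (hF : ∀ s, 1 ≤ s → 0 ≤ F (72 * √(1 + Real.log s)))
    (hFp : ∀ s, 1 ≤ s → F (72 * √(1 + Real.log s)) ^ p ≤ A * (1 + s / (30 * (max m n : ℕ))))
    (h : ∀ V K b, HasSqrtGrowth V K → 1 ≤ b → OscLE V (5 * max m n) (fun _ => b) →
      localizedResolventNorm V k ‖k‖ (dyadicCutoff χ₁ m) (dyadicCutoff χ₁ n)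
        ≤ ENNReal.ofReal (F b)) :
    ∫⁻ ω, blockNorm χ₁ L₀ k m n (q ω) ^ p ∂P ≤ ENNReal.ofReal (2 * A) := by
  have hM : 1 ≤ max m n := le_max_of_le_left (by omega)
  have hM' : (1 : ℝ) ≤ (max m n : ℕ) := by exact_mod_cast hM
  set R : ℕ := 5 * max m n with hR
  set S : Ω → ℝ≥0∞ := fun ω => ∑ j ∈ Finset.Ico (-(R : ℤ)) R, chainingSum (hq.path ω) j with hS
  have hSm : Measurable S := Finset.measurable_sum _ fun j _ => hq.measurable_chainingSum j
  have hES : ∫⁻ ω, S ω ∂P ≤ ENNReal.ofReal (30 * (max m n : ℕ)) := by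
    refine (hq.lintegral_sum_le R).trans (le_of_eq ?_)
    congr 1
    rw [hR]
    push_cast
    ring
  refine lintegral_rpow_le_of_le hp hA (by positivity) hSm hES ?_
  filter_upwards [hq.blockNorm_ae_eq χ₁ L₀ k m n, hq.exists_mem_growthSet_ae,
    ae_lt_top hSm (ne_top_of_le_ne_top ENNReal.ofReal_ne_top hES)] with ω h1 ⟨K, hK⟩ hfin
  have hs1 : 1 ≤ (S ω).toReal := hq.one_le_toReal_sum (by omega) hfin.ne
  refine ⟨_, hF _ hs1, ?_, hFp _ hs1⟩
  rw [h1]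
  refine h _ _ _ ((hq.hasSqrtGrowth_brownian hK).potentialPrimitive hL) ?_
    ((hq.oscLE_brownian hfin.ne).potentialPrimitive hL)
  have : 1 ≤ √(1 + Real.log (S ω).toReal) :=
    Real.one_le_sqrt.2 (by linarith [Real.log_nonneg hs1])
  linarith

end WhiteNoiseResolvent

/-! ### The moment estimate. -/

theorem proposition4p2 (χ₁ : ℝ → ℝ) (hχ₁ : WhiteNoiseResolvent.IsBump χ₁)
    (C₀ : ℝ) (hC₀ : 1 ≤ C₀) (α : ℝ) (hα₀ : 0 < α) (hα₁ : α < 1 / 2) (p : ℝ) (hp : 1 ≤ p) :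
    ∃ C : ℝ, 0 < C ∧
      ∀ (Ω : Type*) [MeasurableSpace Ω] (P : Measure Ω) [IsProbabilityMeasure P]
        (q : Ω → (𝓢(ℝ, ℝ) →L[ℝ] ℝ)), WhiteNoiseResolvent.IsWhiteNoise P q →
      ∀ L₀ : ℕ∞, WhiteNoiseResolvent.IsDyadicOrInfinite L₀ →
      ∀ k : ℂ, WhiteNoiseResolvent.StrictlyAdmissible C₀ k →
      ∀ m n : ℕ, WhiteNoiseResolvent.IsDyadic m → WhiteNoiseResolvent.IsDyadic n →
        AEMeasurable (fun ω => WhiteNoiseResolvent.blockNorm χ₁ L₀ k m n (q ω)) P ∧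
        (m ≤ 4 * n → n ≤ 4 * m →
          ∫⁻ ω, WhiteNoiseResolvent.blockNorm χ₁ L₀ k m n (q ω) ^ p ∂P
            ≤ ENNReal.ofReal (C * Real.log m ^ p)) ∧
        (4 * n < m →
          ∫⁻ ω, WhiteNoiseResolvent.blockNorm χ₁ L₀ k m n (q ω) ^ p ∂P
            ≤ ENNReal.ofReal
              (C * Real.exp (-6 * p * WhiteNoiseResolvent.japaneseBracket m ^ α))) ∧
        (4 * m < n →
          ∫⁻ ω, WhiteNoiseResolvent.blockNorm χ₁ L₀ k m n (q ω) ^ p ∂P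
            ≤ ENNReal.ofReal
              (C * Real.exp (-6 * p * WhiteNoiseResolvent.japaneseBracket n ^ α))) := by
  obtain ⟨D, hD⟩ := hχ₁.exists_isSmoothCutoff
  have hp0 : 0 < p := by linarith
  have hc : 0 < Real.sin (Real.pi / 8) :=
    Real.sin_pos_of_pos_of_lt_pi (by positivity) (by linarith [Real.pi_pos])
  set B := WhiteNoiseResolvent.blockConst D (Real.sin (Real.pi / 8)) with hB
  have hB0 : 0 < B := by
    rw [hB, WhiteNoiseResolvent.blockConst]
    positivity
  obtain ⟨C₁, hC₁, h₁⟩ := WhiteNoiseResolvent.exists_diagonal_moment_const hp0.le hB0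
  obtain ⟨C₂, hC₂, h₂⟩ := WhiteNoiseResolvent.exists_offDiagonal_moment_const hp0 hB0 hc hα₀ hα₁
  -- The constant is fixed before the probability space, the noise, `L₀`, `k`, `m` and `n`; the sum
  -- covers both regimes.
  refine ⟨2 * (C₁ + C₂), by positivity, ?_⟩
  intro Ω _ P _ q hq L₀ hL k hk m n hm hn
  have hS := hk.isSectorial hC₀
  have hm2 := hm.two_le
  have hn2 := hn.two_le
  have hm' : (2 : ℝ) ≤ m := by exact_mod_cast hm2
  have hlm : 0 ≤ Real.log m := Real.log_nonneg (by linarith)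
  have hlog : ∀ s : ℝ, 1 ≤ s → 0 ≤ Real.log s := fun s hs => Real.log_nonneg hs
  have hfar : (4 * n < m ∨ 4 * m < n) →
      ∫⁻ ω, WhiteNoiseResolvent.blockNorm χ₁ L₀ k m n (q ω) ^ p ∂P ≤ ENNReal.ofReal
        (2 * (C₂ * Real.exp (-6 * p * WhiteNoiseResolvent.japaneseBracket (max m n : ℕ) ^ α))) :=
    fun hmn => hq.lintegral_blockNorm_rpow_le hL hm2 hp0.le (by positivity)
      (F := fun b => B * b ^ 2 *
        Real.exp (-(Real.sin (Real.pi / 8) * (max m n : ℕ) / (256 * b))))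
      (fun s hs => by positivity)
      (fun s hs => h₂ (max m n) (le_max_of_le_left (by omega)) s hs)
      (fun V K b hV hb hosc => WhiteNoiseResolvent.block_le_exp hV hS hχ₁ (hD m hm2) (hD n hn2)
        hm hn hb hosc hmn)
  have hle : ∀ x : ℝ, 0 ≤ x → 2 * (C₂ * x) ≤ 2 * (C₁ + C₂) * x := fun x hx => by
    nlinarith [mul_nonneg hC₁.le hx]
  refine ⟨hq.aemeasurable_blockNorm hL hS (hD m hm2) (hD n hn2), fun hmn hnm => ?_, fun hmn => ?_,
    fun hmn => ?_⟩
  · refine (hq.lintegral_blockNorm_rpow_le hL hm2 hp0.le (A := C₁ * Real.log m ^ p) (by positivity)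
      (F := fun b => B * b ^ 2) (fun s hs => by positivity) (fun s hs => h₁ m n hm2 hnm s hs)
      (fun V K b hV hb hosc => WhiteNoiseResolvent.block_le hV hS hχ₁ (hD m hm2) (hD n hn2)
        hm2 hn2 hb hosc)).trans (ENNReal.ofReal_le_ofReal ?_)
    have := mul_nonneg hC₂.le (Real.rpow_nonneg hlm p)
    nlinarith
  · refine (hfar (Or.inl hmn)).trans (ENNReal.ofReal_le_ofReal ?_)
    rw [max_eq_left (by omega)]
    exact hle _ (Real.exp_pos _).le
  · refine (hfar (Or.inr hmn)).trans (ENNReal.ofReal_le_ofReal ?_)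
    rw [max_eq_right (by omega)]
    exact hle _ (Real.exp_pos _).le
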